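/- Let $M$ be a closed (compact, Hausdorff, without boundary) smooth 7-manifold and let $(\varphi,g)$ be a smooth $G_2$-structure on $M$: $\varphi$ is a smooth 3-form which at every point lies in the $GL(7,\mathbb R)$-orbit of $$\varphi_0=e^{123}+e^{145}+e^{167}+e^{246}-e^{257}-e^{347}-e^{356},$$ and $g$ is the Riemannian metric determined by $\varphi$, that is $g_{ab}=(\det s)^{-1/9}s_{ab}$ with $s_{ab}=\frac1{144}\varphi_{amn}\varphi_{bpq}\varphi_{rst}\hat\varepsilon^{mnpqrst}$, where $\hat\varepsilon$ is the alternating symbol. Let $\psi=*\varphi$, the Hodge star being taken with respect to $g$ and the orientation determined by $\varphi$, let $\nabla$ be the Levi-Civita connection of $g$, and let $T$ be the full torsion tensor, $$T_a{}^{m}=\tfrac1{24}(\nabla_a\varphi_{bcd})\psi^{mbcd},\qquad\text{equivalently}\qquad \nabla_a\varphi_{bcd}=T_a{}^{e}\psi_{ebcd}.$$ The $G_2$-structure is called torsion-free if $T=0$. One writes $T\in W_1\oplus W_7$ if $T_{am}=\tau_1g_{am}+\tau_7^c\varphi_{cam}$ for some function $\tau_1$ and vector field $\tau_7$, $T\in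 W_1$ if moreover $\tau_7=0$, and $T\in W_7$ if moreover $\tau_1=0$. The structure is in the strict class $W_1$ (respectively $W_7$) if $T\in W_1$ (respectively $T\in W_7$) and $T$ is not identically zero, and in the strict class $W_1\oplus W_7$ if $T\in W_1\oplus W_7$ but $T\notin W_1$ and $T\notin W_7$. Suppose that $T\in W_1\oplus W_7$, let $v$ be a smooth vector field on $M$, and consider the deformation $\varphi\mapsto\tilde\varphi=\varphi+v\lrcorner\psi$, where $(v\lrcorner\psi)_{bcd}=v^e\psi_{ebcd}$. Then $\tilde\varphi$ is a torsion-free $G_2$-structure (with respect to its own metric $\tilde g$, connection and 4-form) if and only if $T=0$ and $\nabla v=0$. In particular, if $(\varphi,g)$ is in the strict class $W_1$, $W_7$ or $W_1\oplus W_7$, then for no smooth vector field $v$ is $\varphi+v\lrcorner\psi$ a torsion-free $G_2$-structure. -/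

import Mathlib

open scoped Manifold ContDiff

noncomputable section

namespace G2

/-! ### Linear algebra of 3-forms on a 7-dimensional space -/

/-- The model space `ℝ⁷`; every tangent space of a manifold modelled on it is a copy of it. -/
abbrev E7 : Type := EuclideanSpace ℝ (Fin 7)

/-- The standard basis vector `e_i` of `ℝ⁷` (indices run over `0, …, 6`). -/
def stdVec (i : Fin 7) : E7 := EuclideanSpace.single i 1

/-- The form `e¹ ∧ ⋯ ∧ e⁷`; on standard basis vectors it is the alternating symbol. -/
def vol0 : E7 [⋀^Fin 7]→ₗ[ℝ] ℝ := (EuclideanSpace.basisFun (Fin 7) ℝ).toBasis.det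

/-- The 3-form `e^i ∧ e^j ∧ e^k`: on `(x, y, z)` it is the determinant of the 3 × 3 matrix formed by
the coordinates `i, j, k` of `x, y, z`. -/
def coordForm (i j k : Fin 7) : E7 [⋀^Fin 3]→ₗ[ℝ] ℝ :=
  (Matrix.detRowAlternating (n := Fin 3) (R := ℝ)).compLinearMap
    (LinearMap.funLeft ℝ ℝ ![i, j, k] ∘ₗ (WithLp.linearEquiv 2 ℝ (Fin 7 → ℝ)).toLinearMap)

/-- The model form `φ₀ = e¹²³ + e¹⁴⁵ + e¹⁶⁷ + e²⁴⁶ - e²⁵⁷ - e³⁴⁷ - e³⁵⁶` (indices shifted by one). -/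
def phi0 : E7 [⋀^Fin 3]→ₗ[ℝ] ℝ :=
  coordForm 0 1 2 + coordForm 0 3 4 + coordForm 0 5 6 + coordForm 1 3 5
    - coordForm 1 4 6 - coordForm 2 3 6 - coordForm 2 4 5

/-- A 3-form is positive if it lies in the `GL(7, ℝ)`-orbit of `φ₀`. -/
def IsPositive (φ : E7 [⋀^Fin 3]→ₗ[ℝ] ℝ) : Prop :=
  ∃ u : E7 ≃ₗ[ℝ] E7, φ = phi0.compLinearMap u.toLinearMap

/-- The component `φ_{abc}`. -/
def comp3 (φ : E7 [⋀^Fin 3]→ₗ[ℝ] ℝ) (a b c : Fin 7) : ℝ :=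
  φ ![stdVec a, stdVec b, stdVec c]

/-- The component `ψ_{abcd}`. -/
def comp4 (ψ : E7 [⋀^Fin 4]→ₗ[ℝ] ℝ) (a b c d : Fin 7) : ℝ :=
  ψ ![stdVec a, stdVec b, stdVec c, stdVec d]

/-- `s_{ab} = (1/144) φ_{amn} φ_{bpq} φ_{rst} ε^{mnpqrst}`: the coefficients of the `Λ⁷`-valued form
`B(u, w) = (1/6) (u ⌟ φ) ∧ (w ⌟ φ) ∧ φ`. -/
def sMatrix (φ : E7 [⋀^Fin 3]→ₗ[ℝ] ℝ) : Matrix (Fin 7) (Fin 7) ℝ :=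
  Matrix.of fun a b => (1 / 144 : ℝ) * ∑ f : Fin 7 → Fin 7,
    comp3 φ a (f 0) (f 1) * comp3 φ b (f 2) (f 3) * comp3 φ (f 4) (f 5) (f 6)
      * vol0 (fun i => stdVec (f i))

/-- The real ninth root of `det s`; it is the coefficient of the volume form of `φ`, and its sign
records the orientation determined by `φ`. -/
def volCoeff (φ : E7 [⋀^Fin 3]→ₗ[ℝ] ℝ) : ℝ :=
  Real.sign (sMatrix φ).det * |(sMatrix φ).det| ^ (1 / 9 : ℝ)

/-- The metric of `φ`: `g_{ab} = (det s)^{-1/9} s_{ab}`. -/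
def metric (φ : E7 [⋀^Fin 3]→ₗ[ℝ] ℝ) : Matrix (Fin 7) (Fin 7) ℝ :=
  (volCoeff φ)⁻¹ • sMatrix φ

/-- The components `φ^{ijk}`, indices raised with the metric of `φ`. -/
def raise3 (φ : E7 [⋀^Fin 3]→ₗ[ℝ] ℝ) (i j k : Fin 7) : ℝ :=
  ∑ a, ∑ b, ∑ c, (metric φ)⁻¹ i a * (metric φ)⁻¹ j b * (metric φ)⁻¹ k c * comp3 φ a b c

/-- The 4-form `ψ = ∗φ`, the Hodge star being that of the metric and orientation of `φ`:
`ψ = (1/3!) φ^{ijk} (vol)_{ijk⋯}`. -/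
def psi (φ : E7 [⋀^Fin 3]→ₗ[ℝ] ℝ) : E7 [⋀^Fin 4]→ₗ[ℝ] ℝ :=
  ∑ i, ∑ j, ∑ k, (1 / 6 * volCoeff φ * raise3 φ i j k) •
    ((vol0.curryLeft (stdVec i)).curryLeft (stdVec j)).curryLeft (stdVec k)

/-- The deformed form `φ + w ⌟ ψ`, where `ψ = ∗φ` and `(w ⌟ ψ)_{bcd} = w^e ψ_{ebcd}`. -/
def deformForm (φ : E7 [⋀^Fin 3]→ₗ[ℝ] ℝ) (w : E7) : E7 [⋀^Fin 3]→ₗ[ℝ] ℝ :=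
  φ + (psi φ).curryLeft w

/-! ### Local tensor calculus on open subsets of `ℝ⁷` -/

/-- The partial derivative `∂_a f`. -/
def pd (a : Fin 7) (f : E7 → ℝ) (y : E7) : ℝ := fderiv ℝ f y (stdVec a)

/-- The Christoffel symbol `Γ^b_{ac}` of a metric given by its coordinate matrix:
`(1/2) g^{bd} (∂_c g_{da} + ∂_a g_{dc} - ∂_d g_{ac})`. -/
def christoffel (g : E7 → Matrix (Fin 7) (Fin 7) ℝ) (y : E7) (b a c : Fin 7) : ℝ :=
  1 / 2 * ∑ d, (g y)⁻¹ b d *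
    (pd c (fun z => g z d a) y + pd a (fun z => g z d c) y - pd d (fun z => g z a c) y)

/-- `∇_a φ_{bcd}` for the Levi-Civita connection of the metric of `φ`. -/
def covDerivForm (φ : E7 → E7 [⋀^Fin 3]→ₗ[ℝ] ℝ) (y : E7) (a b c d : Fin 7) : ℝ :=
  pd a (fun z => comp3 (φ z) b c d) y
    - ∑ e, (christoffel (fun z => metric (φ z)) y e a b * comp3 (φ y) e c d
          + christoffel (fun z => metric (φ z)) y e a c * comp3 (φ y) b e d
          + christoffel (fun z => metric (φ z)) y e a d * comp3 (φ y) b c e)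

/-- The full torsion tensor `T_{am} = (1/24) (∇_a φ_{bcd}) ψ_m^{bcd}`, equivalently the tensor with
`∇_a φ_{bcd} = T_a^e ψ_{ebcd}`. -/
def torsion (φ : E7 → E7 [⋀^Fin 3]→ₗ[ℝ] ℝ) (y : E7) (a m : Fin 7) : ℝ :=
  1 / 24 * ∑ b, ∑ c, ∑ d, ∑ b', ∑ c', ∑ d',
    covDerivForm φ y a b c d
      * ((metric (φ y))⁻¹ b b' * (metric (φ y))⁻¹ c c' * (metric (φ y))⁻¹ d d')
      * comp4 (psi (φ y)) m b' c' d'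

/-- `∇_a v^b` for the Levi-Civita connection of the metric of `φ`. -/
def covDerivVec (φ : E7 → E7 [⋀^Fin 3]→ₗ[ℝ] ℝ) (v : E7 → E7) (y : E7) (a b : Fin 7) : ℝ :=
  pd a (fun z => v z b) y + ∑ c, christoffel (fun z => metric (φ z)) y b a c * v y c

/-! ### Forms, vector fields and `G₂`-structures on a 7-manifold -/

section Manifold

variable {M : Type*} [TopologicalSpace M] [ChartedSpace E7 M]

/-- A (not necessarily smooth) field of 3-forms on `M`. -/
abbrev FormField (M : Type*) [TopologicalSpace M] [ChartedSpace E7 M] : Type _ :=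
  (p : M) → TangentSpace (𝓡 7) p [⋀^Fin 3]→ₗ[ℝ] ℝ

/-- A (not necessarily smooth) vector field on `M`. -/
abbrev VecField (M : Type*) [TopologicalSpace M] [ChartedSpace E7 M] : Type _ :=
  (p : M) → TangentSpace (𝓡 7) p

/-- The coordinate representation of a 3-form in the chart `x` (its pullback under `x⁻¹`). -/
def formInChart (x : OpenPartialHomeomorph M E7) (φ : FormField M) (y : E7) :
    E7 [⋀^Fin 3]→ₗ[ℝ] ℝ :=
  (φ (x.symm y)).compLinearMap (mfderiv (𝓡 7) (𝓡 7) x.symm y).toLinearMap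

/-- The coordinate representation of a vector field in the chart `x`. -/
def vecInChart (x : OpenPartialHomeomorph M E7) (v : VecField M) (y : E7) : E7 :=
  mfderiv (𝓡 7) (𝓡 7) x (x.symm y) (v (x.symm y))

/-- The 3-form field `φ` is a (smooth) `G₂`-structure: its components in every smooth chart are
smooth, and it is positive at every point. -/
def IsG2Structure (φ : FormField M) : Prop :=
  (∀ x ∈ IsManifold.maximalAtlas (𝓡 7) ∞ M, ∀ a b c : Fin 7,
      ContDiffOn ℝ ∞ (fun y => comp3 (formInChart x φ y) a b c) x.target) ∧
    ∀ p : M, IsPositive (φ p)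

/-- The vector field `v` is smooth. -/
def IsSmoothVecField [IsManifold (𝓡 7) ∞ M] (v : VecField M) : Prop :=
  ContMDiff (𝓡 7) (𝓡 7).tangent ∞ (fun p : M => (⟨p, v p⟩ : TangentBundle (𝓡 7) M))

/-- `T = 0`. -/
def TorsionFree (φ : FormField M) : Prop :=
  ∀ x ∈ IsManifold.maximalAtlas (𝓡 7) ∞ M, ∀ y ∈ x.target, ∀ a m : Fin 7,
    torsion (formInChart x φ) y a m = 0

/-- `T ∈ W₁`: at every point `T_{am} = τ₁ g_{am}`. -/
def TorsionInW1 (φ : FormField M) : Prop :=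
  ∀ x ∈ IsManifold.maximalAtlas (𝓡 7) ∞ M, ∀ y ∈ x.target, ∃ τ₁ : ℝ, ∀ a m : Fin 7,
    torsion (formInChart x φ) y a m = τ₁ * metric (formInChart x φ y) a m

/-- `T ∈ W₇`: at every point `T_{am} = τ₇^c φ_{cam}`. -/
def TorsionInW7 (φ : FormField M) : Prop :=
  ∀ x ∈ IsManifold.maximalAtlas (𝓡 7) ∞ M, ∀ y ∈ x.target, ∃ τ₇ : Fin 7 → ℝ, ∀ a m : Fin 7,
    torsion (formInChart x φ) y a m = ∑ c, τ₇ c * comp3 (formInChart x φ y) c a m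

/-- `T ∈ W₁ ⊕ W₇`: at every point `T_{am} = τ₁ g_{am} + τ₇^c φ_{cam}`. -/
def TorsionInW1W7 (φ : FormField M) : Prop :=
  ∀ x ∈ IsManifold.maximalAtlas (𝓡 7) ∞ M, ∀ y ∈ x.target,
    ∃ (τ₁ : ℝ) (τ₇ : Fin 7 → ℝ), ∀ a m : Fin 7,
      torsion (formInChart x φ) y a m =
        τ₁ * metric (formInChart x φ y) a m + ∑ c, τ₇ c * comp3 (formInChart x φ y) c a m

/-- The strict class `W₁`: `T ∈ W₁` does not vanish identically. -/
def StrictW1 (φ : FormField M) : Prop := TorsionInW1 φ ∧ ¬ TorsionFree φ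

/-- The strict class `W₇`: `T ∈ W₇` does not vanish identically. -/
def StrictW7 (φ : FormField M) : Prop := TorsionInW7 φ ∧ ¬ TorsionFree φ

/-- The strict class `W₁ ⊕ W₇`: `T` lies in `W₁ ⊕ W₇` but neither in `W₁` nor in `W₇`. -/
def StrictW1W7 (φ : FormField M) : Prop :=
  TorsionInW1W7 φ ∧ ¬ TorsionInW1 φ ∧ ¬ TorsionInW7 φ

/-- `∇v = 0` for the Levi-Civita connection of the metric of `φ`. -/
def IsParallel (φ : FormField M) (v : VecField M) : Prop :=
  ∀ x ∈ IsManifold.maximalAtlas (𝓡 7) ∞ M, ∀ y ∈ x.target, ∀ a b : Fin 7,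
    covDerivVec (formInChart x φ) (vecInChart x v) y a b = 0

/-- The deformation of `φ` by the vector field `v`: the field of 3-forms `φ + v ⌟ ψ`. -/
def deform (φ : FormField M) (v : VecField M) : FormField M :=
  fun p => deformForm (φ p) (v p)

end Manifold

end G2

end

set_option linter.unusedSimpArgs false
set_option linter.unusedVariables false

noncomputable section

namespace G2

/-! ### The model forms on basis vectors -/

/-! Write `ν = (1 + |v|²)^{1/3}`, `ξ = ν⁻¹ v♭`, and mark with a tilde the objects of the deformed
form `φ̃ = φ + v ⌟ ψ`.

Pointwise algebra. The stabiliser of `φ₀` is transitive on directions, so a positive form and a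
vector can be brought to the pair `(φ₀, t e₀)` (`IsPositive.exists_frame`). Splitting `ℝ⁷ = ℝ ⊕ ℂ³`
gives `φ₀ = e⁰ ∧ ω + Re Ω` and `e₀ ⌟ ψ₀ = -Im Ω`. Hence `φ₀ + t e₀ ⌟ ψ₀` is the pullback of `φ₀` by
the map that scales `e₀` by `ν⁻¹` and multiplies `ℂ³` by a cube root of `1 + it`. So `φ̃` is always
positive, and `ν² ψ = ψ̃ + ξ ∧ φ̃` (`IsPositive.deform`).

First-order equations. If `T` has components `τ₁, τ₇` then `dφ = 4τ₁ψ - 3τ₇ ∧ φ` and `dψ = -4τ₇ ∧ ψ`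
(`LocalW17.d_form`, `LocalW17.d_psi`), and `d² = 0` forces `dτ₇ = 0` and `dτ₁ = τ₁τ₇`
(`LocalW17.closed`). If `φ̃` is torsion-free then `dφ̃ = dψ̃ = 0`. Differentiating `ν²ψ = ψ̃ + ξ ∧
φ̃`, with `κ = 2 d(log ν) - 4τ₇`, yields `dξ = κ ∧ ξ + ½ κ♯ ⌟ φ̃` (`LocalDeform.dXi_eq`), because
the wedge product with `φ̃` is injective on 2-forms. Applying `d` once more, and using that
symmetric endomorphisms act injectively on `φ̃`, gives `∇̃κ = κ ⊗ κ` (`LocalDeform.nabla_kappaVec`),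
so `d|κ|² = 2|κ|²κ`. At a maximum of `|κ|²` on the compact manifold, evaluation on `κ♯` gives `0 =
2|κ|⁴`, and therefore `κ = 0` everywhere.

Conclusion from `κ = 0`. Now `dν = 2ντ₇`, `d|v|² = 6(1 + |v|²)τ₇` and `dv♭ = 2τ₇ ∧ v♭`. Together
with `dφ̃ = 0` this is a linear system at each point, which yields `3τ₇ = -τ₁ v♭`, and `∇v = 0`
wherever `τ₁ = 0` (`torsion_numbers`, `LocalDeform.tau7_eq`). At a local maximum of `|v|²` one has
`τ₇ = 0`, so `τ₁ = 0` or `v = 0` there. In the first case `τ₁²/ν` is locally constant, so `τ₁`, and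
then `τ₇` and `d|v|²`, vanish nearby; in the second `v` vanishes nearby. So `|v|²` is constant near
each of its local maxima, hence on each component. Then `τ₇ = 0` and `τ₁ v = 0` everywhere; where `v
= 0` it vanishes locally, and `0 = dφ̃ = dφ = 4τ₁ψ` gives `τ₁ = 0`.

Converse. If `φ` and `v` are parallel, the Levi-Civita connection of `φ` annihilates `φ̃` and is
symmetric. It is therefore the Levi-Civita connection of `φ̃`, whose torsion vanishes
(`torsion_eq_zero`).

The calculus takes place in charts: `d` is an alternation of partial derivatives (`alt4`, `alt5`).
As the orbit of `φ₀` is open, each directional derivative of `φ` is the infinitesimal action of an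
endomorphism, and the same endomorphism differentiates the metric and `ψ` by naturality
(`fderiv_natural`). -/

/-- The index `k` of the Fano line through `i` and `j`. -/
def fano (i j : Fin 7) : Fin 7 :=
  ![![0, 2, 1, 4, 3, 6, 5], ![2, 0, 0, 5, 6, 3, 4], ![1, 0, 0, 6, 5, 4, 3],
    ![4, 5, 6, 0, 0, 1, 2], ![3, 6, 5, 0, 0, 2, 1], ![6, 3, 4, 1, 2, 0, 0],
    ![5, 4, 3, 2, 1, 0, 0]] i j

/-- The sign with which `e_k` occurs in the cross product `e_i × e_j`. -/
def fanoSign (i j : Fin 7) : ℤ :=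
  ![![0, 1, -1, 1, -1, 1, -1], ![-1, 0, 1, 1, -1, -1, 1], ![1, -1, 0, -1, -1, 1, 1],
    ![-1, -1, 1, 0, 1, 1, -1], ![1, 1, 1, -1, 0, -1, -1], ![-1, 1, -1, -1, 1, 0, 1],
    ![1, -1, -1, 1, 1, -1, 0]] i j

/-- The integers `φ₀(e_i, e_j, e_k)`. -/
def phiInt (i j k : Fin 7) : ℤ := if k = fano i j then fanoSign i j else 0

/-- The sign of `ψ₀(e_l, e_i, e_j, e_k)` for the only index `l` for which it may not vanish. -/
def fanoSign₄ (i j k : Fin 7) : ℤ :=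
  if k = i ∨ k = j then 0 else -(fanoSign i j * fanoSign (fano i j) k)

/-- The integers `ψ₀(e_i, e_j, e_k, e_l)`. -/
def psiInt (i j k l : Fin 7) : ℤ := if i = fano (fano j k) l then fanoSign₄ j k l else 0

/-- The sign of `j - i`. -/
def signPair (i j : Fin 7) : ℤ := if i < j then 1 else if j < i then -1 else 0

/-- The alternating symbol `ε_{abcdefg}`. -/
def levi (a b c d e f g : Fin 7) : ℤ :=
  signPair a b * signPair a c * signPair a d * signPair a e * signPair a f * signPair a g *
    (signPair b c * signPair b d * signPair b e * signPair b f * signPair b g) *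
    (signPair c d * signPair c e * signPair c f * signPair c g) *
    (signPair d e * signPair d f * signPair d g) * (signPair e f * signPair e g) * signPair f g

/-- `levi`, organised so that the kernel may evaluate it quickly. -/
def leviFast (a b c d e f g : Fin 7) : ℤ :=
  if d = a ∨ d = b ∨ d = c ∨ e = a ∨ e = b ∨ e = c ∨ e = d then 0
  else if f = a ∨ f = b ∨ f = c ∨ g = a ∨ g = b ∨ g = c then 0 else levi a b c d e f g

theorem signPair_self (i : Fin 7) : signPair i i = 0 := by simp [signPair]

theorem signPair_swap (i j : Fin 7) : signPair j i = -signPair i j := by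
  unfold signPair; split_ifs <;> first | rfl | omega

theorem leviFast_eq (a b c d e f g : Fin 7) : leviFast a b c d e f g = levi a b c d e f g := by
  unfold leviFast
  split_ifs with h h
  · rcases h with rfl | rfl | rfl | rfl | rfl | rfl | rfl <;> simp [levi, signPair_self]
  · rcases h with rfl | rfl | rfl | rfl | rfl | rfl <;> simp [levi, signPair_self]
  · rfl

/-- This is `ψ₀ = ∗φ₀` in components, with `6 = 3!`. The third index of `φ₀` is fixed by the Fano
line through the first two, so only a double sum is left to evaluate. -/
theorem hodge_leviFast : ∀ m n p q,
    (∑ i, ∑ j, fanoSign i j * leviFast i j (fano i j) m n p q) = 6 * psiInt m n p q := by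
  decide +kernel

theorem levi_swap (i j k m n p q : Fin 7) : levi m n p q i j k = levi i j k m n p q := by
  unfold levi
  rw [signPair_swap i m, signPair_swap i n, signPair_swap i p, signPair_swap i q,
    signPair_swap j m, signPair_swap j n, signPair_swap j p, signPair_swap j q,
    signPair_swap k m, signPair_swap k n, signPair_swap k p, signPair_swap k q]
  ring

/-- The contraction `φ_{amn} φ_{bpq} ψ_{mnpq}`, with `n` and `q` eliminated along Fano lines. With
the `6` of `hodge_leviFast` it produces `6 · 24 = 144`, which the normalisation of `sMatrix`
cancels. -/
theorem fanoSign_psiInt : ∀ a b, (∑ m, ∑ p,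
    fanoSign a m * fanoSign b p * psiInt m (fano a m) p (fano b p)) = if a = b then 24 else 0 := by
  decide +kernel

theorem psiInt_psiInt : ∀ a b, (∑ n, ∑ p, ∑ q, psiInt a n p q * psiInt b n p q) =
    if a = b then 24 else 0 := by
  decide +kernel

theorem phiInt_phiInt : ∀ a b, (∑ m, ∑ n, phiInt a m n * phiInt b m n) =
    if a = b then 6 else 0 := by
  decide +kernel

theorem sum_phiInt {R : Type*} [Ring R] (i j : Fin 7) (f : Fin 7 → R) :
    ∑ k, (phiInt i j k : R) * f k = fanoSign i j * f (fano i j) := by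
  simp [phiInt]

theorem sum_psiInt {R : Type*} [Ring R] (j k l : Fin 7) (f : Fin 7 → R) :
    ∑ i, (psiInt i j k l : R) * f i = fanoSign₄ j k l * f (fano (fano j k) l) := by
  simp [psiInt]

theorem stdVec_apply (i j : Fin 7) : stdVec i j = if j = i then 1 else 0 := by
  simp [stdVec]

theorem sum_smul_stdVec (w : E7) : ∑ l, w l • stdVec l = w := by
  ext j
  simp [stdVec_apply]

/-- A form as a linear functional of its first argument. -/
def slot {n : ℕ} (α : E7 [⋀^Fin (n + 1)]→ₗ[ℝ] ℝ) (m : Fin n → E7) : E7 →ₗ[ℝ] ℝ where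
  toFun w := α (Matrix.vecCons w m)
  map_add' := α.map_vecCons_add m
  map_smul' := α.map_vecCons_smul m

theorem map_eq_sum (l : E7 →ₗ[ℝ] ℝ) (w : E7) : l w = ∑ i, w i * l (stdVec i) := by
  conv_lhs => rw [← sum_smul_stdVec w]
  simp

theorem map_vecCons_eq_sum {n : ℕ} (α : E7 [⋀^Fin (n + 1)]→ₗ[ℝ] ℝ) (w : E7) (m : Fin n → E7) :
    α (Matrix.vecCons w m) = ∑ l, w l * α (Matrix.vecCons (stdVec l) m) :=
  map_eq_sum (slot α m) w

theorem coordForm_apply (i j k : Fin 7) (x y z : E7) : coordForm i j k ![x, y, z] =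
    x i * (y j * z k - y k * z j) - x j * (y i * z k - y k * z i)
      + x k * (y i * z j - y j * z i) := by
  have : coordForm i j k ![x, y, z] =
      Matrix.det !![x i, x j, x k; y i, y j, y k; z i, z j, z k] := by
    unfold coordForm
    rw [AlternatingMap.compLinearMap_apply]
    refine congrArg Matrix.det ?_
    ext a b
    fin_cases a <;> fin_cases b <;> rfl
  rw [this, Matrix.det_fin_three]
  simp
  ring

/-- The Kronecker symbol. -/
def delta (i j : Fin 7) : ℤ := if i = j then 1 else 0

/-- The integers `(e^i ∧ e^j ∧ e^k)(e_a, e_b, e_c)`. -/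
def coordInt (i j k a b c : Fin 7) : ℤ :=
  delta i a * (delta j b * delta k c - delta k b * delta j c)
    - delta j a * (delta i b * delta k c - delta k b * delta i c)
    + delta k a * (delta i b * delta j c - delta j b * delta i c)

theorem coordForm_stdVec (i j k a b c : Fin 7) :
    coordForm i j k ![stdVec a, stdVec b, stdVec c] = (coordInt i j k a b c : ℝ) := by
  simp only [coordForm_apply, stdVec_apply, coordInt, delta]
  push_cast
  rfl

theorem phiInt_eq_coordInt : ∀ a b c, coordInt 0 1 2 a b c + coordInt 0 3 4 a b c +
    coordInt 0 5 6 a b c + coordInt 1 3 5 a b c - coordInt 1 4 6 a b c - coordInt 2 3 6 a b c -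
    coordInt 2 4 5 a b c = phiInt a b c := by
  decide +kernel

theorem phi0_stdVec (i j k : Fin 7) :
    phi0 ![stdVec i, stdVec j, stdVec k] = (phiInt i j k : ℝ) := by
  rw [← phiInt_eq_coordInt]
  simp [phi0, coordForm_stdVec]

theorem phiInt_rotate : ∀ i j k, phiInt i j k = phiInt j k i := by decide +kernel

theorem phi0_vecCons (w : E7) (j k : Fin 7) :
    phi0 ![w, stdVec j, stdVec k] = fanoSign j k * w (fano j k) := by
  rw [map_vecCons_eq_sum, ← sum_phiInt]
  exact Finset.sum_congr rfl fun i _ => by rw [phi0_stdVec, phiInt_rotate, mul_comm]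

theorem levi_eq_prod (f : Fin 7 → Fin 7) :
    levi (f 0) (f 1) (f 2) (f 3) (f 4) (f 5) (f 6) =
      ∏ i, ∏ j, if i < j then signPair (f i) (f j) else 1 := by
  simp only [Fin.prod_univ_seven, Fin.reduceLT, if_true, if_false, lt_self_iff_false, levi, one_mul,
    mul_one, mul_assoc]

/-- An injective index tuple is a permutation, whose sign is the product of the signs of all pairs.
A repeated index makes the determinant vanish and also contributes a factor `signPair i i = 0`. -/
theorem vol0_stdVec (f : Fin 7 → Fin 7) : vol0 (fun i => stdVec (f i)) =
    (levi (f 0) (f 1) (f 2) (f 3) (f 4) (f 5) (f 6) : ℝ) := by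
  rw [levi_eq_prod]
  by_cases hf : Function.Injective f
  · obtain ⟨σ, hσ⟩ : ∃ σ : Equiv.Perm (Fin 7), ∀ i, σ i = f i :=
      ⟨Equiv.ofBijective f (Finite.injective_iff_bijective.mp hf), fun i => rfl⟩
    have h1 : vol0 (fun i => stdVec (f i)) = vol0 (stdVec ∘ σ) := by
      congr 1; ext1 i; simp [hσ]
    have h2 : vol0 stdVec = 1 := by
      have : (stdVec : Fin 7 → E7) = (EuclideanSpace.basisFun (Fin 7) ℝ).toBasis := by
        ext i; simp [stdVec]
      rw [this]
      exact Module.Basis.det_self _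
    have h3 : (∏ i, ∏ j, if i < j then signPair (f i) (f j) else 1) =
        (Equiv.Perm.sign σ : ℤ) := by
      rw [Equiv.Perm.sign_eq_prod_prod_Ioi, Units.coe_prod]
      refine Finset.prod_congr rfl fun i _ => ?_
      rw [Units.coe_prod, ← Finset.filter_lt_eq_Ioi, Finset.prod_filter]
      refine Finset.prod_congr rfl fun j _ => ?_
      rw [← hσ, ← hσ]
      split_ifs with h h'
      · simp [signPair, h']
      · have h'' : σ j < σ i := lt_of_le_of_ne (not_lt.mp h') fun e => h.ne (σ.injective e.symm)
        simp [signPair, h', h'']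
      · rfl
    rw [h1, AlternatingMap.map_perm, h2, h3]
    simp [Units.smul_def]
  · rw [Function.Injective] at hf
    push Not at hf
    obtain ⟨i, j, hij, hne⟩ := hf
    rw [AlternatingMap.map_eq_zero_of_eq (i := i) (j := j) _ _ (by rw [hij]) hne]
    symm
    rw [Int.cast_eq_zero]
    rcases lt_or_gt_of_ne hne with h | h
    · refine Finset.prod_eq_zero (Finset.mem_univ i) (Finset.prod_eq_zero (Finset.mem_univ j) ?_)
      rw [if_pos h, hij, signPair_self]
    · refine Finset.prod_eq_zero (Finset.mem_univ j) (Finset.prod_eq_zero (Finset.mem_univ i) ?_)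
      rw [if_pos h, hij, signPair_self]

/-! ### Metric, volume and 4-form of a positive form -/

theorem sum_pi_succ {n : ℕ} {R : Type*} [AddCommMonoid R] (F : (Fin (n + 1) → Fin 7) → R) :
    ∑ f, F f = ∑ i, ∑ f, F (Matrix.vecCons i f) := by
  rw [← Fintype.sum_prod_type']
  exact (Fintype.sum_equiv (Fin.consEquiv fun _ => Fin 7) _ _ fun _ => rfl).symm

theorem sum_pi_seven {R : Type*} [AddCommMonoid R] (F : (Fin 7 → Fin 7) → R) :
    ∑ f, F f = ∑ a, ∑ b, ∑ c, ∑ d, ∑ e, ∑ f, ∑ g, F ![a, b, c, d, e, f, g] := by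
  simp only [sum_pi_succ, Fintype.sum_unique]
  rfl

theorem multilinear_eq_sum {n : ℕ} (W : MultilinearMap ℝ (fun _ : Fin n => E7) ℝ)
    (w : Fin n → E7) :
    W w = ∑ g : Fin n → Fin 7, (∏ i, w i (g i)) * W fun i => stdVec (g i) := by
  have h : w = fun i => ∑ k, w i k • stdVec k := funext fun i => (sum_smul_stdVec _).symm
  conv_lhs => rw [h, W.map_sum]
  exact Finset.sum_congr rfl fun g _ => W.map_smul_univ _ _

/-- The matrix of a linear map in the standard basis. -/
def toMat (u : E7 →ₗ[ℝ] E7) : Matrix (Fin 7) (Fin 7) ℝ := Matrix.of fun i j => u (stdVec j) i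

theorem stdVec_eq_basis : (stdVec : Fin 7 → E7) = (EuclideanSpace.basisFun (Fin 7) ℝ).toBasis := by
  ext i; simp [stdVec]

theorem toMat_eq (u : E7 →ₗ[ℝ] E7) : toMat u = LinearMap.toMatrix
    (EuclideanSpace.basisFun (Fin 7) ℝ).toBasis (EuclideanSpace.basisFun (Fin 7) ℝ).toBasis u := by
  ext i j
  simp [toMat, LinearMap.toMatrix_apply, stdVec]

theorem det_toMat (u : E7 →ₗ[ℝ] E7) : (toMat u).det = LinearMap.det u := by
  rw [toMat_eq, LinearMap.det_toMatrix]

theorem vol0_map (u : E7 →ₗ[ℝ] E7) (w : Fin 7 → E7) :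
    vol0 (fun i => u (w i)) = LinearMap.det u * vol0 w :=
  Module.Basis.det_comp _ u w

/-- Contraction with the alternating symbol has the weight of a density. Expanding `W` in the basis
and exchanging the two sums, the coefficients of `u` recombine into `vol0` applied to the transpose
of `u`, which has the same determinant. -/
theorem sum_multilinear_vol0 (W : MultilinearMap ℝ (fun _ : Fin 7 => E7) ℝ) (u : E7 →ₗ[ℝ] E7) :
    ∑ f : Fin 7 → Fin 7, W (fun i => u (stdVec (f i))) * vol0 (fun i => stdVec (f i)) =
      LinearMap.det u *
        ∑ f : Fin 7 → Fin 7, W (fun i => stdVec (f i)) * vol0 (fun i => stdVec (f i)) := by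
  let ut : E7 →ₗ[ℝ] E7 := LinearMap.toMatrix (EuclideanSpace.basisFun (Fin 7) ℝ).toBasis
    (EuclideanSpace.basisFun (Fin 7) ℝ).toBasis |>.symm (toMat u).transpose
  have hut : toMat ut = (toMat u).transpose := by
    rw [toMat_eq]; exact LinearEquiv.apply_symm_apply _ _
  have hdet : LinearMap.det ut = LinearMap.det u := by
    rw [← det_toMat, hut, Matrix.det_transpose, det_toMat]
  have hent : ∀ i j, ut (stdVec i) j = u (stdVec j) i := fun i j =>
    congrFun (congrFun hut j) i
  calc _ = ∑ f : Fin 7 → Fin 7, ∑ g : Fin 7 → Fin 7, (∏ i, u (stdVec (f i)) (g i)) *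
        W (fun i => stdVec (g i)) * vol0 (fun i => stdVec (f i)) := by
        refine Finset.sum_congr rfl fun f _ => ?_
        rw [multilinear_eq_sum W, Finset.sum_mul]
    _ = ∑ g : Fin 7 → Fin 7, W (fun i => stdVec (g i)) * vol0 (fun i => ut (stdVec (g i))) := by
        rw [Finset.sum_comm]
        refine Finset.sum_congr rfl fun g _ => ?_
        have := multilinear_eq_sum vol0.toMultilinearMap (fun i => ut (stdVec (g i)))
        simp only [AlternatingMap.coe_multilinearMap] at this
        rw [this, Finset.mul_sum]
        refine Finset.sum_congr rfl fun f _ => ?_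
        simp only [hent]
        ring
    _ = _ := by
        rw [Finset.mul_sum]
        refine Finset.sum_congr rfl fun g _ => ?_
        rw [vol0_map, hdet]
        ring

/-! ### Multilinearity and alternation of a 3-form, slot by slot -/

section Slots

variable (α : E7 [⋀^Fin 3]→ₗ[ℝ] ℝ) (c : ℝ) (x x' y z : E7)

theorem form3_rotate : α ![x, y, z] = α ![z, x, y] := by
  have h := α.map_perm ![x, y, z] (finRotate 3).symm
  have : (![x, y, z] ∘ (finRotate 3).symm) = ![z, x, y] := by
    ext1 i; fin_cases i <;> rfl
  have hs : Equiv.Perm.sign (finRotate 3).symm = 1 := by decide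
  rw [this, hs] at h
  simpa using h.symm

theorem form3_swap : α ![x, y, z] = -α ![y, x, z] := by
  have h := α.map_swap ![x, y, z] (show (0 : Fin 3) ≠ 1 by decide)
  have : (![x, y, z] ∘ Equiv.swap (0 : Fin 3) 1) = ![y, x, z] := by
    ext1 i; fin_cases i <;> rfl
  rw [this] at h
  rw [h, neg_neg]

theorem form3_add₀ : α ![x + x', y, z] = α ![x, y, z] + α ![x', y, z] := α.map_vecCons_add _ _ _
theorem form3_smul₀ : α ![c • x, y, z] = c * α ![x, y, z] := α.map_vecCons_smul _ _ _
theorem form3_add₁ : α ![y, x + x', z] = α ![y, x, z] + α ![y, x', z] := by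
  rw [form3_swap, form3_add₀, form3_swap α y x, form3_swap α y x']; ring
theorem form3_smul₁ : α ![y, c • x, z] = c * α ![y, x, z] := by
  rw [form3_swap, form3_smul₀, form3_swap α y x]; ring
theorem form3_add₂ : α ![y, z, x + x'] = α ![y, z, x] + α ![y, z, x'] := by
  rw [form3_rotate, form3_add₀, form3_rotate α y, form3_rotate α y]
theorem form3_smul₂ : α ![y, z, c • x] = c * α ![y, z, x] := by
  rw [form3_rotate, form3_smul₀, form3_rotate α y]

end Slots

/-- The 7-linear map whose antisymmetrisation is `(x ⌟ φ) ∧ (y ⌟ φ) ∧ φ` up to a factor. -/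
def tripleMap (φ : E7 [⋀^Fin 3]→ₗ[ℝ] ℝ) (x y : E7) :
    MultilinearMap ℝ (fun _ : Fin 7 => E7) ℝ :=
  MultilinearMap.mk' (fun w => φ ![x, w 0, w 1] * φ ![y, w 2, w 3] * φ ![w 4, w 5, w 6])
    (by
      intro w i a b
      fin_cases i <;> simp [form3_add₀, form3_add₁, form3_add₂] <;> ring)
    (by
      intro w i c a
      fin_cases i <;> simp [form3_smul₀, form3_smul₁, form3_smul₂] <;> ring)


theorem tripleMap_apply (φ : E7 [⋀^Fin 3]→ₗ[ℝ] ℝ) (x y : E7) (w : Fin 7 → E7) :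
    tripleMap φ x y w = φ ![x, w 0, w 1] * φ ![y, w 2, w 3] * φ ![w 4, w 5, w 6] := rfl

theorem pull_apply (φ : E7 [⋀^Fin 3]→ₗ[ℝ] ℝ) (u : E7 →ₗ[ℝ] E7) (x y z : E7) :
    φ.compLinearMap u ![x, y, z] = φ ![u x, u y, u z] := by
  rw [AlternatingMap.compLinearMap_apply]
  congr 1; ext1 i; fin_cases i <;> rfl

theorem pull_apply₄ (ψ : E7 [⋀^Fin 4]→ₗ[ℝ] ℝ) (u : E7 →ₗ[ℝ] E7) (x y z w : E7) :
    ψ.compLinearMap u ![x, y, z, w] = ψ ![u x, u y, u z, u w] := by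
  rw [AlternatingMap.compLinearMap_apply]
  congr 1; ext1 i; fin_cases i <;> rfl

theorem sMatrix_eq (φ : E7 [⋀^Fin 3]→ₗ[ℝ] ℝ) (a b : Fin 7) :
    sMatrix φ a b = (1 / 144 : ℝ) * ∑ f : Fin 7 → Fin 7,
      tripleMap φ (stdVec a) (stdVec b) (fun i => stdVec (f i)) * vol0 (fun i => stdVec (f i)) :=
  rfl

/-- The sevenfold sum collapses in three stages: the last three indices by Hodge duality, the
indices `n` and `q` along Fano lines, and the remaining double sum by `fanoSign_psiInt`. -/
theorem sMatrix_phi0 : sMatrix phi0 = 1 := by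
  ext a b
  have key : (∑ f : Fin 7 → Fin 7, phiInt a (f 0) (f 1) * phiInt b (f 2) (f 3) *
      phiInt (f 4) (f 5) (f 6) * levi (f 0) (f 1) (f 2) (f 3) (f 4) (f 5) (f 6)) =
      144 * if a = b then 1 else 0 := by
    rw [sum_pi_seven]
    have h1 : ∀ m n p q : Fin 7, (∑ r, ∑ s, ∑ t, phiInt a m n * phiInt b p q * phiInt r s t *
        levi m n p q r s t) = phiInt a m n * (phiInt b p q * (6 * psiInt m n p q)) := by
      intro m n p q
      rw [← hodge_leviFast]
      simp only [Finset.mul_sum]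
      refine Finset.sum_congr rfl fun r _ => Finset.sum_congr rfl fun s _ => ?_
      have := sum_phiInt (R := ℤ) r s fun t => phiInt a m n * (phiInt b p q * levi m n p q r s t)
      simp only [Int.cast_id] at this
      rw [leviFast_eq, ← levi_swap]
      calc _ = _ := Finset.sum_congr rfl fun t _ => by ring
        _ = _ := this
        _ = _ := by ring
    have h2 : ∀ m p : Fin 7, (∑ n, ∑ q, phiInt a m n * (phiInt b p q * (6 * psiInt m n p q))) =
        6 * (fanoSign a m * fanoSign b p * psiInt m (fano a m) p (fano b p)) := by
      intro m p
      simp only [← Finset.mul_sum]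
      have h3 := fun n => sum_phiInt (R := ℤ) b p fun q => 6 * psiInt m n p q
      simp only [Int.cast_id] at h3
      simp only [h3]
      have h4 := sum_phiInt (R := ℤ) a m fun n => fanoSign b p * (6 * psiInt m n p (fano b p))
      simp only [Int.cast_id] at h4
      rw [h4]
      ring
    calc _ = ∑ m, ∑ n, ∑ p, ∑ q, phiInt a m n * (phiInt b p q * (6 * psiInt m n p q)) := by
          simp only [← h1]; rfl
      _ = ∑ m, ∑ p, ∑ n, ∑ q, phiInt a m n * (phiInt b p q * (6 * psiInt m n p q)) :=
          Finset.sum_congr rfl fun m _ => Finset.sum_comm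
      _ = _ := by
          simp only [h2]
          simp only [← Finset.mul_sum, fanoSign_psiInt]
          split_ifs <;> norm_num
  have key' := congrArg (fun z : ℤ => (z : ℝ)) key
  push_cast at key'
  rw [sMatrix_eq, Matrix.one_apply]
  simp only [tripleMap_apply, phi0_stdVec, vol0_stdVec]
  rw [key']
  split_ifs <;> norm_num

/-- The two free slots contribute `uᵀ u`, and the seven slots contracted with the alternating symbol
contribute only `det u`, by `sum_multilinear_vol0`. -/
theorem sMatrix_pull (u : E7 →ₗ[ℝ] E7) :
    sMatrix (phi0.compLinearMap u) = LinearMap.det u • ((toMat u).transpose * toMat u) := by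
  ext a b
  have h1 : ∀ x y : E7, (1 / 144 : ℝ) * ∑ f : Fin 7 → Fin 7,
      tripleMap phi0 x y (fun i => stdVec (f i)) * vol0 (fun i => stdVec (f i)) =
      ∑ i, x i * y i := by
    intro x y
    have h : ∀ f : Fin 7 → Fin 7, tripleMap phi0 x y (fun i => stdVec (f i)) =
        ∑ i, ∑ j, x i * y j * tripleMap phi0 (stdVec i) (stdVec j) (fun i => stdVec (f i)) := by
      intro f
      simp only [tripleMap_apply]
      rw [map_vecCons_eq_sum phi0 x, map_vecCons_eq_sum phi0 y, Finset.sum_mul_sum, Finset.sum_mul]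
      refine Finset.sum_congr rfl fun i _ => ?_
      rw [Finset.sum_mul]
      exact Finset.sum_congr rfl fun j _ => by ring
    have h' : ∀ i j, x i * y j * sMatrix phi0 i j = if i = j then x i * y j else 0 := by
      intro i j
      rw [sMatrix_phi0, Matrix.one_apply]
      split_ifs <;> simp
    calc _ = ∑ i, ∑ j, x i * y j * sMatrix phi0 i j := by
          simp only [h, sMatrix_eq, Finset.sum_mul, Finset.mul_sum]
          rw [Finset.sum_comm]
          refine Finset.sum_congr rfl fun i _ => ?_
          rw [Finset.sum_comm]
          exact Finset.sum_congr rfl fun j _ => Finset.sum_congr rfl fun f _ => by ring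
      _ = _ := by simp [h']
  rw [sMatrix_eq]
  have h2 := sum_multilinear_vol0 (tripleMap phi0 (u (stdVec a)) (u (stdVec b))) u
  have h3 : ∀ f : Fin 7 → Fin 7, tripleMap (phi0.compLinearMap u) (stdVec a) (stdVec b)
      (fun i => stdVec (f i)) = tripleMap phi0 (u (stdVec a)) (u (stdVec b))
        (fun i => u (stdVec (f i))) := by
    intro f
    simp only [tripleMap_apply, pull_apply]
  simp only [h3, h2]
  rw [mul_left_comm, h1]
  rfl

/-- Here `det (det u • uᵀu) = (det u)^{7+2}`, so the signed real ninth root returns `det u` itself,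
also when `u` reverses the orientation. -/
theorem volCoeff_pull (u : E7 →ₗ[ℝ] E7) :
    volCoeff (phi0.compLinearMap u) = LinearMap.det u := by
  have h : (sMatrix (phi0.compLinearMap u)).det = LinearMap.det u ^ 9 := by
    rw [sMatrix_pull, Matrix.det_smul, Matrix.det_mul, Matrix.det_transpose, det_toMat]
    simp only [Fintype.card_fin]
    ring
  rw [volCoeff, h]
  set d := LinearMap.det u
  have h9 : |d ^ 9| ^ (1 / 9 : ℝ) = |d| := by
    rw [abs_pow, ← Real.rpow_natCast, ← Real.rpow_mul (abs_nonneg d)]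
    norm_num
  rw [h9]
  rcases lt_trichotomy d 0 with hd | hd | hd
  · have : d ^ 9 < 0 := Odd.pow_neg (by decide) hd
    rw [Real.sign_of_neg this, abs_of_neg hd]; ring
  · simp [hd]
  · rw [Real.sign_of_pos (by positivity), abs_of_pos hd]; ring

/-! ### The orthonormal frame in which a positive form becomes the model form -/

section Frame

variable (u : E7 ≃ₗ[ℝ] E7)

theorem det_ne_zero (u : E7 ≃ₗ[ℝ] E7) : LinearMap.det u.toLinearMap ≠ 0 :=
  (LinearEquiv.isUnit_det' u).ne_zero

theorem metric_pull_matrix : metric (phi0.compLinearMap u.toLinearMap) =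
    (toMat u.toLinearMap).transpose * toMat u.toLinearMap := by
  rw [metric, volCoeff_pull, sMatrix_pull, smul_smul, inv_mul_cancel₀ (det_ne_zero u), one_smul]

theorem metric_pull (i j : Fin 7) : metric (phi0.compLinearMap u.toLinearMap) i j =
    ∑ k, u (stdVec i) k * u (stdVec j) k := by
  rw [metric_pull_matrix]; rfl

/-- The vectors of the frame in which a form takes its normal form. -/
def frame (i : Fin 7) : E7 := u.symm (stdVec i)

theorem map_frame (i : Fin 7) : u (frame u i) = stdVec i := u.apply_symm_apply _

theorem metric_pull_inv (i j : Fin 7) : (metric (phi0.compLinearMap u.toLinearMap))⁻¹ i j =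
    ∑ k, frame u k i * frame u k j := by
  have h1 : toMat u.toLinearMap * toMat u.symm.toLinearMap = 1 := by
    rw [toMat_eq, toMat_eq, ← LinearMap.toMatrix_comp, LinearEquiv.comp_coe,
      LinearEquiv.symm_trans_self, LinearEquiv.refl_toLinearMap, LinearMap.toMatrix_id]
  have h2 : (metric (phi0.compLinearMap u.toLinearMap))⁻¹ =
      toMat u.symm.toLinearMap * (toMat u.symm.toLinearMap).transpose := by
    apply Matrix.inv_eq_right_inv
    rw [metric_pull_matrix, Matrix.mul_assoc, ← Matrix.mul_assoc (toMat _) (toMat _), h1,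
      Matrix.one_mul, ← Matrix.transpose_mul]
    rw [mul_eq_one_comm.mp h1, Matrix.transpose_one]
  rw [h2]; rfl

theorem sum_metric_inv₁ (F : E7 → ℝ) (hF : IsLinearMap ℝ F) (i : Fin 7) :
    ∑ a, (metric (phi0.compLinearMap u.toLinearMap))⁻¹ i a * F (stdVec a) =
      ∑ k, frame u k i * F (frame u k) := by
  have h : ∀ w, F w = ∑ a, w a * F (stdVec a) := fun w => map_eq_sum (hF.mk' F) w
  simp only [h (frame u _), metric_pull_inv, Finset.sum_mul, Finset.mul_sum]
  rw [Finset.sum_comm]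
  exact Finset.sum_congr rfl fun k _ => Finset.sum_congr rfl fun a _ => by ring

/-- Contraction with the inverse metric is summation over the frame. -/
theorem sum_metric_inv (F : E7 → E7 → ℝ) (h₀ : ∀ y, IsLinearMap ℝ fun x => F x y)
    (h₁ : ∀ x, IsLinearMap ℝ (F x)) :
    ∑ i, ∑ j, (metric (phi0.compLinearMap u.toLinearMap))⁻¹ i j * F (stdVec i) (stdVec j) =
      ∑ k, F (frame u k) (frame u k) := by
  have h : ∀ k w, F w (frame u k) = ∑ i, w i * F (stdVec i) (frame u k) := fun k w =>
    map_eq_sum ((h₀ (frame u k)).mk' _) w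
  calc _ = ∑ i, ∑ k, frame u k i * F (stdVec i) (frame u k) :=
        Finset.sum_congr rfl fun i _ => sum_metric_inv₁ u _ (h₁ _) i
    _ = ∑ k, ∑ i, frame u k i * F (stdVec i) (frame u k) := Finset.sum_comm
    _ = _ := by simp only [← h]

end Frame

/-! ### The 4-form of a positive form -/

theorem curry3_apply {n : ℕ} (α : E7 [⋀^Fin (n + 3)]→ₗ[ℝ] ℝ) (x y z : E7) (w : Fin n → E7) :
    ((α.curryLeft x).curryLeft y).curryLeft z w =
      α (Matrix.vecCons x (Matrix.vecCons y (Matrix.vecCons z w))) := rfl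

theorem lin_vecCons₁ {n : ℕ} (α : E7 [⋀^Fin (n + 2)]→ₗ[ℝ] ℝ) (x : E7) (w : Fin n → E7) :
    IsLinearMap ℝ fun y => α (Matrix.vecCons x (Matrix.vecCons y w)) :=
  ⟨(α.curryLeft x).map_vecCons_add _, (α.curryLeft x).map_vecCons_smul _⟩

theorem lin_vecCons₂ {n : ℕ} (α : E7 [⋀^Fin (n + 3)]→ₗ[ℝ] ℝ) (x y : E7) (w : Fin n → E7) :
    IsLinearMap ℝ fun z => α (Matrix.vecCons x (Matrix.vecCons y (Matrix.vecCons z w))) :=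
  ⟨((α.curryLeft x).curryLeft y).map_vecCons_add _,
    ((α.curryLeft x).curryLeft y).map_vecCons_smul _⟩

theorem psi_apply (φ : E7 [⋀^Fin 3]→ₗ[ℝ] ℝ) (w : Fin 4 → E7) :
    psi φ w = 1 / 6 * volCoeff φ * ∑ i, ∑ j, ∑ k, raise3 φ i j k *
      vol0 (Matrix.vecCons (stdVec i) (Matrix.vecCons (stdVec j)
        (Matrix.vecCons (stdVec k) w))) := by
  let ev : (E7 [⋀^Fin 4]→ₗ[ℝ] ℝ) →ₗ[ℝ] ℝ :=
    { toFun := fun α => α w, map_add' := fun _ _ => rfl, map_smul' := fun _ _ => rfl }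
  have h : psi φ w = ev (psi φ) := rfl
  rw [h, psi]
  simp only [map_sum, map_smul, Finset.mul_sum]
  refine Finset.sum_congr rfl fun i _ => Finset.sum_congr rfl fun j _ =>
    Finset.sum_congr rfl fun k _ => ?_
  have hev : ∀ α, ev α = α w := fun _ => rfl
  rw [smul_eq_mul, mul_assoc, hev, curry3_apply (n := 4)]

section Linear

variable (α : E7 [⋀^Fin 3]→ₗ[ℝ] ℝ) (β : E7 [⋀^Fin 4]→ₗ[ℝ] ℝ) (x y z : E7)

theorem lin3₀ : IsLinearMap ℝ fun w => α ![w, x, y] :=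
  ⟨fun _ _ => form3_add₀ .., fun _ _ => form3_smul₀ ..⟩
theorem lin3₁ : IsLinearMap ℝ fun w => α ![x, w, y] :=
  ⟨fun _ _ => form3_add₁ .., fun _ _ => form3_smul₁ ..⟩
theorem lin3₂ : IsLinearMap ℝ fun w => α ![x, y, w] :=
  ⟨fun _ _ => form3_add₂ .., fun _ _ => form3_smul₂ ..⟩
theorem lin4₀ : IsLinearMap ℝ fun w => β ![w, x, y, z] :=
  ⟨β.map_vecCons_add _, β.map_vecCons_smul _⟩
theorem lin4₁ : IsLinearMap ℝ fun w => β ![x, w, y, z] := lin3₀ (β.curryLeft x) y z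
theorem lin4₂ : IsLinearMap ℝ fun w => β ![x, y, w, z] := lin3₁ (β.curryLeft x) y z
theorem lin4₃ : IsLinearMap ℝ fun w => β ![x, y, z, w] := lin3₂ (β.curryLeft x) y z

end Linear

theorem lin_eq_sum {F : E7 → ℝ} (hF : IsLinearMap ℝ F) (w : E7) :
    F w = ∑ a, w a * F (stdVec a) := map_eq_sum (hF.mk' F) w

theorem sum_triple_factor {ι : Type*} [Fintype ι] (p q r : ι → ℝ) (t : ι → ι → ι → ℝ) :
    ∑ a, ∑ b, ∑ c, p a * q b * r c * t a b c = ∑ a, p a * ∑ b, q b * ∑ c, r c * t a b c := by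
  simp only [Finset.mul_sum, mul_assoc]

/-- The inverse metric is the sum of the squares of the frame vectors, so raising an index is
expansion in the frame; there the components of the form are the integers of the model. -/
theorem raise3_pull (u : E7 ≃ₗ[ℝ] E7) (i j k : Fin 7) :
    raise3 (phi0.compLinearMap u.toLinearMap) i j k =
      ∑ l, ∑ m, ∑ n, frame u l i * frame u m j * frame u n k * (phiInt l m n : ℝ) := by
  set φ := phi0.compLinearMap u.toLinearMap with hφ
  have h1 : ∀ a b, ∑ c, (metric φ)⁻¹ k c * comp3 φ a b c =
      ∑ n, frame u n k * φ ![stdVec a, stdVec b, frame u n] := fun a b =>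
    sum_metric_inv₁ u _ (lin3₂ φ _ _) k
  have h2 : ∀ a, ∑ b, (metric φ)⁻¹ j b * ∑ n, frame u n k * φ ![stdVec a, stdVec b, frame u n] =
      ∑ m, frame u m j * ∑ n, frame u n k * φ ![stdVec a, frame u m, frame u n] := by
    intro a
    refine sum_metric_inv₁ u (fun x => ∑ n, frame u n k * φ ![stdVec a, x, frame u n]) ?_ j
    constructor
    · intro x y; simp only [form3_add₁, mul_add, Finset.sum_add_distrib]
    · intro c x
      simp only [form3_smul₁, smul_eq_mul, Finset.mul_sum]
      exact Finset.sum_congr rfl fun n _ => by ring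
  have h3 : ∑ a, (metric φ)⁻¹ i a *
      ∑ m, frame u m j * ∑ n, frame u n k * φ ![stdVec a, frame u m, frame u n] =
      ∑ l, frame u l i * ∑ m, frame u m j * ∑ n, frame u n k *
        φ ![frame u l, frame u m, frame u n] := by
    refine sum_metric_inv₁ u (fun x => ∑ m, frame u m j * ∑ n, frame u n k *
      φ ![x, frame u m, frame u n]) ?_ i
    constructor
    · intro x y; simp only [form3_add₀, mul_add, Finset.sum_add_distrib]
    · intro c x
      simp only [form3_smul₀, smul_eq_mul, Finset.mul_sum]
      exact Finset.sum_congr rfl fun n _ => Finset.sum_congr rfl fun n _ => by ring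
  rw [raise3, sum_triple_factor]
  simp only [h1, h2, h3]
  rw [sum_triple_factor]
  simp only [hφ, pull_apply, LinearEquiv.coe_coe, map_frame, phi0_stdVec]

theorem det_mul_vol0_frame (u : E7 ≃ₗ[ℝ] E7) (w : Fin 7 → E7) :
    LinearMap.det u.toLinearMap * vol0 w = vol0 (fun i => u (w i)) :=
  (vol0_map u.toLinearMap w).symm

/-- The volume coefficient `det u` is absorbed through `det u · vol0 w = vol0 (u w)`, which turns
the frame vectors produced by `raise3_pull` into standard basis vectors. -/
theorem psi_pull_apply (u : E7 ≃ₗ[ℝ] E7) (w : Fin 4 → E7) :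
    psi (phi0.compLinearMap u.toLinearMap) w = 1 / 6 * ∑ l, ∑ m, ∑ n, (phiInt l m n : ℝ) *
      vol0 (Matrix.vecCons (stdVec l) (Matrix.vecCons (stdVec m)
        (Matrix.vecCons (stdVec n) fun i => u (w i)))) := by
  rw [psi_apply, volCoeff_pull, mul_assoc]
  congr 1
  let V : E7 → E7 → E7 → ℝ := fun x y z =>
    vol0 (Matrix.vecCons x (Matrix.vecCons y (Matrix.vecCons z w)))
  have hV₀ : ∀ y z, IsLinearMap ℝ fun x => V x y z := fun y z =>
    ⟨vol0.map_vecCons_add _, vol0.map_vecCons_smul _⟩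
  have hV₁ : ∀ x z, IsLinearMap ℝ fun y => V x y z := fun x z =>
    lin_vecCons₁ vol0 x _
  have hV₂ : ∀ x y, IsLinearMap ℝ fun z => V x y z := fun x y =>
    lin_vecCons₂ vol0 x y w
  have hV : ∀ x y z, V x y z = ∑ i, ∑ j, ∑ k, x i * y j * z k *
      V (stdVec i) (stdVec j) (stdVec k) := by
    intro x y z
    rw [lin_eq_sum (hV₀ y z)]
    refine Finset.sum_congr rfl fun i _ => ?_
    rw [lin_eq_sum (hV₁ _ z), Finset.mul_sum]
    refine Finset.sum_congr rfl fun j _ => ?_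
    rw [lin_eq_sum (hV₂ _ _), Finset.mul_sum, Finset.mul_sum]
    exact Finset.sum_congr rfl fun k _ => by ring
  have h1 : ∀ l m n, LinearMap.det u.toLinearMap * V (frame u l) (frame u m) (frame u n) =
      vol0 (Matrix.vecCons (stdVec l) (Matrix.vecCons (stdVec m)
        (Matrix.vecCons (stdVec n) fun i => u (w i)))) := by
    intro l m n
    rw [det_mul_vol0_frame]
    congr 1
    ext1 i
    refine Fin.cases ?_ (fun i => ?_) i
    · exact map_frame u l
    refine Fin.cases ?_ (fun i => ?_) i
    · exact map_frame u m
    refine Fin.cases ?_ (fun i => ?_) i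
    · exact map_frame u n
    · rfl
  have h2 : ∀ l m n, (phiInt l m n : ℝ) * vol0 (Matrix.vecCons (stdVec l)
      (Matrix.vecCons (stdVec m) (Matrix.vecCons (stdVec n) fun i => u (w i)))) =
      ∑ i, ∑ j, ∑ k, LinearMap.det u.toLinearMap * (frame u l i * frame u m j * frame u n k *
        phiInt l m n * V (stdVec i) (stdVec j) (stdVec k)) := by
    intro l m n
    rw [← h1, hV]
    simp only [Finset.mul_sum]
    exact Finset.sum_congr rfl fun i _ => Finset.sum_congr rfl fun j _ =>
      Finset.sum_congr rfl fun k _ => by ring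
  simp only [h2, raise3_pull, Finset.mul_sum, Finset.sum_mul]
  have comm3 : ∀ G : Fin 7 → Fin 7 → Fin 7 → Fin 7 → Fin 7 → Fin 7 → ℝ,
      ∑ i, ∑ j, ∑ k, ∑ l, ∑ m, ∑ n, G i j k l m n =
      ∑ l, ∑ m, ∑ n, ∑ i, ∑ j, ∑ k, G i j k l m n := by
    intro G
    have e1 : ∀ H : Fin 7 → Fin 7 → Fin 7 → Fin 7 → ℝ, ∑ i, ∑ j, ∑ k, ∑ l, H i j k l =
        ∑ l, ∑ i, ∑ j, ∑ k, H i j k l := by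
      intro H
      calc _ = ∑ i, ∑ j, ∑ l, ∑ k, H i j k l := Finset.sum_congr rfl fun i _ =>
            Finset.sum_congr rfl fun j _ => Finset.sum_comm
        _ = ∑ i, ∑ l, ∑ j, ∑ k, H i j k l := Finset.sum_congr rfl fun i _ => Finset.sum_comm
        _ = _ := Finset.sum_comm
    rw [e1]
    refine Finset.sum_congr rfl fun l _ => ?_
    rw [e1]
    exact Finset.sum_congr rfl fun m _ => e1 _
  exact comm3 _

theorem psi_phi0 : psi phi0 = psi (phi0.compLinearMap (LinearEquiv.refl ℝ E7).toLinearMap) := by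
  congr 1

/-- The 4-form of a positive form is natural. -/
theorem psi_pull (u : E7 ≃ₗ[ℝ] E7) :
    psi (phi0.compLinearMap u.toLinearMap) = (psi phi0).compLinearMap u.toLinearMap := by
  ext w
  rw [psi_pull_apply, psi_phi0, AlternatingMap.compLinearMap_apply, psi_pull_apply]
  rfl

theorem psi0_stdVec (i j k l : Fin 7) :
    psi phi0 ![stdVec i, stdVec j, stdVec k, stdVec l] = (psiInt i j k l : ℝ) := by
  rw [psi_phi0, psi_pull_apply]
  have h1 : ∀ a b c : Fin 7, vol0 (Matrix.vecCons (stdVec a) (Matrix.vecCons (stdVec b)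
      (Matrix.vecCons (stdVec c) fun t => LinearEquiv.refl ℝ E7
        (![stdVec i, stdVec j, stdVec k, stdVec l] t)))) = (levi a b c i j k l : ℝ) := by
    intro a b c
    refine Eq.trans ?_ (vol0_stdVec ![a, b, c, i, j, k, l])
    congr 1
    ext1 t
    fin_cases t <;> rfl
  simp only [h1]
  have h2 := congrArg (fun z : ℤ => (z : ℝ)) (hodge_leviFast i j k l)
  simp only [leviFast_eq] at h2
  push_cast at h2
  have h3 : ∀ a b : Fin 7, ∑ c, (phiInt a b c : ℝ) * (levi a b c i j k l : ℝ) =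
      fanoSign a b * levi a b (fano a b) i j k l := fun a b =>
    sum_phiInt a b fun c => (levi a b c i j k l : ℝ)
  simp only [h3, h2]
  ring

theorem psi0_vecCons (w : E7) (j k l : Fin 7) :
    psi phi0 ![w, stdVec j, stdVec k, stdVec l] = fanoSign₄ j k l * w (fano (fano j k) l) := by
  rw [map_vecCons_eq_sum, ← sum_psiInt]
  exact Finset.sum_congr rfl fun i _ => by rw [psi0_stdVec, mul_comm]

/-! ### Identities for the model forms -/

/-- The model 4-form. -/
def psi0 : E7 [⋀^Fin 4]→ₗ[ℝ] ℝ := psi phi0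

theorem psi0_basis (i j k l : Fin 7) :
    psi0 ![stdVec i, stdVec j, stdVec k, stdVec l] = (psiInt i j k l : ℝ) := psi0_stdVec i j k l

theorem psi0_cons (w : E7) (j k l : Fin 7) :
    psi0 ![w, stdVec j, stdVec k, stdVec l] = fanoSign₄ j k l * w (fano (fano j k) l) :=
  psi0_vecCons w j k l

/-- The standard inner product. -/
def dot (x y : E7) : ℝ := ∑ i, x i * y i

theorem dot_comm (x y : E7) : dot x y = dot y x :=
  Finset.sum_congr rfl fun _ _ => mul_comm _ _

theorem dot_add_left (x y z : E7) : dot (x + y) z = dot x z + dot y z := by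
  simp [dot, add_mul, Finset.sum_add_distrib]

theorem dot_smul_left (c : ℝ) (x z : E7) : dot (c • x) z = c * dot x z := by
  simp [dot, mul_assoc, Finset.mul_sum]

theorem dot_add_right (x y z : E7) : dot z (x + y) = dot z x + dot z y := by
  rw [dot_comm, dot_add_left, dot_comm x, dot_comm y]

theorem dot_smul_right (c : ℝ) (x z : E7) : dot z (c • x) = c * dot z x := by
  rw [dot_comm, dot_smul_left, dot_comm x]

theorem dot_stdVec_right (x : E7) (i : Fin 7) : dot x (stdVec i) = x i := by
  simp [dot, stdVec_apply]

theorem dot_stdVec_left (x : E7) (i : Fin 7) : dot (stdVec i) x = x i := by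
  rw [dot_comm, dot_stdVec_right]

theorem dot_stdVec (i j : Fin 7) : dot (stdVec i) (stdVec j) = (delta i j : ℝ) := by
  rw [dot_stdVec_right, stdVec_apply, delta]
  by_cases h : i = j <;> simp [h, eq_comm]

theorem dot_self_nonneg (x : E7) : 0 ≤ dot x x := Finset.sum_nonneg fun i _ => mul_self_nonneg _

theorem dot_self_eq_zero {x : E7} (h : dot x x = 0) : x = 0 := by
  ext i
  have := (Finset.sum_eq_zero_iff_of_nonneg fun i _ => mul_self_nonneg (x i)).mp h i
    (Finset.mem_univ i)
  simpa using this

/-- The cross product of the model form. -/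
def cross (a b : E7) : E7 := WithLp.toLp 2 fun k => phi0 ![a, b, stdVec k]

theorem cross_apply (a b : E7) (k : Fin 7) : cross a b k = phi0 ![a, b, stdVec k] := rfl

theorem dot_cross (a b c : E7) : dot (cross a b) c = phi0 ![a, b, c] := by
  rw [lin_eq_sum (lin3₂ phi0 a b) c]
  exact Finset.sum_congr rfl fun k _ => by rw [cross_apply, mul_comm]

theorem cross_add_left (a a' b : E7) : cross (a + a') b = cross a b + cross a' b := by
  ext k; exact form3_add₀ ..
theorem cross_smul_left (c : ℝ) (a b : E7) : cross (c • a) b = c • cross a b := by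
  ext k; exact form3_smul₀ ..
theorem cross_add_right (a a' b : E7) : cross b (a + a') = cross b a + cross b a' := by
  ext k; exact form3_add₁ ..
theorem cross_smul_right (c : ℝ) (a b : E7) : cross b (c • a) = c • cross b a := by
  ext k; exact form3_smul₁ ..

theorem cross_stdVec (i j : Fin 7) :
    cross (stdVec i) (stdVec j) = (fanoSign i j : ℝ) • stdVec (fano i j) := by
  ext k
  rw [cross_apply, phi0_stdVec]
  simp [phiInt, stdVec_apply]

section Slots

variable (α : E7 [⋀^Fin 4]→ₗ[ℝ] ℝ) (β : E7 [⋀^Fin 3]→ₗ[ℝ] ℝ) (c : ℝ) (x x' y z w : E7)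

theorem form4_add₀ : α ![x + x', y, z, w] = α ![x, y, z, w] + α ![x', y, z, w] :=
  (lin4₀ α y z w).map_add x x'
theorem form4_smul₀ : α ![c • x, y, z, w] = c * α ![x, y, z, w] := (lin4₀ α y z w).map_smul c x
theorem form4_add₁ : α ![y, x + x', z, w] = α ![y, x, z, w] + α ![y, x', z, w] :=
  (lin4₁ α y z w).map_add x x'
theorem form4_smul₁ : α ![y, c • x, z, w] = c * α ![y, x, z, w] := (lin4₁ α y z w).map_smul c x
theorem form4_add₂ : α ![y, z, x + x', w] = α ![y, z, x, w] + α ![y, z, x', w] :=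
  (lin4₂ α y z w).map_add x x'
theorem form4_smul₂ : α ![y, z, c • x, w] = c * α ![y, z, x, w] := (lin4₂ α y z w).map_smul c x
theorem form4_add₃ : α ![y, z, w, x + x'] = α ![y, z, w, x] + α ![y, z, w, x'] :=
  (lin4₃ α y z w).map_add x x'
theorem form4_smul₃ : α ![y, z, w, c • x] = c * α ![y, z, w, x] := (lin4₃ α y z w).map_smul c x

theorem form3_perm : β ![y, x, z] = -β ![x, y, z] ∧ β ![x, z, y] = -β ![x, y, z] ∧
    β ![y, z, x] = β ![x, y, z] ∧ β ![z, x, y] = β ![x, y, z] ∧ β ![z, y, x] = -β ![x, y, z] := by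
  have h1 := form3_swap β x y z
  have h2 := form3_rotate β x y z
  have h3 := form3_rotate β z x y
  have h4 := form3_rotate β y x z
  have h5 := form3_rotate β x z y
  refine ⟨?_, ?_, ?_, ?_, ?_⟩ <;> linarith

theorem form4_move₁ : α ![x, w, y, z] = -α ![w, x, y, z] := by
  have h := α.map_swap ![w, x, y, z] (show (0 : Fin 4) ≠ 1 by decide)
  have : (![w, x, y, z] ∘ Equiv.swap (0 : Fin 4) 1) = ![x, w, y, z] := by
    ext1 i; fin_cases i <;> rfl
  rw [this] at h
  exact h

theorem form4_move₂ : α ![x, y, w, z] = α ![w, x, y, z] := by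
  have h1 : α ![x, y, w, z] = -α ![x, w, y, z] := (form3_perm (α.curryLeft x) w y z).1
  rw [h1, form4_move₁, neg_neg]

theorem form4_move₃ : α ![x, y, z, w] = -α ![w, x, y, z] := by
  have h1 : α ![x, y, z, w] = α ![x, w, y, z] := (form3_perm (α.curryLeft x) w y z).2.2.1
  rw [h1, form4_move₁]

end Slots

theorem lin_ext {F G : E7 → ℝ} (hF : IsLinearMap ℝ F) (hG : IsLinearMap ℝ G)
    (h : ∀ i, F (stdVec i) = G (stdVec i)) (x : E7) : F x = G x := by
  rw [lin_eq_sum hF, lin_eq_sum hG]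
  simp only [h]

/-- The classical contraction identity for `φ · φ`. On basis vectors it is a finite check over the
integers, transferred to all vectors one slot at a time by `lin_ext`. -/
theorem phiInt_cross : ∀ a b c d : Fin 7, fanoSign a b * phiInt (fano a b) c d =
    delta a c * delta b d - delta a d * delta b c + psiInt a b c d := by decide +kernel

/-- The companion identity for the contraction `φ · ψ`. These two identities carry all later
manipulations of `φ₀` and `ψ₀` involving the cross product. -/
theorem psiInt_cross : ∀ a b c d e : Fin 7, fanoSign a b * psiInt (fano a b) c d e =
    delta a c * phiInt b d e + delta a d * phiInt b e c + delta a e * phiInt b c d -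
    (delta b c * phiInt a d e + delta b d * phiInt a e c + delta b e * phiInt a c d) := by
  decide +kernel

theorem phi0_cross (a b c d : E7) : phi0 ![cross a b, c, d] =
    dot a c * dot b d - dot a d * dot b c + psi0 ![a, b, c, d] := by
  refine lin_ext (F := fun a => phi0 ![cross a b, c, d])
    (G := fun a => dot a c * dot b d - dot a d * dot b c + psi0 ![a, b, c, d]) ?_ ?_ ?_ a
  · constructor <;> intros <;> simp only [cross_add_left, cross_smul_left, form3_add₀, form3_smul₀,
      smul_eq_mul]
  · constructor <;> intros <;> simp only [dot_add_left, dot_smul_left, form4_add₀, form4_smul₀,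
      smul_eq_mul] <;> ring
  intro i
  refine lin_ext (F := fun b => phi0 ![cross _ b, c, d])
    (G := fun b => dot _ c * dot b d - dot _ d * dot b c + psi0 ![_, b, c, d]) ?_ ?_ ?_ b
  · constructor <;> intros <;> simp only [cross_add_right, cross_smul_right, form3_add₀,
      form3_smul₀, smul_eq_mul]
  · constructor <;> intros <;> simp only [dot_add_left, dot_smul_left, form4_add₁, form4_smul₁,
      smul_eq_mul] <;> ring
  intro j
  refine lin_ext (F := fun c => phi0 ![_, c, d])
    (G := fun c => dot _ c * dot _ d - dot _ d * dot _ c + psi0 ![_, _, c, d]) ?_ ?_ ?_ c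
  · exact lin3₁ _ _ _
  · constructor <;> intros <;> simp only [dot_add_right, dot_smul_right, form4_add₂, form4_smul₂,
      smul_eq_mul] <;> ring
  intro k
  refine lin_ext (F := fun d => phi0 ![_, _, d])
    (G := fun d => dot _ _ * dot _ d - dot _ d * dot _ _ + psi0 ![_, _, _, d]) ?_ ?_ ?_ d
  · exact lin3₂ _ _ _
  · constructor <;> intros <;> simp only [dot_add_right, dot_smul_right, form4_add₃, form4_smul₃,
      smul_eq_mul] <;> ring
  intro l
  simp only [cross_stdVec, form3_smul₀, phi0_stdVec, dot_stdVec, psi0_basis]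
  exact_mod_cast phiInt_cross i j k l

theorem psi0_cross (a b c d e : E7) : psi0 ![cross a b, c, d, e] =
    dot a c * phi0 ![b, d, e] + dot a d * phi0 ![b, e, c] + dot a e * phi0 ![b, c, d] -
    (dot b c * phi0 ![a, d, e] + dot b d * phi0 ![a, e, c] + dot b e * phi0 ![a, c, d]) := by
  refine lin_ext (F := fun a => psi0 ![cross a b, c, d, e]) (G := fun a => 
    dot a c * phi0 ![b, d, e] + dot a d * phi0 ![b, e, c] + dot a e * phi0 ![b, c, d] -
    (dot b c * phi0 ![a, d, e] + dot b d * phi0 ![a, e, c] + dot b e * phi0 ![a, c, d]))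
    ?_ ?_ ?_ a
  · constructor <;> intros <;> simp only [cross_add_left, cross_smul_left, form4_add₀, form4_smul₀,
      smul_eq_mul]
  · constructor <;> intros <;> simp only [dot_add_left, dot_smul_left, form3_add₀, form3_smul₀,
      smul_eq_mul] <;> ring
  intro i
  refine lin_ext (F := fun b => psi0 ![cross _ b, c, d, e]) (G := fun b => 
    dot _ c * phi0 ![b, d, e] + dot _ d * phi0 ![b, e, c] + dot _ e * phi0 ![b, c, d] -
    (dot b c * phi0 ![_, d, e] + dot b d * phi0 ![_, e, c] + dot b e * phi0 ![_, c, d]))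
    ?_ ?_ ?_ b
  · constructor <;> intros <;> simp only [cross_add_right, cross_smul_right, form4_add₀,
      form4_smul₀, smul_eq_mul]
  · constructor <;> intros <;> simp only [dot_add_left, dot_smul_left, form3_add₀, form3_smul₀,
      smul_eq_mul] <;> ring
  intro j
  refine lin_ext (F := fun c => psi0 ![_, c, d, e]) (G := fun c => 
    dot _ c * phi0 ![_, d, e] + dot _ d * phi0 ![_, e, c] + dot _ e * phi0 ![_, c, d] -
    (dot _ c * phi0 ![_, d, e] + dot _ d * phi0 ![_, e, c] + dot _ e * phi0 ![_, c, d]))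
    ?_ ?_ ?_ c
  · exact lin4₁ _ _ _ _
  · constructor <;> intros <;> simp only [dot_add_right, dot_smul_right, form3_add₁, form3_smul₁,
      form3_add₂, form3_smul₂, smul_eq_mul] <;> ring
  intro k
  refine lin_ext (F := fun d => psi0 ![_, _, d, e]) (G := fun d => 
    dot _ _ * phi0 ![_, d, e] + dot _ d * phi0 ![_, e, _] + dot _ e * phi0 ![_, _, d] -
    (dot _ _ * phi0 ![_, d, e] + dot _ d * phi0 ![_, e, _] + dot _ e * phi0 ![_, _, d]))
    ?_ ?_ ?_ d
  · exact lin4₂ _ _ _ _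
  · constructor <;> intros <;> simp only [dot_add_right, dot_smul_right, form3_add₁, form3_smul₁,
      form3_add₂, form3_smul₂, smul_eq_mul] <;> ring
  intro l
  refine lin_ext (F := fun e => psi0 ![_, _, _, e]) (G := fun e => 
    dot _ _ * phi0 ![_, _, e] + dot _ _ * phi0 ![_, e, _] + dot _ e * phi0 ![_, _, _] -
    (dot _ _ * phi0 ![_, _, e] + dot _ _ * phi0 ![_, e, _] + dot _ e * phi0 ![_, _, _]))
    ?_ ?_ ?_ e
  · exact lin4₃ _ _ _ _
  · constructor <;> intros <;> simp only [dot_add_right, dot_smul_right, form3_add₁, form3_smul₁,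
      form3_add₂, form3_smul₂, smul_eq_mul] <;> ring
  intro m
  simp only [cross_stdVec, form4_smul₀, phi0_stdVec, dot_stdVec, psi0_basis]
  exact_mod_cast psiInt_cross i j k l m

/-- The action of `(1/3) X ×` on the model 3-form. -/
theorem act_cross_phi0 (X b c d : E7) :
    phi0 ![(1 / 3 : ℝ) • cross X b, c, d] + phi0 ![b, (1 / 3 : ℝ) • cross X c, d] +
      phi0 ![b, c, (1 / 3 : ℝ) • cross X d] = psi0 ![X, b, c, d] := by
  rw [(form3_perm phi0 ((1 / 3 : ℝ) • cross X c) b d).1,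
    (form3_perm phi0 ((1 / 3 : ℝ) • cross X d) b c).2.2.1]
  simp only [form3_smul₀, phi0_cross]
  have h1 : psi0 ![X, c, b, d] = -psi0 ![X, b, c, d] := (form3_perm (psi0.curryLeft X) b c d).1
  have h2 : psi0 ![X, d, b, c] = psi0 ![X, b, c, d] := (form3_perm (psi0.curryLeft X) b c d).2.2.2.1
  rw [h1, h2, dot_comm c b, dot_comm d b, dot_comm d c]
  ring

/-- The action of `(1/3) X ×` on the model 4-form. -/
theorem act_cross_psi0 (X b c d e : E7) :
    psi0 ![(1 / 3 : ℝ) • cross X b, c, d, e] + psi0 ![b, (1 / 3 : ℝ) • cross X c, d, e] +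
      psi0 ![b, c, (1 / 3 : ℝ) • cross X d, e] + psi0 ![b, c, d, (1 / 3 : ℝ) • cross X e] =
    -(dot X b * phi0 ![c, d, e] - dot X c * phi0 ![b, d, e] + dot X d * phi0 ![b, c, e]
      - dot X e * phi0 ![b, c, d]) := by
  rw [form4_move₁ psi0 b d e ((1 / 3 : ℝ) • cross X c), form4_move₂ psi0 b c e,
    form4_move₃ psi0 b c d]
  simp only [form4_smul₀, psi0_cross]
  obtain ⟨p1, p2, p3, p4, p5⟩ := form3_perm phi0 c d e
  obtain ⟨q1, q2, q3, q4, q5⟩ := form3_perm phi0 b d e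
  obtain ⟨r1, r2, r3, r4, r5⟩ := form3_perm phi0 b c e
  obtain ⟨s1, s2, s3, s4, s5⟩ := form3_perm phi0 b c d
  have t : ∀ x y : E7, phi0 ![X, y, x] = -phi0 ![X, x, y] := fun x y => (form3_perm phi0 X x y).2.1
  simp only [p1, p2, p3, p4, p5, q1, q2, q3, q4, q5, r1, r2, r3, r4, r5, s1, s2, s3, s4, s5,
    t b c, t b d, t b e, t c d, t c e, t d e, dot_comm c b, dot_comm d b, dot_comm d c, dot_comm e b,
    dot_comm e c, dot_comm e d]
  ring

/-- The exterior derivative of a 3-form with torsion `t g + φ(τ, ·, ·)`, algebraically. -/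
theorem alt_psi0_torsion (t : ℝ) (τ a b c d : E7) :
    psi0 ![t • a + cross τ a, b, c, d] - psi0 ![t • b + cross τ b, a, c, d]
      + psi0 ![t • c + cross τ c, a, b, d] - psi0 ![t • d + cross τ d, a, b, c] =
    4 * t * psi0 ![a, b, c, d] - 3 * (dot τ a * phi0 ![b, c, d] - dot τ b * phi0 ![a, c, d]
      + dot τ c * phi0 ![a, b, d] - dot τ d * phi0 ![a, b, c]) := by
  simp only [form4_add₀, form4_smul₀, psi0_cross]
  obtain ⟨p1, p2, p3, p4, p5⟩ := form3_perm phi0 b c d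
  obtain ⟨q1, q2, q3, q4, q5⟩ := form3_perm phi0 a c d
  obtain ⟨r1, r2, r3, r4, r5⟩ := form3_perm phi0 a b d
  obtain ⟨s1, s2, s3, s4, s5⟩ := form3_perm phi0 a b c
  have t : ∀ x y : E7, phi0 ![τ, y, x] = -phi0 ![τ, x, y] := fun x y => (form3_perm phi0 τ x y).2.1
  have m1 : psi0 ![b, a, c, d] = -psi0 ![a, b, c, d] := form4_move₁ ..
  have m2 : psi0 ![c, a, b, d] = psi0 ![a, b, c, d] := (form4_move₂ ..).symm
  have m3 : psi0 ![d, a, b, c] = -psi0 ![a, b, c, d] := by rw [form4_move₃ psi0 a b c d, neg_neg]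
  simp only [p1, p2, p3, p4, p5, q1, q2, q3, q4, q5, r1, r2, r3, r4, r5, s1, s2, s3, s4, s5, m1, m2,
    m3, t a b, t a c, t a d, t b c, t b d, t c d, dot_comm b a, dot_comm c a, dot_comm c b,
    dot_comm d a, dot_comm d b, dot_comm d c]
  ring

/-! ### Alternating forms are determined on increasing index tuples -/

/-- Forms are determined on injective index tuples, and sorting such a tuple multiplies both sides
by the same sign. For 3-forms and 4-forms this leaves 35 components. -/
theorem ext_sorted {n : ℕ} {α β : E7 [⋀^Fin n]→ₗ[ℝ] ℝ}
    (h : ∀ f : Fin n → Fin 7, StrictMono f → α (fun i => stdVec (f i)) = β fun i => stdVec (f i)) :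
    α = β := by
  refine Module.Basis.ext_alternating (EuclideanSpace.basisFun (Fin 7) ℝ).toBasis fun f hf => ?_
  rw [← stdVec_eq_basis]
  have hs : StrictMono (f ∘ Tuple.sort f) :=
    (Tuple.monotone_sort f).strictMono_of_injective (hf.comp (Tuple.sort f).injective)
  have key := h _ hs
  have e : (fun i => stdVec ((f ∘ Tuple.sort f) i)) = (fun i => stdVec (f i)) ∘ Tuple.sort f := rfl
  rw [e, AlternatingMap.map_perm, AlternatingMap.map_perm] at key
  exact smul_left_cancel _ key

theorem ext_sorted₃ {α β : E7 [⋀^Fin 3]→ₗ[ℝ] ℝ}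
    (h : ∀ i j k, i < j → j < k → α ![stdVec i, stdVec j, stdVec k] =
      β ![stdVec i, stdVec j, stdVec k]) : α = β := by
  refine ext_sorted fun f hf => ?_
  have e : (fun i => stdVec (f i)) = ![stdVec (f 0), stdVec (f 1), stdVec (f 2)] := by
    ext1 i; fin_cases i <;> rfl
  rw [e]
  exact h _ _ _ (hf (by decide)) (hf (by decide))

theorem ext_sorted₄ {α β : E7 [⋀^Fin 4]→ₗ[ℝ] ℝ}
    (h : ∀ i j k l, i < j → j < k → k < l → α ![stdVec i, stdVec j, stdVec k, stdVec l] =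
      β ![stdVec i, stdVec j, stdVec k, stdVec l]) : α = β := by
  refine ext_sorted fun f hf => ?_
  have e : (fun i => stdVec (f i)) =
      ![stdVec (f 0), stdVec (f 1), stdVec (f 2), stdVec (f 3)] := by
    ext1 i; fin_cases i <;> rfl
  rw [e]
  exact h _ _ _ _ (hf (by decide)) (hf (by decide)) (hf (by decide))

theorem forall_lt₃ {P : Fin 7 → Fin 7 → Fin 7 → Prop} (h :
    P 0 1 2 ∧ P 0 1 3 ∧ P 0 1 4 ∧ P 0 1 5 ∧ P 0 1 6 ∧ P 0 2 3 ∧ P 0 2 4 ∧ P 0 2 5 ∧ P 0 2 6 ∧ P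
    0 3 4 ∧ P 0 3 5 ∧ P 0 3 6 ∧ P 0 4 5 ∧ P 0 4 6 ∧ P 0 5 6 ∧ P 1 2 3 ∧ P 1 2 4 ∧ P 1 2 5 ∧ P 1
    2 6 ∧ P 1 3 4 ∧ P 1 3 5 ∧ P 1 3 6 ∧ P 1 4 5 ∧ P 1 4 6 ∧ P 1 5 6 ∧ P 2 3 4 ∧ P 2 3 5 ∧ P 2 3
    6 ∧ P 2 4 5 ∧ P 2 4 6 ∧ P 2 5 6 ∧ P 3 4 5 ∧ P 3 4 6 ∧ P 3 5 6 ∧ P 4 5 6) :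
    ∀ i j k, i < j → j < k → P i j k := by
  have h1 : ∀ i j k : Fin 7, i < j → j < k → (i, j, k) ∈ [
      (0, 1, 2), (0, 1, 3), (0, 1, 4), (0, 1, 5), (0, 1, 6), (0, 2, 3), (0, 2, 4), (0, 2, 5),
      (0, 2, 6), (0, 3, 4), (0, 3, 5), (0, 3, 6), (0, 4, 5), (0, 4, 6), (0, 5, 6), (1, 2, 3),
      (1, 2, 4), (1, 2, 5), (1, 2, 6), (1, 3, 4), (1, 3, 5), (1, 3, 6), (1, 4, 5), (1, 4, 6),
      (1, 5, 6), (2, 3, 4), (2, 3, 5), (2, 3, 6), (2, 4, 5), (2, 4, 6), (2, 5, 6), (3, 4, 5),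
      (3, 4, 6), (3, 5, 6), (4, 5, 6)] := by decide +kernel
  have h2 : ∀ t ∈ [
      ((0, 1, 2) : Fin 7 × Fin 7 × Fin 7), (0, 1, 3), (0, 1, 4), (0, 1, 5), (0, 1, 6), (0, 2,
      3), (0, 2, 4), (0, 2, 5), (0, 2, 6), (0, 3, 4), (0, 3, 5), (0, 3, 6), (0, 4, 5), (0, 4,
      6), (0, 5, 6), (1, 2, 3), (1, 2, 4), (1, 2, 5), (1, 2, 6), (1, 3, 4), (1, 3, 5), (1, 3,
      6), (1, 4, 5), (1, 4, 6), (1, 5, 6), (2, 3, 4), (2, 3, 5), (2, 3, 6), (2, 4, 5), (2, 4,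
      6), (2, 5, 6), (3, 4, 5), (3, 4, 6), (3, 5, 6), (4, 5, 6)],
      P t.1 t.2.1 t.2.2 := by
    simp only [List.forall_mem_cons]
    simpa using h
  exact fun i j k hij hjk => h2 _ (h1 i j k hij hjk)

/-! ### The infinitesimal action of endomorphisms -/

/-- The derivative of `ω ∘ (1 + s B)` at `s = 0`. -/
def act {n : ℕ} (B : E7 →ₗ[ℝ] E7) (α : E7 [⋀^Fin (n + 1)]→ₗ[ℝ] ℝ) : E7 [⋀^Fin (n + 1)]→ₗ[ℝ] ℝ :=
  AlternatingMap.alternatizeUncurryFin (α.curryLeft ∘ₗ B)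

theorem act_apply₃ (B : E7 →ₗ[ℝ] E7) (α : E7 [⋀^Fin 3]→ₗ[ℝ] ℝ) (x y z : E7) :
    act B α ![x, y, z] = α ![B x, y, z] + α ![x, B y, z] + α ![x, y, B z] := by
  have h : act B α ![x, y, z] = α ![B x, y, z] - α ![B y, x, z] + α ![B z, x, y] := by
    rw [act, AlternatingMap.alternatizeUncurryFin_apply, Fin.sum_univ_three]
    have e0 : Fin.removeNth 0 ![x, y, z] = ![y, z] := by ext1 i; fin_cases i <;> rfl
    have e1 : Fin.removeNth 1 ![x, y, z] = ![x, z] := by ext1 i; fin_cases i <;> rfl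
    have e2 : Fin.removeNth 2 ![x, y, z] = ![x, y] := by ext1 i; fin_cases i <;> rfl
    rw [e0, e1, e2]
    simp
    ring
  rw [h, (form3_perm α (B y) x z).1, (form3_perm α (B z) x y).2.2.1]
  ring

/-- The endomorphism with matrix entries `b i m`, the `i`-th row holding the image of `e_i`. -/
def ofRows (b : Fin 7 → Fin 7 → ℝ) : E7 →ₗ[ℝ] E7 :=
  ∑ i, (EuclideanSpace.proj (𝕜 := ℝ) i : E7 →L[ℝ] ℝ).toLinearMap.smulRight (WithLp.toLp 2 (b i))

theorem ofRows_stdVec (b : Fin 7 → Fin 7 → ℝ) (i m : Fin 7) : ofRows b (stdVec i) m = b i m := by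
  simp [ofRows, stdVec_apply]

theorem act_phi0 (B : E7 →ₗ[ℝ] E7) (i j k : Fin 7) :
    act B phi0 ![stdVec i, stdVec j, stdVec k] = fanoSign j k * B (stdVec i) (fano j k) +
      fanoSign k i * B (stdVec j) (fano k i) + fanoSign i j * B (stdVec k) (fano i j) := by
  rw [act_apply₃, (form3_perm phi0 (B (stdVec j)) (stdVec k) (stdVec i)).2.2.2.1,
    (form3_perm phi0 (B (stdVec k)) (stdVec i) (stdVec j)).2.2.1]
  simp only [phi0_vecCons]

/-- Every 3-form is tangent to the orbit of the model form. -/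
theorem exists_act_eq (α : E7 [⋀^Fin 3]→ₗ[ℝ] ℝ) : ∃ B, act B phi0 = α := by
  obtain ⟨F, hF⟩ : ∃ F : Fin 7 → Fin 7 → Fin 7 → ℝ, ∀ i j k,
    α ![stdVec i, stdVec j, stdVec k] = F i j k := ⟨fun i j k => _, fun i j k => rfl⟩
  -- The witness is a linear right inverse of `B ↦ act B φ₀` from 49 matrix entries to 35
  -- components. The kernel is the stabiliser algebra, of dimension 14; the solution displayed has
  -- fourteen entries equal to zero.
  refine ⟨ofRows ![
    ![1/3 * F 0 1 2 + 1/3 * F 0 3 4 + 1/3 * F 0 5 6 - 1/6 * F 1 3 5 + 1/6 * F 1 4 6 + 1/6 * F 2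
    3 6 + 1/6 * F 2 4 5, 1/2 * F 0 3 5 - 1/2 * F 0 4 6 + 1/2 * F 1 3 4 - 1/2 * F 1 5 6, - 1/2 *
    F 0 3 6 - 1/2 * F 0 4 5 + 1/2 * F 2 3 4 - 1/2 * F 2 5 6, - 1/2 * F 0 1 5 + 1/2 * F 0 2 6 +
    1/2 * F 1 2 3 - 1/2 * F 3 5 6, 1/2 * F 0 1 6 + 1/2 * F 0 2 5 + 1/2 * F 1 2 4 - 1/2 * F 4 5
    6, 1/2 * F 0 1 3 - 1/2 * F 0 2 4 + 1/2 * F 1 2 5 + 1/2 * F 3 4 5, - 1/2 * F 0 1 4 - 1/2 * F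
    0 2 3 + 1/2 * F 1 2 6 + 1/2 * F 3 4 6],
    ![F 1 5 6, 1/3 * F 0 1 2 - 1/6 * F 0 3 4 - 1/6 * F 0 5 6 + 1/3 * F 1 3 5 - 1/3 * F 1 4 6 +
    1/6 * F 2 3 6 + 1/6 * F 2 4 5, - 1/2 * F 1 3 6 - 1/2 * F 1 4 5 + 1/2 * F 2 3 5 + 1/2 * F 2 4
    6, 1/2 * F 0 1 4 - 1/2 * F 0 2 3 + 1/2 * F 1 2 6 + 1/2 * F 3 4 6, - 1/2 * F 0 1 3 - 1/2 * F
    0 2 4 + 1/2 * F 1 2 5 - 1/2 * F 3 4 5, 1/2 * F 0 1 6 - 1/2 * F 0 2 5 - 1/2 * F 1 2 4 + 1/2 *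
    F 4 5 6, - 1/2 * F 0 1 5 - 1/2 * F 0 2 6 - 1/2 * F 1 2 3 + 1/2 * F 3 5 6],
    ![F 2 5 6, - F 2 4 6, 1/3 * F 0 1 2 - 1/6 * F 0 3 4 - 1/6 * F 0 5 6 - 1/6 * F 1 3 5 + 1/6 *
    F 1 4 6 - 1/3 * F 2 3 6 - 1/3 * F 2 4 5, 1/2 * F 0 1 3 + 1/2 * F 0 2 4 + 1/2 * F 1 2 5 + 1/2
    * F 3 4 5, 1/2 * F 0 1 4 - 1/2 * F 0 2 3 - 1/2 * F 1 2 6 + 1/2 * F 3 4 6, 1/2 * F 0 1 5 +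
    1/2 * F 0 2 6 - 1/2 * F 1 2 3 + 1/2 * F 3 5 6, 1/2 * F 0 1 6 - 1/2 * F 0 2 5 + 1/2 * F 1 2 4
    - 1/2 * F 4 5 6],
    ![F 3 5 6, - F 3 4 6, - F 3 4 5, - 1/6 * F 0 1 2 + 1/3 * F 0 3 4 - 1/6 * F 0 5 6 + 1/3 * F 1
    3 5 + 1/6 * F 1 4 6 - 1/3 * F 2 3 6 + 1/6 * F 2 4 5, - 1/2 * F 1 3 6 + 1/2 * F 1 4 5 - 1/2 *
    F 2 3 5 - 1/2 * F 2 4 6, 1/2 * F 0 3 6 - 1/2 * F 0 4 5 + 1/2 * F 2 3 4 - 1/2 * F 2 5 6, -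
    1/2 * F 0 3 5 - 1/2 * F 0 4 6 + 1/2 * F 1 3 4 - 1/2 * F 1 5 6],
    ![F 4 5 6, 0, 0, 0, - 1/6 * F 0 1 2 + 1/3 * F 0 3 4 - 1/6 * F 0 5 6 - 1/6 * F 1 3 5 - 1/3 *
    F 1 4 6 + 1/6 * F 2 3 6 - 1/3 * F 2 4 5, 1/2 * F 0 3 5 + 1/2 * F 0 4 6 + 1/2 * F 1 3 4 - 1/2
    * F 1 5 6, 1/2 * F 0 3 6 - 1/2 * F 0 4 5 - 1/2 * F 2 3 4 + 1/2 * F 2 5 6],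
    ![0, 0, 0, 0, 0, - 1/6 * F 0 1 2 - 1/6 * F 0 3 4 + 1/3 * F 0 5 6 + 1/3 * F 1 3 5 + 1/6 * F 1
    4 6 + 1/6 * F 2 3 6 - 1/3 * F 2 4 5, 1/2 * F 1 3 6 - 1/2 * F 1 4 5 - 1/2 * F 2 3 5 - 1/2 * F
    2 4 6],
    ![0, 0, 0, 0, 0, 0, - 1/6 * F 0 1 2 - 1/6 * F 0 3 4 + 1/3 * F 0 5 6 - 1/6 * F 1 3 5 - 1/3 *
    F 1 4 6 - 1/3 * F 2 3 6 + 1/6 * F 2 4 5]], ext_sorted₃ (forall_lt₃ ?_)⟩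
  simp only [act_phi0, ofRows_stdVec, hF, fano, fanoSign]
  refine ⟨?_, ?_, ?_, ?_, ?_, ?_, ?_, ?_, ?_, ?_, ?_, ?_, ?_, ?_, ?_, ?_, ?_, ?_, ?_, ?_, ?_, ?_, ?_, ?_, ?_, ?_, ?_, ?_, ?_, ?_, ?_, ?_, ?_, ?_, ?_⟩ <;>
    (simp only [Matrix.cons_val]; push_cast; ring)

theorem ofRows_apply (b : Fin 7 → Fin 7 → ℝ) (x : E7) (m : Fin 7) :
    ofRows b x m = ∑ i, x i * b i m := by
  simp [ofRows]

/-- A skew endomorphism acts on the model 3-form by contraction of a vector with the 4-form. -/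
theorem act_skew (C : E7 →ₗ[ℝ] E7) (hC : ∀ x y, dot (C x) y = -dot x (C y)) :
    ∃ X : E7, act C phi0 = psi0.curryLeft X := by
  have h : ∀ i j, C (stdVec i) j = -C (stdVec j) i := fun i j => by
    have := hC (stdVec i) (stdVec j)
    rwa [dot_stdVec_right, dot_stdVec_left] at this
  have h0 : ∀ i, C (stdVec i) i = 0 := fun i => by linarith [h i i]
  -- `X` is the contraction `½ φ_{kij} C_{ij}`, the seven-dimensional part of the 2-form `C`; the
  -- complementary part lies in the stabiliser algebra and acts trivially.
  refine ⟨WithLp.toLp 2 ![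
    C (stdVec 1) 2 + C (stdVec 3) 4 - C (stdVec 6) 5,
    - C (stdVec 0) 2 + C (stdVec 3) 5 + C (stdVec 6) 4,
    C (stdVec 0) 1 - C (stdVec 3) 6 + C (stdVec 5) 4,
    - C (stdVec 0) 4 - C (stdVec 1) 5 - C (stdVec 6) 2,
    C (stdVec 0) 3 + C (stdVec 1) 6 - C (stdVec 5) 2,
    - C (stdVec 0) 6 + C (stdVec 1) 3 + C (stdVec 4) 2,
    C (stdVec 0) 5 - C (stdVec 1) 4 + C (stdVec 3) 2], ext_sorted₃ (forall_lt₃ ?_)⟩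
  have e : ∀ (x : E7) (i j k : Fin 7), psi0.curryLeft x ![stdVec i, stdVec j, stdVec k] =
    fanoSign₄ i j k * x (fano (fano i j) k) := psi0_cons
  simp only [act_phi0, e, fanoSign₄]
  refine ⟨?_, ?_, ?_, ?_, ?_, ?_, ?_, ?_, ?_, ?_, ?_, ?_, ?_, ?_, ?_, ?_, ?_, ?_, ?_, ?_, ?_, ?_, ?_, ?_, ?_, ?_, ?_, ?_, ?_, ?_, ?_, ?_, ?_, ?_, ?_⟩ <;>
    (simp only [fano, fanoSign, Matrix.cons_val, Fin.reduceEq, or_self, or_true, true_or, if_true,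
      if_false, h0]
     push_cast
     linarith [h 0 1, h 0 2, h 0 3, h 0 4, h 0 5, h 0 6, h 1 2, h 1 3, h 1 4, h 1 5, h 1 6, h 2 3,
       h 2 4, h 2 5, h 2 6, h 3 4, h 3 5, h 3 6, h 4 5, h 4 6, h 5 6])

theorem psi0_contract (x y : E7) : ∑ j, ∑ k, ∑ l, psi0 ![x, stdVec j, stdVec k, stdVec l] *
    psi0 ![y, stdVec j, stdVec k, stdVec l] = 24 * dot x y := by
  refine lin_ext (F := fun x => ∑ j, ∑ k, ∑ l, psi0 ![x, stdVec j, stdVec k, stdVec l] *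
    psi0 ![y, stdVec j, stdVec k, stdVec l]) (G := fun x => 24 * dot x y) ?_ ?_ ?_ x
  · constructor <;> intros <;> simp only [form4_add₀, form4_smul₀, add_mul, Finset.sum_add_distrib,
      smul_eq_mul, Finset.mul_sum, mul_assoc]
  · constructor <;> intros <;> simp only [dot_add_left, dot_smul_left, smul_eq_mul] <;> ring
  intro i
  refine lin_ext (F := fun y => ∑ j, ∑ k, ∑ l, psi0 ![stdVec i, stdVec j, stdVec k, stdVec l] *
    psi0 ![y, stdVec j, stdVec k, stdVec l]) (G := fun y => 24 * dot (stdVec i) y) ?_ ?_ ?_ y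
  · constructor <;> intros <;> simp only [form4_add₀, form4_smul₀, mul_add, Finset.sum_add_distrib,
      smul_eq_mul, Finset.mul_sum, mul_left_comm]
  · constructor <;> intros <;> simp only [dot_add_right, dot_smul_right, smul_eq_mul] <;> ring
  intro m
  simp only [psi0_basis, dot_stdVec, delta]
  have := congrArg (fun z : ℤ => (z : ℝ)) (psiInt_psiInt i m)
  push_cast at this ⊢
  rw [this]
  split_ifs <;> norm_num

theorem phi0_contract (x y : E7) : ∑ j, ∑ k, phi0 ![x, stdVec j, stdVec k] *
    phi0 ![y, stdVec j, stdVec k] = 6 * dot x y := by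
  refine lin_ext (F := fun x => ∑ j, ∑ k, phi0 ![x, stdVec j, stdVec k] *
    phi0 ![y, stdVec j, stdVec k]) (G := fun x => 6 * dot x y) ?_ ?_ ?_ x
  · constructor <;> intros <;> simp only [form3_add₀, form3_smul₀, add_mul, Finset.sum_add_distrib,
      smul_eq_mul, Finset.mul_sum, mul_assoc]
  · constructor <;> intros <;> simp only [dot_add_left, dot_smul_left, smul_eq_mul] <;> ring
  intro i
  refine lin_ext (F := fun y => ∑ j, ∑ k, phi0 ![stdVec i, stdVec j, stdVec k] *
    phi0 ![y, stdVec j, stdVec k]) (G := fun y => 6 * dot (stdVec i) y) ?_ ?_ ?_ y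
  · constructor <;> intros <;> simp only [form3_add₀, form3_smul₀, mul_add, Finset.sum_add_distrib,
      smul_eq_mul, Finset.mul_sum, mul_left_comm]
  · constructor <;> intros <;> simp only [dot_add_right, dot_smul_right, smul_eq_mul] <;> ring
  intro m
  simp only [phi0_stdVec, dot_stdVec, delta]
  have := congrArg (fun z : ℤ => (z : ℝ)) (phiInt_phiInt i m)
  push_cast at this ⊢
  rw [this]
  split_ifs <;> norm_num

/-- A symmetric endomorphism that acts trivially on the model 3-form vanishes. -/
theorem eq_zero_of_act_symm (S : E7 →ₗ[ℝ] E7) (hS : ∀ x y, dot (S x) y = dot x (S y))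
    (h : act S phi0 = 0) : S = 0 := by
  have hs : ∀ i j, S (stdVec i) j = S (stdVec j) i := fun i j => by
    have := hS (stdVec i) (stdVec j)
    rwa [dot_stdVec_right, dot_stdVec_left] at this
  have h1 : ∀ i j k, (fanoSign j k * S (stdVec i) (fano j k) : ℝ) +
      fanoSign k i * S (stdVec j) (fano k i) + fanoSign i j * S (stdVec k) (fano i j) = 0 := by
    intro i j k
    rw [← act_phi0, h]; rfl
  have e012 := h1 0 1 2
  have e013 := h1 0 1 3
  have e014 := h1 0 1 4
  have e015 := h1 0 1 5
  have e016 := h1 0 1 6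
  have e023 := h1 0 2 3
  have e024 := h1 0 2 4
  have e025 := h1 0 2 5
  have e026 := h1 0 2 6
  have e034 := h1 0 3 4
  have e035 := h1 0 3 5
  have e036 := h1 0 3 6
  have e045 := h1 0 4 5
  have e046 := h1 0 4 6
  have e056 := h1 0 5 6
  have e123 := h1 1 2 3
  have e124 := h1 1 2 4
  have e125 := h1 1 2 5
  have e126 := h1 1 2 6
  have e134 := h1 1 3 4
  have e135 := h1 1 3 5
  have e136 := h1 1 3 6
  have e145 := h1 1 4 5
  have e146 := h1 1 4 6
  have e156 := h1 1 5 6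
  have e234 := h1 2 3 4
  have e235 := h1 2 3 5
  have e236 := h1 2 3 6
  have e245 := h1 2 4 5
  have e246 := h1 2 4 6
  have e256 := h1 2 5 6
  have e345 := h1 3 4 5
  have e346 := h1 3 4 6
  have e356 := h1 3 5 6
  have e456 := h1 4 5 6
  simp only [fano, fanoSign, Matrix.cons_val] at e012 e013 e014 e015 e016 e023
  simp only [fano, fanoSign, Matrix.cons_val] at e024 e025 e026 e034 e035 e036
  push_cast at e012 e013 e014 e015 e016 e023 e024 e025 e026 e034 e035 e036
  simp only [fano, fanoSign, Matrix.cons_val] at e045 e046 e056 e123 e124 e125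
  simp only [fano, fanoSign, Matrix.cons_val] at e126 e134 e135 e136 e145 e146
  push_cast at e045 e046 e056 e123 e124 e125 e126 e134 e135 e136 e145 e146
  simp only [fano, fanoSign, Matrix.cons_val] at e156 e234 e235 e236 e245 e246
  simp only [fano, fanoSign, Matrix.cons_val] at e256 e345 e346 e356 e456
  push_cast at e156 e234 e235 e236 e245 e246 e256 e345 e346 e356 e456
  -- The seven Fano lines give seven equations for the diagonal entries. The other 28 triples fall
  -- into seven blocks of four, one for each point `k`, and a block involves only the three entries
  -- `S_{ij}` with `{i, j, k}` a line.
  have z00 : S (stdVec 0) 0 = 0 := by linarith only [e012, e034, e056, e135, e146, e236, e245]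
  have z01 : S (stdVec 0) 1 = 0 := by linarith only [e035, e046, e134, e156, hs 0 1, hs 3 6, hs 4 5]
  have z02 : S (stdVec 0) 2 = 0 := by linarith only [e036, e045, e234, e256, hs 0 2, hs 3 5, hs 4 6]
  have z03 : S (stdVec 0) 3 = 0 := by linarith only [e015, e026, e123, e356, hs 0 3, hs 1 6, hs 2 5]
  have z04 : S (stdVec 0) 4 = 0 := by linarith only [e016, e025, e124, e456, hs 0 4, hs 1 5, hs 2 6]
  have z05 : S (stdVec 0) 5 = 0 := by linarith only [e013, e024, e125, e345, hs 0 5, hs 1 4, hs 2 3]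
  have z06 : S (stdVec 0) 6 = 0 := by linarith only [e014, e023, e126, e346, hs 0 6, hs 1 3, hs 2 4]
  have z11 : S (stdVec 1) 1 = 0 := by linarith only [e012, e034, e056, e135, e146, e236, e245]
  have z12 : S (stdVec 1) 2 = 0 := by linarith only [e136, e145, e235, e246, hs 1 2, hs 3 4, hs 5 6]
  have z13 : S (stdVec 1) 3 = 0 := by linarith only [e014, e023, e126, e346, hs 0 6, hs 1 3, hs 2 4]
  have z14 : S (stdVec 1) 4 = 0 := by linarith only [e013, e024, e125, e345, hs 0 5, hs 1 4, hs 2 3]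
  have z15 : S (stdVec 1) 5 = 0 := by linarith only [e016, e025, e124, e456, hs 0 4, hs 1 5, hs 2 6]
  have z16 : S (stdVec 1) 6 = 0 := by linarith only [e015, e026, e123, e356, hs 0 3, hs 1 6, hs 2 5]
  have z22 : S (stdVec 2) 2 = 0 := by linarith only [e012, e034, e056, e135, e146, e236, e245]
  have z23 : S (stdVec 2) 3 = 0 := by linarith only [e013, e024, e125, e345, hs 0 5, hs 1 4, hs 2 3]
  have z24 : S (stdVec 2) 4 = 0 := by linarith only [e014, e023, e126, e346, hs 0 6, hs 1 3, hs 2 4]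
  have z25 : S (stdVec 2) 5 = 0 := by linarith only [e015, e026, e123, e356, hs 0 3, hs 1 6, hs 2 5]
  have z26 : S (stdVec 2) 6 = 0 := by linarith only [e016, e025, e124, e456, hs 0 4, hs 1 5, hs 2 6]
  have z33 : S (stdVec 3) 3 = 0 := by linarith only [e012, e034, e056, e135, e146, e236, e245]
  have z34 : S (stdVec 3) 4 = 0 := by linarith only [e136, e145, e235, e246, hs 1 2, hs 3 4, hs 5 6]
  have z35 : S (stdVec 3) 5 = 0 := by linarith only [e036, e045, e234, e256, hs 0 2, hs 3 5, hs 4 6]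
  have z36 : S (stdVec 3) 6 = 0 := by linarith only [e035, e046, e134, e156, hs 0 1, hs 3 6, hs 4 5]
  have z44 : S (stdVec 4) 4 = 0 := by linarith only [e012, e034, e056, e135, e146, e236, e245]
  have z45 : S (stdVec 4) 5 = 0 := by linarith only [e035, e046, e134, e156, hs 0 1, hs 3 6, hs 4 5]
  have z46 : S (stdVec 4) 6 = 0 := by linarith only [e036, e045, e234, e256, hs 0 2, hs 3 5, hs 4 6]
  have z55 : S (stdVec 5) 5 = 0 := by linarith only [e012, e034, e056, e135, e146, e236, e245]
  have z56 : S (stdVec 5) 6 = 0 := by linarith only [e136, e145, e235, e246, hs 1 2, hs 3 4, hs 5 6]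
  have z66 : S (stdVec 6) 6 = 0 := by linarith only [e012, e034, e056, e135, e146, e236, e245]
  have hz : ∀ i j, S (stdVec i) j = 0 := by
    have hu : ∀ i j, i ≤ j → S (stdVec i) j = 0 := by
      intro i j hij
      fin_cases i <;> fin_cases j <;>
        first | exact absurd hij (by decide) | assumption
    intro i j
    rcases le_total i j with hij | hij
    · exact hu i j hij
    · rw [hs]; exact hu j i hij
  ext x m
  have : S x m = ∑ i, x i * S (stdVec i) m := lin_eq_sum
    (F := fun x => S x m) ⟨fun _ _ => by simp, fun _ _ => by simp⟩ x
  rw [this]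
  simp [hz]

/-! ### Wedge products and alternation, written out -/

section Wedge

variable {ι R : Type*} [Ring R]

/-- `τ ∧ α` for a 1-form and a 3-form. -/
def wedge13 (τ : ι → R) (α : ι → ι → ι → R) (a b c d : ι) : R :=
    τ a * α b c d - τ b * α a c d + τ c * α a b d - τ d * α a b c

/-- `τ ∧ α` for a 1-form and a 4-form. -/
def wedge14 (τ : ι → R) (α : ι → ι → ι → ι → R) (a b c d e : ι) : R :=
    τ a * α b c d e - τ b * α a c d e + τ c * α a b d e - τ d * α a b c e + τ e * α a b c d

/-- `β ∧ α` for a 2-form and a 3-form. -/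
def wedge23 (β : ι → ι → R) (α : ι → ι → ι → R) (a b c d e : ι) : R :=
    β a b * α c d e - β a c * α b d e + β a d * α b c e - β a e * α b c d + β b c * α a d e - β
    b d * α a c e + β b e * α a c d + β c d * α a b e - β c e * α a b d + β d e * α a b c

/-- `β ∧ α` for a 2-form and a 4-form. -/
def wedge24 (β : ι → ι → R) (α : ι → ι → ι → ι → R) (a b c d e f : ι) : R :=
    β a b * α c d e f - β a c * α b d e f + β a d * α b c e f - β a e * α b c d f + β a f * α b
    c d e + β b c * α a d e f - β b d * α a c e f + β b e * α a c d f - β b f * α a c d e + β c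
    d * α a b e f - β c e * α a b d f + β c f * α a b d e + β d e * α a b c f - β d f * α a b c
    e + β e f * α a b c d

/-- Alternation in the first of four arguments. -/
def alt4 (D : ι → ι → ι → ι → R) (a b c d : ι) : R :=
  D a b c d - D b a c d + D c a b d - D d a b c

/-- Alternation in the first of five arguments. -/
def alt5 (D : ι → ι → ι → ι → ι → R) (a b c d e : ι) : R :=
  D a b c d e - D b a c d e + D c a b d e - D d a b c e + D e a b c d

end Wedge

/-- A 3-form as a function of three vectors. -/
def fun3 (α : E7 [⋀^Fin 3]→ₗ[ℝ] ℝ) (a b c : E7) : ℝ := α ![a, b, c]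

/-- A 4-form as a function of four vectors. -/
def fun4 (α : E7 [⋀^Fin 4]→ₗ[ℝ] ℝ) (a b c d : E7) : ℝ := α ![a, b, c, d]

/-- The exterior product with a 1-form. -/
def wedge1 {n : ℕ} (τ : E7 →ₗ[ℝ] ℝ) (α : E7 [⋀^Fin n]→ₗ[ℝ] ℝ) : E7 [⋀^Fin (n + 1)]→ₗ[ℝ] ℝ :=
  AlternatingMap.alternatizeUncurryFin (τ.smulRight α)

theorem wedge1_apply₃ (τ : E7 →ₗ[ℝ] ℝ) (α : E7 [⋀^Fin 3]→ₗ[ℝ] ℝ) (a b c d : E7) :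
    wedge1 τ α ![a, b, c, d] = wedge13 τ (fun3 α) a b c d := by
  rw [wedge1, AlternatingMap.alternatizeUncurryFin_apply, Fin.sum_univ_four]
  have e0 : Fin.removeNth 0 ![a, b, c, d] = ![b, c, d] := by ext1 i; fin_cases i <;> rfl
  have e1 : Fin.removeNth 1 ![a, b, c, d] = ![a, c, d] := by ext1 i; fin_cases i <;> rfl
  have e2 : Fin.removeNth 2 ![a, b, c, d] = ![a, b, d] := by ext1 i; fin_cases i <;> rfl
  have e3 : Fin.removeNth 3 ![a, b, c, d] = ![a, b, c] := by ext1 i; fin_cases i <;> rfl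
  rw [e0, e1, e2, e3]
  have h3 : ((3 : Fin 4) : ℕ) = 3 := rfl
  have h2 : ((2 : Fin 4) : ℕ) = 2 := rfl
  simp [wedge13, fun3, h3, h2, pow_succ]
  ring

theorem wedge1_apply₄ (τ : E7 →ₗ[ℝ] ℝ) (α : E7 [⋀^Fin 4]→ₗ[ℝ] ℝ) (a b c d e : E7) :
    wedge1 τ α ![a, b, c, d, e] = wedge14 τ (fun4 α) a b c d e := by
  rw [wedge1, AlternatingMap.alternatizeUncurryFin_apply, Fin.sum_univ_five]
  have e0 : Fin.removeNth 0 ![a, b, c, d, e] = ![b, c, d, e] := by ext1 i; fin_cases i <;> rfl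
  have e1 : Fin.removeNth 1 ![a, b, c, d, e] = ![a, c, d, e] := by ext1 i; fin_cases i <;> rfl
  have e2 : Fin.removeNth 2 ![a, b, c, d, e] = ![a, b, d, e] := by ext1 i; fin_cases i <;> rfl
  have e3 : Fin.removeNth 3 ![a, b, c, d, e] = ![a, b, c, e] := by ext1 i; fin_cases i <;> rfl
  have e4 : Fin.removeNth 4 ![a, b, c, d, e] = ![a, b, c, d] := by ext1 i; fin_cases i <;> rfl
  rw [e0, e1, e2, e3, e4]
  have h4 : ((4 : Fin 5) : ℕ) = 4 := rfl
  have h3 : ((3 : Fin 5) : ℕ) = 3 := rfl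
  have h2 : ((2 : Fin 5) : ℕ) = 2 := rfl
  simp [wedge14, fun4, h4, h3, h2, pow_succ]
  ring

theorem wedge1_add {n : ℕ} (τ σ : E7 →ₗ[ℝ] ℝ) (α : E7 [⋀^Fin n]→ₗ[ℝ] ℝ) :
    wedge1 (τ + σ) α = wedge1 τ α + wedge1 σ α := by
  ext v
  simp [wedge1, AlternatingMap.alternatizeUncurryFin_apply, add_mul, Finset.sum_add_distrib]

theorem wedge1_smul {n : ℕ} (c : ℝ) (τ : E7 →ₗ[ℝ] ℝ) (α : E7 [⋀^Fin n]→ₗ[ℝ] ℝ) :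
    wedge1 (c • τ) α = c • wedge1 τ α := by
  ext v
  simp only [wedge1, AlternatingMap.alternatizeUncurryFin_apply, AlternatingMap.smul_apply,
    Finset.smul_sum, LinearMap.smulRight_apply, LinearMap.smul_apply]
  exact Finset.sum_congr rfl fun i _ => by rw [smul_comm c]; congr 1; exact smul_assoc _ _ _

/-- The 2-form `X ⌟ φ₀` as a bilinear form. -/
def contractPhi0 (X : E7) (a : E7) : E7 →ₗ[ℝ] ℝ := (lin3₂ phi0 X a).mk' _

/-- Twice the form `(X ⌟ φ₀) ∧ φ₀`. -/
def wedgeContract (X : E7) : E7 [⋀^Fin 5]→ₗ[ℝ] ℝ :=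
  AlternatingMap.alternatizeUncurryFin
    { toFun := fun a => wedge1 (contractPhi0 X a) phi0
      map_add' := fun a b => by
        rw [← wedge1_add]; congr 1; ext x; exact form3_add₁ phi0 a b X x
      map_smul' := fun c a => by
        rw [RingHom.id_apply, ← wedge1_smul]; congr 1; ext x; exact form3_smul₁ phi0 c a X x }

theorem wedgeContract_apply (X a b c d e : E7) : wedgeContract X ![a, b, c, d, e] =
    2 * wedge23 (fun x y => phi0 ![X, x, y]) (fun3 phi0) a b c d e := by
  rw [wedgeContract, AlternatingMap.alternatizeUncurryFin_apply, Fin.sum_univ_five]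
  have e0 : Fin.removeNth 0 ![a, b, c, d, e] = ![b, c, d, e] := by ext1 i; fin_cases i <;> rfl
  have e1 : Fin.removeNth 1 ![a, b, c, d, e] = ![a, c, d, e] := by ext1 i; fin_cases i <;> rfl
  have e2 : Fin.removeNth 2 ![a, b, c, d, e] = ![a, b, d, e] := by ext1 i; fin_cases i <;> rfl
  have e3 : Fin.removeNth 3 ![a, b, c, d, e] = ![a, b, c, e] := by ext1 i; fin_cases i <;> rfl
  have e4 : Fin.removeNth 4 ![a, b, c, d, e] = ![a, b, c, d] := by ext1 i; fin_cases i <;> rfl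
  rw [e0, e1, e2, e3, e4]
  have h4 : ((4 : Fin 5) : ℕ) = 4 := rfl
  have h3 : ((3 : Fin 5) : ℕ) = 3 := rfl
  have h2 : ((2 : Fin 5) : ℕ) = 2 := rfl
  have t : ∀ x y : E7, contractPhi0 X x y = phi0 ![X, x, y] := fun x y => rfl
  have s : ∀ x y : E7, phi0 ![X, y, x] = -phi0 ![X, x, y] := fun x y => (form3_perm phi0 X x y).2.1
  simp only [LinearMap.coe_mk, AddHom.coe_mk, wedge1_apply₃, wedge13, t, h4, h3, h2,
    Matrix.cons_val, s a b, s a c, s a d, s a e, s b c, s b d, s b e, s c d, s c e, s d e, wedge23]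
  simp
  ring

theorem wedgeContract_int : ∀ k a b, a < b → ∀ c, b < c → ∀ d, c < d → ∀ e, d < e →
    wedge23 (fun x y => phiInt k x y) phiInt a b c d e = 2 * wedge14 (delta k) psiInt a b c d e := by
  decide +kernel

/-- `(X ⌟ φ) ∧ φ = 2 X ∧ ψ`. -/
theorem wedge_contract_phi0 (X a b c d e : E7) :
    wedge23 (fun x y => phi0 ![X, x, y]) (fun3 phi0) a b c d e =
      2 * wedge14 (dot X) (fun4 psi0) a b c d e := by
  have hl : ∀ Y, IsLinearMap ℝ (dot Y) := fun Y =>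
    ⟨fun x y => dot_add_right x y Y, fun c x => dot_smul_right c x Y⟩
  have key : wedgeContract X = (4 : ℝ) • wedge1 ((hl X).mk' _) psi0 := by
    refine ext_sorted fun f hf => ?_
    have e : (fun i => stdVec (f i)) =
        ![stdVec (f 0), stdVec (f 1), stdVec (f 2), stdVec (f 3), stdVec (f 4)] := by
      ext1 i; fin_cases i <;> rfl
    rw [e, AlternatingMap.smul_apply, wedge1_apply₄, wedgeContract_apply]
    have h01 : f 0 < f 1 := hf (by decide)
    have h12 : f 1 < f 2 := hf (by decide)
    have h23 : f 2 < f 3 := hf (by decide)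
    have h34 : f 3 < f 4 := hf (by decide)
    have hd : ⇑((hl X).mk' _) = dot X := rfl
    rw [hd]
    refine lin_ext (F := fun X => 2 * wedge23 (fun x y => phi0 ![X, x, y]) (fun3 phi0) (stdVec (f 0))
      (stdVec (f 1)) (stdVec (f 2)) (stdVec (f 3)) (stdVec (f 4))) (G := fun X => (4 : ℝ) •
      wedge14 (dot X) (fun4 psi0) (stdVec (f 0))
      (stdVec (f 1)) (stdVec (f 2)) (stdVec (f 3)) (stdVec (f 4))) ?_ ?_ ?_ X
    · constructor <;> intros <;> simp only [wedge23, form3_add₀, form3_smul₀, smul_eq_mul] <;> ring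
    · constructor <;> intros <;> simp only [wedge14, dot_add_left, dot_smul_left, smul_eq_mul] <;>
        ring
    intro k
    have := congrArg (fun z : ℤ => (z : ℝ)) (wedgeContract_int k _ _ h01 _ h12 _ h23 _ h34)
    simp only [wedge23, wedge14, fun3, fun4, phi0_stdVec, psi0_basis, dot_stdVec] at this ⊢
    push_cast at this ⊢
    rw [smul_eq_mul]
    linarith
  have h := congrArg (fun α => α ![a, b, c, d, e]) key
  simp only [AlternatingMap.smul_apply, wedge1_apply₄, wedgeContract_apply, smul_eq_mul] at h
  have hd : ⇑((hl X).mk' _) = dot X := rfl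
  rw [hd] at h
  linarith

set_option maxHeartbeats 2000000 in
/-- The algebra behind the closedness of the torsion 1-form. -/
theorem eq_zero_of_wedge (α : Fin 7 → ℝ) (β : Fin 7 → Fin 7 → ℝ) (hβ : ∀ i j, β j i = -β i j)
    (h5 : ∀ i j k l m, 4 * wedge14 α (fun a b c d => (psiInt a b c d : ℝ)) i j k l m -
      3 * wedge23 β (fun a b c => (phiInt a b c : ℝ)) i j k l m = 0)
    (h6 : ∀ i j k l m n, wedge24 β (fun a b c d => (psiInt a b c d : ℝ)) i j k l m n = 0) :
    (∀ i j, β i j = 0) ∧ ∀ i, α i = 0 := by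
  have f01234 := h5 0 1 2 3 4
  have f01235 := h5 0 1 2 3 5
  have f01236 := h5 0 1 2 3 6
  have f01245 := h5 0 1 2 4 5
  have f01246 := h5 0 1 2 4 6
  have f01256 := h5 0 1 2 5 6
  have f01345 := h5 0 1 3 4 5
  have f01346 := h5 0 1 3 4 6
  have f01356 := h5 0 1 3 5 6
  have f01456 := h5 0 1 4 5 6
  have f02345 := h5 0 2 3 4 5
  have f02346 := h5 0 2 3 4 6
  have f02356 := h5 0 2 3 5 6
  have f02456 := h5 0 2 4 5 6
  have f03456 := h5 0 3 4 5 6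
  have f12345 := h5 1 2 3 4 5
  have f12346 := h5 1 2 3 4 6
  have f12356 := h5 1 2 3 5 6
  have f12456 := h5 1 2 4 5 6
  have f13456 := h5 1 3 4 5 6
  have f23456 := h5 2 3 4 5 6
  have g012345 := h6 0 1 2 3 4 5
  have g012346 := h6 0 1 2 3 4 6
  have g012356 := h6 0 1 2 3 5 6
  have g012456 := h6 0 1 2 4 5 6
  have g013456 := h6 0 1 3 4 5 6
  have g023456 := h6 0 2 3 4 5 6
  have g123456 := h6 1 2 3 4 5 6
  clear h5 h6
  simp only [wedge14, wedge23, wedge24, phiInt, psiInt, fano, fanoSign, fanoSign₄, Matrix.cons_val,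
    Fin.reduceEq, or_self, or_true, true_or, if_true, if_false] at *
  push_cast at *
  -- The system splits into one block for each point `k`: the unknown `α_k` and the three `β_{ij}`
  -- with `{i, j, k}` a Fano line, determined by three components of the 5-form equation and one of
  -- the 6-form equation.
  have a0 : α 0 = 0 := by linarith only [f03456, f01256, f01234, g123456]
  have a1 : α 1 = 0 := by linarith only [f13456, f01246, f01235, g023456]
  have a2 : α 2 = 0 := by linarith only [f23456, f01245, f01236, g013456]
  have a3 : α 3 = 0 := by linarith only [f12356, f02346, f01345, g012456]
  have a4 : α 4 = 0 := by linarith only [f12456, f02345, f01346, g012356]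
  have a5 : α 5 = 0 := by linarith only [f12345, f02456, f01356, g012346]
  have a6 : α 6 = 0 := by linarith only [f12346, f02356, f01456, g012345]
  have b01 : β 0 1 = 0 := by linarith only [f23456, f01245, f01236, g013456]
  have b02 : β 0 2 = 0 := by linarith only [f13456, f01246, f01235, g023456]
  have b03 : β 0 3 = 0 := by linarith only [f12456, f02345, f01346, g012356]
  have b04 : β 0 4 = 0 := by linarith only [f12356, f02346, f01345, g012456]
  have b05 : β 0 5 = 0 := by linarith only [f12346, f02356, f01456, g012345]
  have b06 : β 0 6 = 0 := by linarith only [f12345, f02456, f01356, g012346]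
  have b12 : β 1 2 = 0 := by linarith only [f03456, f01256, f01234, g123456]
  have b13 : β 1 3 = 0 := by linarith only [f12345, f02456, f01356, g012346]
  have b14 : β 1 4 = 0 := by linarith only [f12346, f02356, f01456, g012345]
  have b15 : β 1 5 = 0 := by linarith only [f12356, f02346, f01345, g012456]
  have b16 : β 1 6 = 0 := by linarith only [f12456, f02345, f01346, g012356]
  have b23 : β 2 3 = 0 := by linarith only [f12346, f02356, f01456, g012345]
  have b24 : β 2 4 = 0 := by linarith only [f12345, f02456, f01356, g012346]
  have b25 : β 2 5 = 0 := by linarith only [f12456, f02345, f01346, g012356]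
  have b26 : β 2 6 = 0 := by linarith only [f12356, f02346, f01345, g012456]
  have b34 : β 3 4 = 0 := by linarith only [f03456, f01256, f01234, g123456]
  have b35 : β 3 5 = 0 := by linarith only [f13456, f01246, f01235, g023456]
  have b36 : β 3 6 = 0 := by linarith only [f23456, f01245, f01236, g013456]
  have b45 : β 4 5 = 0 := by linarith only [f23456, f01245, f01236, g013456]
  have b46 : β 4 6 = 0 := by linarith only [f13456, f01246, f01235, g023456]
  have b56 : β 5 6 = 0 := by linarith only [f03456, f01256, f01234, g123456]
  refine ⟨fun i j => ?_, fun i => by fin_cases i <;> assumption⟩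
  have hu : ∀ i j, i < j → β i j = 0 := by
    intro i j hij
    fin_cases i <;> fin_cases j <;> first | exact absurd hij (by decide) | assumption
  rcases lt_trichotomy i j with h | rfl | h
  · exact hu i j h
  · linarith [hβ i i]
  · rw [hβ j i, hu j i h, neg_zero]

/-- The wedge product with a positive 3-form is injective on 2-forms. -/
theorem eq_zero_of_wedge_phi (β : Fin 7 → Fin 7 → ℝ) (hβ : ∀ i j, β j i = -β i j)
    (h5 : ∀ i j k l m, wedge23 β (fun a b c => (phiInt a b c : ℝ)) i j k l m = 0) (i j : Fin 7) :
    β i j = 0 := by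
  have f01234 := h5 0 1 2 3 4
  have f01235 := h5 0 1 2 3 5
  have f01236 := h5 0 1 2 3 6
  have f01245 := h5 0 1 2 4 5
  have f01246 := h5 0 1 2 4 6
  have f01256 := h5 0 1 2 5 6
  have f01345 := h5 0 1 3 4 5
  have f01346 := h5 0 1 3 4 6
  have f01356 := h5 0 1 3 5 6
  have f01456 := h5 0 1 4 5 6
  have f02345 := h5 0 2 3 4 5
  have f02346 := h5 0 2 3 4 6
  have f02356 := h5 0 2 3 5 6
  have f02456 := h5 0 2 4 5 6
  have f03456 := h5 0 3 4 5 6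
  have f12345 := h5 1 2 3 4 5
  have f12346 := h5 1 2 3 4 6
  have f12356 := h5 1 2 3 5 6
  have f12456 := h5 1 2 4 5 6
  have f13456 := h5 1 3 4 5 6
  have f23456 := h5 2 3 4 5 6
  clear h5
  simp only [wedge14, wedge23, wedge24, phiInt, psiInt, fano, fanoSign, fanoSign₄, Matrix.cons_val,
    Fin.reduceEq, or_self, or_true, true_or, if_true, if_false] at *
  push_cast at *
  have b01 : β 0 1 = 0 := by linarith only [f23456, f01245, f01236]
  have b02 : β 0 2 = 0 := by linarith only [f13456, f01246, f01235]
  have b03 : β 0 3 = 0 := by linarith only [f12456, f02345, f01346]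
  have b04 : β 0 4 = 0 := by linarith only [f12356, f02346, f01345]
  have b05 : β 0 5 = 0 := by linarith only [f12346, f02356, f01456]
  have b06 : β 0 6 = 0 := by linarith only [f12345, f02456, f01356]
  have b12 : β 1 2 = 0 := by linarith only [f03456, f01256, f01234]
  have b13 : β 1 3 = 0 := by linarith only [f12345, f02456, f01356]
  have b14 : β 1 4 = 0 := by linarith only [f12346, f02356, f01456]
  have b15 : β 1 5 = 0 := by linarith only [f12356, f02346, f01345]
  have b16 : β 1 6 = 0 := by linarith only [f12456, f02345, f01346]
  have b23 : β 2 3 = 0 := by linarith only [f12346, f02356, f01456]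
  have b24 : β 2 4 = 0 := by linarith only [f12345, f02456, f01356]
  have b25 : β 2 5 = 0 := by linarith only [f12456, f02345, f01346]
  have b26 : β 2 6 = 0 := by linarith only [f12356, f02346, f01345]
  have b34 : β 3 4 = 0 := by linarith only [f03456, f01256, f01234]
  have b35 : β 3 5 = 0 := by linarith only [f13456, f01246, f01235]
  have b36 : β 3 6 = 0 := by linarith only [f23456, f01245, f01236]
  have b45 : β 4 5 = 0 := by linarith only [f23456, f01245, f01236]
  have b46 : β 4 6 = 0 := by linarith only [f13456, f01246, f01235]
  have b56 : β 5 6 = 0 := by linarith only [f03456, f01256, f01234]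
  have hu : ∀ i j, i < j → β i j = 0 := by
    intro i j hij
    fin_cases i <;> fin_cases j <;> first | exact absurd hij (by decide) | assumption
  rcases lt_trichotomy i j with h | rfl | h
  · exact hu i j h
  · linarith [hβ i i]
  · rw [hβ j i, hu j i h, neg_zero]

/-! ### The algebraic consequences of torsion-freeness of the deformed form -/

-- The linear algebra at a point once `κ = 0`, in a frame with `v = t e₀`: `s` is `τ₁`, `τ` is `τ₇`,
-- and `N i j` is the component of `∇_i v` along `e_j`. The three hypotheses encode `dφ̃ = 0`, `dv♭
-- = 2 τ₇ ∧ v♭` and `d|v|² = 6 (1 + |v|²) τ₇`. The first conclusion is `3 τ₇ = -τ₁ v♭`.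
set_option maxHeartbeats 4000000 in
theorem torsion_numbers (s t : ℝ) (τ : Fin 7 → ℝ) (N : Fin 7 → Fin 7 → ℝ)
    (h : ∀ i j k l, 4 * s * psiInt i j k l -
      3 * wedge13 τ (fun a b c => (phiInt a b c : ℝ)) i j k l +
      alt4 (fun a b c d => fanoSign₄ b c d * N a (fano (fano b c) d)) i j k l -
      alt4 (fun a b c d => wedge13 (fun m => s * (delta a m : ℝ) + fanoSign a m * τ (fano a m))
        (fun a b c => (phiInt a b c : ℝ)) 0 b c d * t) i j k l = 0)
    (hskew : ∀ i j, N i j - N j i = 2 * t * (τ i * delta j 0 - τ j * delta i 0))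
    (hM : ∀ i, t * N i 0 = 3 * (1 + t ^ 2) * τ i) :
    (∀ i, 3 * τ i = -s * t * delta i 0) ∧ (s = 0 → ∀ i j, N i j = 0) := by
  -- Since `t` may vanish, `hM` cannot be solved for `N i 0`. Parametrising `N i 0` by `q` instead
  -- gives `τ = t q` for every `t`.
  obtain ⟨q, hq⟩ : ∃ q : Fin 7 → ℝ, ∀ i, N i 0 = 3 * (1 + t ^ 2) * q i :=
    ⟨fun i => N i 0 / (3 * (1 + t ^ 2)), fun i => by field_simp⟩
  have hτ : ∀ i, τ i = t * q i := fun i => by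
    have h1 := hM i
    rw [hq] at h1
    have h2 : 3 * (1 + t ^ 2) ≠ 0 := by positivity
    exact mul_left_cancel₀ h2 (by linarith)
  have n01 : N 0 1 = (3 + t ^ 2) * q 1 := by
    have h1 := hskew 0 1
    simp [hq, hτ, delta] at h1
    linarith
  have n02 : N 0 2 = (3 + t ^ 2) * q 2 := by
    have h1 := hskew 0 2
    simp [hq, hτ, delta] at h1
    linarith
  have n03 : N 0 3 = (3 + t ^ 2) * q 3 := by
    have h1 := hskew 0 3
    simp [hq, hτ, delta] at h1
    linarith
  have n04 : N 0 4 = (3 + t ^ 2) * q 4 := by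
    have h1 := hskew 0 4
    simp [hq, hτ, delta] at h1
    linarith
  have n05 : N 0 5 = (3 + t ^ 2) * q 5 := by
    have h1 := hskew 0 5
    simp [hq, hτ, delta] at h1
    linarith
  have n06 : N 0 6 = (3 + t ^ 2) * q 6 := by
    have h1 := hskew 0 6
    simp [hq, hτ, delta] at h1
    linarith
  have n21 : N 2 1 = N 1 2 := by
    have h1 := hskew 2 1
    simp [delta] at h1
    linarith
  have n31 : N 3 1 = N 1 3 := by
    have h1 := hskew 3 1
    simp [delta] at h1
    linarith
  have n41 : N 4 1 = N 1 4 := by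
    have h1 := hskew 4 1
    simp [delta] at h1
    linarith
  have n51 : N 5 1 = N 1 5 := by
    have h1 := hskew 5 1
    simp [delta] at h1
    linarith
  have n61 : N 6 1 = N 1 6 := by
    have h1 := hskew 6 1
    simp [delta] at h1
    linarith
  have n32 : N 3 2 = N 2 3 := by
    have h1 := hskew 3 2
    simp [delta] at h1
    linarith
  have n42 : N 4 2 = N 2 4 := by
    have h1 := hskew 4 2
    simp [delta] at h1
    linarith
  have n52 : N 5 2 = N 2 5 := by
    have h1 := hskew 5 2
    simp [delta] at h1
    linarith
  have n62 : N 6 2 = N 2 6 := by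
    have h1 := hskew 6 2
    simp [delta] at h1
    linarith
  have n43 : N 4 3 = N 3 4 := by
    have h1 := hskew 4 3
    simp [delta] at h1
    linarith
  have n53 : N 5 3 = N 3 5 := by
    have h1 := hskew 5 3
    simp [delta] at h1
    linarith
  have n63 : N 6 3 = N 3 6 := by
    have h1 := hskew 6 3
    simp [delta] at h1
    linarith
  have n54 : N 5 4 = N 4 5 := by
    have h1 := hskew 5 4
    simp [delta] at h1
    linarith
  have n64 : N 6 4 = N 4 6 := by
    have h1 := hskew 6 4
    simp [delta] at h1
    linarith
  have n65 : N 6 5 = N 5 6 := by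
    have h1 := hskew 6 5
    simp [delta] at h1
    linarith
  have e0123 := h 0 1 2 3
  have e0124 := h 0 1 2 4
  have e0125 := h 0 1 2 5
  have e0126 := h 0 1 2 6
  have e0134 := h 0 1 3 4
  have e0135 := h 0 1 3 5
  have e0136 := h 0 1 3 6
  have e0145 := h 0 1 4 5
  have e0146 := h 0 1 4 6
  have e0156 := h 0 1 5 6
  have e0234 := h 0 2 3 4
  have e0235 := h 0 2 3 5
  have e0236 := h 0 2 3 6
  have e0245 := h 0 2 4 5
  have e0246 := h 0 2 4 6
  have e0256 := h 0 2 5 6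
  have e0345 := h 0 3 4 5
  have e0346 := h 0 3 4 6
  have e0356 := h 0 3 5 6
  have e0456 := h 0 4 5 6
  have e1234 := h 1 2 3 4
  have e1235 := h 1 2 3 5
  have e1236 := h 1 2 3 6
  have e1245 := h 1 2 4 5
  have e1246 := h 1 2 4 6
  have e1256 := h 1 2 5 6
  have e1345 := h 1 3 4 5
  have e1346 := h 1 3 4 6
  have e1356 := h 1 3 5 6
  have e1456 := h 1 4 5 6
  have e2345 := h 2 3 4 5
  have e2346 := h 2 3 4 6
  have e2356 := h 2 3 5 6
  have e2456 := h 2 4 5 6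
  have e3456 := h 3 4 5 6
  clear h hskew hM
  simp only [wedge13, alt4, phiInt, psiInt, fano, fanoSign, fanoSign₄, delta, Matrix.cons_val,
    Fin.reduceEq, or_self, or_true, true_or, if_true, if_false] at *
  push_cast at *
  simp only [hq, hτ, n01, n02, n03, n04, n05, n06] at e0123 e0124 e0125 e0126 e0134 e0135
  try simp only [n21, n31, n41, n51, n61, n32, n42, n52, n62, n43, n53, n63, n54, n64, n65]
    at e0123 e0124 e0125 e0126 e0134 e0135
  simp only [hq, hτ, n01, n02, n03, n04, n05, n06] at e0136 e0145 e0146 e0156 e0234 e0235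
  try simp only [n21, n31, n41, n51, n61, n32, n42, n52, n62, n43, n53, n63, n54, n64, n65]
    at e0136 e0145 e0146 e0156 e0234 e0235
  simp only [hq, hτ, n01, n02, n03, n04, n05, n06] at e0236 e0245 e0246 e0256 e0345 e0346
  try simp only [n21, n31, n41, n51, n61, n32, n42, n52, n62, n43, n53, n63, n54, n64, n65]
    at e0236 e0245 e0246 e0256 e0345 e0346
  simp only [hq, hτ, n01, n02, n03, n04, n05, n06] at e0356 e0456 e1234 e1235 e1236 e1245
  try simp only [n21, n31, n41, n51, n61, n32, n42, n52, n62, n43, n53, n63, n54, n64, n65]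
    at e0356 e0456 e1234 e1235 e1236 e1245
  simp only [hq, hτ, n01, n02, n03, n04, n05, n06] at e1246 e1256 e1345 e1346 e1356 e1456
  try simp only [n21, n31, n41, n51, n61, n32, n42, n52, n62, n43, n53, n63, n54, n64, n65]
    at e1246 e1256 e1345 e1346 e1356 e1456
  simp only [hq, hτ, n01, n02, n03, n04, n05, n06] at e2345 e2346 e2356 e2456 e3456
  try simp only [n21, n31, n41, n51, n61, n32, n42, n52, n62, n43, n53, n63, n54, n64, n65]
    at e2345 e2346 e2356 e2456 e3456
  -- The components of `dφ̃ = 0` give `s = -3 q₀`. For each complex pair `(1,2)`, `(3,4)`, `(5,6)`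
  -- they give a homogeneous 2 × 2 system of determinant `±(1 + t²)`, so `q₀` is the only component
  -- that can survive.
  have hs : s = -3 * q 0 := by linarith only [e0136, e0145, e0235, e0246, e1234, e1256, e3456]
  have u1 : t * q 1 = q 2 := by linarith only [e0134, e0156, e0234, e0256, e1235, e1236, e1245, e1246]
  have w1 : q 1 + t * q 2 = 0 := by linarith only [e0134, e0156, e0234, e0256, e1235, e1236, e1245, e1246]
  have q1 : q 1 = 0 := by
    rw [← u1] at w1
    have h2 : (1 + t ^ 2) ≠ 0 := by positivity
    exact mul_left_cancel₀ h2 (by linarith)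
  have q2 : q 2 = 0 := by rw [← u1, q1, mul_zero]
  have u3 : t * q 3 = q 4 := by linarith only [e0123, e0124, e0356, e0456, e1345, e1346, e2345, e2346]
  have w3 : q 3 + t * q 4 = 0 := by linarith only [e0123, e0124, e0356, e0456, e1345, e1346, e2345, e2346]
  have q3 : q 3 = 0 := by
    rw [← u3] at w3
    have h2 : (1 + t ^ 2) ≠ 0 := by positivity
    exact mul_left_cancel₀ h2 (by linarith)
  have q4 : q 4 = 0 := by rw [← u3, q3, mul_zero]
  have u5 : t * q 5 = q 6 := by linarith only [e0125, e0126, e0345, e0346, e1356, e1456, e2356, e2456]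
  have w5 : q 5 + t * q 6 = 0 := by linarith only [e0125, e0126, e0345, e0346, e1356, e1456, e2356, e2456]
  have q5 : q 5 = 0 := by
    rw [← u5] at w5
    have h2 : (1 + t ^ 2) ≠ 0 := by positivity
    exact mul_left_cancel₀ h2 (by linarith)
  have q6 : q 6 = 0 := by rw [← u5, q5, mul_zero]
  refine ⟨?_, fun s0 => ?_⟩
  · intro i
    rw [hτ]
    fin_cases i <;> simp [*] <;> ring
  have q0 : q 0 = 0 := by linarith only [hs, s0]
  have m11 : N 1 1 = 0 := by
    rw [s0, q0] at e0136 e0145 e0235 e0246 e1234 e1256 e3456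
    linarith only [e0136, e0145, e0235, e0246, e1234, e1256, e3456]
  have m12 : N 1 2 = 0 := by
    simp only [s0, q0, q1, q2, q3, q4, q5, q6] at e0135 e0146 e0236 e0245
    linarith only [e0135, e0146, e0236, e0245]
  have m13 : N 1 3 = 0 := by
    simp only [s0, q0, q1, q2, q3, q4, q5, q6] at e0125 e0345 e1456 e2356
    linarith only [e0125, e0345, e1456, e2356]
  have m14 : N 1 4 = 0 := by
    simp only [s0, q0, q1, q2, q3, q4, q5, q6] at e0126 e0346 e1356 e2456
    linarith only [e0126, e0346, e1356, e2456]
  have m15 : N 1 5 = 0 := by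
    simp only [s0, q0, q1, q2, q3, q4, q5, q6] at e0123 e0356 e1346 e2345
    linarith only [e0123, e0356, e1346, e2345]
  have m16 : N 1 6 = 0 := by
    simp only [s0, q0, q1, q2, q3, q4, q5, q6] at e0124 e0456 e1345 e2346
    linarith only [e0124, e0456, e1345, e2346]
  have m22 : N 2 2 = 0 := by
    rw [s0, q0] at e0136 e0145 e0235 e0246 e1234 e1256 e3456
    linarith only [e0136, e0145, e0235, e0246, e1234, e1256, e3456]
  have m23 : N 2 3 = 0 := by
    simp only [s0, q0, q1, q2, q3, q4, q5, q6] at e0126 e0346 e1356 e2456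
    linarith only [e0126, e0346, e1356, e2456]
  have m24 : N 2 4 = 0 := by
    simp only [s0, q0, q1, q2, q3, q4, q5, q6] at e0125 e0345 e1456 e2356
    linarith only [e0125, e0345, e1456, e2356]
  have m25 : N 2 5 = 0 := by
    simp only [s0, q0, q1, q2, q3, q4, q5, q6] at e0124 e0456 e1345 e2346
    linarith only [e0124, e0456, e1345, e2346]
  have m26 : N 2 6 = 0 := by
    simp only [s0, q0, q1, q2, q3, q4, q5, q6] at e0123 e0356 e1346 e2345
    linarith only [e0123, e0356, e1346, e2345]
  have m33 : N 3 3 = 0 := by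
    rw [s0, q0] at e0136 e0145 e0235 e0246 e1234 e1256 e3456
    linarith only [e0136, e0145, e0235, e0246, e1234, e1256, e3456]
  have m34 : N 3 4 = 0 := by
    simp only [s0, q0, q1, q2, q3, q4, q5, q6] at e0135 e0146 e0236 e0245
    linarith only [e0135, e0146, e0236, e0245]
  have m35 : N 3 5 = 0 := by
    simp only [s0, q0, q1, q2, q3, q4, q5, q6] at e0134 e0156 e1236 e1245
    linarith only [e0134, e0156, e1236, e1245]
  have m36 : N 3 6 = 0 := by
    simp only [s0, q0, q1, q2, q3, q4, q5, q6] at e0234 e0256 e1235 e1246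
    linarith only [e0234, e0256, e1235, e1246]
  have m44 : N 4 4 = 0 := by
    rw [s0, q0] at e0136 e0145 e0235 e0246 e1234 e1256 e3456
    linarith only [e0136, e0145, e0235, e0246, e1234, e1256, e3456]
  have m45 : N 4 5 = 0 := by
    simp only [s0, q0, q1, q2, q3, q4, q5, q6] at e0234 e0256 e1235 e1246
    linarith only [e0234, e0256, e1235, e1246]
  have m46 : N 4 6 = 0 := by
    simp only [s0, q0, q1, q2, q3, q4, q5, q6] at e0134 e0156 e1236 e1245
    linarith only [e0134, e0156, e1236, e1245]
  have m55 : N 5 5 = 0 := by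
    rw [s0, q0] at e0136 e0145 e0235 e0246 e1234 e1256 e3456
    linarith only [e0136, e0145, e0235, e0246, e1234, e1256, e3456]
  have m56 : N 5 6 = 0 := by
    simp only [s0, q0, q1, q2, q3, q4, q5, q6] at e0135 e0146 e0236 e0245
    linarith only [e0135, e0146, e0236, e0245]
  have m66 : N 6 6 = 0 := by
    rw [s0, q0] at e0136 e0145 e0235 e0246 e1234 e1256 e3456
    linarith only [e0136, e0145, e0235, e0246, e1234, e1256, e3456]
  intro i j
  have hu : ∀ i j : Fin 7, i ≤ j → i ≠ 0 → N i j = 0 ∧ N j i = 0 := by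
    intro i j hij hi
    fin_cases i <;> fin_cases j <;>
      first | exact absurd hij (by decide) | exact absurd rfl hi | (constructor <;> simp [*])
  have h0 : ∀ i, N i 0 = 0 ∧ N 0 i = 0 := by
    intro i
    fin_cases i <;> constructor <;> simp [*]
  by_cases hi : i = 0
  · rw [hi]; exact (h0 j).2
  by_cases hj : j = 0
  · rw [hj]; exact (h0 i).1
  rcases le_total i j with hij | hij
  · exact (hu i j hij hi).1
  · exact (hu j i hij hj).2

/-! ### Transitivity of the stabiliser of the model form on directions -/

theorem phi0_apply (x y z : E7) : phi0 ![x, y, z] =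
    (x 0 * (y 1 * z 2 - y 2 * z 1) - x 1 * (y 0 * z 2 - y 2 * z 0) + x 2 * (y 0 * z 1 - y 1 * z
    0)) + (x 0 * (y 3 * z 4 - y 4 * z 3) - x 3 * (y 0 * z 4 - y 4 * z 0) + x 4 * (y 0 * z 3 - y
    3 * z 0)) + (x 0 * (y 5 * z 6 - y 6 * z 5) - x 5 * (y 0 * z 6 - y 6 * z 0) + x 6 * (y 0 * z
    5 - y 5 * z 0)) + (x 1 * (y 3 * z 5 - y 5 * z 3) - x 3 * (y 1 * z 5 - y 5 * z 1) + x 5 * (y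
    1 * z 3 - y 3 * z 1)) - (x 1 * (y 4 * z 6 - y 6 * z 4) - x 4 * (y 1 * z 6 - y 6 * z 1) + x 6
    * (y 1 * z 4 - y 4 * z 1)) - (x 2 * (y 3 * z 6 - y 6 * z 3) - x 3 * (y 2 * z 6 - y 6 * z 2)
    + x 6 * (y 2 * z 3 - y 3 * z 2)) - (x 2 * (y 4 * z 5 - y 5 * z 4) - x 4 * (y 2 * z 5 - y 5 *
    z 2) + x 5 * (y 2 * z 4 - y 4 * z 2)) := by
  simp only [phi0, AlternatingMap.add_apply, AlternatingMap.sub_apply, coordForm_apply]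

theorem ext_three {α β : E7 [⋀^Fin 3]→ₗ[ℝ] ℝ} (h : ∀ x y z, α ![x, y, z] = β ![x, y, z]) :
    α = β := ext_sorted₃ fun _ _ _ _ _ => h _ _ _

/-- `w` is the image of `v` under an endomorphism preserving the model form. -/
def Reaches (v w : E7) : Prop := ∃ T : E7 →ₗ[ℝ] E7, phi0.compLinearMap T = phi0 ∧ T v = w

theorem Reaches.trans {v w x : E7} (h1 : Reaches v w) (h2 : Reaches w x) : Reaches v x := by
  obtain ⟨S, hS, rfl⟩ := h1
  obtain ⟨T, hT, rfl⟩ := h2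
  refine ⟨T ∘ₗ S, ?_, rfl⟩
  rw [← AlternatingMap.compLinearMap_assoc, hT, hS]

/-- A plane rotation that kills the second of two coordinates. -/
theorem exists_rotation (a b : ℝ) : ∃ c s : ℝ, c ^ 2 + s ^ 2 = 1 ∧ -s * a + c * b = 0 := by
  by_cases h : a ^ 2 + b ^ 2 = 0
  · have ha : a = 0 := by nlinarith [sq_nonneg a, sq_nonneg b]
    have hb : b = 0 := by nlinarith [sq_nonneg a, sq_nonneg b]
    exact ⟨1, 0, by norm_num, by simp [ha, hb]⟩
  · have hp : 0 < a ^ 2 + b ^ 2 := lt_of_le_of_ne (by positivity) (Ne.symm h)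
    have hr := Real.sq_sqrt hp.le
    have hr0 : Real.sqrt (a ^ 2 + b ^ 2) ≠ 0 := (Real.sqrt_pos.mpr hp).ne'
    refine ⟨a / Real.sqrt (a ^ 2 + b ^ 2), b / Real.sqrt (a ^ 2 + b ^ 2), ?_, ?_⟩
    · rw [div_pow, div_pow, hr, ← add_div, div_self h]
    · field_simp
      ring

/-- Rotating one coordinate plane alone does not preserve `φ₀`; it has to be accompanied by a
rotation of a second plane. In this lemma and its five analogues the three untouched coordinates
form a Fano line, and the angle is chosen so that one coordinate of `v` becomes zero. -/
theorem reaches_01 (v : E7) : ∃ c s : ℝ, ∃ w, Reaches v w ∧ w 1 = 0 ∧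
    w 3 = c * v 3 + s * v 6 ∧ w 6 = -s * v 3 + c * v 6 ∧ w 2 = v 2 ∧ w 4 = v 4 ∧ w 5 = v 5 := by
  obtain ⟨c, s, hcs, hv⟩ := exists_rotation (v 0) (v 1)
  obtain ⟨T, hT⟩ : ∃ T : E7 →ₗ[ℝ] E7, ∀ (x : E7) (m : Fin 7), T x m =
      (![c * x 0 + s * x 1, -s * x 0 + c * x 1, x 2, c * x 3 + s * x 6, x 4, x 5, -s * x 3 + c * x 6] : Fin 7 → ℝ) m := by
    refine ⟨ofRows ![
      ![c, -s, 0, 0, 0, 0, 0], ![s, c, 0, 0, 0, 0, 0], ![0, 0, 1, 0, 0, 0, 0], ![0, 0, 0, c, 0,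
      0, -s], ![0, 0, 0, 0, 1, 0, 0], ![0, 0, 0, 0, 0, 1, 0], ![0, 0, 0, s, 0, 0, c]], fun x m => ?_⟩
    rw [ofRows_apply, Fin.sum_univ_seven]
    fin_cases m <;> simp <;> ring
  refine ⟨c, s, T v, ⟨T, ext_three fun x y z => ?_, rfl⟩, ?_⟩
  · rw [pull_apply, phi0_apply, phi0_apply]
    simp only [hT, Matrix.cons_val]
    -- The difference of the two sides is `c² + s² - 1` times the terms of `φ₀` that meet the
    -- rotated planes. The remaining term lies on the fixed line.
    linear_combination (
      (x 0 * (y 1 * z 2 - y 2 * z 1) - x 1 * (y 0 * z 2 - y 2 * z 0) + x 2 * (y 0 * z 1 - y 1 *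
      z 0)) + (x 0 * (y 3 * z 4 - y 4 * z 3) - x 3 * (y 0 * z 4 - y 4 * z 0) + x 4 * (y 0 * z 3
      - y 3 * z 0)) + (x 0 * (y 5 * z 6 - y 6 * z 5) - x 5 * (y 0 * z 6 - y 6 * z 0) + x 6 * (y
      0 * z 5 - y 5 * z 0)) + (x 1 * (y 3 * z 5 - y 5 * z 3) - x 3 * (y 1 * z 5 - y 5 * z 1) + x
      5 * (y 1 * z 3 - y 3 * z 1)) - (x 1 * (y 4 * z 6 - y 6 * z 4) - x 4 * (y 1 * z 6 - y 6 * z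
      1) + x 6 * (y 1 * z 4 - y 4 * z 1)) - (x 2 * (y 3 * z 6 - y 6 * z 3) - x 3 * (y 2 * z 6 -
      y 6 * z 2) + x 6 * (y 2 * z 3 - y 3 * z 2))) * hcs
  · simp only [hT, Matrix.cons_val, hv, true_and, and_true]

theorem reaches_02 (v : E7) : ∃ c s : ℝ, ∃ w, Reaches v w ∧ w 2 = 0 ∧
    w 3 = c * v 3 + s * v 5 ∧ w 5 = -s * v 3 + c * v 5 ∧ w 1 = v 1 ∧ w 4 = v 4 ∧ w 6 = v 6 := by
  obtain ⟨c, s, hcs, hv⟩ := exists_rotation (v 0) (v 2)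
  obtain ⟨T, hT⟩ : ∃ T : E7 →ₗ[ℝ] E7, ∀ (x : E7) (m : Fin 7), T x m =
      (![c * x 0 + s * x 2, x 1, -s * x 0 + c * x 2, c * x 3 + s * x 5, x 4, -s * x 3 + c * x 5, x 6] : Fin 7 → ℝ) m := by
    refine ⟨ofRows ![
      ![c, 0, -s, 0, 0, 0, 0], ![0, 1, 0, 0, 0, 0, 0], ![s, 0, c, 0, 0, 0, 0], ![0, 0, 0, c, 0,
      -s, 0], ![0, 0, 0, 0, 1, 0, 0], ![0, 0, 0, s, 0, c, 0], ![0, 0, 0, 0, 0, 0, 1]], fun x m => ?_⟩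
    rw [ofRows_apply, Fin.sum_univ_seven]
    fin_cases m <;> simp <;> ring
  refine ⟨c, s, T v, ⟨T, ext_three fun x y z => ?_, rfl⟩, ?_⟩
  · rw [pull_apply, phi0_apply, phi0_apply]
    simp only [hT, Matrix.cons_val]
    linear_combination (
      (x 0 * (y 1 * z 2 - y 2 * z 1) - x 1 * (y 0 * z 2 - y 2 * z 0) + x 2 * (y 0 * z 1 - y 1 *
      z 0)) + (x 0 * (y 3 * z 4 - y 4 * z 3) - x 3 * (y 0 * z 4 - y 4 * z 0) + x 4 * (y 0 * z 3
      - y 3 * z 0)) + (x 0 * (y 5 * z 6 - y 6 * z 5) - x 5 * (y 0 * z 6 - y 6 * z 0) + x 6 * (y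
      0 * z 5 - y 5 * z 0)) + (x 1 * (y 3 * z 5 - y 5 * z 3) - x 3 * (y 1 * z 5 - y 5 * z 1) + x
      5 * (y 1 * z 3 - y 3 * z 1)) - (x 2 * (y 3 * z 6 - y 6 * z 3) - x 3 * (y 2 * z 6 - y 6 * z
      2) + x 6 * (y 2 * z 3 - y 3 * z 2)) - (x 2 * (y 4 * z 5 - y 5 * z 4) - x 4 * (y 2 * z 5 -
      y 5 * z 2) + x 5 * (y 2 * z 4 - y 4 * z 2))) * hcs
  · simp only [hT, Matrix.cons_val, hv, true_and, and_true]

theorem reaches_34 (v : E7) : ∃ c s : ℝ, ∃ w, Reaches v w ∧ w 4 = 0 ∧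
    w 1 = c * v 1 - s * v 2 ∧ w 2 = s * v 1 + c * v 2 ∧ w 0 = v 0 ∧ w 5 = v 5 ∧ w 6 = v 6 := by
  obtain ⟨c, s, hcs, hv⟩ := exists_rotation (v 3) (v 4)
  obtain ⟨T, hT⟩ : ∃ T : E7 →ₗ[ℝ] E7, ∀ (x : E7) (m : Fin 7), T x m =
      (![x 0, c * x 1 - s * x 2, s * x 1 + c * x 2, c * x 3 + s * x 4, -s * x 3 + c * x 4, x 5, x 6] : Fin 7 → ℝ) m := by
    refine ⟨ofRows ![
      ![1, 0, 0, 0, 0, 0, 0], ![0, c, s, 0, 0, 0, 0], ![0, -s, c, 0, 0, 0, 0], ![0, 0, 0, c, -s,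
      0, 0], ![0, 0, 0, s, c, 0, 0], ![0, 0, 0, 0, 0, 1, 0], ![0, 0, 0, 0, 0, 0, 1]], fun x m => ?_⟩
    rw [ofRows_apply, Fin.sum_univ_seven]
    fin_cases m <;> simp <;> ring
  refine ⟨c, s, T v, ⟨T, ext_three fun x y z => ?_, rfl⟩, ?_⟩
  · rw [pull_apply, phi0_apply, phi0_apply]
    simp only [hT, Matrix.cons_val]
    linear_combination (
      (x 0 * (y 1 * z 2 - y 2 * z 1) - x 1 * (y 0 * z 2 - y 2 * z 0) + x 2 * (y 0 * z 1 - y 1 *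
      z 0)) + (x 0 * (y 3 * z 4 - y 4 * z 3) - x 3 * (y 0 * z 4 - y 4 * z 0) + x 4 * (y 0 * z 3
      - y 3 * z 0)) + (x 1 * (y 3 * z 5 - y 5 * z 3) - x 3 * (y 1 * z 5 - y 5 * z 1) + x 5 * (y
      1 * z 3 - y 3 * z 1)) - (x 1 * (y 4 * z 6 - y 6 * z 4) - x 4 * (y 1 * z 6 - y 6 * z 1) + x
      6 * (y 1 * z 4 - y 4 * z 1)) - (x 2 * (y 3 * z 6 - y 6 * z 3) - x 3 * (y 2 * z 6 - y 6 * z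
      2) + x 6 * (y 2 * z 3 - y 3 * z 2)) - (x 2 * (y 4 * z 5 - y 5 * z 4) - x 4 * (y 2 * z 5 -
      y 5 * z 2) + x 5 * (y 2 * z 4 - y 4 * z 2))) * hcs
  · simp only [hT, Matrix.cons_val, hv, true_and, and_true]

theorem reaches_56 (v : E7) : ∃ c s : ℝ, ∃ w, Reaches v w ∧ w 6 = 0 ∧
    w 1 = c * v 1 - s * v 2 ∧ w 2 = s * v 1 + c * v 2 ∧ w 0 = v 0 ∧ w 3 = v 3 ∧ w 4 = v 4 := by
  obtain ⟨c, s, hcs, hv⟩ := exists_rotation (v 5) (v 6)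
  obtain ⟨T, hT⟩ : ∃ T : E7 →ₗ[ℝ] E7, ∀ (x : E7) (m : Fin 7), T x m =
      (![x 0, c * x 1 - s * x 2, s * x 1 + c * x 2, x 3, x 4, c * x 5 + s * x 6, -s * x 5 + c * x 6] : Fin 7 → ℝ) m := by
    refine ⟨ofRows ![
      ![1, 0, 0, 0, 0, 0, 0], ![0, c, s, 0, 0, 0, 0], ![0, -s, c, 0, 0, 0, 0], ![0, 0, 0, 1, 0,
      0, 0], ![0, 0, 0, 0, 1, 0, 0], ![0, 0, 0, 0, 0, c, -s], ![0, 0, 0, 0, 0, s, c]], fun x m => ?_⟩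
    rw [ofRows_apply, Fin.sum_univ_seven]
    fin_cases m <;> simp <;> ring
  refine ⟨c, s, T v, ⟨T, ext_three fun x y z => ?_, rfl⟩, ?_⟩
  · rw [pull_apply, phi0_apply, phi0_apply]
    simp only [hT, Matrix.cons_val]
    linear_combination (
      (x 0 * (y 1 * z 2 - y 2 * z 1) - x 1 * (y 0 * z 2 - y 2 * z 0) + x 2 * (y 0 * z 1 - y 1 *
      z 0)) + (x 0 * (y 5 * z 6 - y 6 * z 5) - x 5 * (y 0 * z 6 - y 6 * z 0) + x 6 * (y 0 * z 5
      - y 5 * z 0)) + (x 1 * (y 3 * z 5 - y 5 * z 3) - x 3 * (y 1 * z 5 - y 5 * z 1) + x 5 * (y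
      1 * z 3 - y 3 * z 1)) - (x 1 * (y 4 * z 6 - y 6 * z 4) - x 4 * (y 1 * z 6 - y 6 * z 1) + x
      6 * (y 1 * z 4 - y 4 * z 1)) - (x 2 * (y 3 * z 6 - y 6 * z 3) - x 3 * (y 2 * z 6 - y 6 * z
      2) + x 6 * (y 2 * z 3 - y 3 * z 2)) - (x 2 * (y 4 * z 5 - y 5 * z 4) - x 4 * (y 2 * z 5 -
      y 5 * z 2) + x 5 * (y 2 * z 4 - y 4 * z 2))) * hcs
  · simp only [hT, Matrix.cons_val, hv, true_and, and_true]

theorem reaches_35 (v : E7) : ∃ c s : ℝ, ∃ w, Reaches v w ∧ w 5 = 0 ∧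
    w 4 = c * v 4 + s * v 6 ∧ w 6 = -s * v 4 + c * v 6 ∧ w 0 = v 0 ∧ w 1 = v 1 ∧ w 2 = v 2 := by
  obtain ⟨c, s, hcs, hv⟩ := exists_rotation (v 3) (v 5)
  obtain ⟨T, hT⟩ : ∃ T : E7 →ₗ[ℝ] E7, ∀ (x : E7) (m : Fin 7), T x m =
      (![x 0, x 1, x 2, c * x 3 + s * x 5, c * x 4 + s * x 6, -s * x 3 + c * x 5, -s * x 4 + c * x 6] : Fin 7 → ℝ) m := by
    refine ⟨ofRows ![
      ![1, 0, 0, 0, 0, 0, 0], ![0, 1, 0, 0, 0, 0, 0], ![0, 0, 1, 0, 0, 0, 0], ![0, 0, 0, c, 0,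
      -s, 0], ![0, 0, 0, 0, c, 0, -s], ![0, 0, 0, s, 0, c, 0], ![0, 0, 0, 0, s, 0, c]], fun x m => ?_⟩
    rw [ofRows_apply, Fin.sum_univ_seven]
    fin_cases m <;> simp <;> ring
  refine ⟨c, s, T v, ⟨T, ext_three fun x y z => ?_, rfl⟩, ?_⟩
  · rw [pull_apply, phi0_apply, phi0_apply]
    simp only [hT, Matrix.cons_val]
    linear_combination (
      (x 0 * (y 3 * z 4 - y 4 * z 3) - x 3 * (y 0 * z 4 - y 4 * z 0) + x 4 * (y 0 * z 3 - y 3 *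
      z 0)) + (x 0 * (y 5 * z 6 - y 6 * z 5) - x 5 * (y 0 * z 6 - y 6 * z 0) + x 6 * (y 0 * z 5
      - y 5 * z 0)) + (x 1 * (y 3 * z 5 - y 5 * z 3) - x 3 * (y 1 * z 5 - y 5 * z 1) + x 5 * (y
      1 * z 3 - y 3 * z 1)) - (x 1 * (y 4 * z 6 - y 6 * z 4) - x 4 * (y 1 * z 6 - y 6 * z 1) + x
      6 * (y 1 * z 4 - y 4 * z 1)) - (x 2 * (y 3 * z 6 - y 6 * z 3) - x 3 * (y 2 * z 6 - y 6 * z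
      2) + x 6 * (y 2 * z 3 - y 3 * z 2)) - (x 2 * (y 4 * z 5 - y 5 * z 4) - x 4 * (y 2 * z 5 -
      y 5 * z 2) + x 5 * (y 2 * z 4 - y 4 * z 2))) * hcs
  · simp only [hT, Matrix.cons_val, hv, true_and, and_true]

theorem reaches_03 (v : E7) : ∃ c s : ℝ, ∃ w, Reaches v w ∧ w 3 = 0 ∧
    w 1 = c * v 1 - s * v 6 ∧ w 6 = s * v 1 + c * v 6 ∧ w 2 = v 2 ∧ w 4 = v 4 ∧ w 5 = v 5 := by
  obtain ⟨c, s, hcs, hv⟩ := exists_rotation (v 0) (v 3)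
  obtain ⟨T, hT⟩ : ∃ T : E7 →ₗ[ℝ] E7, ∀ (x : E7) (m : Fin 7), T x m =
      (![c * x 0 + s * x 3, c * x 1 - s * x 6, x 2, -s * x 0 + c * x 3, x 4, x 5, s * x 1 + c * x 6] : Fin 7 → ℝ) m := by
    refine ⟨ofRows ![
      ![c, 0, 0, -s, 0, 0, 0], ![0, c, 0, 0, 0, 0, s], ![0, 0, 1, 0, 0, 0, 0], ![s, 0, 0, c, 0,
      0, 0], ![0, 0, 0, 0, 1, 0, 0], ![0, 0, 0, 0, 0, 1, 0], ![0, -s, 0, 0, 0, 0, c]], fun x m => ?_⟩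
    rw [ofRows_apply, Fin.sum_univ_seven]
    fin_cases m <;> simp <;> ring
  refine ⟨c, s, T v, ⟨T, ext_three fun x y z => ?_, rfl⟩, ?_⟩
  · rw [pull_apply, phi0_apply, phi0_apply]
    simp only [hT, Matrix.cons_val]
    linear_combination (
      (x 0 * (y 1 * z 2 - y 2 * z 1) - x 1 * (y 0 * z 2 - y 2 * z 0) + x 2 * (y 0 * z 1 - y 1 *
      z 0)) + (x 0 * (y 3 * z 4 - y 4 * z 3) - x 3 * (y 0 * z 4 - y 4 * z 0) + x 4 * (y 0 * z 3
      - y 3 * z 0)) + (x 0 * (y 5 * z 6 - y 6 * z 5) - x 5 * (y 0 * z 6 - y 6 * z 0) + x 6 * (y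
      0 * z 5 - y 5 * z 0)) + (x 1 * (y 3 * z 5 - y 5 * z 3) - x 3 * (y 1 * z 5 - y 5 * z 1) + x
      5 * (y 1 * z 3 - y 3 * z 1)) - (x 1 * (y 4 * z 6 - y 6 * z 4) - x 4 * (y 1 * z 6 - y 6 * z
      1) + x 6 * (y 1 * z 4 - y 4 * z 1)) - (x 2 * (y 3 * z 6 - y 6 * z 3) - x 3 * (y 2 * z 6 -
      y 6 * z 2) + x 6 * (y 2 * z 3 - y 3 * z 2))) * hcs
  · simp only [hT, Matrix.cons_val, hv, true_and, and_true]

/-- The coordinates `1, 2, 4, 6, 5, 3` are removed in this order. At each stage the accompanying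
rotation mixes only coordinates that are still arbitrary or both already zero, so that earlier zeros
persist. -/
theorem exists_reaches (v : E7) : ∃ t : ℝ, Reaches v (t • stdVec 0) := by
  obtain ⟨c1, s1, v1, h1, a1, a3, a6, a2, a4, a5⟩ := reaches_01 v
  obtain ⟨c2, s2, v2, h2, b2, b3, b5, b1, b4, b6⟩ := reaches_02 v1
  rw [a1] at b1
  obtain ⟨c3, s3, v3, h3, d4, d1, d2, d0, d5, d6⟩ := reaches_34 v2
  rw [b1, b2, mul_zero, mul_zero, sub_zero] at d1
  rw [b1, b2, mul_zero, mul_zero, add_zero] at d2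
  obtain ⟨c4, s4, v4, h4, e6, e1, e2, e0, e3, e4⟩ := reaches_56 v3
  rw [d1, d2, mul_zero, mul_zero, sub_zero] at e1
  rw [d1, d2, mul_zero, mul_zero, add_zero] at e2
  rw [d4] at e4
  obtain ⟨c5, s5, v5, h5, f5, f4, f6, f0, f1, f2⟩ := reaches_35 v4
  rw [e4, e6, mul_zero, mul_zero, add_zero] at f4
  rw [e4, e6, mul_zero, mul_zero, add_zero] at f6
  rw [e1] at f1
  rw [e2] at f2
  obtain ⟨c6, s6, v6, h6, g3, g1, g6, g2, g4, g5⟩ := reaches_03 v5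
  rw [f1, f6, mul_zero, mul_zero, sub_zero] at g1
  rw [f1, f6, mul_zero, mul_zero, add_zero] at g6
  rw [f2] at g2
  rw [f4] at g4
  rw [f5] at g5
  refine ⟨v6 0, ?_⟩
  have : v6 = v6 0 • stdVec 0 := by
    ext i
    fin_cases i <;> simp [stdVec_apply, g1, g2, g3, g4, g5, g6]
  rw [← this]
  exact h1.trans (h2.trans (h3.trans (h4.trans (h5.trans h6))))

/-- A vector `x` in the kernel satisfies `x ⌟ φ₀ = 0`, and the squares of the components of `x ⌟ φ₀`
add up to `6 |x|²`. -/
theorem phi0_injective {T : E7 →ₗ[ℝ] E7} (hT : phi0.compLinearMap T = phi0) :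
    Function.Injective T := by
  rw [← LinearMap.ker_eq_bot, LinearMap.ker_eq_bot']
  intro x hx
  refine dot_self_eq_zero ?_
  have h : ∀ j k, phi0 ![x, stdVec j, stdVec k] = 0 := by
    intro j k
    rw [← hT, pull_apply, hx]
    simpa using form3_smul₀ phi0 0 0 (T (stdVec j)) (T (stdVec k))
  have := phi0_contract x x
  simp only [h] at this
  simp at this
  exact this

/-- Every positive form together with a vector has a frame in which the form is the model form and
the vector is a multiple of the first basis vector. -/
theorem IsPositive.exists_frame {φ : E7 [⋀^Fin 3]→ₗ[ℝ] ℝ} (hφ : IsPositive φ) (v : E7) :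
    ∃ (u : E7 ≃ₗ[ℝ] E7) (t : ℝ), φ = phi0.compLinearMap u.toLinearMap ∧ u v = t • stdVec 0 := by
  obtain ⟨u, rfl⟩ := hφ
  obtain ⟨t, T, hT, hv⟩ := exists_reaches (u v)
  refine ⟨u.trans (LinearEquiv.ofInjectiveEndo T (phi0_injective hT)), t, ?_, hv⟩
  have : (u.trans (LinearEquiv.ofInjectiveEndo T (phi0_injective hT))).toLinearMap =
      T ∘ₗ u.toLinearMap := rfl
  rw [this, ← AlternatingMap.compLinearMap_assoc, hT]

/-! ### The normal form of the deformed form -/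

/-- With the complex coordinates formed from the pairs `(1,2)`, `(3,4)`, `(5,6)` and `Ω = dz¹ ∧ dz²
∧ dz³`, this is `e₀ ⌟ ψ₀ = -Im Ω`. -/
theorem psi0_e0_apply (x y z : E7) : psi0 ![stdVec 0, x, y, z] =
    - (x 1 * (y 3 * z 6 - y 6 * z 3) - x 3 * (y 1 * z 6 - y 6 * z 1) + x 6 * (y 1 * z 3 - y 3 *
    z 1)) - (x 1 * (y 4 * z 5 - y 5 * z 4) - x 4 * (y 1 * z 5 - y 5 * z 1) + x 5 * (y 1 * z 4 -
    y 4 * z 1)) - (x 2 * (y 3 * z 5 - y 5 * z 3) - x 3 * (y 2 * z 5 - y 5 * z 2) + x 5 * (y 2 *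
    z 3 - y 3 * z 2)) + (x 2 * (y 4 * z 6 - y 6 * z 4) - x 4 * (y 2 * z 6 - y 6 * z 2) + x 6 *
    (y 2 * z 4 - y 4 * z 2)) := by
  have h : psi0.curryLeft (stdVec 0) = coordForm 2 4 6 - coordForm 1 3 6 - coordForm 1 4 5 -
      coordForm 2 3 5 := by
    have hi : ∀ a b c, psiInt 0 a b c = coordInt 2 4 6 a b c - coordInt 1 3 6 a b c -
        coordInt 1 4 5 a b c - coordInt 2 3 5 a b c := by decide +kernel
    refine ext_sorted₃ fun a b c _ _ => ?_
    have h1 : psi0.curryLeft (stdVec 0) ![stdVec a, stdVec b, stdVec c] = (psiInt 0 a b c : ℝ) :=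
      psi0_basis 0 a b c
    rw [h1, hi]
    simp only [AlternatingMap.sub_apply, coordForm_stdVec]
    push_cast
    ring
  have h2 : psi0 ![stdVec 0, x, y, z] = psi0.curryLeft (stdVec 0) ![x, y, z] := rfl
  rw [h2, h]
  simp only [AlternatingMap.sub_apply, coordForm_apply]
  ring

/-- The endomorphism which scales `e₀` by `r` and multiplies the complementary complex coordinates by
`p + q i`. -/
def twist (r p q : ℝ) : E7 →ₗ[ℝ] E7 := ofRows ![![r, 0, 0, 0, 0, 0, 0],
    ![0, p, q, 0, 0, 0, 0], ![0, -q, p, 0, 0, 0, 0], ![0, 0, 0, p, q, 0, 0],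
    ![0, 0, 0, -q, p, 0, 0], ![0, 0, 0, 0, 0, p, q], ![0, 0, 0, 0, 0, -q, p]]

theorem twist_apply (r p q : ℝ) (x : E7) (m : Fin 7) : twist r p q x m =
    (![r * x 0, p * x 1 - q * x 2, q * x 1 + p * x 2, p * x 3 - q * x 4, q * x 3 + p * x 4,
      p * x 5 - q * x 6, q * x 5 + p * x 6] : Fin 7 → ℝ) m := by
  rw [twist, ofRows_apply, Fin.sum_univ_seven]
  fin_cases m <;> simp <;> ring

/-- In `φ₀ = e⁰ ∧ ω + Re Ω` the twist multiplies `e⁰` by `r`, `ω` by `p² + q²` and `Ω` by `(p + qi)³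
= 1 + ti`. The first term is unchanged and the second becomes `Re Ω - t Im Ω`. -/
theorem phi0_twist {r p q t : ℝ} (h1 : r * (p ^ 2 + q ^ 2) = 1) (hp : p ^ 3 - 3 * p * q ^ 2 = 1)
    (hq : 3 * p ^ 2 * q - q ^ 3 = t) :
    phi0.compLinearMap (twist r p q) = phi0 + psi0.curryLeft (t • stdVec 0) := by
  refine ext_three fun x y z => ?_
  have h2 : psi0.curryLeft (t • stdVec 0) ![x, y, z] = t * psi0 ![stdVec 0, x, y, z] :=
    form4_smul₀ psi0 t (stdVec 0) x y z
  rw [pull_apply, AlternatingMap.add_apply, h2, psi0_e0_apply, phi0_apply, phi0_apply]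
  simp only [twist_apply, Matrix.cons_val]
  linear_combination (
    (x 0 * (y 1 * z 2 - y 2 * z 1) - x 1 * (y 0 * z 2 - y 2 * z 0) + x 2 * (y 0 * z 1 - y 1 * z
    0)) + (x 0 * (y 3 * z 4 - y 4 * z 3) - x 3 * (y 0 * z 4 - y 4 * z 0) + x 4 * (y 0 * z 3 - y
    3 * z 0)) + (x 0 * (y 5 * z 6 - y 6 * z 5) - x 5 * (y 0 * z 6 - y 6 * z 0) + x 6 * (y 0 * z
    5 - y 5 * z 0))) * h1 + (
    (x 1 * (y 3 * z 5 - y 5 * z 3) - x 3 * (y 1 * z 5 - y 5 * z 1) + x 5 * (y 1 * z 3 - y 3 * z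
    1)) - (x 1 * (y 4 * z 6 - y 6 * z 4) - x 4 * (y 1 * z 6 - y 6 * z 1) + x 6 * (y 1 * z 4 - y
    4 * z 1)) - (x 2 * (y 3 * z 6 - y 6 * z 3) - x 3 * (y 2 * z 6 - y 6 * z 2) + x 6 * (y 2 * z
    3 - y 3 * z 2)) - (x 2 * (y 4 * z 5 - y 5 * z 4) - x 4 * (y 2 * z 5 - y 5 * z 2) + x 5 * (y
    2 * z 4 - y 4 * z 2))) * hp - (
    (x 1 * (y 3 * z 6 - y 6 * z 3) - x 3 * (y 1 * z 6 - y 6 * z 1) + x 6 * (y 1 * z 3 - y 3 * z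
    1)) + (x 1 * (y 4 * z 5 - y 5 * z 4) - x 4 * (y 1 * z 5 - y 5 * z 1) + x 5 * (y 1 * z 4 - y
    4 * z 1)) + (x 2 * (y 3 * z 5 - y 5 * z 3) - x 3 * (y 2 * z 5 - y 5 * z 2) + x 5 * (y 2 * z
    3 - y 3 * z 2)) - (x 2 * (y 4 * z 6 - y 6 * z 4) - x 4 * (y 2 * z 6 - y 6 * z 2) + x 6 * (y
    2 * z 4 - y 4 * z 2))) * hq

theorem forall_lt₄ {P : Fin 7 → Fin 7 → Fin 7 → Fin 7 → Prop} (h :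
    P 0 1 2 3 ∧ P 0 1 2 4 ∧ P 0 1 2 5 ∧ P 0 1 2 6 ∧ P 0 1 3 4 ∧ P 0 1 3 5 ∧ P 0 1 3 6 ∧ P 0 1 4
    5 ∧ P 0 1 4 6 ∧ P 0 1 5 6 ∧ P 0 2 3 4 ∧ P 0 2 3 5 ∧ P 0 2 3 6 ∧ P 0 2 4 5 ∧ P 0 2 4 6 ∧ P 0
    2 5 6 ∧ P 0 3 4 5 ∧ P 0 3 4 6 ∧ P 0 3 5 6 ∧ P 0 4 5 6 ∧ P 1 2 3 4 ∧ P 1 2 3 5 ∧ P 1 2 3 6 ∧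
    P 1 2 4 5 ∧ P 1 2 4 6 ∧ P 1 2 5 6 ∧ P 1 3 4 5 ∧ P 1 3 4 6 ∧ P 1 3 5 6 ∧ P 1 4 5 6 ∧ P 2 3 4
    5 ∧ P 2 3 4 6 ∧ P 2 3 5 6 ∧ P 2 4 5 6 ∧ P 3 4 5 6) :
    ∀ i j k l, i < j → j < k → k < l → P i j k l := by
  have h1 : ∀ i j, i < j → ∀ k, j < k → ∀ l, k < l → ((i, j, k, l) : Fin 7 × Fin 7 × Fin 7 × Fin 7) ∈ [
      (0, 1, 2, 3), (0, 1, 2, 4), (0, 1, 2, 5), (0, 1, 2, 6), (0, 1, 3, 4), (0, 1, 3, 5), (0, 1,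
      3, 6), (0, 1, 4, 5), (0, 1, 4, 6), (0, 1, 5, 6), (0, 2, 3, 4), (0, 2, 3, 5), (0, 2, 3, 6),
      (0, 2, 4, 5), (0, 2, 4, 6), (0, 2, 5, 6), (0, 3, 4, 5), (0, 3, 4, 6), (0, 3, 5, 6), (0, 4,
      5, 6), (1, 2, 3, 4), (1, 2, 3, 5), (1, 2, 3, 6), (1, 2, 4, 5), (1, 2, 4, 6), (1, 2, 5, 6),
      (1, 3, 4, 5), (1, 3, 4, 6), (1, 3, 5, 6), (1, 4, 5, 6), (2, 3, 4, 5), (2, 3, 4, 6), (2, 3,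
      5, 6), (2, 4, 5, 6), (3, 4, 5, 6)] := by decide +kernel
  have h2 : ∀ t ∈ ([
      (0, 1, 2, 3), (0, 1, 2, 4), (0, 1, 2, 5), (0, 1, 2, 6), (0, 1, 3, 4), (0, 1, 3, 5), (0, 1,
      3, 6), (0, 1, 4, 5), (0, 1, 4, 6), (0, 1, 5, 6), (0, 2, 3, 4), (0, 2, 3, 5), (0, 2, 3, 6),
      (0, 2, 4, 5), (0, 2, 4, 6), (0, 2, 5, 6), (0, 3, 4, 5), (0, 3, 4, 6), (0, 3, 5, 6), (0, 4,
      5, 6), (1, 2, 3, 4), (1, 2, 3, 5), (1, 2, 3, 6), (1, 2, 4, 5), (1, 2, 4, 6), (1, 2, 5, 6),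
      (1, 3, 4, 5), (1, 3, 4, 6), (1, 3, 5, 6), (1, 4, 5, 6), (2, 3, 4, 5), (2, 3, 4, 6), (2, 3,
      5, 6), (2, 4, 5, 6), (3, 4, 5, 6)] :
        List (Fin 7 × Fin 7 × Fin 7 × Fin 7)), P t.1 t.2.1 t.2.2.1 t.2.2.2 := by
    simp only [List.forall_mem_cons]
    simpa using h
  exact fun i j k l hij hjk hkl => h2 _ (h1 i j hij k hjk l hkl)

-- Here `ψ₀ = ½ ω² - e⁰ ∧ Im Ω`. The twist turns it into `½ ν² ω² - ν⁻¹ e⁰ ∧ (Im Ω + t Re Ω)`.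
-- Adding `ξ ∧ φ̃ = ν⁻¹ t e⁰ ∧ (Re Ω - t Im Ω)` removes the `Re Ω` terms and leaves the factor `ν⁻¹
-- (1 + t²) = ν²` in front of `-e⁰ ∧ Im Ω`.
set_option maxHeartbeats 2000000 in
theorem psi0_twist {ν p q t : ℝ} (hν : 0 < ν) (h3 : ν ^ 3 = 1 + t ^ 2) (hpq : p ^ 2 + q ^ 2 = ν)
    (hp : p ^ 3 - 3 * p * q ^ 2 = 1) (hq : 3 * p ^ 2 * q - q ^ 3 = t) (ξ : E7 →ₗ[ℝ] ℝ)
    (hξ : ∀ x, ξ x = ν⁻¹ * t * x 0) :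
    ν ^ 2 • psi0 = psi0.compLinearMap (twist ν⁻¹ p q) +
      wedge1 ξ (phi0.compLinearMap (twist ν⁻¹ p q)) := by
  have h1 : ν⁻¹ * (p ^ 2 + q ^ 2) = 1 := by rw [hpq]; exact inv_mul_cancel₀ hν.ne'
  have h4 : (p ^ 2 + q ^ 2) ^ 2 = ν ^ 2 := by rw [hpq]
  have hr : ν ^ 2 = ν⁻¹ * (1 + t ^ 2) := by rw [← h3]; field_simp
  rw [phi0_twist h1 hp hq]
  generalize ν⁻¹ = r at *
  have c0 : twist r p q (stdVec 0) = r • stdVec 0 := by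
    ext m; rw [twist_apply]; fin_cases m <;> simp [stdVec_apply]
  have c1 : twist r p q (stdVec 1) = p • stdVec 1 + q • stdVec 2 := by
    ext m; rw [twist_apply]; fin_cases m <;> simp [stdVec_apply]
  have c2 : twist r p q (stdVec 2) = (-q) • stdVec 1 + p • stdVec 2 := by
    ext m; rw [twist_apply]; fin_cases m <;> simp [stdVec_apply]
  have c3 : twist r p q (stdVec 3) = p • stdVec 3 + q • stdVec 4 := by
    ext m; rw [twist_apply]; fin_cases m <;> simp [stdVec_apply]
  have c4 : twist r p q (stdVec 4) = (-q) • stdVec 3 + p • stdVec 4 := by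
    ext m; rw [twist_apply]; fin_cases m <;> simp [stdVec_apply]
  have c5 : twist r p q (stdVec 5) = p • stdVec 5 + q • stdVec 6 := by
    ext m; rw [twist_apply]; fin_cases m <;> simp [stdVec_apply]
  have c6 : twist r p q (stdVec 6) = (-q) • stdVec 5 + p • stdVec 6 := by
    ext m; rw [twist_apply]; fin_cases m <;> simp [stdVec_apply]
  have e : ∀ (x : E7) (i j k : Fin 7), psi0.curryLeft x ![stdVec i, stdVec j, stdVec k] =
    psi0 ![x, stdVec i, stdVec j, stdVec k] := fun _ _ _ _ => rfl
  refine ext_sorted₄ (forall_lt₄ ?_)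
  simp only [AlternatingMap.smul_apply, AlternatingMap.add_apply, wedge1_apply₃, wedge13, fun3,
    pull_apply₄, c0, c1, c2, c3, c4, c5, c6, form4_add₀, form4_add₁, form4_add₂, form4_add₃,
    form4_smul₀, form4_smul₁, form4_smul₂, form4_smul₃, psi0_basis, phi0_stdVec, e, hξ, stdVec_apply,
    smul_eq_mul]
  refine ⟨?_, ?_, ?_, ?_, ?_, ?_, ?_, ?_, ?_, ?_, ?_, ?_, ?_, ?_, ?_, ?_, ?_, ?_, ?_, ?_, ?_, ?_, ?_, ?_, ?_, ?_, ?_, ?_, ?_, ?_, ?_, ?_, ?_, ?_, ?_⟩ <;>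
    simp only [phiInt, psiInt, fano, fanoSign, fanoSign₄, Matrix.cons_val, Fin.reduceEq, or_self,
      or_true, true_or, if_true, if_false] <;> push_cast
  · linear_combination (0) * hr + (0) * r * hp + (0) * r * hq
  · linear_combination (0) * hr + (0) * r * hp + (0) * r * hq
  · linear_combination (0) * hr + (0) * r * hp + (0) * r * hq
  · linear_combination (0) * hr + (0) * r * hp + (0) * r * hq
  · linear_combination (0) * hr + (0) * r * hp + (0) * r * hq
  · linear_combination (0) * hr + (0) * r * hp + (1) * r * hq
  · linear_combination (-1) * hr + (1) * r * hp + (0) * r * hq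
  · linear_combination (-1) * hr + (1) * r * hp + (0) * r * hq
  · linear_combination (0) * hr + (0) * r * hp + (-1) * r * hq
  · linear_combination (0) * hr + (0) * r * hp + (0) * r * hq
  · linear_combination (0) * hr + (0) * r * hp + (0) * r * hq
  · linear_combination (-1) * hr + (1) * r * hp + (0) * r * hq
  · linear_combination (0) * hr + (0) * r * hp + (-1) * r * hq
  · linear_combination (0) * hr + (0) * r * hp + (-1) * r * hq
  · linear_combination (1) * hr + (-1) * r * hp + (0) * r * hq
  · linear_combination (0) * hr + (0) * r * hp + (0) * r * hq
  · linear_combination (0) * hr + (0) * r * hp + (0) * r * hq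
  · linear_combination (0) * hr + (0) * r * hp + (0) * r * hq
  · linear_combination (0) * hr + (0) * r * hp + (0) * r * hq
  · linear_combination (0) * hr + (0) * r * hp + (0) * r * hq
  · linear_combination (-1) * h4
  · linear_combination (0) * h4
  · linear_combination (0) * h4
  · linear_combination (0) * h4
  · linear_combination (0) * h4
  · linear_combination (-1) * h4
  · linear_combination (0) * h4
  · linear_combination (0) * h4
  · linear_combination (0) * h4
  · linear_combination (0) * h4
  · linear_combination (0) * h4
  · linear_combination (0) * h4
  · linear_combination (0) * h4
  · linear_combination (0) * h4
  · linear_combination (-1) * h4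

/-! ### Smooth dependence of the metric and the 4-form on the components of the 3-form -/

/-- Arrays of components of 3-forms. -/
abbrev Comps : Type := Fin 7 → Fin 7 → Fin 7 → ℝ

/-- `sMatrix` in terms of components. -/
def sMatrixC (c : Comps) : Matrix (Fin 7) (Fin 7) ℝ :=
  Matrix.of fun a b => (1 / 144 : ℝ) * ∑ f : Fin 7 → Fin 7,
    c a (f 0) (f 1) * c b (f 2) (f 3) * c (f 4) (f 5) (f 6) * vol0 (fun i => stdVec (f i))

/-- `volCoeff` in terms of components. -/
def volC (c : Comps) : ℝ := Real.sign (sMatrixC c).det * |(sMatrixC c).det| ^ (1 / 9 : ℝ)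

/-- `metric` in terms of components. -/
def metricC (c : Comps) : Matrix (Fin 7) (Fin 7) ℝ := (volC c)⁻¹ • sMatrixC c

/-- `psi` in terms of components. -/
def psiC (c : Comps) (w : Fin 4 → E7) : ℝ :=
  1 / 6 * volC c * ∑ i, ∑ j, ∑ k, (∑ a, ∑ b, ∑ d, (metricC c)⁻¹ i a * (metricC c)⁻¹ j b *
    (metricC c)⁻¹ k d * c a b d) *
      vol0 (Matrix.vecCons (stdVec i) (Matrix.vecCons (stdVec j) (Matrix.vecCons (stdVec k) w)))

theorem metric_eq_metricC (φ : E7 [⋀^Fin 3]→ₗ[ℝ] ℝ) : metric φ = metricC (comp3 φ) := rfl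

theorem psi_eq_psiC (φ : E7 [⋀^Fin 3]→ₗ[ℝ] ℝ) (w : Fin 4 → E7) : psi φ w = psiC (comp3 φ) w :=
  psi_apply φ w

section Matrix

variable {V : Type*} [NormedAddCommGroup V] [NormedSpace ℝ V] {m : WithTop ℕ∞} {x : V}

theorem contDiffAt_det {ι : Type*} [Fintype ι] [DecidableEq ι] {A : V → Matrix ι ι ℝ}
    (h : ∀ i j, ContDiffAt ℝ m (fun z => A z i j) x) : ContDiffAt ℝ m (fun z => (A z).det) x := by
  simp only [Matrix.det_apply']
  exact ContDiffAt.sum fun σ _ => contDiffAt_const.mul (contDiffAt_prod fun i _ => h _ _)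

theorem contDiffAt_matrix_inv {ι : Type*} [Fintype ι] [DecidableEq ι] {A : V → Matrix ι ι ℝ}
    (h : ∀ i j, ContDiffAt ℝ m (fun z => A z i j) x) (hx : (A x).det ≠ 0) (i j : ι) :
    ContDiffAt ℝ m (fun z => (A z)⁻¹ i j) x := by
  have e : (fun z => (A z)⁻¹ i j) =
      fun z => (A z).det⁻¹ * ((A z).updateRow j (Pi.single i 1)).det := by
    ext z
    rw [Matrix.inv_def, Matrix.smul_apply, Matrix.adjugate_apply, Ring.inverse_eq_inv', smul_eq_mul]
  rw [e]
  refine ((contDiffAt_det h).inv hx).mul (contDiffAt_det fun k l => ?_)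
  by_cases hk : k = j
  · subst hk
    simp only [Matrix.updateRow_self]
    exact contDiffAt_const
  · simp only [Matrix.updateRow_ne hk]
    exact h k l

theorem contDiffAt_sMatrixC (c : Comps) (i j : Fin 7) :
    ContDiffAt ℝ m (fun c : Comps => sMatrixC c i j) c := by
  have hc : ∀ a b d, ContDiffAt ℝ m (fun c : Comps => c a b d) c := fun a b d =>
    (contDiff_apply_apply ℝ ℝ b d).contDiffAt.comp c (contDiff_apply ℝ _ a).contDiffAt
  exact contDiffAt_const.mul (ContDiffAt.sum fun f _ =>
    (((hc _ _ _).mul (hc _ _ _)).mul (hc _ _ _)).mul contDiffAt_const)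

/-- Near a point with nonzero determinant the sign is constant, so the coefficient is a smooth power
of a positive function, up to that sign. -/
theorem contDiffAt_volC {c : Comps} (h : (sMatrixC c).det ≠ 0) : ContDiffAt ℝ m volC c := by
  have hd : ContDiffAt ℝ m (fun c => (sMatrixC c).det) c :=
    contDiffAt_det fun i j => contDiffAt_sMatrixC c i j
  rcases lt_or_gt_of_ne h with h' | h'
  · have e : volC =ᶠ[nhds c] fun c => -(-(sMatrixC c).det) ^ (1 / 9 : ℝ) := by
      filter_upwards [hd.continuousAt.eventually_lt continuousAt_const h'] with z hz
      rw [volC, Real.sign_of_neg hz, abs_of_neg hz, neg_one_mul]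
    exact ((hd.neg.rpow_const_of_ne (neg_ne_zero.mpr h)).neg).congr_of_eventuallyEq e
  · have e : volC =ᶠ[nhds c] fun c => (sMatrixC c).det ^ (1 / 9 : ℝ) := by
      filter_upwards [continuousAt_const.eventually_lt hd.continuousAt h'] with z hz
      rw [volC, Real.sign_of_pos hz, abs_of_pos hz, one_mul]
    exact (hd.rpow_const_of_ne h).congr_of_eventuallyEq e

theorem volC_ne_zero {c : Comps} (h : (sMatrixC c).det ≠ 0) : volC c ≠ 0 := by
  refine mul_ne_zero ?_ (Real.rpow_pos_of_pos (abs_pos.mpr h) _).ne'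
  rw [Ne, Real.sign_eq_zero_iff]
  exact h

theorem contDiffAt_metricC {c : Comps} (h : (sMatrixC c).det ≠ 0) (i j : Fin 7) :
    ContDiffAt ℝ m (fun c => metricC c i j) c :=
  ((contDiffAt_volC h).inv (volC_ne_zero h)).mul (contDiffAt_sMatrixC c i j)

theorem contDiffAt_metricC_inv {c : Comps} (h : (sMatrixC c).det ≠ 0) (i j : Fin 7) :
    ContDiffAt ℝ m (fun c => (metricC c)⁻¹ i j) c := by
  refine contDiffAt_matrix_inv (contDiffAt_metricC h) ?_ i j
  rw [metricC, Matrix.det_smul]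
  exact mul_ne_zero (pow_ne_zero _ (inv_ne_zero (volC_ne_zero h))) h

theorem contDiffAt_psiC {c : Comps} (h : (sMatrixC c).det ≠ 0) (w : Fin 4 → E7) :
    ContDiffAt ℝ m (fun c => psiC c w) c := by
  have hc : ∀ a b d, ContDiffAt ℝ m (fun c : Comps => c a b d) c := fun a b d =>
    (contDiff_apply_apply ℝ ℝ b d).contDiffAt.comp c (contDiff_apply ℝ _ a).contDiffAt
  have hi := contDiffAt_metricC_inv (m := m) h
  unfold psiC
  refine (contDiffAt_const.mul (contDiffAt_volC h)).mul ?_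
  refine ContDiffAt.sum fun i _ => ContDiffAt.sum fun j _ => ContDiffAt.sum fun k _ => ?_
  refine ContDiffAt.mul ?_ contDiffAt_const
  exact ContDiffAt.sum fun a _ => ContDiffAt.sum fun b _ => ContDiffAt.sum fun d _ =>
    (((hi i a).mul (hi j b)).mul (hi k d)).mul (hc a b d)

end Matrix

theorem IsPositive.det_ne_zero {φ : E7 [⋀^Fin 3]→ₗ[ℝ] ℝ} (h : IsPositive φ) :
    (sMatrixC (comp3 φ)).det ≠ 0 := by
  obtain ⟨u, rfl⟩ := h
  have : (sMatrix (phi0.compLinearMap u.toLinearMap)).det ≠ 0 := by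
    rw [sMatrix_pull, Matrix.det_smul, Matrix.det_mul, Matrix.det_transpose, det_toMat]
    have := G2.det_ne_zero u
    positivity
  exact this

/-! ### Derivatives of natural functions of a 3-form -/

/-- The metric of a 3-form as a bilinear function. -/
def met (φ : E7 [⋀^Fin 3]→ₗ[ℝ] ℝ) (x y : E7) : ℝ := ∑ i, ∑ j, metric φ i j * x i * y j

theorem met_stdVec (φ : E7 [⋀^Fin 3]→ₗ[ℝ] ℝ) (i j : Fin 7) :
    met φ (stdVec i) (stdVec j) = metric φ i j := by
  simp [met, stdVec_apply]

theorem met_add_left (φ : E7 [⋀^Fin 3]→ₗ[ℝ] ℝ) (x x' y : E7) :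
    met φ (x + x') y = met φ x y + met φ x' y := by
  simp [met, mul_add, add_mul, Finset.sum_add_distrib]

theorem met_smul_left (φ : E7 [⋀^Fin 3]→ₗ[ℝ] ℝ) (c : ℝ) (x y : E7) :
    met φ (c • x) y = c * met φ x y := by
  simp only [met, Finset.mul_sum, PiLp.smul_apply, smul_eq_mul]
  exact Finset.sum_congr rfl fun i _ => Finset.sum_congr rfl fun j _ => by ring

theorem met_pull (u : E7 ≃ₗ[ℝ] E7) (x y : E7) :
    met (phi0.compLinearMap u.toLinearMap) x y = dot (u x) (u y) := by
  have hl : ∀ z, IsLinearMap ℝ fun x => dot (u x) z := fun z =>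
    ⟨fun _ _ => by rw [map_add, dot_add_left], fun _ _ => by rw [map_smul, dot_smul_left]; rfl⟩
  have hr : ∀ z, IsLinearMap ℝ fun x => dot z (u x) := fun z =>
    ⟨fun _ _ => by rw [map_add, dot_add_right], fun _ _ => by rw [map_smul, dot_smul_right]; rfl⟩
  rw [lin_eq_sum (hl _) x, met]
  refine Finset.sum_congr rfl fun i _ => ?_
  rw [lin_eq_sum (hr _) y, Finset.mul_sum]
  refine Finset.sum_congr rfl fun j _ => ?_
  rw [metric_pull, ← dot]
  ring

theorem IsPositive.met_comm {φ : E7 [⋀^Fin 3]→ₗ[ℝ] ℝ} (h : IsPositive φ) (x y : E7) :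
    met φ x y = met φ y x := by
  obtain ⟨u, rfl⟩ := h
  rw [met_pull, met_pull, dot_comm]

/-- Pulling back by `1 + sB` makes the metric, the 3-form and the 4-form polynomials in `s` of
degree 2, 3 and 4. Their derivative at zero is the linear coefficient. -/
theorem hasDerivAt_quartic (c₀ c₁ c₂ c₃ c₄ : ℝ) :
    HasDerivAt (fun s : ℝ => c₀ + s * c₁ + s ^ 2 * c₂ + s ^ 3 * c₃ + s ^ 4 * c₄) c₁ 0 := by
  have h1 : HasDerivAt (fun s : ℝ => s * c₁) c₁ 0 := hasDerivAt_mul_const c₁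
  have hp : ∀ (n : ℕ) (c : ℝ), HasDerivAt (fun s : ℝ => s ^ (n + 2) * c) 0 0 := fun n c => by
    simpa using (hasDerivAt_pow (n + 2) (0 : ℝ)).mul_const c
  simpa using (((h1.const_add c₀).fun_add (hp 0 c₂)).fun_add (hp 1 c₃)).fun_add (hp 2 c₄)

/-- The chain rule sees only the velocity of the curve of forms. The actual variation of `φ` in the
direction `a` may therefore be replaced by the pullbacks of `φ y` under `1 + sB`, along which a
natural `Φ` is computable. -/
theorem fderiv_natural {φ : E7 → E7 [⋀^Fin 3]→ₗ[ℝ] ℝ} {y : E7} (a : E7) (B : E7 →ₗ[ℝ] E7)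
    (hφ : ∀ i j k, DifferentiableAt ℝ (fun z => comp3 (φ z) i j k) y)
    (hB : ∀ i j k, fderiv ℝ (fun z => comp3 (φ z) i j k) y a = comp3 (act B (φ y)) i j k)
    {Φ : Comps → ℝ} (hΦ : DifferentiableAt ℝ Φ (comp3 (φ y))) :
    HasDerivAt (fun s : ℝ => Φ (comp3 ((φ y).compLinearMap (LinearMap.id + s • B))))
      (fderiv ℝ (fun z => Φ (comp3 (φ z))) y a) 0 := by
  have h1 : HasFDerivAt (fun z => comp3 (φ z))
      (ContinuousLinearMap.pi fun i => ContinuousLinearMap.pi fun j => ContinuousLinearMap.pi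
        fun k => fderiv ℝ (fun z => comp3 (φ z) i j k) y) y := by
    rw [hasFDerivAt_pi]; intro i
    rw [hasFDerivAt_pi]; intro j
    rw [hasFDerivAt_pi]; intro k
    exact (hφ i j k).hasFDerivAt
  have h2 := hΦ.hasFDerivAt.comp y h1
  have h3 : fderiv ℝ (fun z => Φ (comp3 (φ z))) y a =
      fderiv ℝ Φ (comp3 (φ y)) (comp3 (act B (φ y))) := by
    have : fderiv ℝ (fun z => Φ (comp3 (φ z))) y = _ := h2.fderiv
    rw [this, ContinuousLinearMap.comp_apply]
    congr 1
    ext i j k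
    exact hB i j k
  rw [h3]
  have h4 : HasDerivAt (fun s : ℝ => comp3 ((φ y).compLinearMap (LinearMap.id + s • B)))
      (comp3 (act B (φ y))) 0 := by
    rw [hasDerivAt_pi]; intro i
    rw [hasDerivAt_pi]; intro j
    rw [hasDerivAt_pi]; intro k
    have e : (fun s : ℝ => comp3 ((φ y).compLinearMap (LinearMap.id + s • B)) i j k) = fun s =>
        comp3 (φ y) i j k + s * comp3 (act B (φ y)) i j k +
        s ^ 2 * (φ y ![B (stdVec i), B (stdVec j), stdVec k] +
          φ y ![B (stdVec i), stdVec j, B (stdVec k)] +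
          φ y ![stdVec i, B (stdVec j), B (stdVec k)]) +
        s ^ 3 * φ y ![B (stdVec i), B (stdVec j), B (stdVec k)] := by
      ext s
      simp only [comp3, pull_apply, act_apply₃, LinearMap.add_apply, LinearMap.smul_apply,
        LinearMap.id_apply, form3_add₀, form3_add₁, form3_add₂, form3_smul₀, form3_smul₁,
        form3_smul₂]
      ring
    rw [e]
    simpa using hasDerivAt_quartic _ _ _ _ 0
  have h5 : comp3 ((φ y).compLinearMap (LinearMap.id + (0 : ℝ) • B)) = comp3 (φ y) := by
    rw [zero_smul, add_zero, AlternatingMap.compLinearMap_id]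
  have hΦ' := hΦ.hasFDerivAt
  rw [← h5] at hΦ'
  have := hΦ'.comp_hasDerivAt (0 : ℝ) h4
  rwa [h5] at this

theorem eventually_isUnit (B : E7 →ₗ[ℝ] E7) :
    ∀ᶠ s : ℝ in nhds 0, ∃ e : E7 ≃ₗ[ℝ] E7, e.toLinearMap = LinearMap.id + s • B := by
  have hc : ContinuousAt (fun s : ℝ => (toMat (LinearMap.id + s • B)).det) 0 := by
    refine (contDiffAt_det (m := 0) fun i j => ?_).continuousAt
    have : (fun s : ℝ => toMat (LinearMap.id + s • B) i j) =
        fun s => stdVec j i + s * B (stdVec j) i := by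
      ext s; simp [toMat]
    rw [this]
    fun_prop
  have h0 : (toMat (LinearMap.id + (0 : ℝ) • B)).det ≠ 0 := by
    rw [det_toMat, zero_smul, add_zero, LinearMap.det_id]; exact one_ne_zero
  filter_upwards [hc.eventually_ne h0] with s hs
  rw [det_toMat] at hs
  exact ⟨LinearMap.equivOfDetNeZero _ hs, rfl⟩

section Natural

variable {φ : E7 → E7 [⋀^Fin 3]→ₗ[ℝ] ℝ} {y a : E7} {B : E7 →ₗ[ℝ] E7}

/-- For small `s` the map `1 + sB` is invertible, so the metric of the pulled-back form is the
pulled-back metric, a quadratic polynomial in `s`. -/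
theorem fderiv_metric (hp : IsPositive (φ y))
    (hφ : ∀ i j k, DifferentiableAt ℝ (fun z => comp3 (φ z) i j k) y)
    (hB : ∀ i j k, fderiv ℝ (fun z => comp3 (φ z) i j k) y a = comp3 (act B (φ y)) i j k)
    (i j : Fin 7) : fderiv ℝ (fun z => metric (φ z) i j) y a =
    met (φ y) (B (stdVec i)) (stdVec j) + met (φ y) (stdVec i) (B (stdVec j)) := by
  have h1 := fderiv_natural a B hφ hB (Φ := fun c => metricC c i j)
    ((contDiffAt_metricC (m := 1) hp.det_ne_zero i j).differentiableAt one_ne_zero)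
  obtain ⟨u, hu⟩ := hp
  have e : (fun s : ℝ => metricC (comp3 ((φ y).compLinearMap (LinearMap.id + s • B))) i j)
      =ᶠ[nhds 0] fun s => met (φ y) (stdVec i) (stdVec j) +
        s * (met (φ y) (B (stdVec i)) (stdVec j) + met (φ y) (stdVec i) (B (stdVec j))) +
        s ^ 2 * met (φ y) (B (stdVec i)) (B (stdVec j)) := by
    filter_upwards [eventually_isUnit B] with s hs
    obtain ⟨e, he⟩ := hs
    have h2 : (φ y).compLinearMap (LinearMap.id + s • B) =
        phi0.compLinearMap (e.trans u).toLinearMap := by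
      rw [hu, ← he]; rfl
    have h3 : ∀ x, e x = x + s • B x := fun x => by
      have := congrArg (fun l : E7 →ₗ[ℝ] E7 => l x) he
      exact this
    rw [← metric_eq_metricC, ← met_stdVec, h2, met_pull, hu, met_pull, met_pull, met_pull, met_pull]
    simp only [LinearEquiv.trans_apply, h3, map_add, map_smul, dot_add_left, dot_add_right,
      dot_smul_left, dot_smul_right]
    ring
  have h4 := h1.congr_of_eventuallyEq e.symm
  exact h4.unique (by simpa using hasDerivAt_quartic _ _ _ 0 0)

theorem fderiv_psi (hp : IsPositive (φ y))
    (hφ : ∀ i j k, DifferentiableAt ℝ (fun z => comp3 (φ z) i j k) y)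
    (hB : ∀ i j k, fderiv ℝ (fun z => comp3 (φ z) i j k) y a = comp3 (act B (φ y)) i j k)
    (v w x z : E7) : fderiv ℝ (fun p => psi (φ p) ![v, w, x, z]) y a =
    psi (φ y) ![B v, w, x, z] + psi (φ y) ![v, B w, x, z] + psi (φ y) ![v, w, B x, z] +
      psi (φ y) ![v, w, x, B z] := by
  have h1 := fderiv_natural a B hφ hB (Φ := fun c => psiC c ![v, w, x, z])
    ((contDiffAt_psiC (m := 1) hp.det_ne_zero _).differentiableAt one_ne_zero)
  obtain ⟨u, hu⟩ := hp
  set ψ := psi (φ y) with hψ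
  have e : (fun s : ℝ => psiC (comp3 ((φ y).compLinearMap (LinearMap.id + s • B))) ![v, w, x, z])
      =ᶠ[nhds 0] fun s => ψ ![v, w, x, z] +
        s * (ψ ![B v, w, x, z] + ψ ![v, B w, x, z] + ψ ![v, w, B x, z] + ψ ![v, w, x, B z]) +
        s ^ 2 * (ψ ![B v, B w, x, z] + ψ ![B v, w, B x, z] + ψ ![B v, w, x, B z] +
          ψ ![v, B w, B x, z] + ψ ![v, B w, x, B z] + ψ ![v, w, B x, B z]) +
        s ^ 3 * (ψ ![B v, B w, B x, z] + ψ ![B v, B w, x, B z] + ψ ![B v, w, B x, B z] +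
          ψ ![v, B w, B x, B z]) + s ^ 4 * ψ ![B v, B w, B x, B z] := by
    filter_upwards [eventually_isUnit B] with s hs
    obtain ⟨e, he⟩ := hs
    have h2 : (φ y).compLinearMap (LinearMap.id + s • B) =
        phi0.compLinearMap (e.trans u).toLinearMap := by
      rw [hu, ← he]; rfl
    have h3 : ∀ x, e x = x + s • B x := fun x => by
      have := congrArg (fun l : E7 →ₗ[ℝ] E7 => l x) he
      exact this
    have h6 : ψ = (psi phi0).compLinearMap u.toLinearMap := by rw [hψ, hu, psi_pull]
    rw [← psi_eq_psiC, h2, psi_pull, h6]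
    simp only [pull_apply₄, LinearEquiv.coe_coe, LinearEquiv.trans_apply, h3, map_add, map_smul,
      form4_add₀, form4_add₁, form4_add₂, form4_add₃, form4_smul₀, form4_smul₁, form4_smul₂,
      form4_smul₃]
    ring
  have h4 := h1.congr_of_eventuallyEq e.symm
  simpa only [psi_eq_psiC] using h4.unique (hasDerivAt_quartic _ _ _ _ _)

end Natural

/-! ### The structure of the torsion of a 3-form on an open subset of `ℝ⁷` -/

/-- A field of 3-forms is smooth at a point. -/
def SmoothAt (φ : E7 → E7 [⋀^Fin 3]→ₗ[ℝ] ℝ) (y : E7) : Prop :=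
  ∀ i j k, ContDiffAt ℝ ∞ (fun z => comp3 (φ z) i j k) y

theorem form3_eq_sum (α : E7 [⋀^Fin 3]→ₗ[ℝ] ℝ) (a b c : E7) :
    α ![a, b, c] = ∑ i, ∑ j, ∑ k, a i * b j * c k * comp3 α i j k := by
  rw [lin_eq_sum (lin3₀ α b c) a]
  refine Finset.sum_congr rfl fun i _ => ?_
  rw [lin_eq_sum (lin3₁ α _ c) b, Finset.mul_sum]
  refine Finset.sum_congr rfl fun j _ => ?_
  rw [lin_eq_sum (lin3₂ α _ _) c, Finset.mul_sum, Finset.mul_sum]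
  exact Finset.sum_congr rfl fun k _ => by rw [comp3]; ring

theorem contDiffAt_coord {w : E7 → E7} {y : E7} {n : WithTop ℕ∞} (hw : ContDiffAt ℝ n w y)
    (i : Fin 7) : ContDiffAt ℝ n (fun z => w z i) y := by
  have h : ContDiffAt ℝ n (EuclideanSpace.proj (𝕜 := ℝ) i : E7 →L[ℝ] ℝ) (w y) :=
    (EuclideanSpace.proj (𝕜 := ℝ) i : E7 →L[ℝ] ℝ).contDiff.contDiffAt
  exact h.comp y hw

theorem SmoothAt.apply {φ : E7 → E7 [⋀^Fin 3]→ₗ[ℝ] ℝ} {y : E7} (h : SmoothAt φ y)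
    {a b c : E7 → E7} (ha : ContDiffAt ℝ ∞ a y) (hb : ContDiffAt ℝ ∞ b y)
    (hc : ContDiffAt ℝ ∞ c y) : ContDiffAt ℝ ∞ (fun z => φ z ![a z, b z, c z]) y := by
  simp only [form3_eq_sum]
  exact ContDiffAt.sum fun i _ => ContDiffAt.sum fun j _ => ContDiffAt.sum fun k _ =>
    (((contDiffAt_coord ha i).mul (contDiffAt_coord hb j)).mul (contDiffAt_coord hc k)).mul
      (h i j k)

theorem SmoothAt.differentiableAt {φ : E7 → E7 [⋀^Fin 3]→ₗ[ℝ] ℝ} {y : E7} (h : SmoothAt φ y)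
    (m : Fin 3 → E7) : DifferentiableAt ℝ (fun z => φ z m) y := by
  have e : m = ![m 0, m 1, m 2] := by ext1 i; fin_cases i <;> rfl
  rw [e]
  exact (h.apply contDiffAt_const contDiffAt_const contDiffAt_const).differentiableAt (by simp)

/-- The directional derivative of a field of 3-forms. -/
def SmoothAt.deriv {φ : E7 → E7 [⋀^Fin 3]→ₗ[ℝ] ℝ} {y : E7} (h : SmoothAt φ y) (a : E7) :
    E7 [⋀^Fin 3]→ₗ[ℝ] ℝ where
  toFun m := fderiv ℝ (fun z => φ z m) y a
  map_update_add' m i x x' := by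
    simp only [AlternatingMap.map_update_add]
    rw [fderiv_fun_add (h.differentiableAt _) (h.differentiableAt _)]
    rfl
  map_update_smul' m i c x := by
    simp only [AlternatingMap.map_update_smul, smul_eq_mul]
    rw [fderiv_const_mul (h.differentiableAt _)]
    rfl
  map_eq_zero_of_eq' m i j hm hij := by
    have : (fun z => φ z m) = fun _ => 0 := funext fun z => (φ z).map_eq_zero_of_eq m hm hij
    simp [this]

theorem act_conj (u : E7 ≃ₗ[ℝ] E7) (B : E7 →ₗ[ℝ] E7) :
    act (u.symm.toLinearMap ∘ₗ B ∘ₗ u.toLinearMap) (phi0.compLinearMap u.toLinearMap) =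
      (act B phi0).compLinearMap u.toLinearMap := by
  refine ext_three fun x y z => ?_
  rw [pull_apply, act_apply₃, act_apply₃]
  simp only [pull_apply, LinearMap.comp_apply, LinearEquiv.coe_coe,
    LinearEquiv.apply_symm_apply]

theorem comp_symm_comp (u : E7 ≃ₗ[ℝ] E7) (α : E7 [⋀^Fin 3]→ₗ[ℝ] ℝ) :
    (α.compLinearMap u.symm.toLinearMap).compLinearMap u.toLinearMap = α := by
  refine ext_three fun x y z => ?_
  simp only [pull_apply, LinearEquiv.coe_coe, LinearEquiv.symm_apply_apply]

/-- The infinitesimal form of the openness of the orbit of positive forms, transported from `φ₀` by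
conjugation. -/
theorem IsPositive.exists_act {φ : E7 [⋀^Fin 3]→ₗ[ℝ] ℝ} (h : IsPositive φ)
    (α : E7 [⋀^Fin 3]→ₗ[ℝ] ℝ) : ∃ B, act B φ = α := by
  obtain ⟨u, rfl⟩ := h
  obtain ⟨B, hB⟩ := exists_act_eq (α.compLinearMap u.symm.toLinearMap)
  exact ⟨_, by rw [act_conj u B, hB, comp_symm_comp]⟩

theorem IsPositive.exists_contract {φ : E7 [⋀^Fin 3]→ₗ[ℝ] ℝ} (h : IsPositive φ)
    (C : E7 →ₗ[ℝ] E7) (hC : ∀ x y, met φ (C x) y = -met φ x (C y)) :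
    ∃ X, act C φ = (psi φ).curryLeft X := by
  obtain ⟨u, rfl⟩ := h
  obtain ⟨X, hX⟩ := act_skew (u.toLinearMap ∘ₗ C ∘ₗ u.symm.toLinearMap) fun x y => by
    have := hC (u.symm x) (u.symm y)
    simpa [met_pull] using this
  refine ⟨u.symm X, ?_⟩
  have h1 := act_conj u (u.toLinearMap ∘ₗ C ∘ₗ u.symm.toLinearMap)
  have h2 : u.symm.toLinearMap ∘ₗ (u.toLinearMap ∘ₗ C ∘ₗ u.symm.toLinearMap) ∘ₗ u.toLinearMap = C := by
    ext x; simp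
  rw [h2, hX] at h1
  rw [h1, psi_pull]
  refine ext_three fun x y z => ?_
  have e1 : ∀ (α : E7 [⋀^Fin 4]→ₗ[ℝ] ℝ) (w : E7), α.curryLeft w ![x, y, z] = α ![w, x, y, z] :=
    fun _ _ => rfl
  rw [e1, pull_apply₄, pull_apply]
  simp only [LinearEquiv.coe_coe, LinearEquiv.apply_symm_apply]
  rfl

theorem IsPositive.metric_det {φ : E7 [⋀^Fin 3]→ₗ[ℝ] ℝ} (h : IsPositive φ) :
    IsUnit (metric φ).det := by
  obtain ⟨u, rfl⟩ := h
  rw [metric_pull_matrix, Matrix.det_mul, Matrix.det_transpose, det_toMat]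
  exact (mul_ne_zero (G2.det_ne_zero u) (G2.det_ne_zero u)).isUnit

theorem met_lin_left (φ : E7 [⋀^Fin 3]→ₗ[ℝ] ℝ) (y : E7) : IsLinearMap ℝ fun x => met φ x y :=
  ⟨fun _ _ => met_add_left .., fun _ _ => met_smul_left ..⟩

theorem IsPositive.met_lin_right {φ : E7 [⋀^Fin 3]→ₗ[ℝ] ℝ} (h : IsPositive φ) (x : E7) :
    IsLinearMap ℝ (met φ x) := by
  have : met φ x = fun y => met φ y x := funext fun y => h.met_comm x y
  rw [this]
  exact met_lin_left φ x

theorem IsPositive.met_inv {φ : E7 [⋀^Fin 3]→ₗ[ℝ] ℝ} (h : IsPositive φ) (w : E7) (b : Fin 7) :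
    ∑ d, (metric φ)⁻¹ b d * met φ (stdVec d) w = w b := by
  have h1 : ∀ d, met φ (stdVec d) w = ∑ e, metric φ d e * w e := fun d => by
    rw [lin_eq_sum (h.met_lin_right (stdVec d)) w]
    exact Finset.sum_congr rfl fun e _ => by rw [met_stdVec, mul_comm]
  simp only [h1, Finset.mul_sum, ← mul_assoc]
  rw [Finset.sum_comm]
  simp only [← Finset.sum_mul, ← Matrix.mul_apply, Matrix.nonsing_inv_mul _ h.metric_det,
    Matrix.one_apply]
  simp

theorem IsPositive.met_ext {φ : E7 [⋀^Fin 3]→ₗ[ℝ] ℝ} (h : IsPositive φ) {v w : E7}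
    (hvw : ∀ d, met φ (stdVec d) v = met φ (stdVec d) w) : v = w := by
  ext b
  rw [← h.met_inv v b, ← h.met_inv w b]
  simp only [hvw]

/-- The Christoffel symbols as an endomorphism `b ↦ Γ(a, b)`. -/
def chr (φ : E7 → E7 [⋀^Fin 3]→ₗ[ℝ] ℝ) (y a : E7) : E7 →ₗ[ℝ] E7 :=
  ofRows fun k e => ∑ i, a i * christoffel (fun z => metric (φ z)) y e i k

theorem chr_stdVec (φ : E7 → E7 [⋀^Fin 3]→ₗ[ℝ] ℝ) (y : E7) (i k e : Fin 7) :
    chr φ y (stdVec i) (stdVec k) e = christoffel (fun z => metric (φ z)) y e i k := by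
  rw [chr, ofRows_stdVec]
  simp [stdVec_apply]

theorem chr_add (φ : E7 → E7 [⋀^Fin 3]→ₗ[ℝ] ℝ) (y a a' b : E7) :
    chr φ y (a + a') b = chr φ y a b + chr φ y a' b := by
  ext m
  simp [chr, ofRows_apply, add_mul, mul_add, Finset.sum_add_distrib]

theorem chr_smul (φ : E7 → E7 [⋀^Fin 3]→ₗ[ℝ] ℝ) (y a b : E7) (c : ℝ) :
    chr φ y (c • a) b = c • chr φ y a b := by
  ext m
  simp only [chr, ofRows_apply, PiLp.smul_apply, smul_eq_mul, Finset.mul_sum]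
  exact Finset.sum_congr rfl fun i _ => Finset.sum_congr rfl fun j _ => by ring

/-! ### The torsion as the part of the derivative of `φ` not produced by the Christoffel symbols -/

section Chart

variable {φ : E7 → E7 [⋀^Fin 3]→ₗ[ℝ] ℝ} {y : E7}

/-- The derivative of the metric is governed by endomorphisms generating the derivative of `φ`. -/
theorem pd_metric (hp : IsPositive (φ y)) (hs : SmoothAt φ y) {B : E7 →ₗ[ℝ] E7} {a : E7}
    (hB : ∀ b c d, fderiv ℝ (fun z => φ z ![b, c, d]) y a = act B (φ y) ![b, c, d]) (i j : Fin 7) :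
    fderiv ℝ (fun z => metric (φ z) i j) y a =
      met (φ y) (B (stdVec i)) (stdVec j) + met (φ y) (stdVec i) (B (stdVec j)) :=
  fderiv_metric hp (fun i j k => hs.differentiableAt _) (fun i j k => hB _ _ _) i j

theorem exists_generators (hp : IsPositive (φ y)) (hs : SmoothAt φ y) :
    ∃ B : Fin 7 → E7 →ₗ[ℝ] E7, ∀ i b c d,
      fderiv ℝ (fun z => φ z ![b, c, d]) y (stdVec i) = act (B i) (φ y) ![b, c, d] := by
  choose B hB using fun i => hp.exists_act (hs.deriv (stdVec i))
  exact ⟨B, fun i b c d => by rw [hB]; rfl⟩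

theorem pd_metric_symm (hp : IsPositive (φ y)) (hs : SmoothAt φ y) (a i j : Fin 7) :
    pd a (fun z => metric (φ z) i j) y = pd a (fun z => metric (φ z) j i) y := by
  obtain ⟨B, hB⟩ := exists_generators hp hs
  rw [pd, pd, pd_metric hp hs (hB a), pd_metric hp hs (hB a), hp.met_comm, add_comm, hp.met_comm]

/-- The Koszul formula: lowering the upper index cancels the inverse metric in the definition of the
Christoffel symbols. -/
theorem met_chr (hp : IsPositive (φ y)) (a c e : Fin 7) :
    met (φ y) (stdVec e) (chr φ y (stdVec a) (stdVec c)) =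
      1 / 2 * (pd c (fun z => metric (φ z) e a) y + pd a (fun z => metric (φ z) e c) y -
        pd e (fun z => metric (φ z) a c) y) := by
  set Q : Fin 7 → ℝ := fun d => 1 / 2 * (pd c (fun z => metric (φ z) d a) y +
    pd a (fun z => metric (φ z) d c) y - pd d (fun z => metric (φ z) a c) y) with hQ
  have h1 : ∀ b, chr φ y (stdVec a) (stdVec c) b = ∑ d, (metric (φ y))⁻¹ b d * Q d := by
    intro b
    rw [chr_stdVec, christoffel, Finset.mul_sum]
    exact Finset.sum_congr rfl fun d _ => by rw [hQ]; ring
  rw [lin_eq_sum (hp.met_lin_right (stdVec e))]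
  simp only [h1, met_stdVec]
  have h2 : ∑ b, (∑ d, (metric (φ y))⁻¹ b d * Q d) * metric (φ y) e b =
      ∑ d, (metric (φ y) * (metric (φ y))⁻¹) e d * Q d := by
    simp only [Matrix.mul_apply, Finset.sum_mul]
    rw [Finset.sum_comm]
    exact Finset.sum_congr rfl fun d _ => Finset.sum_congr rfl fun b _ => by ring
  rw [h2, Matrix.mul_nonsing_inv _ hp.metric_det]
  simp [Matrix.one_apply, hQ]

theorem chr_symm (hp : IsPositive (φ y)) (hs : SmoothAt φ y) (a b : E7) :
    chr φ y a b = chr φ y b a := by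
  have h : ∀ i j, chr φ y (stdVec i) (stdVec j) = chr φ y (stdVec j) (stdVec i) := by
    intro i j
    refine hp.met_ext fun d => ?_
    rw [met_chr hp, met_chr hp, pd_metric_symm hp hs d i j]
    ring
  ext m
  refine lin_ext (F := fun a => chr φ y a b m) (G := fun a => chr φ y b a m) ?_ ?_ ?_ a
  · constructor <;> intros <;> simp [chr_add, chr_smul]
  · constructor <;> intros <;> simp
  intro i
  refine lin_ext (F := fun b => chr φ y _ b m) (G := fun b => chr φ y b _ m) ?_ ?_ ?_ b
  · constructor <;> intros <;> simp
  · constructor <;> intros <;> simp [chr_add, chr_smul]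
  intro j
  simp only [h i j]

theorem sum_three_comm (G : Fin 7 → Fin 7 → Fin 7 → Fin 7 → Fin 7 → Fin 7 → ℝ) :
    ∑ i, ∑ j, ∑ k, ∑ l, ∑ m, ∑ n, G i j k l m n = ∑ l, ∑ m, ∑ n, ∑ i, ∑ j, ∑ k, G i j k l m n := by
  have e1 : ∀ H : Fin 7 → Fin 7 → Fin 7 → Fin 7 → ℝ, ∑ i, ∑ j, ∑ k, ∑ l, H i j k l =
      ∑ l, ∑ i, ∑ j, ∑ k, H i j k l := by
    intro H
    calc _ = ∑ i, ∑ j, ∑ l, ∑ k, H i j k l := Finset.sum_congr rfl fun i _ =>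
          Finset.sum_congr rfl fun j _ => Finset.sum_comm
      _ = ∑ i, ∑ l, ∑ j, ∑ k, H i j k l := Finset.sum_congr rfl fun i _ => Finset.sum_comm
      _ = _ := Finset.sum_comm
  rw [e1]
  refine Finset.sum_congr rfl fun l _ => ?_
  rw [e1]
  exact Finset.sum_congr rfl fun m _ => e1 _

theorem raise_form (u : E7 ≃ₗ[ℝ] E7) (α : E7 [⋀^Fin 3]→ₗ[ℝ] ℝ) (i j k : Fin 7) :
    ∑ a, ∑ b, ∑ c, (metric (phi0.compLinearMap u.toLinearMap))⁻¹ i a *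
      (metric (phi0.compLinearMap u.toLinearMap))⁻¹ j b *
      (metric (phi0.compLinearMap u.toLinearMap))⁻¹ k c * α ![stdVec a, stdVec b, stdVec c] =
    ∑ l, ∑ m, ∑ n, frame u l i * frame u m j * frame u n k *
      α ![frame u l, frame u m, frame u n] := by
  set φ := phi0.compLinearMap u.toLinearMap with hφ
  have h1 : ∀ a b, ∑ c, (metric φ)⁻¹ k c * α ![stdVec a, stdVec b, stdVec c] =
      ∑ n, frame u n k * α ![stdVec a, stdVec b, frame u n] := fun a b =>
    sum_metric_inv₁ u _ (lin3₂ α _ _) k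
  have h2 : ∀ a, ∑ b, (metric φ)⁻¹ j b * ∑ n, frame u n k * α ![stdVec a, stdVec b, frame u n] =
      ∑ m, frame u m j * ∑ n, frame u n k * α ![stdVec a, frame u m, frame u n] := by
    intro a
    refine sum_metric_inv₁ u (fun x => ∑ n, frame u n k * α ![stdVec a, x, frame u n]) ?_ j
    constructor
    · intro x y; simp only [form3_add₁, mul_add, Finset.sum_add_distrib]
    · intro c x
      simp only [form3_smul₁, smul_eq_mul, Finset.mul_sum]
      exact Finset.sum_congr rfl fun n _ => by ring
  have h3 : ∑ a, (metric φ)⁻¹ i a *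
      ∑ m, frame u m j * ∑ n, frame u n k * α ![stdVec a, frame u m, frame u n] =
      ∑ l, frame u l i * ∑ m, frame u m j * ∑ n, frame u n k *
        α ![frame u l, frame u m, frame u n] := by
    refine sum_metric_inv₁ u (fun x => ∑ m, frame u m j * ∑ n, frame u n k *
      α ![x, frame u m, frame u n]) ?_ i
    constructor
    · intro x y; simp only [form3_add₀, mul_add, Finset.sum_add_distrib]
    · intro c x
      simp only [form3_smul₀, smul_eq_mul, Finset.mul_sum]
      exact Finset.sum_congr rfl fun n _ => Finset.sum_congr rfl fun n _ => by ring
  rw [sum_triple_factor]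
  simp only [h1, h2, h3]
  rw [sum_triple_factor]

/-- Contraction of two 3-forms with the metric is a sum over the frame. -/
theorem contract_forms (u : E7 ≃ₗ[ℝ] E7) (α β : E7 [⋀^Fin 3]→ₗ[ℝ] ℝ) :
    ∑ b, ∑ c, ∑ d, ∑ b', ∑ c', ∑ d', α ![stdVec b, stdVec c, stdVec d] *
      ((metric (phi0.compLinearMap u.toLinearMap))⁻¹ b b' *
      (metric (phi0.compLinearMap u.toLinearMap))⁻¹ c c' *
      (metric (phi0.compLinearMap u.toLinearMap))⁻¹ d d') *
      β ![stdVec b', stdVec c', stdVec d'] =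
    ∑ l, ∑ m, ∑ n, α ![frame u l, frame u m, frame u n] * β ![frame u l, frame u m, frame u n] := by
  have h1 : ∀ l m n, α ![frame u l, frame u m, frame u n] * β ![frame u l, frame u m, frame u n] =
      ∑ b, ∑ c, ∑ d, α ![stdVec b, stdVec c, stdVec d] * (frame u l b * frame u m c * frame u n d *
        β ![frame u l, frame u m, frame u n]) := by
    intro l m n
    rw [form3_eq_sum α]
    simp only [Finset.sum_mul]
    exact Finset.sum_congr rfl fun b _ => Finset.sum_congr rfl fun c _ =>
      Finset.sum_congr rfl fun d _ => by rw [comp3]; ring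
  simp only [h1]
  refine Eq.trans ?_ (sum_three_comm _)
  refine Finset.sum_congr rfl fun b _ => Finset.sum_congr rfl fun c _ =>
    Finset.sum_congr rfl fun d _ => ?_
  have h2 := raise_form u β b c d
  simp only [mul_assoc, ← Finset.mul_sum] at h2 ⊢
  rw [h2]

/-- The covariant derivative of `φ` in terms of the torsion. -/
theorem exists_torsion (hp : IsPositive (φ y)) (hs : SmoothAt φ y) :
    ∃ X : E7 →ₗ[ℝ] E7, (∀ a b c d, fderiv ℝ (fun z => φ z ![b, c, d]) y a =
        act (chr φ y a) (φ y) ![b, c, d] + psi (φ y) ![X a, b, c, d]) ∧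
      ∀ a m, torsion φ y a m = met (φ y) (X (stdVec a)) (stdVec m) := by
  obtain ⟨B, hB⟩ := exists_generators hp hs
  -- `B i` and the Christoffel endomorphism both generate the derivative of the metric, so their
  -- difference is skew. Skew endomorphisms act on `φ` by contraction of a vector with `ψ`, and that
  -- vector is the torsion.
  have hskew : ∀ i x z, met (φ y) ((B i - chr φ y (stdVec i)) x) z =
      -met (φ y) x ((B i - chr φ y (stdVec i)) z) := by
    intro i x z
    have h1 := pd_metric_symm hp hs
    have key : ∀ j k, met (φ y) ((B i - chr φ y (stdVec i)) (stdVec j)) (stdVec k) =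
        -met (φ y) (stdVec j) ((B i - chr φ y (stdVec i)) (stdVec k)) := by
      intro j k
      have h2 := pd_metric hp hs (hB i) j k
      rw [← pd] at h2
      have h3 := met_chr (φ := φ) hp i j k
      have h4 := met_chr (φ := φ) hp i k j
      rw [LinearMap.sub_apply, LinearMap.sub_apply, hp.met_comm _ (stdVec k),
        (hp.met_lin_right _).map_sub, (hp.met_lin_right _).map_sub, h3, h4,
        hp.met_comm (stdVec k) (B i (stdVec j))]
      linarith [h1 i j k, h1 j k i, h1 k j i]
    refine lin_ext (F := fun x => met (φ y) ((B i - chr φ y (stdVec i)) x) z)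
      (G := fun x => -met (φ y) x ((B i - chr φ y (stdVec i)) z)) ?_ ?_ ?_ x
    · constructor <;> intros <;> simp only [map_add, map_smul, met_add_left, met_smul_left,
        smul_eq_mul]
    · constructor <;> intros <;> simp only [met_add_left, met_smul_left, smul_eq_mul] <;> ring
    intro j
    refine lin_ext (F := fun z => met (φ y) ((B i - chr φ y (stdVec i)) (stdVec j)) z)
      (G := fun z => -met (φ y) (stdVec j) ((B i - chr φ y (stdVec i)) z)) ?_ ?_ ?_ z
    · exact hp.met_lin_right _
    · constructor <;> intros <;> simp only [map_add, map_smul, (hp.met_lin_right _).map_add,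
        (hp.met_lin_right _).map_smul, smul_eq_mul] <;> ring
    exact key j
  choose X hX using fun i => hp.exists_contract _ (hskew i)
  have hX' : ∀ i b c d, fderiv ℝ (fun z => φ z ![b, c, d]) y (stdVec i) =
      act (chr φ y (stdVec i)) (φ y) ![b, c, d] + psi (φ y) ![X i, b, c, d] := by
    intro i b c d
    have h1 : act (B i - chr φ y (stdVec i)) (φ y) ![b, c, d] = psi (φ y) ![X i, b, c, d] := by
      rw [hX]; rfl
    rw [hB, ← h1]
    simp only [act_apply₃, LinearMap.sub_apply, (lin3₀ _ _ _).map_sub, (lin3₁ _ _ _).map_sub,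
      (lin3₂ _ _ _).map_sub]
    ring
  have hXi : ∀ i, ofRows (fun i => X i) (stdVec i) = X i := fun i => by
    ext m; exact ofRows_stdVec _ i m
  refine ⟨ofRows fun i => X i, fun a b c d => ?_, fun a m => ?_⟩
  · refine lin_ext (F := fun a => fderiv ℝ (fun z => φ z ![b, c, d]) y a) (G := fun a =>
      act (chr φ y a) (φ y) ![b, c, d] + psi (φ y) ![ofRows (fun i => X i) a, b, c, d]) ?_ ?_ ?_ a
    · constructor <;> intros <;> simp
    · constructor <;> intros <;> simp only [act_apply₃, chr_add, chr_smul, map_add, map_smul,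
        form3_add₀, form3_add₁, form3_add₂, form3_smul₀, form3_smul₁, form3_smul₂, form4_add₀,
        form4_smul₀, smul_eq_mul] <;> ring
    intro i
    rw [hXi]
    exact hX' i b c d
  · have hcov : ∀ b c d, covDerivForm φ y a b c d =
        (psi (φ y)).curryLeft (X a) ![stdVec b, stdVec c, stdVec d] := by
      intro b c d
      have h1 := hX' a (stdVec b) (stdVec c) (stdVec d)
      have e1 : (psi (φ y)).curryLeft (X a) ![stdVec b, stdVec c, stdVec d] =
        psi (φ y) ![X a, stdVec b, stdVec c, stdVec d] := rfl
      rw [e1, covDerivForm, pd]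
      simp only [comp3]
      rw [h1, act_apply₃, lin_eq_sum (lin3₀ _ _ _) (chr φ y _ _), lin_eq_sum (lin3₁ _ _ _)
        (chr φ y _ _), lin_eq_sum (lin3₂ _ _ _) (chr φ y _ _)]
      simp only [chr_stdVec, Finset.sum_add_distrib]
      ring
    rw [hXi, torsion]
    obtain ⟨u, hu⟩ := hp
    have h2 := contract_forms u ((psi (φ y)).curryLeft (X a)) ((psi (φ y)).curryLeft (stdVec m))
    simp only [hcov]
    rw [← hu] at h2
    have e2 : ∀ b c d, comp4 (psi (φ y)) m b c d =
      (psi (φ y)).curryLeft (stdVec m) ![stdVec b, stdVec c, stdVec d] := fun _ _ _ => rfl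
    simp only [e2]
    rw [h2]
    have e3 : ∀ w l m n, (psi (φ y)).curryLeft w ![frame u l, frame u m, frame u n] =
        psi0 ![u w, stdVec l, stdVec m, stdVec n] := by
      intro w l m n
      rw [hu, psi_pull]
      have : ∀ (α : E7 [⋀^Fin 4]→ₗ[ℝ] ℝ) (x y z : E7), α.curryLeft w ![x, y, z] =
        α ![w, x, y, z] := fun _ _ _ _ => rfl
      rw [this, pull_apply₄]
      simp only [LinearEquiv.coe_coe, map_frame]
      rfl
    simp only [e3]
    -- The contraction of `ψ` with itself over three indices is `24 g`, which cancels the factor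
    -- `1/24` of the torsion.
    rw [psi0_contract, hu, met_pull]
    ring

/-- If the derivative of `φ` is generated by symmetric endomorphisms, the torsion vanishes. -/
theorem torsion_eq_zero (hp : IsPositive (φ y)) (hs : SmoothAt φ y) (G : E7 → E7 →ₗ[ℝ] E7)
    (hG : ∀ a b, G a b = G b a)
    (h : ∀ a b c d, fderiv ℝ (fun z => φ z ![b, c, d]) y a = act (G a) (φ y) ![b, c, d])
    (a m : Fin 7) : torsion φ y a m = 0 := by
  -- Uniqueness of the Levi-Civita connection: `G` is symmetric and generates the derivative of the
  -- metric, so the Koszul formula identifies it with the Christoffel symbols.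
  have hchr : ∀ i k, chr φ y (stdVec i) (stdVec k) = G (stdVec i) (stdVec k) := by
    intro i k
    refine hp.met_ext fun d => ?_
    rw [met_chr hp, pd, pd, pd, pd_metric hp hs (h _), pd_metric hp hs (h _),
      pd_metric hp hs (h _), hG (stdVec k) (stdVec d), hG (stdVec k) (stdVec i),
      hG (stdVec i) (stdVec d), hp.met_comm (G (stdVec d) (stdVec k)) (stdVec i)]
    ring
  have hcov : ∀ b c d, covDerivForm φ y a b c d = 0 := by
    intro b c d
    have h1 := h (stdVec a) (stdVec b) (stdVec c) (stdVec d)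
    rw [covDerivForm, pd]
    simp only [comp3]
    rw [h1, act_apply₃, ← hchr, ← hchr, ← hchr, lin_eq_sum (lin3₀ _ _ _) (chr φ y _ _),
      lin_eq_sum (lin3₁ _ _ _) (chr φ y _ _), lin_eq_sum (lin3₂ _ _ _) (chr φ y _ _)]
    simp only [chr_stdVec, Finset.sum_add_distrib]
    ring
  rw [torsion]
  simp [hcov]

end Chart

/-! ### Smoothness of the derived tensors -/

section Smooth

variable {φ : E7 → E7 [⋀^Fin 3]→ₗ[ℝ] ℝ} {y : E7}

theorem SmoothAt.comp3 (hs : SmoothAt φ y) : ContDiffAt ℝ ∞ (fun z => G2.comp3 (φ z)) y :=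
  contDiffAt_pi.mpr fun i => contDiffAt_pi.mpr fun j => contDiffAt_pi.mpr fun k => hs i j k

theorem SmoothAt.metric (hs : SmoothAt φ y) (hp : IsPositive (φ y)) (i j : Fin 7) :
    ContDiffAt ℝ ∞ (fun z => metric (φ z) i j) y :=
  ContDiffAt.comp (g := fun c => metricC c i j) y (contDiffAt_metricC hp.det_ne_zero i j) hs.comp3

theorem SmoothAt.metric_inv (hs : SmoothAt φ y) (hp : IsPositive (φ y)) (i j : Fin 7) :
    ContDiffAt ℝ ∞ (fun z => (G2.metric (φ z))⁻¹ i j) y :=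
  ContDiffAt.comp (g := fun c => (metricC c)⁻¹ i j) y
    (contDiffAt_metricC_inv hp.det_ne_zero i j) hs.comp3

theorem SmoothAt.psi (hs : SmoothAt φ y) (hp : IsPositive (φ y)) (w : Fin 4 → E7) :
    ContDiffAt ℝ ∞ (fun z => psi (φ z) w) y := by
  simp only [psi_eq_psiC]
  exact ContDiffAt.comp (g := fun c => psiC c w) y (contDiffAt_psiC hp.det_ne_zero w) hs.comp3

theorem contDiffAt_fderiv {f : E7 → ℝ} (hf : ContDiffAt ℝ ∞ f y) (a : E7) :
    ContDiffAt ℝ ∞ (fun z => fderiv ℝ f z a) y :=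
  (hf.fderiv_right (m := ∞) (by simp)).clm_apply contDiffAt_const

theorem SmoothAt.christoffel (hs : SmoothAt φ y) (hp : IsPositive (φ y)) (b a c : Fin 7) :
    ContDiffAt ℝ ∞ (fun z => G2.christoffel (fun z => G2.metric (φ z)) z b a c) y := by
  unfold G2.christoffel
  exact contDiffAt_const.mul (ContDiffAt.sum fun d _ => (hs.metric_inv hp b d).mul
    (((contDiffAt_fderiv (hs.metric hp _ _) _).add (contDiffAt_fderiv (hs.metric hp _ _) _)).sub
      (contDiffAt_fderiv (hs.metric hp _ _) _)))

theorem SmoothAt.torsion (hs : SmoothAt φ y) (hp : IsPositive (φ y)) (a m : Fin 7) :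
    ContDiffAt ℝ ∞ (fun z => G2.torsion φ z a m) y := by
  unfold G2.torsion
  refine contDiffAt_const.mul (ContDiffAt.sum fun b _ => ContDiffAt.sum fun c _ =>
    ContDiffAt.sum fun d _ => ContDiffAt.sum fun b' _ => ContDiffAt.sum fun c' _ =>
    ContDiffAt.sum fun d' _ => ContDiffAt.mul (ContDiffAt.mul ?_ ?_) (hs.psi hp _))
  · unfold covDerivForm
    refine (contDiffAt_fderiv (hs b c d) _).sub (ContDiffAt.sum fun e _ => ?_)
    exact (((hs.christoffel hp e a b).mul (hs e c d)).add
      ((hs.christoffel hp e a c).mul (hs b e d))).add ((hs.christoffel hp e a d).mul (hs b c e))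
  · exact ((hs.metric_inv hp b b').mul (hs.metric_inv hp c c')).mul (hs.metric_inv hp d d')

end Smooth

/-! ### Rules of differentiation for alternations and wedge products -/

section Leibniz

variable {ι : Type*} {y e : E7}

theorem fderiv_wedge13 {τ : E7 → ι → ℝ} {α : E7 → ι → ι → ι → ℝ}
    (hτ : ∀ a, DifferentiableAt ℝ (fun z => τ z a) y)
    (hα : ∀ a b c, DifferentiableAt ℝ (fun z => α z a b c) y) (a b c d : ι) :
    fderiv ℝ (fun z => wedge13 (τ z) (α z) a b c d) y e =
      wedge13 (fun x => fderiv ℝ (fun z => τ z x) y e) (α y) a b c d +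
      wedge13 (τ y) (fun x₁ x₂ x₃ => fderiv ℝ (fun z => α z x₁ x₂ x₃) y e) a b c d := by
  have h := ((((hτ a).hasFDerivAt.mul (hα b c d).hasFDerivAt).sub
    ((hτ b).hasFDerivAt.mul (hα a c d).hasFDerivAt)).add
    ((hτ c).hasFDerivAt.mul (hα a b d).hasFDerivAt)).sub
    ((hτ d).hasFDerivAt.mul (hα a b c).hasFDerivAt)
  have h2 : fderiv ℝ (fun z => wedge13 (τ z) (α z) a b c d) y = _ := h.fderiv
  rw [h2]
  simp [wedge13]
  ring

theorem fderiv_wedge14 {τ : E7 → ι → ℝ} {α : E7 → ι → ι → ι → ι → ℝ}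
    (hτ : ∀ a, DifferentiableAt ℝ (fun z => τ z a) y)
    (hα : ∀ a b c d, DifferentiableAt ℝ (fun z => α z a b c d) y) (a b c d f : ι) :
    fderiv ℝ (fun z => wedge14 (τ z) (α z) a b c d f) y e =
      wedge14 (fun x => fderiv ℝ (fun z => τ z x) y e) (α y) a b c d f +
      wedge14 (τ y) (fun x₁ x₂ x₃ x₄ => fderiv ℝ (fun z => α z x₁ x₂ x₃ x₄) y e) a b c d f := by
  have h := (((((hτ a).hasFDerivAt.mul (hα b c d f).hasFDerivAt).sub
    ((hτ b).hasFDerivAt.mul (hα a c d f).hasFDerivAt)).add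
    ((hτ c).hasFDerivAt.mul (hα a b d f).hasFDerivAt)).sub
    ((hτ d).hasFDerivAt.mul (hα a b c f).hasFDerivAt)).add
    ((hτ f).hasFDerivAt.mul (hα a b c d).hasFDerivAt)
  have h2 : fderiv ℝ (fun z => wedge14 (τ z) (α z) a b c d f) y = _ := h.fderiv
  rw [h2]
  simp [wedge14]
  ring

theorem fderiv_alt4 {D : E7 → ι → ι → ι → ι → ℝ}
    (hD : ∀ a b c d, DifferentiableAt ℝ (fun z => D z a b c d) y) (a b c d : ι) :
    fderiv ℝ (fun z => alt4 (D z) a b c d) y e =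
      alt4 (fun a b c d => fderiv ℝ (fun z => D z a b c d) y e) a b c d := by
  have h := (((hD a b c d).hasFDerivAt.sub (hD b a c d).hasFDerivAt).add
    (hD c a b d).hasFDerivAt).sub (hD d a b c).hasFDerivAt
  have h2 : fderiv ℝ (fun z => alt4 (D z) a b c d) y = _ := h.fderiv
  rw [h2]
  simp [alt4]

theorem fderiv_alt5 {D : E7 → ι → ι → ι → ι → ι → ℝ}
    (hD : ∀ a b c d f, DifferentiableAt ℝ (fun z => D z a b c d f) y) (a b c d f : ι) :
    fderiv ℝ (fun z => alt5 (D z) a b c d f) y e =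
      alt5 (fun a b c d f => fderiv ℝ (fun z => D z a b c d f) y e) a b c d f := by
  have h := ((((hD a b c d f).hasFDerivAt.sub (hD b a c d f).hasFDerivAt).add
    (hD c a b d f).hasFDerivAt).sub (hD d a b c f).hasFDerivAt).add (hD f a b c d).hasFDerivAt
  have h2 : fderiv ℝ (fun z => alt5 (D z) a b c d f) y = _ := h.fderiv
  rw [h2]
  simp [alt5]

theorem fderiv_symm {W : Type*} [NormedAddCommGroup W] [NormedSpace ℝ W] {f : E7 → W}
    (hf : ContDiffAt ℝ ∞ f y) (a b : E7) :
    fderiv ℝ (fun z => fderiv ℝ f z a) y b = fderiv ℝ (fun z => fderiv ℝ f z b) y a := by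
  have hd : DifferentiableAt ℝ (fderiv ℝ f) y :=
    (hf.fderiv_right (m := ∞) (by simp)).differentiableAt (by simp)
  have h : ∀ c d, fderiv ℝ (fun z => fderiv ℝ f z c) y d = fderiv ℝ (fderiv ℝ f) y d c := by
    intro c d
    rw [fderiv_clm_apply hd (differentiableAt_const _)]
    simp
  rw [h, h]
  exact (hf.isSymmSndFDerivAt (by
    rw [minSmoothness_of_isRCLikeNormedField]; exact WithTop.coe_le_coe.mpr (le_top : (2 : ℕ∞) ≤ ⊤))).eq b a

end Leibniz

/-! ### First-order consequences of `T ∈ W₁ ⊕ W₇` -/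

/-- The partial derivatives of a field of 3-forms. -/
def dForm (φ : E7 → E7 [⋀^Fin 3]→ₗ[ℝ] ℝ) (y a b c d : E7) : ℝ :=
  fderiv ℝ (fun z => φ z ![b, c, d]) y a

/-- The partial derivatives of the 4-form of a field of 3-forms. -/
def dPsi (φ : E7 → E7 [⋀^Fin 3]→ₗ[ℝ] ℝ) (y a b c d e : E7) : ℝ :=
  fderiv ℝ (fun z => psi (φ z) ![b, c, d, e]) y a

/-- Every term containing `G a b` occurs a second time with `a` and `b` interchanged and the
opposite sign. This is why, in an exterior derivative, a symmetric connection may replace the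
partial derivatives. -/
theorem alt_act_symm (α : E7 [⋀^Fin 3]→ₗ[ℝ] ℝ) (G : E7 → E7 →ₗ[ℝ] E7)
    (hG : ∀ a b, G a b = G b a) (a b c d : E7) :
    alt4 (fun a b c d => act (G a) α ![b, c, d]) a b c d = 0 := by
  have m1 : ∀ x y z : E7, α ![x, y, z] = -α ![y, x, z] := fun x y z => form3_swap α x y z
  have m2 : ∀ x y z : E7, α ![x, y, z] = α ![z, x, y] := fun x y z => form3_rotate α x y z
  simp only [alt4, act_apply₃]
  rw [m1 b (G a c) d, m2 b c (G a d), m1 a (G b c) d, m2 a c (G b d), m1 a (G c b) d,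
    m2 a b (G c d), m1 a (G d b) c, m2 a b (G d c), hG b a, hG c a, hG d a, hG c b, hG d b, hG d c]
  ring

theorem alt_act_symm₄ (α : E7 [⋀^Fin 4]→ₗ[ℝ] ℝ) (G : E7 → E7 →ₗ[ℝ] E7)
    (hG : ∀ a b, G a b = G b a) (a b c d e : E7) :
    alt5 (fun a b c d e => α ![G a b, c, d, e] + α ![b, G a c, d, e] + α ![b, c, G a d, e] +
      α ![b, c, d, G a e]) a b c d e = 0 := by
  have m1 : ∀ x w y z : E7, α ![x, w, y, z] = -α ![w, x, y, z] := fun x w y z =>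
    form4_move₁ α x y z w
  have m2 : ∀ x y w z : E7, α ![x, y, w, z] = α ![w, x, y, z] := fun x y w z =>
    form4_move₂ α x y z w
  have m3 : ∀ x y z w : E7, α ![x, y, z, w] = -α ![w, x, y, z] := fun x y z w =>
    form4_move₃ α x y z w
  simp only [alt5]
  rw [m1 b (G a c) d e, m2 b c (G a d) e, m3 b c d (G a e), m1 a (G b c) d e, m2 a c (G b d) e,
    m3 a c d (G b e), m1 a (G c b) d e, m2 a b (G c d) e, m3 a b d (G c e), m1 a (G d b) c e,
    m2 a b (G d c) e, m3 a b c (G d e), m1 a (G e b) c d, m2 a b (G e c) d, m3 a b c (G e d),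
    hG b a, hG c a, hG d a, hG e a, hG c b, hG d b, hG e b, hG d c, hG e c, hG e d]
  ring

theorem fun3_pull (u : E7 ≃ₗ[ℝ] E7) (a b c : E7) :
    phi0.compLinearMap u.toLinearMap ![a, b, c] = phi0 ![u a, u b, u c] := pull_apply ..

theorem psi_pull_fun (u : E7 ≃ₗ[ℝ] E7) (a b c d : E7) :
    psi (phi0.compLinearMap u.toLinearMap) ![a, b, c, d] = psi0 ![u a, u b, u c, u d] := by
  rw [psi_pull, pull_apply₄]; rfl

/-- The derivative of the 4-form in terms of that of the 3-form. -/
theorem dPsi_eq {φ : E7 → E7 [⋀^Fin 3]→ₗ[ℝ] ℝ} {y a X : E7} {G : E7 →ₗ[ℝ] E7}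
    (hp : IsPositive (φ y)) (hs : SmoothAt φ y) (u : E7 ≃ₗ[ℝ] E7)
    (hu : φ y = phi0.compLinearMap u.toLinearMap)
    (h : ∀ b c d, dForm φ y a b c d = act G (φ y) ![b, c, d] + psi (φ y) ![X, b, c, d])
    (b c d e : E7) : dPsi φ y a b c d e =
      psi (φ y) ![G b, c, d, e] + psi (φ y) ![b, G c, d, e] + psi (φ y) ![b, c, G d, e] +
      psi (φ y) ![b, c, d, G e] -
      wedge13 (fun w => dot (u X) (u w)) (fun3 (φ y)) b c d e := by
  -- The term `X ⌟ ψ` is the action of `⅓ X ×` on `φ` (`act_cross_phi0`), so `G + m` generates the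
  -- derivative of `φ`, hence that of `ψ`. On `ψ` the extra part acts as `-X ∧ φ`
  -- (`act_cross_psi0`).
  let m : E7 →ₗ[ℝ] E7 := (1 / 3 : ℝ) • (u.symm.toLinearMap ∘ₗ
    (IsLinearMap.mk' (cross (u X)) ⟨fun a b => cross_add_right a b _, fun c a =>
      cross_smul_right c a _⟩) ∘ₗ u.toLinearMap)
  have hm : ∀ w, u (m w) = (1 / 3 : ℝ) • cross (u X) (u w) := fun w => by simp [m]
  have hB : ∀ i j k, fderiv ℝ (fun z => comp3 (φ z) i j k) y a =
      comp3 (act (G + m) (φ y)) i j k := by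
    intro i j k
    have h1 := h (stdVec i) (stdVec j) (stdVec k)
    have h2 := act_cross_phi0 (u X) (u (stdVec i)) (u (stdVec j)) (u (stdVec k))
    rw [dForm] at h1
    simp only [comp3]
    rw [h1, act_apply₃, act_apply₃, hu, psi_pull_fun]
    simp only [LinearMap.add_apply, form3_add₀, form3_add₁, form3_add₂, fun3_pull, hm]
    rw [← h2]
    ring
  rw [dPsi, fderiv_psi hp (fun i j k => hs.differentiableAt _) hB]
  have h2 := act_cross_psi0 (u X) (u b) (u c) (u d) (u e)
  simp only [LinearMap.add_apply, form4_add₀, form4_add₁, form4_add₂, form4_add₃]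
  rw [hu]
  simp only [psi_pull_fun, hm, wedge13, fun3, fun3_pull]
  linarith

/-- The scalar part of the torsion. -/
def tau1 (φ : E7 → E7 [⋀^Fin 3]→ₗ[ℝ] ℝ) (y : E7) : ℝ :=
  1 / 7 * ∑ a, ∑ m, (metric (φ y))⁻¹ a m * torsion φ y a m

/-- The 1-form part of the torsion. -/
def tau7 (φ : E7 → E7 [⋀^Fin 3]→ₗ[ℝ] ℝ) (y x : E7) : ℝ :=
  1 / 6 * ∑ a, ∑ a', (metric (φ y))⁻¹ a a' * ∑ m, ∑ m', (metric (φ y))⁻¹ m m' *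
    (torsion φ y a m * φ y ![x, stdVec a', stdVec m'])

/-- A 3-form field on an open set that is a `G₂`-structure with `T ∈ W₁ ⊕ W₇`. -/
structure LocalW17 (φ : E7 → E7 [⋀^Fin 3]→ₗ[ℝ] ℝ) (U : Set E7) : Prop where
  isOpen : IsOpen U
  pos : ∀ y ∈ U, IsPositive (φ y)
  smooth : ∀ y ∈ U, SmoothAt φ y
  torsion : ∀ y ∈ U, ∃ (τ₁ : ℝ) (τ₇ : E7), ∀ a m : Fin 7, torsion φ y a m =
    τ₁ * metric (φ y) a m + φ y ![τ₇, stdVec a, stdVec m]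

section W17

variable {φ : E7 → E7 [⋀^Fin 3]→ₗ[ℝ] ℝ} {U : Set E7} {y : E7}

theorem LocalW17.smooth_tau1 (h : LocalW17 φ U) (hy : y ∈ U) : ContDiffAt ℝ ∞ (tau1 φ) y :=
  contDiffAt_const.mul (ContDiffAt.sum fun a _ => ContDiffAt.sum fun m _ =>
    ((h.smooth y hy).metric_inv (h.pos y hy) a m).mul ((h.smooth y hy).torsion (h.pos y hy) a m))

theorem LocalW17.smooth_tau7 (h : LocalW17 φ U) (hy : y ∈ U) (x : E7) :
    ContDiffAt ℝ ∞ (fun z => tau7 φ z x) y := by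
  have hs := h.smooth y hy
  have hp := h.pos y hy
  exact contDiffAt_const.mul (ContDiffAt.sum fun a _ => ContDiffAt.sum fun a' _ =>
    (hs.metric_inv hp a a').mul (ContDiffAt.sum fun m _ => ContDiffAt.sum fun m' _ =>
    (hs.metric_inv hp m m').mul ((hs.torsion hp a m).mul
      (hs.apply contDiffAt_const contDiffAt_const contDiffAt_const))))

theorem tau7_lin (φ : E7 → E7 [⋀^Fin 3]→ₗ[ℝ] ℝ) (y : E7) : IsLinearMap ℝ (tau7 φ y) := by
  constructor
  · intro x x'
    simp only [tau7, form3_add₀, mul_add, Finset.sum_add_distrib]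
  · intro c x
    simp only [tau7, form3_smul₀, smul_eq_mul, Finset.mul_sum]
    exact Finset.sum_congr rfl fun _ _ => Finset.sum_congr rfl fun _ _ =>
      Finset.sum_congr rfl fun _ _ => Finset.sum_congr rfl fun _ _ => by ring

/-- The derivative of `φ` in a frame. -/
theorem LocalW17.exists_frame (h : LocalW17 φ U) (hy : y ∈ U) (u : E7 ≃ₗ[ℝ] E7)
    (hu : φ y = phi0.compLinearMap u.toLinearMap) :
    ∃ θ : E7, (∀ x, tau7 φ y x = dot θ (u x)) ∧
      (∀ a b c d, dForm φ y a b c d = act (chr φ y a) (φ y) ![b, c, d] +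
        psi (φ y) ![u.symm (tau1 φ y • u a + cross θ (u a)), b, c, d]) ∧
      ∀ a m, G2.torsion φ y a m = tau1 φ y * metric (φ y) a m +
        phi0 ![θ, u (stdVec a), u (stdVec m)] := by
  have hp := h.pos y hy
  obtain ⟨t, τ, hT⟩ := h.torsion y hy
  obtain ⟨X, hX, hXT⟩ := exists_torsion hp (h.smooth y hy)
  set T : E7 → E7 → ℝ := fun a m => t * met (φ y) a m + φ y ![τ, a, m] with hTdef
  have hT0 : ∀ a, IsLinearMap ℝ fun x => T x a := fun a => by
    constructor <;> intros <;> simp only [hTdef, met_add_left, met_smul_left, form3_add₁,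
      form3_smul₁, smul_eq_mul] <;> ring
  have hT1 : ∀ a, IsLinearMap ℝ (T a) := fun a => by
    constructor <;> intros <;> simp only [hTdef, (hp.met_lin_right _).map_add,
      (hp.met_lin_right _).map_smul, form3_add₂, form3_smul₂, smul_eq_mul] <;> ring
  have hTb : ∀ a m, G2.torsion φ y a m = T (stdVec a) (stdVec m) := fun a m => by
    rw [hT, hTdef]; simp only [met_stdVec]
  have hTu : ∀ a m, T a m = t * dot (u a) (u m) + phi0 ![u τ, u a, u m] := fun a m => by
    rw [hTdef]; simp only [hu, met_pull, fun3_pull]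
  -- In the trace over the frame the skew part `φ(τ, ·, ·)` drops out and `t g` contributes `7t`.
  have h1 : tau1 φ y = t := by
    have := sum_metric_inv u T hT0 hT1
    rw [← hu] at this
    simp only [tau1, hTb]
    rw [this]
    have e : ∀ k, T (G2.frame u k) (G2.frame u k) = t := fun k => by
      rw [hTu, map_frame, dot_stdVec_right, stdVec_apply, (form3_perm phi0 (stdVec k) (u τ) _).1]
      have : phi0 ![stdVec k, u τ, stdVec k] = 0 :=
        phi0.map_eq_zero_of_eq _ (i := 0) (j := 2) rfl (by decide)
      rw [this]; simp
    simp only [e]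
    simp
  -- Contraction with the skew form `x ⌟ φ` kills the part `t g`, while `φ · φ = 6 g` over two
  -- indices matches the normalising factor `1/6`.
  have h2 : ∀ x, tau7 φ y x = dot (u τ) (u x) := by
    intro x
    have hin : ∀ a a', ∑ m, ∑ m', (metric (φ y))⁻¹ m m' * (T (stdVec a) (stdVec m) *
        φ y ![x, stdVec a', stdVec m']) = ∑ l, T (stdVec a) (G2.frame u l) *
          φ y ![x, stdVec a', G2.frame u l] := by
      intro a a'
      have := sum_metric_inv u (fun m m' => T (stdVec a) m * φ y ![x, stdVec a', m'])
        (fun m' => ⟨fun _ _ => by rw [(hT1 _).map_add]; ring, fun _ _ => by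
          rw [(hT1 _).map_smul, smul_eq_mul, smul_eq_mul]; ring⟩)
        (fun m => ⟨fun _ _ => by rw [form3_add₂]; ring, fun _ _ => by
          rw [form3_smul₂, smul_eq_mul]; ring⟩)
      rw [← hu] at this
      exact this
    have hout := sum_metric_inv u (fun a a' => ∑ l, T a (G2.frame u l) * φ y ![x, a', G2.frame u l])
        (fun a' => ⟨fun _ _ => by simp only [(hT0 _).map_add, add_mul, Finset.sum_add_distrib],
          fun _ _ => by simp only [(hT0 _).map_smul, smul_eq_mul, mul_assoc, Finset.mul_sum]⟩)
        (fun a => ⟨fun _ _ => by simp only [form3_add₁, mul_add, Finset.sum_add_distrib],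
          fun _ _ => by simp only [form3_smul₁, smul_eq_mul, mul_left_comm, Finset.mul_sum]⟩)
    rw [← hu] at hout
    simp only [tau7, hTb, hin]
    rw [hout]
    have e : ∀ k l, T (G2.frame u k) (G2.frame u l) * φ y ![x, G2.frame u k, G2.frame u l] =
        t * (delta k l * phi0 ![u x, stdVec k, stdVec l]) +
        phi0 ![u τ, stdVec k, stdVec l] * phi0 ![u x, stdVec k, stdVec l] := fun k l => by
      rw [hTu, hu, fun3_pull]
      simp only [map_frame, dot_stdVec]
      ring
    simp only [e, Finset.sum_add_distrib, ← Finset.mul_sum]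
    rw [phi0_contract]
    have z : ∀ k l : Fin 7, (delta k l : ℝ) * phi0 ![u x, stdVec k, stdVec l] = 0 := by
      intro k l
      by_cases hkl : k = l
      · subst hkl
        have : phi0 ![u x, stdVec k, stdVec k] = 0 :=
          phi0.map_eq_zero_of_eq _ (i := 1) (j := 2) rfl (by decide)
        rw [this, mul_zero]
      · simp [delta, hkl]
    simp only [z]
    simp
  refine ⟨u τ, h2, fun a b c d => ?_, fun a m => ?_⟩
  · have e : X a = u.symm (tau1 φ y • u a + cross (u τ) (u a)) := by
      have hXa : ∀ a m, met (φ y) (X a) (stdVec m) = T a (stdVec m) := fun a m => by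
        refine lin_ext (F := fun a => met (φ y) (X a) (stdVec m)) (G := fun a => T a (stdVec m))
          ?_ (hT0 _) ?_ a
        · constructor <;> intros <;> simp only [map_add, map_smul, met_add_left, met_smul_left,
            smul_eq_mul]
        · intro i
          rw [← hXT, hTb]
      refine hp.met_ext fun m => ?_
      rw [hp.met_comm, hXa, hTu, hp.met_comm, hu, met_pull, LinearEquiv.apply_symm_apply,
        dot_add_left, dot_smul_left, dot_cross, h1]
    rw [← e]
    exact hX a b c d
  · rw [hTb, hTu, h1, hu, ← met_stdVec, met_pull]

/-- The Christoffel part of the derivative disappears under alternation, and the torsion part is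
evaluated in the frame by `alt_psi0_torsion`. -/
theorem LocalW17.d_form (h : LocalW17 φ U) (hy : y ∈ U) (a b c d : E7) :
    alt4 (dForm φ y) a b c d = 4 * tau1 φ y * psi (φ y) ![a, b, c, d] -
      3 * wedge13 (tau7 φ y) (fun3 (φ y)) a b c d := by
  obtain ⟨u, hu⟩ := h.pos y hy
  obtain ⟨θ, hθ, hd, -⟩ := h.exists_frame hy u hu
  have h1 := alt_psi0_torsion (tau1 φ y) θ (u a) (u b) (u c) (u d)
  have h2 := alt_act_symm (φ y) (chr φ y) (chr_symm (h.pos y hy) (h.smooth y hy)) a b c d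
  simp only [alt4, wedge13, hd, hθ, fun3] at h1 h2 ⊢
  have h3 : ∀ x b c d, psi (φ y) ![u.symm x, b, c, d] = psi0 ![x, u b, u c, u d] := by
    intro x b c d
    rw [hu, psi_pull_fun, LinearEquiv.apply_symm_apply]
  have h4 : ∀ a b c d, psi (φ y) ![a, b, c, d] = psi0 ![u a, u b, u c, u d] := by
    intro a b c d
    rw [hu, psi_pull_fun]
  have h5 : ∀ a b c, φ y ![a, b, c] = phi0 ![u a, u b, u c] := by
    intro a b c
    rw [hu, fun3_pull]
  simp only [h3]
  simp only [h4, h5]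
  linarith

/-- Covariantly `∇_a ψ = -T_a ∧ φ`. Under alternation the symmetric part `τ₁ g` of `T` cancels, and
the skew part gives `-2 (τ₇ ⌟ φ) ∧ φ = -4 τ₇ ∧ ψ` by `wedge_contract_phi0`. -/
theorem LocalW17.d_psi (h : LocalW17 φ U) (hy : y ∈ U) (a b c d e : E7) :
    alt5 (dPsi φ y) a b c d e = -4 * wedge14 (tau7 φ y) (fun4 (psi (φ y))) a b c d e := by
  obtain ⟨u, hu⟩ := h.pos y hy
  obtain ⟨θ, hθ, hd, -⟩ := h.exists_frame hy u hu
  have hψ := fun a => dPsi_eq (h.pos y hy) (h.smooth y hy) u hu (hd a)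
  have h1 := wedge_contract_phi0 θ (u a) (u b) (u c) (u d) (u e)
  have h2 := alt_act_symm₄ (psi (φ y)) (chr φ y) (chr_symm (h.pos y hy) (h.smooth y hy)) a b c d e
  have h4 : ∀ a b c d, psi (φ y) ![a, b, c, d] = psi0 ![u a, u b, u c, u d] := by
    intro a b c d
    rw [hu, psi_pull_fun]
  have h5 : ∀ a b c, φ y ![a, b, c] = phi0 ![u a, u b, u c] := by
    intro a b c
    rw [hu, fun3_pull]
  have s : ∀ x y : E7, phi0 ![θ, y, x] = -phi0 ![θ, x, y] := fun x y => (form3_perm phi0 θ x y).2.1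
  simp only [alt5, hψ, wedge13, wedge14, wedge23, fun3, fun4, h5, hθ,
    LinearEquiv.apply_symm_apply, dot_add_left, dot_smul_left, dot_cross, s (u a) (u b),
    s (u a) (u c), s (u a) (u d), s (u a) (u e), s (u b) (u c), s (u b) (u d), s (u b) (u e),
    s (u c) (u d), s (u c) (u e), s (u d) (u e), dot_comm (u b) (u a), dot_comm (u c) (u a),
    dot_comm (u d) (u a), dot_comm (u e) (u a), dot_comm (u c) (u b), dot_comm (u d) (u b),
    dot_comm (u e) (u b), dot_comm (u d) (u c), dot_comm (u e) (u c), dot_comm (u e) (u d)]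
    at h1 h2 ⊢
  rw [h4 b c d e, h4 a c d e, h4 a b d e, h4 a b c e, h4 a b c d]
  linear_combination h2 - 2 * h1

end W17

/-! ### The torsion 1-form is closed -/

section Alternation

variable {ι R : Type*} [CommRing R]

/-- Alternation in the first of six arguments. -/
def alt6 (D : ι → ι → ι → ι → ι → ι → R) (a b c d e f : ι) : R :=
  D a b c d e f - D b a c d e f + D c a b d e f - D d a b c e f + D e a b c d f - D f a b c d e

/-- `d² = 0` for 3-forms: `H` stands for second derivatives, symmetric in their first two arguments.
-/
theorem alt5_alt4 (H : ι → ι → ι → ι → ι → R) (hH : ∀ e a b c d, H e a b c d = H a e b c d)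
    (e a b c d : ι) : alt5 (fun e => alt4 (H e)) e a b c d = 0 := by
  simp only [alt5, alt4]
  rw [hH a e, hH b e, hH c e, hH d e, hH b a, hH c a, hH d a, hH c b, hH d b, hH d c]
  ring

theorem alt6_alt5 (H : ι → ι → ι → ι → ι → ι → R)
    (hH : ∀ e a b c d f, H e a b c d f = H a e b c d f)
    (e a b c d f : ι) : alt6 (fun e => alt5 (H e)) e a b c d f = 0 := by
  simp only [alt6, alt5]
  rw [hH a e, hH b e, hH c e, hH d e, hH b a, hH c a, hH d a, hH c b, hH d b, hH d c, hH f e,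
    hH f a, hH f b, hH f c, hH f d]
  ring

/-- The Leibniz rule `d(τ ∧ P) = dτ ∧ P - τ ∧ dP`, with `T` and `D` in place of the derivatives of
`τ` and `P`. -/
theorem alt5_wedge13 (T : ι → ι → R) (τ : ι → R) (P : ι → ι → ι → R) (D : ι → ι → ι → ι → R)
    (e a b c d : ι) : alt5 (fun e a b c d => wedge13 (T e) P a b c d + wedge13 τ (D e) a b c d)
      e a b c d = wedge23 (fun x y => T x y - T y x) P e a b c d - wedge14 τ (alt4 D) e a b c d := by
  simp only [alt5, alt4, wedge13, wedge23, wedge14]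
  ring

theorem alt6_wedge14 (T : ι → ι → R) (τ : ι → R) (P : ι → ι → ι → ι → R)
    (D : ι → ι → ι → ι → ι → R) (e a b c d f : ι) :
    alt6 (fun e a b c d f => wedge14 (T e) P a b c d f + wedge14 τ (D e) a b c d f) e a b c d f =
      wedge24 (fun x y => T x y - T y x) P e a b c d f -
      (τ e * alt5 D a b c d f - τ a * alt5 D e b c d f + τ b * alt5 D e a c d f -
        τ c * alt5 D e a b d f + τ d * alt5 D e a b c f - τ f * alt5 D e a b c d) := by
  simp only [alt6, alt5, wedge14, wedge24]
  ring

end Alternation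

theorem eq_zero_of_frame (u : E7 ≃ₗ[ℝ] E7) {F : E7 → ℝ} (hF : IsLinearMap ℝ F)
    (h : ∀ i, F (frame u i) = 0) (x : E7) : F x = 0 := by
  have := lin_ext (F := fun x => F (u.symm x)) (G := fun _ => 0)
    ⟨fun _ _ => by rw [map_add, hF.map_add], fun _ _ => by rw [map_smul, hF.map_smul]⟩
    ⟨fun _ _ => by simp, fun _ _ => by simp⟩ h (u x)
  simpa using this

theorem form_frame (u : E7 ≃ₗ[ℝ] E7) (i j k : Fin 7) :
    phi0.compLinearMap u.toLinearMap ![frame u i, frame u j, frame u k] = (phiInt i j k : ℝ) := by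
  rw [fun3_pull, map_frame, map_frame, map_frame, phi0_stdVec]

theorem psi_frame (u : E7 ≃ₗ[ℝ] E7) (i j k l : Fin 7) :
    psi (phi0.compLinearMap u.toLinearMap) ![frame u i, frame u j, frame u k, frame u l] =
      (psiInt i j k l : ℝ) := by
  rw [psi_pull_fun, map_frame, map_frame, map_frame, map_frame, psi0_basis]

section W17

variable {φ : E7 → E7 [⋀^Fin 3]→ₗ[ℝ] ℝ} {U : Set E7} {y : E7}

theorem SmoothAt.fderiv_dForm_symm (hs : SmoothAt φ y) (e a b c d : E7) :
    fderiv ℝ (fun z => dForm φ z a b c d) y e = fderiv ℝ (fun z => dForm φ z e b c d) y a :=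
  fderiv_symm (hs.apply contDiffAt_const contDiffAt_const contDiffAt_const) a e

theorem SmoothAt.fderiv_dPsi_symm (hs : SmoothAt φ y) (hp : IsPositive (φ y)) (e a b c d f : E7) :
    fderiv ℝ (fun z => dPsi φ z a b c d f) y e = fderiv ℝ (fun z => dPsi φ z e b c d f) y a :=
  fderiv_symm (hs.psi hp _) a e

theorem SmoothAt.differentiableAt_dForm (hs : SmoothAt φ y) (a b c d : E7) :
    DifferentiableAt ℝ (fun z => dForm φ z a b c d) y :=
  (contDiffAt_fderiv (hs.apply contDiffAt_const contDiffAt_const contDiffAt_const) a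
    ).differentiableAt (by simp)

theorem SmoothAt.differentiableAt_dPsi (hs : SmoothAt φ y) (hp : IsPositive (φ y))
    (a b c d e : E7) : DifferentiableAt ℝ (fun z => dPsi φ z a b c d e) y :=
  (contDiffAt_fderiv (hs.psi hp _) a).differentiableAt (by simp)

/-- `4 (dτ₁ - τ₁ τ₇) ∧ ψ - 3 dτ₇ ∧ φ = 0`. -/
theorem LocalW17.dd_form (h : LocalW17 φ U) (hy : y ∈ U) (e a b c d : E7) :
    4 * wedge14 (fun x => fderiv ℝ (tau1 φ) y x - tau1 φ y * tau7 φ y x) (fun4 (psi (φ y)))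
      e a b c d - 3 * wedge23 (fun x x' => fderiv ℝ (fun z => tau7 φ z x') y x -
        fderiv ℝ (fun z => tau7 φ z x) y x') (fun3 (φ y)) e a b c d = 0 := by
  have hs := h.smooth y hy
  have hp := h.pos y hy
  have h1 : ∀ e a b c d : E7, alt4 (fun a b c d => fderiv ℝ (fun z => dForm φ z a b c d) y e)
      a b c d = 4 * (fderiv ℝ (tau1 φ) y e * fun4 (psi (φ y)) a b c d +
        tau1 φ y * dPsi φ y e a b c d) -
      3 * (wedge13 (fun x => fderiv ℝ (fun z => tau7 φ z x) y e) (fun3 (φ y)) a b c d +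
        wedge13 (tau7 φ y) (dForm φ y e) a b c d) := by
    intro e a b c d
    rw [← fderiv_alt4 (fun a b c d => hs.differentiableAt_dForm a b c d)]
    have e1 : (fun z => alt4 (dForm φ z) a b c d) =ᶠ[nhds y] fun z =>
        4 * (tau1 φ z * psi (φ z) ![a, b, c, d]) -
        3 * wedge13 (tau7 φ z) (fun3 (φ z)) a b c d := by
      filter_upwards [h.isOpen.mem_nhds hy] with z hz
      rw [h.d_form hz]; ring
    have d1 : DifferentiableAt ℝ (tau1 φ) y := (h.smooth_tau1 hy).differentiableAt (by simp)
    have d2 : DifferentiableAt ℝ (fun z => psi (φ z) ![a, b, c, d]) y :=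
      (hs.psi hp _).differentiableAt (by simp)
    have d3 : ∀ x, DifferentiableAt ℝ (fun z => tau7 φ z x) y := fun x =>
      (h.smooth_tau7 hy x).differentiableAt (by simp)
    have d4 : ∀ x₁ x₂ x₃, DifferentiableAt ℝ (fun z => fun3 (φ z) x₁ x₂ x₃) y := fun _ _ _ =>
      hs.differentiableAt _
    have d5 : DifferentiableAt ℝ (fun z => wedge13 (tau7 φ z) (fun3 (φ z)) a b c d) y :=
      ((((d3 a).mul (d4 b c d)).sub ((d3 b).mul (d4 a c d))).add ((d3 c).mul (d4 a b d))).sub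
        ((d3 d).mul (d4 a b c))
    rw [e1.fderiv_eq, fderiv_fun_sub ((d1.fun_mul d2).const_mul 4) (d5.const_mul 3),
      fderiv_const_mul (d1.fun_mul d2), fderiv_const_mul d5, fderiv_fun_mul d1 d2]
    simp only [sub_apply, smul_apply,
      add_apply, smul_eq_mul]
    rw [fderiv_wedge13 d3 d4]
    have e2 : (fun x₁ x₂ x₃ => fderiv ℝ (fun z => fun3 (φ z) x₁ x₂ x₃) y e) = dForm φ y e := rfl
    rw [e2]
    simp only [dPsi, fun4]
    ring
  have h2 := alt5_alt4 (fun e a b c d => fderiv ℝ (fun z => dForm φ z a b c d) y e)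
    (fun e a b c d => hs.fderiv_dForm_symm e a b c d) e a b c d
  have h3 := alt5_wedge13 (fun e x => fderiv ℝ (fun z => tau7 φ z x) y e) (tau7 φ y)
    (fun3 (φ y)) (dForm φ y) e a b c d
  have h4 := h.d_psi hy e a b c d
  simp only [alt5, wedge14, wedge23, h1, h.d_form hy, wedge13, fun4] at h2 h3 h4 ⊢
  -- In `d(4τ₁ψ - 3τ₇ ∧ φ) = 0` the term `4τ₁ dψ` contributes `-16 τ₁τ₇ ∧ ψ` and `3τ₇ ∧ dφ`
  -- contributes `12 τ₁τ₇ ∧ ψ`. The difference is the `-4 τ₁τ₇ ∧ ψ` of the statement.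
  linear_combination h2 + 3 * h3 - 4 * tau1 φ y * h4

/-- `dτ₇ ∧ ψ = 0`. -/
theorem LocalW17.dd_psi (h : LocalW17 φ U) (hy : y ∈ U) (e a b c d f : E7) :
    wedge24 (fun x x' => fderiv ℝ (fun z => tau7 φ z x') y x -
      fderiv ℝ (fun z => tau7 φ z x) y x') (fun4 (psi (φ y))) e a b c d f = 0 := by
  have hs := h.smooth y hy
  have hp := h.pos y hy
  have h1 : ∀ e a b c d f : E7, alt5 (fun a b c d f => fderiv ℝ (fun z => dPsi φ z a b c d f) y e)
      a b c d f =
      -4 * (wedge14 (fun x => fderiv ℝ (fun z => tau7 φ z x) y e) (fun4 (psi (φ y))) a b c d f +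
        wedge14 (tau7 φ y) (dPsi φ y e) a b c d f) := by
    intro e a b c d f
    rw [← fderiv_alt5 (fun a b c d f => hs.differentiableAt_dPsi hp a b c d f)]
    have e1 : (fun z => alt5 (dPsi φ z) a b c d f) =ᶠ[nhds y] fun z =>
        -4 * wedge14 (tau7 φ z) (fun4 (psi (φ z))) a b c d f := by
      filter_upwards [h.isOpen.mem_nhds hy] with z hz
      rw [h.d_psi hz]
    have d3 : ∀ x, DifferentiableAt ℝ (fun z => tau7 φ z x) y := fun x =>
      (h.smooth_tau7 hy x).differentiableAt (by simp)
    have d4 : ∀ x₁ x₂ x₃ x₄, DifferentiableAt ℝ (fun z => fun4 (psi (φ z)) x₁ x₂ x₃ x₄) y :=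
      fun _ _ _ _ => (hs.psi hp _).differentiableAt (by simp)
    have d5 : DifferentiableAt ℝ (fun z => wedge14 (tau7 φ z) (fun4 (psi (φ z))) a b c d f) y :=
      (((((d3 a).mul (d4 b c d f)).sub ((d3 b).mul (d4 a c d f))).add
        ((d3 c).mul (d4 a b d f))).sub ((d3 d).mul (d4 a b c f))).add ((d3 f).mul (d4 a b c d))
    rw [e1.fderiv_eq, fderiv_const_mul d5]
    simp only [smul_apply, smul_eq_mul]
    rw [fderiv_wedge14 d3 d4]
    rfl
  have h2 := alt6_alt5 (fun e a b c d f => fderiv ℝ (fun z => dPsi φ z a b c d f) y e)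
    (fun e a b c d f => hs.fderiv_dPsi_symm hp e a b c d f) e a b c d f
  have h3 := alt6_wedge14 (fun e x => fderiv ℝ (fun z => tau7 φ z x) y e) (tau7 φ y)
    (fun4 (psi (φ y))) (dPsi φ y) e a b c d f
  simp only [alt6, h1, h.d_psi hy] at h2 h3
  have h5 : wedge24 (fun x x' => fderiv ℝ (fun z => tau7 φ z x') y x -
      fderiv ℝ (fun z => tau7 φ z x) y x') (fun4 (psi (φ y))) e a b c d f =
      tau7 φ y e * (-4 * wedge14 (tau7 φ y) (fun4 (psi (φ y))) a b c d f) -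
      tau7 φ y a * (-4 * wedge14 (tau7 φ y) (fun4 (psi (φ y))) e b c d f) +
      tau7 φ y b * (-4 * wedge14 (tau7 φ y) (fun4 (psi (φ y))) e a c d f) -
      tau7 φ y c * (-4 * wedge14 (tau7 φ y) (fun4 (psi (φ y))) e a b d f) +
      tau7 φ y d * (-4 * wedge14 (tau7 φ y) (fun4 (psi (φ y))) e a b c f) -
      tau7 φ y f * (-4 * wedge14 (tau7 φ y) (fun4 (psi (φ y))) e a b c d) := by
    linarith
  -- What remains is a multiple of `τ₇ ∧ τ₇ ∧ ψ`, which cancels identically.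
  rw [h5]
  simp only [wedge14]
  ring

/-- `dτ₇ = 0` and `dτ₁ = τ₁ τ₇`. -/
theorem LocalW17.closed (h : LocalW17 φ U) (hy : y ∈ U) :
    (∀ a b, fderiv ℝ (fun z => tau7 φ z b) y a = fderiv ℝ (fun z => tau7 φ z a) y b) ∧
      ∀ a, fderiv ℝ (tau1 φ) y a = tau1 φ y * tau7 φ y a := by
  obtain ⟨u, hu⟩ := h.pos y hy
  have hl : ∀ a, IsLinearMap ℝ fun b => fderiv ℝ (fun z => tau7 φ z b) y a := by
    have d3 : ∀ x, DifferentiableAt ℝ (fun z => tau7 φ z x) y := fun x =>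
      (h.smooth_tau7 hy x).differentiableAt (by simp)
    intro a
    constructor
    · intro b c
      simp only [(tau7_lin φ _).map_add]
      rw [fderiv_fun_add (d3 b) (d3 c)]; rfl
    · intro r b
      simp only [(tau7_lin φ _).map_smul, smul_eq_mul]
      rw [fderiv_const_mul (d3 b)]; rfl
  -- On the frame `φ` and `ψ` have the integer components of the model, so `dd_form` and `dd_psi`
  -- become the linear system solved in `eq_zero_of_wedge`.
  have key := eq_zero_of_wedge
    (fun i => fderiv ℝ (tau1 φ) y (frame u i) - tau1 φ y * tau7 φ y (frame u i))
    (fun i j => fderiv ℝ (fun z => tau7 φ z (frame u j)) y (frame u i) -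
      fderiv ℝ (fun z => tau7 φ z (frame u i)) y (frame u j))
    (fun i j => by ring)
    (fun i j k l m => by
      have := h.dd_form hy (frame u i) (frame u j) (frame u k) (frame u l) (frame u m)
      simpa only [wedge14, wedge23, fun3, fun4, hu, form_frame, psi_frame] using this)
    (fun i j k l m n => by
      have := h.dd_psi hy (frame u i) (frame u j) (frame u k) (frame u l) (frame u m) (frame u n)
      simpa only [wedge24, fun3, fun4, hu, form_frame, psi_frame] using this)
  constructor
  · intro a b
    rw [← sub_eq_zero]
    refine eq_zero_of_frame u (F := fun a => fderiv ℝ (fun z => tau7 φ z b) y a -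
      fderiv ℝ (fun z => tau7 φ z a) y b) ?_ (fun i => ?_) a
    · exact ⟨fun _ _ => by simp only [map_add, (hl b).map_add]; ring,
        fun _ _ => by simp only [map_smul, (hl b).map_smul, smul_eq_mul]; ring⟩
    refine eq_zero_of_frame u (F := fun b => fderiv ℝ (fun z => tau7 φ z b) y (frame u i) -
      fderiv ℝ (fun z => tau7 φ z (frame u i)) y b) ?_ (fun j => ?_) b
    · exact ⟨fun _ _ => by simp only [map_add, (hl (frame u i)).map_add]; ring,
        fun _ _ => by simp only [map_smul, (hl (frame u i)).map_smul, smul_eq_mul]; ring⟩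
    exact key.1 i j
  · intro a
    rw [← sub_eq_zero]
    refine eq_zero_of_frame u (F := fun a => fderiv ℝ (tau1 φ) y a - tau1 φ y * tau7 φ y a)
      ?_ key.2 a
    exact ⟨fun _ _ => by simp only [map_add, (tau7_lin φ y).map_add]; ring,
      fun _ _ => by simp only [map_smul, (tau7_lin φ y).map_smul, smul_eq_mul]; ring⟩

end W17

/-! ### The pointwise algebra of the deformation `φ + v ⌟ ψ` -/

/-- `p + qi` is a complex cube root of `1 + ti`. -/
theorem exists_cube_root (t : ℝ) : ∃ p q : ℝ, p ^ 3 - 3 * p * q ^ 2 = 1 ∧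
    3 * p ^ 2 * q - q ^ 3 = t := by
  obtain ⟨z, hz⟩ := IsAlgClosed.exists_pow_nat_eq (⟨1, t⟩ : ℂ) (n := 3) (by norm_num)
  refine ⟨z.re, z.im, ?_, ?_⟩
  · have := congrArg Complex.re hz
    simp only [pow_succ, pow_zero, one_mul, Complex.mul_re, Complex.mul_im] at this
    linarith
  · have := congrArg Complex.im hz
    simp only [pow_succ, pow_zero, one_mul, Complex.mul_re, Complex.mul_im] at this
    linarith

theorem twist_injective {r p q : ℝ} (hr : r ≠ 0) (hpq : p ^ 2 + q ^ 2 ≠ 0) :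
    Function.Injective (twist r p q) := by
  rw [← LinearMap.ker_eq_bot, LinearMap.ker_eq_bot']
  intro x hx
  have h : ∀ m, twist r p q x m = 0 := fun m => by rw [hx]; rfl
  simp only [twist_apply] at h
  have key : ∀ a b : ℝ, p * a - q * b = 0 → q * a + p * b = 0 → a = 0 ∧ b = 0 := by
    intro a b h1 h2
    constructor
    · refine (mul_eq_zero.mp ?_).resolve_left hpq
      linear_combination p * h1 + q * h2
    · refine (mul_eq_zero.mp ?_).resolve_left hpq
      linear_combination p * h2 - q * h1
  have h0 := (mul_eq_zero.mp (h 0)).resolve_left hr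
  have h1 := key _ _ (h 1) (h 2)
  have h2 := key _ _ (h 3) (h 4)
  have h3 := key _ _ (h 5) (h 6)
  ext m
  fin_cases m
  exacts [h0, h1.1, h1.2, h2.1, h2.2, h3.1, h3.2]

section Metric

variable {φ : E7 [⋀^Fin 3]→ₗ[ℝ] ℝ}

theorem IsPositive.met_self_nonneg (h : IsPositive φ) (x : E7) : 0 ≤ met φ x x := by
  obtain ⟨u, rfl⟩ := h
  rw [met_pull]
  exact dot_self_nonneg _

theorem IsPositive.met_self_eq_zero (h : IsPositive φ) {x : E7} (hx : met φ x x = 0) : x = 0 := by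
  obtain ⟨u, rfl⟩ := h
  rw [met_pull] at hx
  exact (map_eq_zero_iff u u.injective).mp (dot_self_eq_zero hx)

/-- The function `(1 + |v|²)^{1/3}`. -/
def nu (φ : E7 [⋀^Fin 3]→ₗ[ℝ] ℝ) (v : E7) : ℝ := (1 + met φ v v) ^ (1 / 3 : ℝ)

/-- The 1-form `(1 + |v|²)^{-1/3} v`. -/
def xi (φ : E7 [⋀^Fin 3]→ₗ[ℝ] ℝ) (v a : E7) : ℝ := (nu φ v)⁻¹ * met φ v a

theorem IsPositive.nu_pos (h : IsPositive φ) (v : E7) : 0 < nu φ v :=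
  Real.rpow_pos_of_pos (by linarith [h.met_self_nonneg v]) _

theorem IsPositive.nu_pow (h : IsPositive φ) (v : E7) : nu φ v ^ 3 = 1 + met φ v v := by
  rw [nu, ← Real.rpow_natCast, ← Real.rpow_mul (by linarith [h.met_self_nonneg v])]
  norm_num

theorem deformForm_apply (φ : E7 [⋀^Fin 3]→ₗ[ℝ] ℝ) (v a b c : E7) :
    deformForm φ v ![a, b, c] = φ ![a, b, c] + psi φ ![v, a, b, c] := rfl

/-- The deformed form is positive, and `ν² ψ = ψ̃ + ξ ∧ φ̃`. -/
theorem IsPositive.deform (h : IsPositive φ) (v : E7) : IsPositive (deformForm φ v) ∧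
    ∀ a b c d, nu φ v ^ 2 * psi φ ![a, b, c, d] = psi (deformForm φ v) ![a, b, c, d] +
      wedge13 (xi φ v) (fun3 (deformForm φ v)) a b c d := by
  have hν := h.nu_pos v
  have hν3 := h.nu_pow v
  set ν := nu φ v with hνdef
  obtain ⟨u, t, hu, hv⟩ := h.exists_frame v
  have hM : met φ v v = t ^ 2 := by
    rw [hu, met_pull, hv, dot_smul_left, dot_smul_right, dot_stdVec]
    simp [delta]
    ring
  rw [hM] at hν3
  obtain ⟨p, q, hp, hq⟩ := exists_cube_root t
  -- Taking squared moduli in `(p + qi)³ = 1 + ti` gives `(p² + q²)³ = 1 + t² = ν³`.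
  have hpq : p ^ 2 + q ^ 2 = ν := by
    refine (pow_left_inj₀ (by positivity) hν.le (three_ne_zero)).mp ?_
    rw [hν3, ← hq]
    linear_combination (p ^ 3 - 3 * p * q ^ 2 + 1) * hp
  have hinj : Function.Injective (twist ν⁻¹ p q) :=
    twist_injective (inv_ne_zero hν.ne') (by rw [hpq]; exact hν.ne')
  let e : E7 ≃ₗ[ℝ] E7 := u.trans (LinearEquiv.ofInjectiveEndo _ hinj)
  have he : ∀ x, e x = twist ν⁻¹ p q (u x) := fun x => rfl
  have h3 := phi0_twist (r := ν⁻¹) (by rw [hpq]; exact inv_mul_cancel₀ hν.ne') hp hq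
  have hdef : deformForm φ v = phi0.compLinearMap e.toLinearMap := by
    refine ext_three fun x y z => ?_
    have := congrArg (fun α : E7 [⋀^Fin 3]→ₗ[ℝ] ℝ => α ![u x, u y, u z]) h3
    simp only [pull_apply] at this
    rw [fun3_pull, he, he, he, this, deformForm_apply, hu, fun3_pull, psi_pull_fun, hv]
    rfl
  let ξ : E7 →ₗ[ℝ] ℝ := (IsLinearMap.mk' (fun x : E7 => ν⁻¹ * t * x 0)
    ⟨fun x y => by simp only [PiLp.add_apply]; ring,
      fun c x => by simp only [PiLp.smul_apply, smul_eq_mul]; ring⟩)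
  have h4 := psi0_twist hν hν3 hpq hp hq ξ fun x => rfl
  refine ⟨⟨e, hdef⟩, fun a b c d => ?_⟩
  have h5 := congrArg (fun α : E7 [⋀^Fin 4]→ₗ[ℝ] ℝ => α ![u a, u b, u c, u d]) h4
  simp only [AlternatingMap.smul_apply, AlternatingMap.add_apply, smul_eq_mul, pull_apply₄,
    wedge1_apply₃] at h5
  have h6 : ∀ x, xi φ v x = ξ (u x) := fun x => by
    change ν⁻¹ * met φ v x = ν⁻¹ * t * (u x) 0
    rw [hu, met_pull, hv, dot_smul_left, dot_stdVec_left, mul_assoc]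
  have h7 : ∀ x y z, fun3 (deformForm φ v) x y z =
      fun3 (phi0.compLinearMap (twist ν⁻¹ p q)) (u x) (u y) (u z) := fun x y z => by
    rw [hdef, fun3, fun3, fun3_pull, pull_apply]
    rfl
  have h8 : psi φ ![a, b, c, d] = psi0 ![u a, u b, u c, u d] := by rw [hu, psi_pull_fun]
  rw [h8, h5, hdef, psi_pull_fun, he, he, he, he, ← hdef]
  simp only [wedge13, h6, h7]

end Metric

/-! ### Differentiation along vector fields -/

section VectorFields

variable {φ : E7 → E7 [⋀^Fin 3]→ₗ[ℝ] ℝ} {y : E7} {v w : E7 → E7}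

theorem fderiv_coord (hv : DifferentiableAt ℝ v y) (a : E7) (i : Fin 7) :
    fderiv ℝ (fun z => v z i) y a = fderiv ℝ v y a i := by
  have h : HasFDerivAt (fun z => v z i) ((EuclideanSpace.proj (𝕜 := ℝ) i : E7 →L[ℝ] ℝ) ∘L
      fderiv ℝ v y) y :=
    (EuclideanSpace.proj (𝕜 := ℝ) i : E7 →L[ℝ] ℝ).hasFDerivAt.comp y hv.hasFDerivAt
  rw [h.fderiv]
  rfl

/-- The product rule for a linear function depending on a point, applied to a vector field. -/
theorem fderiv_lin_apply {L : E7 → E7 → ℝ} (hL : ∀ z, IsLinearMap ℝ (L z))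
    (hd : ∀ i, DifferentiableAt ℝ (fun z => L z (stdVec i)) y) (hv : DifferentiableAt ℝ v y)
    (a : E7) : fderiv ℝ (fun z => L z (v z)) y a =
      fderiv ℝ (fun z => L z (v y)) y a + L y (fderiv ℝ v y a) := by
  have hv' : ∀ i, DifferentiableAt ℝ (fun z => v z i) y := fun i =>
    (EuclideanSpace.proj (𝕜 := ℝ) i : E7 →L[ℝ] ℝ).differentiableAt.comp y hv
  have e1 : (fun z => L z (v z)) = fun z => ∑ i, v z i * L z (stdVec i) :=
    funext fun z => lin_eq_sum (hL z) _
  have e2 : (fun z => L z (v y)) = fun z => ∑ i, v y i * L z (stdVec i) :=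
    funext fun z => lin_eq_sum (hL z) _
  rw [e1, e2, lin_eq_sum (hL y) (fderiv ℝ v y a),
    fderiv_fun_sum fun i _ => (hv' i).fun_mul (hd i),
    fderiv_fun_sum fun i _ => (differentiableAt_const _).fun_mul (hd i)]
  simp only [sum_apply]
  rw [← Finset.sum_add_distrib]
  refine Finset.sum_congr rfl fun i _ => ?_
  rw [fderiv_fun_mul (hv' i) (hd i), fderiv_const_mul (hd i)]
  simp only [add_apply, smul_apply, smul_eq_mul, fderiv_coord hv]
  ring

theorem contDiffAt_lin_apply {L : E7 → E7 → ℝ} (hL : ∀ z, IsLinearMap ℝ (L z))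
    (hd : ∀ i, ContDiffAt ℝ ∞ (fun z => L z (stdVec i)) y) (hv : ContDiffAt ℝ ∞ v y) :
    ContDiffAt ℝ ∞ (fun z => L z (v z)) y := by
  have e1 : (fun z => L z (v z)) = fun z => ∑ i, v z i * L z (stdVec i) :=
    funext fun z => lin_eq_sum (hL z) _
  rw [e1]
  exact ContDiffAt.sum fun i _ => (contDiffAt_coord hv i).mul (hd i)

theorem SmoothAt.met (hs : SmoothAt φ y) (hp : IsPositive (φ y)) (hv : ContDiffAt ℝ ∞ v y)
    (hw : ContDiffAt ℝ ∞ w y) : ContDiffAt ℝ ∞ (fun z => G2.met (φ z) (v z) (w z)) y :=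
  ContDiffAt.sum fun i _ => ContDiffAt.sum fun j _ =>
    ((hs.metric hp i j).mul (contDiffAt_coord hv i)).mul (contDiffAt_coord hw j)

theorem SmoothAt.deform (hs : SmoothAt φ y) (hp : IsPositive (φ y)) (hv : ContDiffAt ℝ ∞ v y) :
    SmoothAt (fun z => deformForm (φ z) (v z)) y := fun i j k =>
  (hs i j k).add (contDiffAt_lin_apply (L := fun z w => G2.psi (φ z) ![w, stdVec i, stdVec j, stdVec k])
    (fun z => lin4₀ _ _ _ _) (fun l => hs.psi hp _) hv)

theorem SmoothAt.nu (hs : SmoothAt φ y) (hp : IsPositive (φ y)) (hv : ContDiffAt ℝ ∞ v y) :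
    ContDiffAt ℝ ∞ (fun z => G2.nu (φ z) (v z)) y :=
  (contDiffAt_const.add (hs.met hp hv hv)).rpow_const_of_ne
    (by linarith [hp.met_self_nonneg (v y)] : (0 : ℝ) < 1 + G2.met (φ y) (v y) (v y)).ne'

theorem SmoothAt.xi (hs : SmoothAt φ y) (hp : IsPositive (φ y)) (hv : ContDiffAt ℝ ∞ v y)
    (hw : ContDiffAt ℝ ∞ w y) : ContDiffAt ℝ ∞ (fun z => G2.xi (φ z) (v z) (w z)) y :=
  ((hs.nu hp hv).inv (hp.nu_pos _).ne').mul (hs.met hp hv hw)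

/-- The Levi-Civita connection is metric. -/
theorem fderiv_met_const (hs : SmoothAt φ y) (hp : IsPositive (φ y)) (a b c : E7) :
    fderiv ℝ (fun z => met (φ z) b c) y a =
      met (φ y) (chr φ y a b) c + met (φ y) b (chr φ y a c) := by
  have hd : ∀ i j, DifferentiableAt ℝ (fun z => metric (φ z) i j) y := fun i j =>
    (hs.metric hp i j).differentiableAt (by simp)
  have h1 : ∀ a i j : Fin 7, fderiv ℝ (fun z => metric (φ z) i j) y (stdVec a) =
      met (φ y) (chr φ y (stdVec a) (stdVec i)) (stdVec j) +
      met (φ y) (stdVec i) (chr φ y (stdVec a) (stdVec j)) := by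
    intro a i j
    rw [hp.met_comm, met_chr hp, met_chr hp, ← pd]
    linarith [pd_metric_symm hp hs a i j, pd_metric_symm hp hs i j a, pd_metric_symm hp hs j a i]
  have hl : ∀ b c, DifferentiableAt ℝ (fun z => met (φ z) b c) y := fun b c =>
    (hs.met hp contDiffAt_const contDiffAt_const).differentiableAt (by simp)
  refine lin_ext (F := fun a => fderiv ℝ (fun z => met (φ z) b c) y a) (G := fun a =>
    met (φ y) (chr φ y a b) c + met (φ y) b (chr φ y a c)) ?_ ?_ ?_ a
  · constructor <;> intros <;> simp
  · constructor <;> intros <;> simp only [chr_add, chr_smul, met_add_left, met_smul_left,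
      (hp.met_lin_right _).map_add, (hp.met_lin_right _).map_smul, smul_eq_mul] <;> ring
  intro a
  have e : (fun z => met (φ z) b c) = fun z => ∑ i, ∑ j, b i * c j * metric (φ z) i j := by
    ext z
    exact Finset.sum_congr rfl fun i _ => Finset.sum_congr rfl fun j _ => by ring
  have h2 : ∀ G : E7 →ₗ[ℝ] E7, met (φ y) (G b) c + met (φ y) b (G c) = ∑ i, ∑ j, b i * c j *
      (met (φ y) (G (stdVec i)) (stdVec j) + met (φ y) (stdVec i) (G (stdVec j))) := by
    intro G
    have k1 : ∀ b, IsLinearMap ℝ fun c => met (φ y) (G b) c + met (φ y) b (G c) := fun b => by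
      constructor <;> intros <;> simp only [map_add, map_smul, (hp.met_lin_right _).map_add,
        (hp.met_lin_right _).map_smul, smul_eq_mul] <;> ring
    have k2 : ∀ c, IsLinearMap ℝ fun b => met (φ y) (G b) c + met (φ y) b (G c) := fun b => by
      constructor <;> intros <;> simp only [map_add, map_smul, met_add_left, met_smul_left,
        smul_eq_mul] <;> ring
    rw [lin_eq_sum (k2 c) b]
    refine Finset.sum_congr rfl fun i _ => ?_
    rw [lin_eq_sum (k1 _) c, Finset.mul_sum]
    exact Finset.sum_congr rfl fun j _ => by ring
  rw [e, h2, fderiv_fun_sum fun i _ => DifferentiableAt.fun_sum fun j _ => (hd i j).const_mul _]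
  simp only [sum_apply]
  refine Finset.sum_congr rfl fun i _ => ?_
  rw [fderiv_fun_sum fun j _ => (hd i j).const_mul _]
  simp only [sum_apply]
  refine Finset.sum_congr rfl fun j _ => ?_
  rw [fderiv_const_mul (hd i j), smul_apply, smul_eq_mul, h1]

theorem met_linear (φ : E7 [⋀^Fin 3]→ₗ[ℝ] ℝ) (x : E7) : IsLinearMap ℝ (met φ x) :=
  ⟨fun x x' => by simp only [met, PiLp.add_apply, mul_add, Finset.sum_add_distrib], fun c x => by
    simp only [met, PiLp.smul_apply, smul_eq_mul, Finset.mul_sum]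
    exact Finset.sum_congr rfl fun _ _ => Finset.sum_congr rfl fun _ _ => by ring⟩

theorem fderiv_met (hs : SmoothAt φ y) (hp0 : IsPositive (φ y))
    (hv : ContDiffAt ℝ ∞ v y) (hw : ContDiffAt ℝ ∞ w y) (a : E7) :
    fderiv ℝ (fun z => met (φ z) (v z) (w z)) y a =
      met (φ y) (fderiv ℝ v y a + chr φ y a (v y)) (w y) +
      met (φ y) (v y) (fderiv ℝ w y a + chr φ y a (w y)) := by
  have hdv := hv.differentiableAt (n := ∞) (by simp)
  have hdw := hw.differentiableAt (n := ∞) (by simp)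
  have h1 := fderiv_lin_apply (L := fun z x => met (φ z) x (w z)) (y := y)
    (fun z => met_lin_left _ _)
    (fun i => (hs.met hp0 contDiffAt_const hw).differentiableAt (by simp)) hdv a
  have h2 := fderiv_lin_apply (L := fun z x => met (φ z) (v y) x) (y := y)
    (fun z => met_linear _ _)
    (fun i => (hs.met hp0 contDiffAt_const contDiffAt_const).differentiableAt (by simp)) hdw a
  rw [h1, h2, fderiv_met_const hs hp0]
  simp only [met_add_left, (hp0.met_lin_right _).map_add]
  ring

/-- The vector dual to a 1-form with respect to the metric of a 3-form. -/
def sharp (φ : E7 [⋀^Fin 3]→ₗ[ℝ] ℝ) (τ : E7 → ℝ) : E7 :=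
  WithLp.toLp 2 fun i => ∑ j, (metric φ)⁻¹ i j * τ (stdVec j)

theorem IsPositive.met_sharp {φ : E7 [⋀^Fin 3]→ₗ[ℝ] ℝ} (hp : IsPositive φ) {τ : E7 → ℝ}
    (hτ : IsLinearMap ℝ τ) (x : E7) : met φ (sharp φ τ) x = τ x := by
  refine lin_ext (F := met φ (sharp φ τ)) (hp.met_lin_right _) hτ (fun k => ?_) x
  rw [hp.met_comm, lin_eq_sum (hp.met_lin_right (stdVec k))]
  simp only [met_stdVec, sharp]
  have : ∑ a, (∑ j, (metric φ)⁻¹ a j * τ (stdVec j)) * metric φ k a =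
      ∑ j, (metric φ * (metric φ)⁻¹) k j * τ (stdVec j) := by
    simp only [Matrix.mul_apply, Finset.sum_mul]
    rw [Finset.sum_comm]
    exact Finset.sum_congr rfl fun _ _ => Finset.sum_congr rfl fun _ _ => by ring
  rw [this, Matrix.mul_nonsing_inv _ hp.metric_det]
  simp [Matrix.one_apply]

theorem SmoothAt.sharp (hs : SmoothAt φ y) (hp : IsPositive (φ y)) {τ : E7 → E7 → ℝ}
    (hτ : ∀ x, ContDiffAt ℝ ∞ (fun z => τ z x) y) :
    ContDiffAt ℝ ∞ (fun z => G2.sharp (φ z) (τ z)) y := by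
  rw [contDiffAt_euclidean]
  intro i
  have : (fun z => G2.sharp (φ z) (τ z) i) =
    fun z => ∑ j, (G2.metric (φ z))⁻¹ i j * τ z (stdVec j) := rfl
  rw [this]
  exact ContDiffAt.sum fun j _ => (hs.metric_inv hp i j).mul (hτ _)

end VectorFields

/-! ### The 1-form `κ` of a torsion-free deformation -/

theorem IsPositive.eq_zero_of_act_symm {φ : E7 [⋀^Fin 3]→ₗ[ℝ] ℝ} (hp : IsPositive φ)
    (S : E7 →ₗ[ℝ] E7) (hS : ∀ x y, met φ (S x) y = met φ x (S y))
    (h : ∀ a b c, act S φ ![a, b, c] = 0) : S = 0 := by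
  obtain ⟨u, rfl⟩ := hp
  have h1 := act_conj u (u.toLinearMap ∘ₗ S ∘ₗ u.symm.toLinearMap)
  have h2 : u.symm.toLinearMap ∘ₗ (u.toLinearMap ∘ₗ S ∘ₗ u.symm.toLinearMap) ∘ₗ u.toLinearMap =
      S := by
    ext x; simp
  rw [h2] at h1
  have h3 := G2.eq_zero_of_act_symm (u.toLinearMap ∘ₗ S ∘ₗ u.symm.toLinearMap) (fun x y => by
    have := hS (u.symm x) (u.symm y)
    simpa [met_pull] using this) (ext_three fun x y z => by
      have h4 := h (u.symm x) (u.symm y) (u.symm z)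
      rw [h1, pull_apply] at h4
      simpa using h4)
  ext1 x
  have h5 := congrArg (fun l : E7 →ₗ[ℝ] E7 => l (u x)) h3
  simpa using h5

/-! ### Torsion-free forms and their 4-forms are closed -/

section TorsionFree

variable {φ : E7 → E7 [⋀^Fin 3]→ₗ[ℝ] ℝ} {y : E7}

theorem dForm_eq_act (hp : IsPositive (φ y)) (hs : SmoothAt φ y)
    (hT : ∀ a m, torsion φ y a m = 0) (a b c d : E7) :
    dForm φ y a b c d = act (chr φ y a) (φ y) ![b, c, d] := by
  obtain ⟨X, hX, hXT⟩ := exists_torsion hp hs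
  have h0 : ∀ i, X (stdVec i) = 0 := fun i => hp.met_ext fun d => by
    rw [hp.met_comm, ← hXT, hT, (hp.met_lin_right _).map_zero]
  have h1 : X a = 0 := by
    ext m
    exact lin_ext (F := fun a => X a m) (G := fun _ => 0)
      ⟨fun _ _ => by simp, fun _ _ => by simp⟩ ⟨fun _ _ => by simp, fun _ _ => by simp⟩
      (fun i => by rw [h0]; rfl) a
  rw [dForm, hX, h1, (lin4₀ _ _ _ _).map_zero, add_zero]

theorem alt_dForm_eq_zero (hp : IsPositive (φ y)) (hs : SmoothAt φ y)
    (hT : ∀ a m, torsion φ y a m = 0) (a b c d : E7) : alt4 (dForm φ y) a b c d = 0 := by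
  rw [← alt_act_symm (φ y) (chr φ y) (chr_symm hp hs) a b c d]
  simp only [alt4, dForm_eq_act hp hs hT]

theorem alt_dPsi_eq_zero (hp : IsPositive (φ y)) (hs : SmoothAt φ y)
    (hT : ∀ a m, torsion φ y a m = 0) (a b c d e : E7) : alt5 (dPsi φ y) a b c d e = 0 := by
  rw [← alt_act_symm₄ (psi (φ y)) (chr φ y) (chr_symm hp hs) a b c d e]
  have h : ∀ a b c d e, dPsi φ y a b c d e = _ := fun a b c d e =>
    fderiv_psi hp (fun i j k => hs.differentiableAt _)
      (fun i j k => dForm_eq_act hp hs hT a _ _ _) b c d e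
  simp only [alt5, h]

end TorsionFree

/-- The deformation of a field of 3-forms by a vector field. -/
def deformField (φ : E7 → E7 [⋀^Fin 3]→ₗ[ℝ] ℝ) (v : E7 → E7) (z : E7) : E7 [⋀^Fin 3]→ₗ[ℝ] ℝ :=
  deformForm (φ z) (v z)

/-- A torsion-free deformation of a local `G₂`-structure with `T ∈ W₁ ⊕ W₇`. -/
structure LocalDeform (φ : E7 → E7 [⋀^Fin 3]→ₗ[ℝ] ℝ) (v : E7 → E7) (U : Set E7) : Prop
    extends LocalW17 φ U where
  smooth_vec : ∀ y ∈ U, ContDiffAt ℝ ∞ v y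
  torsion_deform : ∀ y ∈ U, ∀ a m, G2.torsion (deformField φ v) y a m = 0

/-- The partial derivatives of the 1-form `ξ`. -/
def dXi (φ : E7 → E7 [⋀^Fin 3]→ₗ[ℝ] ℝ) (v : E7 → E7) (y a b : E7) : ℝ :=
  fderiv ℝ (fun z => xi (φ z) (v z) b) y a

/-- The partial derivatives of `ν`. -/
def dNu (φ : E7 → E7 [⋀^Fin 3]→ₗ[ℝ] ℝ) (v : E7 → E7) (y a : E7) : ℝ :=
  fderiv ℝ (fun z => nu (φ z) (v z)) y a

/-- The 1-form `κ = 2 d(log ν) - 4 τ₇`. -/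
def kappa (φ : E7 → E7 [⋀^Fin 3]→ₗ[ℝ] ℝ) (v : E7 → E7) (y a : E7) : ℝ :=
  2 * ((nu (φ y) (v y))⁻¹ * dNu φ v y a) - 4 * tau7 φ y a

/-- The vector field dual to `κ` with respect to the deformed metric. -/
def kappaVec (φ : E7 → E7 [⋀^Fin 3]→ₗ[ℝ] ℝ) (v : E7 → E7) (y : E7) : E7 :=
  sharp (deformField φ v y) (kappa φ v y)

/-- The squared norm of `κ` with respect to the deformed metric. -/
def kappaSq (φ : E7 → E7 [⋀^Fin 3]→ₗ[ℝ] ℝ) (v : E7 → E7) (y : E7) : ℝ :=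
  met (deformField φ v y) (kappaVec φ v y) (kappaVec φ v y)

theorem kappa_lin (φ : E7 → E7 [⋀^Fin 3]→ₗ[ℝ] ℝ) (v : E7 → E7) (y : E7) :
    IsLinearMap ℝ (kappa φ v y) :=
  ⟨fun _ _ => by simp only [kappa, dNu, map_add, (tau7_lin φ y).map_add]; ring,
    fun _ _ => by simp only [kappa, dNu, map_smul, (tau7_lin φ y).map_smul, smul_eq_mul]; ring⟩

theorem wedge14_wedge13 {ι R : Type*} [CommRing R] (κ ξ : ι → R) (P : ι → ι → ι → R)
    (e a b c d : ι) : wedge14 κ (wedge13 ξ P) e a b c d =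
      wedge23 (fun x x' => κ x * ξ x' - κ x' * ξ x) P e a b c d := by
  simp only [wedge14, wedge13, wedge23]
  ring

theorem alt5_add {ι R : Type*} [CommRing R] (A B : ι → ι → ι → ι → ι → R) (e a b c d : ι) :
    alt5 (fun e a b c d => A e a b c d + B e a b c d) e a b c d =
      alt5 A e a b c d + alt5 B e a b c d := by
  simp only [alt5]
  ring

namespace LocalDeform

variable {φ : E7 → E7 [⋀^Fin 3]→ₗ[ℝ] ℝ} {v : E7 → E7} {U : Set E7} {y : E7}

theorem pos_deform (h : LocalDeform φ v U) (hy : y ∈ U) : IsPositive (deformField φ v y) :=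
  ((h.pos y hy).deform (v y)).1

theorem smooth_deform (h : LocalDeform φ v U) (hy : y ∈ U) : SmoothAt (deformField φ v) y :=
  (h.smooth y hy).deform (h.pos y hy) (h.smooth_vec y hy)

theorem smooth_nu (h : LocalDeform φ v U) (hy : y ∈ U) :
    ContDiffAt ℝ ∞ (fun z => nu (φ z) (v z)) y :=
  (h.smooth y hy).nu (h.pos y hy) (h.smooth_vec y hy)

theorem smooth_xi (h : LocalDeform φ v U) (hy : y ∈ U) (a : E7) :
    ContDiffAt ℝ ∞ (fun z => xi (φ z) (v z) a) y :=
  (h.smooth y hy).xi (h.pos y hy) (h.smooth_vec y hy) contDiffAt_const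

theorem smooth_kappa (h : LocalDeform φ v U) (hy : y ∈ U) (a : E7) :
    ContDiffAt ℝ ∞ (fun z => kappa φ v z a) y :=
  (contDiffAt_const.mul (((h.smooth_nu hy).inv ((h.pos y hy).nu_pos _).ne').mul
    (contDiffAt_fderiv (h.smooth_nu hy) a))).sub
      (contDiffAt_const.mul (h.toLocalW17.smooth_tau7 hy a))

theorem smooth_kappaVec (h : LocalDeform φ v U) (hy : y ∈ U) :
    ContDiffAt ℝ ∞ (kappaVec φ v) y :=
  (h.smooth_deform hy).sharp (h.pos_deform hy) (h.smooth_kappa hy)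

/-- The part `2 d(log ν)` is exact, so its second derivatives are symmetric, and `τ₇` is closed by
`LocalW17.closed`. -/
theorem kappa_closed (h : LocalDeform φ v U) (hy : y ∈ U) (a b : E7) :
    fderiv ℝ (fun z => kappa φ v z b) y a = fderiv ℝ (fun z => kappa φ v z a) y b := by
  have hν : DifferentiableAt ℝ (fun z => nu (φ z) (v z)) y :=
    (h.smooth_nu hy).differentiableAt (by simp)
  have hν0 := ((h.pos y hy).nu_pos (v y)).ne'
  have hi : DifferentiableAt ℝ (fun z => (nu (φ z) (v z))⁻¹) y := hν.fun_inv hν0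
  have hd : ∀ b, DifferentiableAt ℝ (fun z => dNu φ v z b) y := fun b =>
    (contDiffAt_fderiv (h.smooth_nu hy) b).differentiableAt (by simp)
  have hτ : ∀ b, DifferentiableAt ℝ (fun z => tau7 φ z b) y := fun b =>
    (h.toLocalW17.smooth_tau7 hy b).differentiableAt (by simp)
  have hinv : fderiv ℝ (fun z => (nu (φ z) (v z))⁻¹) y =
      (-(nu (φ y) (v y) ^ 2)⁻¹) • fderiv ℝ (fun z => nu (φ z) (v z)) y :=
    ((hasDerivAt_inv hν0).comp_hasFDerivAt y hν.hasFDerivAt).fderiv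
  have key : ∀ a b, fderiv ℝ (fun z => kappa φ v z b) y a =
      2 * ((nu (φ y) (v y))⁻¹ * fderiv ℝ (fun z => dNu φ v z b) y a +
        dNu φ v y b * (-(nu (φ y) (v y) ^ 2)⁻¹ * dNu φ v y a)) -
      4 * fderiv ℝ (fun z => tau7 φ z b) y a := by
    intro a b
    simp only [kappa]
    rw [fderiv_fun_sub ((hi.fun_mul (hd b)).const_mul 2) ((hτ b).const_mul 4),
      fderiv_const_mul (hi.fun_mul (hd b)), fderiv_const_mul (hτ b), fderiv_fun_mul hi (hd b),
      hinv]
    simp only [sub_apply, add_apply, smul_apply, smul_eq_mul, neg_apply, neg_smul]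
    simp only [dNu]
    ring
  have h2 : fderiv ℝ (fun z => dNu φ v z b) y a = fderiv ℝ (fun z => dNu φ v z a) y b :=
    fderiv_symm (h.smooth_nu hy) b a
  rw [key, key, (h.toLocalW17.closed hy).1 a b, h2]
  ring

/-- `(dξ - κ ∧ ξ) ∧ φ̃ = κ ∧ ψ̃`. -/
theorem wedge_dXi (h : LocalDeform φ v U) (hy : y ∈ U) (e a b c d : E7) :
    wedge23 (fun x x' => dXi φ v y x x' - dXi φ v y x' x -
      (kappa φ v y x * xi (φ y) (v y) x' - kappa φ v y x' * xi (φ y) (v y) x))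
      (fun3 (deformField φ v y)) e a b c d =
    wedge14 (kappa φ v y) (fun4 (psi (deformField φ v y))) e a b c d := by
  have hp := h.pos y hy
  have hs := h.smooth y hy
  have hpt := h.pos_deform hy
  have hst := h.smooth_deform hy
  have hν0 := (hp.nu_pos (v y)).ne'
  have hR : ∀ z ∈ U, ∀ a b c d, nu (φ z) (v z) ^ 2 * psi (φ z) ![a, b, c, d] =
      psi (deformField φ v z) ![a, b, c, d] +
        wedge13 (xi (φ z) (v z)) (fun3 (deformField φ v z)) a b c d := fun z hz =>
    ((h.pos z hz).deform (v z)).2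
  have h1 : ∀ e a b c d : E7, 2 * nu (φ y) (v y) * dNu φ v y e * psi (φ y) ![a, b, c, d] +
      nu (φ y) (v y) ^ 2 * dPsi φ y e a b c d = dPsi (deformField φ v) y e a b c d +
      (wedge13 (dXi φ v y e) (fun3 (deformField φ v y)) a b c d +
        wedge13 (xi (φ y) (v y)) (dForm (deformField φ v) y e) a b c d) := by
    intro e a b c d
    have e1 : (fun z => nu (φ z) (v z) ^ 2 * psi (φ z) ![a, b, c, d]) =ᶠ[nhds y] fun z =>
        psi (deformField φ v z) ![a, b, c, d] +
          wedge13 (xi (φ z) (v z)) (fun3 (deformField φ v z)) a b c d := by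
      filter_upwards [h.isOpen.mem_nhds hy] with z hz
      exact hR z hz a b c d
    have d1 : DifferentiableAt ℝ (fun z => nu (φ z) (v z)) y :=
      (h.smooth_nu hy).differentiableAt (by simp)
    have d2 : DifferentiableAt ℝ (fun z => psi (φ z) ![a, b, c, d]) y :=
      (hs.psi hp _).differentiableAt (by simp)
    have d2' : DifferentiableAt ℝ (fun z => psi (deformField φ v z) ![a, b, c, d]) y :=
      (hst.psi hpt _).differentiableAt (by simp)
    have d3 : ∀ x, DifferentiableAt ℝ (fun z => xi (φ z) (v z) x) y := fun x =>
      (h.smooth_xi hy x).differentiableAt (by simp)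
    have d4 : ∀ x₁ x₂ x₃, DifferentiableAt ℝ (fun z => fun3 (deformField φ v z) x₁ x₂ x₃) y :=
      fun _ _ _ => hst.differentiableAt _
    have d5 : DifferentiableAt ℝ (fun z => wedge13 (xi (φ z) (v z)) (fun3 (deformField φ v z))
        a b c d) y :=
      ((((d3 a).mul (d4 b c d)).sub ((d3 b).mul (d4 a c d))).add ((d3 c).mul (d4 a b d))).sub
        ((d3 d).mul (d4 a b c))
    have h2 := congrArg (fun l : E7 →L[ℝ] ℝ => l e) (e1.fderiv_eq (𝕜 := ℝ))
    rw [fderiv_fun_add d2' d5, fderiv_fun_mul (d1.fun_pow 2) d2, fderiv_fun_pow 2 d1] at h2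
    simp only [add_apply, smul_apply, smul_eq_mul] at h2
    rw [fderiv_wedge13 d3 d4] at h2
    have e2 : (fun x₁ x₂ x₃ => fderiv ℝ (fun z => fun3 (deformField φ v z) x₁ x₂ x₃) y e) =
      dForm (deformField φ v) y e := rfl
    have e3 : (fun x => fderiv ℝ (fun z => xi (φ z) (v z) x) y e) = dXi φ v y e := rfl
    rw [e2, e3] at h2
    simp only [dPsi, dNu]
    rw [← h2]
    simp
    ring
  have hA := alt5_wedge13 (dXi φ v y) (xi (φ y) (v y)) (fun3 (deformField φ v y))
    (dForm (deformField φ v) y) e a b c d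
  have hB := alt5_add (dPsi (deformField φ v) y) (fun e a b c d =>
    wedge13 (dXi φ v y e) (fun3 (deformField φ v y)) a b c d +
        wedge13 (xi (φ y) (v y)) (dForm (deformField φ v) y e) a b c d) e a b c d
  have hC := alt5_add (fun e a b c d => 2 * nu (φ y) (v y) * dNu φ v y e * psi (φ y) ![a, b, c, d])
    (fun e a b c d => nu (φ y) (v y) ^ 2 * dPsi φ y e a b c d) e a b c d
  simp only [← h1] at hB
  rw [hC] at hB
  rw [hA, alt_dPsi_eq_zero hpt hst (h.torsion_deform y hy)] at hB
  have hD : wedge14 (xi (φ y) (v y)) (alt4 (dForm (deformField φ v) y)) e a b c d = 0 := by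
    simp only [wedge14, alt_dForm_eq_zero hpt hst (h.torsion_deform y hy)]
    ring
  have hE : alt5 (fun e a b c d => nu (φ y) (v y) ^ 2 * dPsi φ y e a b c d) e a b c d =
      nu (φ y) (v y) ^ 2 * (-4 * wedge14 (tau7 φ y) (fun4 (psi (φ y))) e a b c d) := by
    rw [← h.toLocalW17.d_psi hy]
    simp only [alt5]
    ring
  have hk : ∀ x, nu (φ y) (v y) ^ 2 * kappa φ v y x = 2 * nu (φ y) (v y) * dNu φ v y x -
      4 * nu (φ y) (v y) ^ 2 * tau7 φ y x := by
    intro x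
    rw [kappa]
    field_simp
  have hF : wedge14 (fun x => nu (φ y) (v y) ^ 2 * kappa φ v y x) (fun4 (psi (φ y))) e a b c d =
      alt5 (fun e a b c d => 2 * nu (φ y) (v y) * dNu φ v y e * psi (φ y) ![a, b, c, d]) e a b c d +
      nu (φ y) (v y) ^ 2 * (-4 * wedge14 (tau7 φ y) (fun4 (psi (φ y))) e a b c d) := by
    simp only [hk, wedge14, alt5, fun4]
    ring
  -- Up to this point the equation reads `ν² κ ∧ ψ = dξ ∧ φ̃`. Substituting `ν² ψ = ψ̃ + ξ ∧ φ̃`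
  -- again expresses it entirely through the deformed structure.
  have hG : wedge14 (kappa φ v y) (fun4 (psi (deformField φ v y))) e a b c d =
      wedge14 (fun x => nu (φ y) (v y) ^ 2 * kappa φ v y x) (fun4 (psi (φ y))) e a b c d -
      wedge14 (kappa φ v y) (wedge13 (xi (φ y) (v y)) (fun3 (deformField φ v y))) e a b c d := by
    have : ∀ a b c d, fun4 (psi (deformField φ v y)) a b c d = nu (φ y) (v y) ^ 2 *
      fun4 (psi (φ y)) a b c d - wedge13 (xi (φ y) (v y)) (fun3 (deformField φ v y)) a b c d :=
      fun a b c d => by rw [fun4, fun4, hR y hy]; ring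
    simp only [wedge14, this]
    ring
  rw [hG, hF, wedge14_wedge13]
  have hH : ∀ (A B : E7 → E7 → ℝ) P, wedge23 (fun x x' => A x x' - B x x') P e a b c d =
      wedge23 A P e a b c d - wedge23 B P e a b c d := fun A B P => by
    simp only [wedge23]; ring
  rw [hH]
  linarith

/-- `dξ = κ ∧ ξ + (1/2) κ^♯ ⌟ φ̃`. -/
theorem dXi_eq (h : LocalDeform φ v U) (hy : y ∈ U) (a b : E7) :
    dXi φ v y a b - dXi φ v y b a =
      kappa φ v y a * xi (φ y) (v y) b - kappa φ v y b * xi (φ y) (v y) a +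
      1 / 2 * deformField φ v y ![kappaVec φ v y, a, b] := by
  have hpt := h.pos_deform hy
  have hl : ∀ a, IsLinearMap ℝ (dXi φ v y a) := by
    have d3 : ∀ x, DifferentiableAt ℝ (fun z => xi (φ z) (v z) x) y := fun x =>
      (h.smooth_xi hy x).differentiableAt (by simp)
    have hx : ∀ z, IsLinearMap ℝ (xi (φ z) (v z)) := fun z =>
      ⟨fun _ _ => by simp only [xi, (met_linear _ _).map_add]; ring,
        fun _ _ => by simp only [xi, (met_linear _ _).map_smul, smul_eq_mul]; ring⟩
    intro a
    constructor
    · intro b c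
      simp only [dXi, (hx _).map_add]
      rw [fderiv_fun_add (d3 b) (d3 c)]; rfl
    · intro r b
      simp only [dXi, (hx _).map_smul, smul_eq_mul]
      rw [fderiv_const_mul (d3 b)]; rfl
  have hl' : ∀ b, IsLinearMap ℝ fun a => dXi φ v y a b := fun b =>
    ⟨fun _ _ => by simp only [dXi, map_add], fun _ _ => by simp only [dXi, map_smul]⟩
  have hx : IsLinearMap ℝ (xi (φ y) (v y)) :=
    ⟨fun _ _ => by simp only [xi, (met_linear _ _).map_add]; ring,
      fun _ _ => by simp only [xi, (met_linear _ _).map_smul, smul_eq_mul]; ring⟩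
  have hκ := kappa_lin φ v y
  have hK : ∀ x, met (deformField φ v y) (kappaVec φ v y) x = kappa φ v y x :=
    hpt.met_sharp hκ
  have hw := h.wedge_dXi hy
  obtain ⟨u, hu⟩ := hpt
  set F : E7 → E7 → ℝ := fun a b => dXi φ v y a b - dXi φ v y b a -
    (kappa φ v y a * xi (φ y) (v y) b - kappa φ v y b * xi (φ y) (v y) a) -
      1 / 2 * deformField φ v y ![kappaVec φ v y, a, b] with hF
  have hF1 : ∀ a, IsLinearMap ℝ (F a) := fun a =>
    ⟨fun _ _ => by simp only [hF, (hl _).map_add, (hl' _).map_add, hx.map_add, hκ.map_add,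
      form3_add₂]; ring,
      fun _ _ => by simp only [hF, (hl _).map_smul, (hl' _).map_smul, hx.map_smul, hκ.map_smul,
        form3_smul₂, smul_eq_mul]; ring⟩
  have hF2 : ∀ a b, F b a = -F a b := fun a b => by
    have := (form3_perm (deformField φ v y) (kappaVec φ v y) a b).2.1
    simp only [hF, this]
    ring
  -- Since `(κ♯ ⌟ φ̃) ∧ φ̃ = 2 κ ∧ ψ̃`, the 2-form `½ κ♯ ⌟ φ̃` accounts for the right-hand side of
  -- `wedge_dXi`. The difference `F` then has zero wedge product with `φ̃`, hence vanishes.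
  have key := eq_zero_of_wedge_phi (fun i j => F (frame u i) (frame u j)) (fun i j => hF2 _ _)
    (fun i j k l m => by
      have h1 := hw (frame u i) (frame u j) (frame u k) (frame u l) (frame u m)
      have h2 := wedge_contract_phi0 (u (kappaVec φ v y)) (stdVec i) (stdVec j) (stdVec k)
        (stdVec l) (stdVec m)
      have h3 : ∀ i, dot (u (kappaVec φ v y)) (stdVec i) = kappa φ v y (frame u i) := fun i => by
        rw [← hK, hu, met_pull, map_frame]
      have h4 : ∀ i j, deformField φ v y ![kappaVec φ v y, frame u i, frame u j] =
          phi0 ![u (kappaVec φ v y), stdVec i, stdVec j] := fun i j => by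
        rw [hu, fun3_pull, map_frame, map_frame]
      simp only [wedge23, wedge14, fun3, fun4, hu, form_frame, psi_frame, phi0_stdVec, psi0_basis,
        h3] at h1 h2
      simp only [wedge23, hF, h4]
      linear_combination h1 - 1 / 2 * h2)
  have h5 : F a b = 0 := by
    refine eq_zero_of_frame u (hF1 a) (fun j => ?_) b
    have e : F a (frame u j) = -F (frame u j) a := hF2 _ _
    rw [e, neg_eq_zero]
    exact eq_zero_of_frame u (hF1 _) (fun i => key j i) a
  simp only [hF] at h5
  linarith

end LocalDeform

namespace LocalDeform

/-! ### The 1-form `κ` satisfies `∇̃κ = κ ⊗ κ` -/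

variable {φ : E7 → E7 [⋀^Fin 3]→ₗ[ℝ] ℝ} {v : E7 → E7} {U : Set E7} {y : E7}

theorem met_kappaVec (h : LocalDeform φ v U) (hy : y ∈ U) (x : E7) :
    met (deformField φ v y) (kappaVec φ v y) x = kappa φ v y x :=
  (h.pos_deform hy).met_sharp (kappa_lin φ v y) x

/-- Apply `d` to `dξ = κ ∧ ξ + ½ κ♯ ⌟ φ̃`. Because `dκ = 0` and `κ ∧ κ = 0`, this gives `d(κ♯ ⌟ φ̃)
= κ ∧ (κ♯ ⌟ φ̃)`. As `φ̃` is parallel, the left-hand side is the alternation of `(∇̃κ♯) ⌟ φ̃`, so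
the alternation of `(S ·) ⌟ φ̃` vanishes, and this alternation is the action of `S` on `φ̃`. -/
theorem alt_kappaVec (h : LocalDeform φ v U) (hy : y ∈ U) (S : E7 →ₗ[ℝ] E7)
    (hS : ∀ a, S a = fderiv ℝ (kappaVec φ v) y a + chr (deformField φ v) y a (kappaVec φ v y) -
      kappa φ v y a • kappaVec φ v y) (c a b : E7) :
    act S (deformField φ v y) ![c, a, b] = 0 := by
  have hpt := h.pos_deform hy
  have hst := h.smooth_deform hy
  have d1 : ∀ x, DifferentiableAt ℝ (fun z => kappa φ v z x) y := fun x =>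
    (h.smooth_kappa hy x).differentiableAt (by simp)
  have d2 : ∀ x, DifferentiableAt ℝ (fun z => xi (φ z) (v z) x) y := fun x =>
    (h.smooth_xi hy x).differentiableAt (by simp)
  have d3 : ∀ a b, DifferentiableAt ℝ (fun z => dXi φ v z a b) y := fun a b =>
    (contDiffAt_fderiv (h.smooth_xi hy b) a).differentiableAt (by simp)
  have d4 : ∀ a b, DifferentiableAt ℝ (fun z => deformField φ v z ![kappaVec φ v z, a, b]) y :=
    fun a b => (hst.apply (h.smooth_kappaVec hy) contDiffAt_const contDiffAt_const).differentiableAt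
      (by simp)
  have key : ∀ c a b, fderiv ℝ (fun z => dXi φ v z a b) y c - fderiv ℝ (fun z => dXi φ v z b a) y c =
      fderiv ℝ (fun z => kappa φ v z a) y c * xi (φ y) (v y) b + kappa φ v y a * dXi φ v y c b -
      fderiv ℝ (fun z => kappa φ v z b) y c * xi (φ y) (v y) a - kappa φ v y b * dXi φ v y c a +
      1 / 2 * (act (chr (deformField φ v) y c) (deformField φ v y) ![kappaVec φ v y, a, b] +
        deformField φ v y ![fderiv ℝ (kappaVec φ v) y c, a, b]) := by
    intro c a b
    have e1 : (fun z => dXi φ v z a b - dXi φ v z b a) =ᶠ[nhds y] fun z =>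
        kappa φ v z a * xi (φ z) (v z) b - kappa φ v z b * xi (φ z) (v z) a +
        1 / 2 * deformField φ v z ![kappaVec φ v z, a, b] := by
      filter_upwards [h.isOpen.mem_nhds hy] with z hz
      exact h.dXi_eq hz a b
    have h2 := congrArg (fun l : E7 →L[ℝ] ℝ => l c) (e1.fderiv_eq (𝕜 := ℝ))
    rw [fderiv_fun_sub (d3 a b) (d3 b a), fderiv_fun_add (((d1 a).fun_mul (d2 b)).fun_sub
      ((d1 b).fun_mul (d2 a))) ((d4 a b).const_mul _), fderiv_fun_sub ((d1 a).fun_mul (d2 b))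
      ((d1 b).fun_mul (d2 a)), fderiv_fun_mul (d1 a) (d2 b), fderiv_fun_mul (d1 b) (d2 a),
      fderiv_const_mul (d4 a b)] at h2
    simp only [add_apply, sub_apply, smul_apply, smul_eq_mul] at h2
    have h3 := fderiv_lin_apply (L := fun z w => deformField φ v z ![w, a, b]) (y := y)
      (fun z => lin3₀ _ _ _) (fun i => hst.differentiableAt _)
      ((h.smooth_kappaVec hy).differentiableAt (by simp)) c
    have h4 := dForm_eq_act hpt hst (h.torsion_deform y hy) c (kappaVec φ v y) a b
    rw [dForm] at h4
    rw [h3, h4] at h2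
    rw [h2]
    simp only [dXi]
    ring
  have hsym : ∀ c a b, fderiv ℝ (fun z => dXi φ v z a b) y c =
      fderiv ℝ (fun z => dXi φ v z c b) y a := fun c a b => fderiv_symm (h.smooth_xi hy b) a c
  have hG := chr_symm hpt hst
  set G := chr (deformField φ v) y with hGdef
  set K := kappaVec φ v y with hK
  set P := deformField φ v y with hP
  have p1 : ∀ x y z, P ![y, x, z] = -P ![x, y, z] := fun x y z => (form3_perm P x y z).1
  have p2 : ∀ x y z, P ![x, z, y] = -P ![x, y, z] := fun x y z => (form3_perm P x y z).2.1
  have p3 : ∀ x y z, P ![z, x, y] = P ![x, y, z] := fun x y z => (form3_perm P x y z).2.2.2.1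
  have s1 : ∀ a x z, P ![S a, x, z] = P ![fderiv ℝ (kappaVec φ v) y a, x, z] +
      P ![G a K, x, z] - kappa φ v y a * P ![K, x, z] := by
    intro a x z
    rw [hS, (lin3₀ _ _ _).map_sub, form3_add₀, form3_smul₀]
  have k1 := key c a b
  have k2 := key a c b
  have k3 := key b c a
  rw [act_apply₃] at k1 k2 k3 ⊢
  rw [p1 (S a) c b, ← p3 c a (S b), s1, s1, s1]
  rw [hG a c] at k2
  rw [hG b a, hG b c, p2 K a (G c b)] at k3
  linear_combination (-2) * k1 + 2 * k2 - 2 * k3 + 2 * hsym c a b - 2 * hsym c b a +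
    2 * hsym a b c - 2 * xi (φ y) (v y) b * h.kappa_closed hy c a +
    2 * xi (φ y) (v y) a * h.kappa_closed hy c b - 2 * xi (φ y) (v y) c * h.kappa_closed hy a b -
    2 * kappa φ v y a * h.dXi_eq hy c b + 2 * kappa φ v y b * h.dXi_eq hy c a +
    2 * kappa φ v y c * h.dXi_eq hy a b

/-- The endomorphism `∇̃κ♯ - κ ⊗ κ♯` is symmetric for the deformed metric because `κ` is closed. It
acts trivially on `φ̃` by `alt_kappaVec`, and a symmetric endomorphism with this property is zero.
-/
theorem nabla_kappaVec (h : LocalDeform φ v U) (hy : y ∈ U) (a : E7) :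
    fderiv ℝ (kappaVec φ v) y a + chr (deformField φ v) y a (kappaVec φ v y) =
      kappa φ v y a • kappaVec φ v y := by
  have hpt := h.pos_deform hy
  have hst := h.smooth_deform hy
  -- The type of `chr` makes it linear in its last argument only, so the direction of
  -- differentiation is placed there; the symmetry of `chr` restores the intended order.
  let S : E7 →ₗ[ℝ] E7 := (fderiv ℝ (kappaVec φ v) y).toLinearMap +
    chr (deformField φ v) y (kappaVec φ v y) -
    ((kappa_lin φ v y).mk' _).smulRight (kappaVec φ v y)
  have hS : ∀ a, S a = fderiv ℝ (kappaVec φ v) y a +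
      chr (deformField φ v) y a (kappaVec φ v y) - kappa φ v y a • kappaVec φ v y := fun a => by
    rw [chr_symm hpt hst a]
    rfl
  have hmet : ∀ a b, met (deformField φ v y) (S a) b = fderiv ℝ (fun z => kappa φ v z b) y a -
      kappa φ v y (chr (deformField φ v) y a b) - kappa φ v y a * kappa φ v y b := by
    intro a b
    have e1 : (fun z => kappa φ v z b) =ᶠ[nhds y] fun z =>
        met (deformField φ v z) (kappaVec φ v z) b := by
      filter_upwards [h.isOpen.mem_nhds hy] with z hz
      exact (h.met_kappaVec hz b).symm
    rw [e1.fderiv_eq, fderiv_met hst hpt (h.smooth_kappaVec hy) contDiffAt_const, hS,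
      (met_lin_left _ _).map_sub, met_smul_left, h.met_kappaVec hy, h.met_kappaVec hy]
    simp
  have h0 : S = 0 := by
    refine hpt.eq_zero_of_act_symm S (fun x z => ?_) (h.alt_kappaVec hy S hS)
    rw [hmet, hpt.met_comm, hmet, h.kappa_closed hy x z, chr_symm hpt hst x z]
    ring
  rw [← sub_eq_zero, ← hS, h0]
  rfl

theorem fderiv_kappaSq (h : LocalDeform φ v U) (hy : y ∈ U) (a : E7) :
    fderiv ℝ (kappaSq φ v) y a = 2 * kappaSq φ v y * kappa φ v y a := by
  have hpt := h.pos_deform hy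
  have e : kappaSq φ v = fun z => met (deformField φ v z) (kappaVec φ v z) (kappaVec φ v z) := rfl
  rw [e, fderiv_met (h.smooth_deform hy) hpt (h.smooth_kappaVec hy) (h.smooth_kappaVec hy),
    h.nabla_kappaVec hy, met_smul_left, (met_linear _ _).map_smul]
  simp only [smul_eq_mul]
  ring

/-- At a local maximum of `|κ|²` the 1-form `κ` vanishes. -/
theorem kappaSq_eq_zero (h : LocalDeform φ v U) (hy : y ∈ U) (hm : IsLocalMax (kappaSq φ v) y) :
    kappaSq φ v y = 0 := by
  -- Evaluated on `κ♯` itself, `d|κ|² = 2|κ|²κ` becomes `0 = 2|κ|⁴` at a critical point.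
  have h1 := h.fderiv_kappaSq hy (kappaVec φ v y)
  rw [hm.fderiv_eq_zero, ← h.met_kappaVec hy] at h1
  change 0 = 2 * kappaSq φ v y * kappaSq φ v y at h1
  nlinarith

theorem kappa_eq_zero (h : LocalDeform φ v U) (hy : y ∈ U) (h0 : kappaSq φ v y = 0) (a : E7) :
    kappa φ v y a = 0 := by
  rw [← h.met_kappaVec hy, (h.pos_deform hy).met_self_eq_zero h0, (met_lin_left _ _).map_zero]

theorem continuousAt_kappaSq (h : LocalDeform φ v U) (hy : y ∈ U) :
    ContinuousAt (kappaSq φ v) y :=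
  ((h.smooth_deform hy).met (h.pos_deform hy) (h.smooth_kappaVec hy)
    (h.smooth_kappaVec hy)).continuousAt

end LocalDeform

/-! ### The consequences of `κ = 0` -/

/-- The squared norm of a vector field. -/
def normSq (φ : E7 → E7 [⋀^Fin 3]→ₗ[ℝ] ℝ) (v : E7 → E7) (y : E7) : ℝ := met (φ y) (v y) (v y)

/-- The covariant derivative of a vector field. -/
def nabla (φ : E7 → E7 [⋀^Fin 3]→ₗ[ℝ] ℝ) (v : E7 → E7) (y a : E7) : E7 :=
  fderiv ℝ v y a + chr φ y a (v y)

theorem eventually_eq_of_fderiv_eq_zero {f : E7 → ℝ} {y : E7} {s : Set E7} (hs : s ∈ nhds y)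
    (hf : ∀ z ∈ s, DifferentiableAt ℝ f z) (h : ∀ z ∈ s, ∀ a, fderiv ℝ f z a = 0) :
    ∀ᶠ z in nhds y, f z = f y := by
  obtain ⟨r, hr, hrs⟩ := Metric.mem_nhds_iff.mp hs
  filter_upwards [Metric.ball_mem_nhds y hr] with z hz
  exact Metric.isOpen_ball.is_const_of_fderiv_eq_zero (convex_ball y r).isPreconnected
    (fun w hw => (hf w (hrs hw)).differentiableWithinAt)
    (fun w hw => ContinuousLinearMap.ext fun a => h w (hrs hw) a) hz (Metric.mem_ball_self hr)

theorem fderiv_deformField {φ : E7 → E7 [⋀^Fin 3]→ₗ[ℝ] ℝ} {v : E7 → E7} {y : E7}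
    (hp : IsPositive (φ y)) (hs : SmoothAt φ y) (hv : ContDiffAt ℝ ∞ v y) (a b c d : E7) :
    dForm (deformField φ v) y a b c d = dForm φ y a b c d + dPsi φ y a (v y) b c d +
      psi (φ y) ![fderiv ℝ v y a, b, c, d] := by
  have e : (fun z => deformField φ v z ![b, c, d]) = fun z => φ z ![b, c, d] +
    psi (φ z) ![v z, b, c, d] := rfl
  have hψ : DifferentiableAt ℝ (fun z => psi (φ z) ![v z, b, c, d]) y :=
    (contDiffAt_lin_apply (L := fun z w => psi (φ z) ![w, b, c, d])
      (fun z => lin4₀ _ _ _ _) (fun l => hs.psi hp _) hv).differentiableAt (by simp)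
  rw [dForm, e, fderiv_fun_add (hs.differentiableAt _) hψ, add_apply,
    fderiv_lin_apply (L := fun z w => psi (φ z) ![w, b, c, d])
      (fun z => lin4₀ _ _ _ _) (fun l => (hs.psi hp _).differentiableAt (by simp))
      (hv.differentiableAt (by simp)), ← add_assoc]
  rfl

namespace LocalDeform

variable {φ : E7 → E7 [⋀^Fin 3]→ₗ[ℝ] ℝ} {v : E7 → E7} {U : Set E7} {y : E7}

/-- The equation `dφ̃ = 0` in terms of the torsion of `φ` and the covariant derivative of `v`. -/
theorem d_deform (h : LocalDeform φ v U) (hy : y ∈ U) (u : E7 ≃ₗ[ℝ] E7)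
    (hu : φ y = phi0.compLinearMap u.toLinearMap) {θ : E7} (hθ : ∀ x, tau7 φ y x = dot θ (u x))
    (hd : ∀ a b c d, dForm φ y a b c d = act (chr φ y a) (φ y) ![b, c, d] +
        psi (φ y) ![u.symm (tau1 φ y • u a + cross θ (u a)), b, c, d]) (a b c d : E7) :
    4 * tau1 φ y * psi (φ y) ![a, b, c, d] - 3 * wedge13 (tau7 φ y) (fun3 (φ y)) a b c d +
      alt4 (fun a b c d => psi (φ y) ![nabla φ v y a, b, c, d]) a b c d -
      alt4 (fun a b c d => wedge13 (fun w => tau1 φ y * dot (u a) (u w) + phi0 ![θ, u a, u w])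
        (fun3 (φ y)) (v y) b c d) a b c d = 0 := by
  have hp := h.pos y hy
  have hs := h.smooth y hy
  have h1 := alt_dForm_eq_zero (h.pos_deform hy) (h.smooth_deform hy) (h.torsion_deform y hy)
    a b c d
  have h2 := h.toLocalW17.d_form hy a b c d
  have h3 := alt_act_symm ((psi (φ y)).curryLeft (v y)) (chr φ y) (chr_symm hp hs) a b c d
  have hψ := fun a => dPsi_eq hp hs u hu (hd a)
  have e : ∀ x y' z, (psi (φ y)).curryLeft (v y) ![x, y', z] = psi (φ y) ![v y, x, y', z] :=
    fun _ _ _ => rfl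
  simp only [alt4, fderiv_deformField hp hs (h.smooth_vec y hy), hψ, act_apply₃, e, nabla,
    form4_add₀, LinearEquiv.apply_symm_apply, dot_add_left, dot_smul_left, dot_cross]
    at h1 h2 h3 ⊢
  linear_combination h1 - h2 - h3

theorem dNu_eq (h : LocalDeform φ v U) (hκ : ∀ z ∈ U, ∀ a, kappa φ v z a = 0) (hy : y ∈ U)
    (a : E7) : dNu φ v y a = 2 * nu (φ y) (v y) * tau7 φ y a := by
  have h1 := hκ y hy a
  have hν0 := ((h.pos y hy).nu_pos (v y)).ne'
  rw [kappa] at h1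
  field_simp at h1
  linarith

theorem smooth_normSq (h : LocalDeform φ v U) (hy : y ∈ U) : ContDiffAt ℝ ∞ (normSq φ v) y :=
  (h.smooth y hy).met (h.pos y hy) (h.smooth_vec y hy) (h.smooth_vec y hy)

/-- `|v|² = ν³ - 1`, and `κ = 0` means `dν = 2ντ₇`. -/
theorem fderiv_normSq (h : LocalDeform φ v U) (hκ : ∀ z ∈ U, ∀ a, kappa φ v z a = 0) (hy : y ∈ U)
    (a : E7) : fderiv ℝ (normSq φ v) y a = 6 * (1 + normSq φ v y) * tau7 φ y a := by
  have d1 : DifferentiableAt ℝ (fun z => nu (φ z) (v z)) y :=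
    (h.smooth_nu hy).differentiableAt (by simp)
  have e1 : normSq φ v =ᶠ[nhds y] fun z => nu (φ z) (v z) ^ 3 - 1 := by
    filter_upwards [h.isOpen.mem_nhds hy] with z hz
    rw [(h.pos z hz).nu_pow, normSq]; ring
  have e2 : nu (φ y) (v y) ^ 3 = 1 + normSq φ v y := (h.pos y hy).nu_pow (v y)
  rw [e1.fderiv_eq, fderiv_sub_const, fderiv_fun_pow 3 d1, ← e2]
  simp only [smul_apply, smul_eq_mul]
  rw [← dNu, h.dNu_eq hκ hy]
  simp
  ring

/-- For `κ = 0` the form `ξ` is closed, so `v♭ = νξ` satisfies `dv♭ = d(log ν) ∧ v♭ = 2τ₇ ∧ v♭`. The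
Christoffel terms cancel by symmetry. -/
theorem nabla_skew (h : LocalDeform φ v U) (hκ : ∀ z ∈ U, ∀ a, kappa φ v z a = 0) (hy : y ∈ U)
    (a b : E7) : met (φ y) (nabla φ v y a) b - met (φ y) (nabla φ v y b) a =
      2 * (tau7 φ y a * met (φ y) (v y) b - tau7 φ y b * met (φ y) (v y) a) := by
  have hp := h.pos y hy
  have hs := h.smooth y hy
  have hξ : ∀ z ∈ U, ∀ b, met (φ z) (v z) b = nu (φ z) (v z) * xi (φ z) (v z) b := by
    intro z hz b
    rw [xi, mul_inv_cancel_left₀ ((h.pos z hz).nu_pos (v z)).ne']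
  have hK : kappaVec φ v y = 0 := by
    refine (h.pos_deform hy).met_self_eq_zero ?_
    rw [h.met_kappaVec hy, hκ y hy]
  have hd := h.dXi_eq hy a b
  rw [hK, (lin3₀ _ _ _).map_zero, hκ y hy, hκ y hy] at hd
  have key : ∀ a b, met (φ y) (nabla φ v y a) b + met (φ y) (v y) (chr φ y a b) =
      2 * tau7 φ y a * met (φ y) (v y) b + nu (φ y) (v y) * dXi φ v y a b := by
    intro a b
    have d1 : DifferentiableAt ℝ (fun z => nu (φ z) (v z)) y :=
      (h.smooth_nu hy).differentiableAt (by simp)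
    have d2 : DifferentiableAt ℝ (fun z => xi (φ z) (v z) b) y :=
      (h.smooth_xi hy b).differentiableAt (by simp)
    have e1 : (fun z => met (φ z) (v z) b) =ᶠ[nhds y] fun z =>
        nu (φ z) (v z) * xi (φ z) (v z) b := by
      filter_upwards [h.isOpen.mem_nhds hy] with z hz
      exact hξ z hz b
    have h1 := fderiv_met hs hp (h.smooth_vec y hy) (contDiffAt_const (c := b)) a
    rw [e1.fderiv_eq, fderiv_fun_mul d1 d2] at h1
    simp only [add_apply, smul_apply, smul_eq_mul] at h1
    rw [← dNu, ← dXi, h.dNu_eq hκ hy] at h1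
    simp only [fderiv_fun_const, Pi.zero_apply, zero_apply, zero_add] at h1
    rw [nabla, ← h1, hξ y hy]
    ring
  have h1 := key a b
  have h2 := key b a
  rw [chr_symm hp hs b a] at h2
  linear_combination h1 - h2 + nu (φ y) (v y) * hd

/-- In a frame with `v = t e₀` the equations `d_deform`, `nabla_skew` and `fderiv_normSq` are the
hypotheses of `torsion_numbers`; the conclusions extend from the frame by linearity. -/
theorem tau7_eq (h : LocalDeform φ v U) (hκ : ∀ z ∈ U, ∀ a, kappa φ v z a = 0) (hy : y ∈ U) :
    (∀ a, 3 * tau7 φ y a = -tau1 φ y * met (φ y) (v y) a) ∧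
      (tau1 φ y = 0 → ∀ a, nabla φ v y a = 0) := by
  have hp := h.pos y hy
  have hs := h.smooth y hy
  obtain ⟨u, t, hu, huv⟩ := hp.exists_frame (v y)
  obtain ⟨θ, hθ, hd, -⟩ := h.toLocalW17.exists_frame hy u hu
  have hv : v y = t • frame u 0 := by
    rw [frame, ← map_smul, ← huv, LinearEquiv.symm_apply_apply]
  have hvb : ∀ j, met (φ y) (v y) (frame u j) = t * delta j 0 := fun j => by
    rw [hu, met_pull, huv, map_frame, dot_smul_left, dot_comm, dot_stdVec]
  have hN : ∀ i j, met (φ y) (nabla φ v y (frame u i)) (frame u j) =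
      u (nabla φ v y (frame u i)) j := fun i j => by
    rw [hu, met_pull, map_frame, dot_stdVec_right]
  have hτ : ∀ i, tau7 φ y (frame u i) = θ i := fun i => by
    rw [hθ, map_frame, dot_stdVec_right]
  have hM : normSq φ v y = t ^ 2 := by
    have := hvb 0
    rw [normSq]
    nth_rewrite 2 [hv]
    rw [(met_linear _ _).map_smul, this]
    simp [delta]
    ring
  have key := torsion_numbers (tau1 φ y) t (fun i => θ i)
    (fun i j => u (nabla φ v y (frame u i)) j)
    (fun i j k l => by
      have h1 := h.d_deform hy u hu hθ hd (frame u i) (frame u j) (frame u k) (frame u l)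
      have h2 : ∀ x b c d, psi (φ y) ![x, frame u b, frame u c, frame u d] =
          fanoSign₄ b c d * u x (fano (fano b c) d) := fun x b c d => by
        rw [hu, psi_pull_fun, map_frame, map_frame, map_frame, psi0_cons]
      have h3 : ∀ a m, phi0 ![θ, stdVec a, stdVec m] = fanoSign a m * θ (fano a m) := fun a m =>
        phi0_vecCons θ a m
      have h4 : psi (φ y) ![frame u i, frame u j, frame u k, frame u l] = psiInt i j k l := by
        rw [hu, psi_frame]
      have h5 : ∀ a b c, fun3 (φ y) (frame u a) (frame u b) (frame u c) = phiInt a b c :=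
        fun a b c => by rw [fun3, hu, form_frame]
      have h6 : ∀ b c, fun3 (φ y) (v y) (frame u b) (frame u c) = t * phiInt 0 b c :=
        fun b c => by rw [hv, fun3, form3_smul₀, ← fun3, h5]
      rw [h4] at h1
      simp only [alt4, wedge13, h2, hτ, h5, h6, huv, dot_smul_right, form3_smul₂, map_frame, h3,
        dot_stdVec] at h1 ⊢
      linear_combination h1)
    (fun i j => by
      have h1 := h.nabla_skew hκ hy (frame u i) (frame u j)
      rw [hN, hN, hvb, hvb, hτ, hτ] at h1
      rw [h1]; ring)
    (fun i => by
      have h1 := h.fderiv_normSq hκ hy (frame u i)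
      have h2 : fderiv ℝ (normSq φ v) y (frame u i) =
          2 * met (φ y) (nabla φ v y (frame u i)) (v y) := by
        have := fderiv_met hs hp (h.smooth_vec y hy) (h.smooth_vec y hy) (frame u i)
        rw [← nabla, hp.met_comm (v y)] at this
        rw [two_mul, ← this]
        rfl
      rw [h2, hv, (met_linear _ _).map_smul, hN, hM, hτ, smul_eq_mul] at h1
      linarith)
  refine ⟨fun a => ?_, fun h0 a => ?_⟩
  · have hl : IsLinearMap ℝ fun a => 3 * tau7 φ y a - -tau1 φ y * met (φ y) (v y) a :=
      ⟨fun _ _ => by simp only [(tau7_lin φ y).map_add, (met_linear _ _).map_add]; ring,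
        fun _ _ => by simp only [(tau7_lin φ y).map_smul, (met_linear _ _).map_smul,
          smul_eq_mul]; ring⟩
    refine sub_eq_zero.mp (eq_zero_of_frame u hl (fun i => ?_) a)
    have := key.1 i
    simp only [hτ, hvb]
    linarith
  · have h1 : ∀ i, u (nabla φ v y (frame u i)) = 0 := fun i => by
      ext j
      exact key.2 h0 i j
    refine (map_eq_zero_iff u u.injective).mp ?_
    ext j
    refine eq_zero_of_frame u (F := fun a => u (nabla φ v y a) j) ?_ (fun i => by rw [h1]; rfl) a
    constructor
    · intro a b
      simp [nabla, chr_add]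
      ring
    · intro c a
      simp [nabla, chr_smul]
      ring

/-- Near a local maximum of `|v|²` the function `|v|²` is constant. -/
theorem eventually_normSq_eq (h : LocalDeform φ v U) (hκ : ∀ z ∈ U, ∀ a, kappa φ v z a = 0)
    (hy : y ∈ U) (hm : IsLocalMax (normSq φ v) y) : ∀ᶠ z in nhds y, normSq φ v z = normSq φ v y := by
  have hp := h.pos y hy
  have hU := h.isOpen.mem_nhds hy
  have hd : ∀ z ∈ U, DifferentiableAt ℝ (normSq φ v) z := fun z hz =>
    (h.smooth_normSq hz).differentiableAt (by simp)
  have hτ : ∀ a, tau7 φ y a = 0 := fun a => by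
    have h1 := h.fderiv_normSq hκ hy a
    rw [hm.fderiv_eq_zero, zero_apply] at h1
    have h2 : 0 ≤ normSq φ v y := hp.met_self_nonneg _
    have h3 : (6 * (1 + normSq φ v y)) ≠ 0 := by positivity
    exact (mul_eq_zero.mp h1.symm).resolve_left h3
  have h1 := (h.tau7_eq hκ hy).1 (v y)
  rw [hτ, mul_zero, eq_comm, mul_eq_zero, neg_eq_zero] at h1
  rcases h1 with h1 | h1
  -- From `dτ₁ = τ₁τ₇` and `dν = 2ντ₇` the function `τ₁²/ν` has zero derivative on `U`. As `τ₁`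
  -- vanishes at `y`, it vanishes near `y`, and then so do `τ₇` and `d|v|²`.
  · have hf : ∀ᶠ z in nhds y, tau1 φ z ^ 2 * (nu (φ z) (v z))⁻¹ =
        tau1 φ y ^ 2 * (nu (φ y) (v y))⁻¹ := by
      refine eventually_eq_of_fderiv_eq_zero (f := fun z => tau1 φ z ^ 2 * (nu (φ z) (v z))⁻¹) hU
        (fun z hz => ?_) fun z hz a => ?_
      · exact ((((h.toLocalW17.smooth_tau1 hz).pow 2).mul ((h.smooth_nu hz).inv
          ((h.pos z hz).nu_pos _).ne')).differentiableAt (by simp))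
      · have hν0 := ((h.pos z hz).nu_pos (v z)).ne'
        have hν : DifferentiableAt ℝ (fun z => nu (φ z) (v z)) z :=
          (h.smooth_nu hz).differentiableAt (by simp)
        have ht : DifferentiableAt ℝ (tau1 φ) z :=
          (h.toLocalW17.smooth_tau1 hz).differentiableAt (by simp)
        have hinv : fderiv ℝ (fun z => (nu (φ z) (v z))⁻¹) z =
            (-(nu (φ z) (v z) ^ 2)⁻¹) • fderiv ℝ (fun z => nu (φ z) (v z)) z :=
          ((hasDerivAt_inv hν0).comp_hasFDerivAt z hν.hasFDerivAt).fderiv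
        rw [fderiv_fun_mul (ht.fun_pow 2) (hν.fun_inv hν0), fderiv_fun_pow 2 ht, hinv]
        simp only [add_apply, smul_apply, smul_eq_mul]
        rw [← dNu, h.dNu_eq hκ hz, (h.toLocalW17.closed hz).2]
        simp only [Nat.add_one_sub_one, pow_one, nsmul_eq_mul, Nat.cast_ofNat]
        field_simp
        ring
    have h0 : ∀ᶠ z in nhds y, z ∈ U ∧ tau1 φ z = 0 := by
      filter_upwards [hf, hU] with z hz hzU
      rw [h1] at hz
      have := ((h.pos z hzU).nu_pos (v z)).ne'
      refine ⟨hzU, ?_⟩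
      simpa [this] using hz
    refine eventually_eq_of_fderiv_eq_zero h0 (fun z hz => hd z hz.1) fun z hz a => ?_
    have h2 := (h.tau7_eq hκ hz.1).1 a
    rw [hz.2] at h2
    rw [h.fderiv_normSq hκ hz.1]
    have : tau7 φ z a = 0 := by linarith
    rw [this, mul_zero]
  -- In this case the local maximum of `|v|²` is zero, so `v` vanishes nearby.
  · filter_upwards [hm, hU] with z hz hzU
    have h2 : 0 ≤ normSq φ v z := (h.pos z hzU).met_self_nonneg _
    have h3 : normSq φ v y = 0 := h1
    linarith

/-- Where `|v|²` is locally constant, the torsion vanishes and `v` is parallel. -/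
theorem torsion_eq_zero_and_nabla_eq_zero (h : LocalDeform φ v U)
    (hκ : ∀ z ∈ U, ∀ a, kappa φ v z a = 0) (hy : y ∈ U)
    (hc : ∀ᶠ z in nhds y, normSq φ v z = normSq φ v y) :
    (∀ a m, G2.torsion φ y a m = 0) ∧ ∀ a, nabla φ v y a = 0 := by
  have hp := h.pos y hy
  have hτ : ∀ a, tau7 φ y a = 0 := fun a => by
    have h1 := h.fderiv_normSq hκ hy a
    have e : normSq φ v =ᶠ[nhds y] fun _ => normSq φ v y := hc
    rw [e.fderiv_eq] at h1
    simp only [fderiv_fun_const, Pi.zero_apply, zero_apply] at h1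
    have h2 : 0 ≤ normSq φ v y := hp.met_self_nonneg _
    have h3 : (6 * (1 + normSq φ v y)) ≠ 0 := by positivity
    exact (mul_eq_zero.mp h1.symm).resolve_left h3
  have h1 := (h.tau7_eq hκ hy).1 (v y)
  rw [hτ, mul_zero, eq_comm, mul_eq_zero, neg_eq_zero] at h1
  obtain ⟨u, hu⟩ := id hp
  obtain ⟨θ, hθ, hd, hT⟩ := h.toLocalW17.exists_frame hy u hu
  have hθ0 : θ = 0 := by
    refine dot_self_eq_zero ?_
    have := hθ (u.symm θ)
    rw [hτ, LinearEquiv.apply_symm_apply] at this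
    exact this.symm
  have h2 : tau1 φ y = 0 := by
    rcases h1 with h1 | h1
    · exact h1
    have hv : ∀ᶠ z in nhds y, v z = 0 := by
      filter_upwards [hc, h.isOpen.mem_nhds hy] with z hz hzU
      refine (h.pos z hzU).met_self_eq_zero ?_
      change normSq φ v z = 0
      rw [hz]
      exact h1
    have hv0 : v y = 0 := hv.self_of_nhds
    have hN : ∀ a, nabla φ v y a = 0 := fun a => by
      have e : v =ᶠ[nhds y] fun _ => 0 := hv
      rw [nabla, e.fderiv_eq, hv0]
      simp
    -- With `v = 0` near `y` and `τ₇ = 0`, the equation `dφ̃ = 0` reduces to `4τ₁ψ = 0`; one nonzero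
    -- component of `ψ` suffices.
    have h3 := h.d_deform hy u hu hθ hd (frame u 3) (frame u 4) (frame u 5) (frame u 6)
    have e1 : psi (φ y) ![frame u 3, frame u 4, frame u 5, frame u 6] = 1 := by
      rw [hu, psi_frame, show psiInt 3 4 5 6 = 1 by decide]
      norm_num
    have e2 : ∀ b c, fun3 (φ y) 0 b c = 0 := fun b c => (lin3₀ _ _ _).map_zero
    rw [e1] at h3
    simp only [wedge13, alt4, hτ, hN, hv0, (lin4₀ _ _ _ _).map_zero, hθ0, map_zero, e2,
      dot_stdVec] at h3
    have e3 : ∀ x, dot x 0 = 0 := fun x => by simp [dot]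
    have e4 : ∀ x, phi0 ![0, x, 0] = 0 := fun x => (lin3₀ _ _ _).map_zero
    simp only [e3, e4] at h3
    linarith
  refine ⟨fun a m => ?_, (h.tau7_eq hκ hy).2 h2⟩
  rw [hT, h2, hθ0, zero_mul, (lin3₀ _ _ _).map_zero, add_zero]

end LocalDeform

/-! ### Invariance under changes of coordinates -/

section Pullback

variable {φ : E7 [⋀^Fin 3]→ₗ[ℝ] ℝ} (L : E7 ≃ₗ[ℝ] E7)

theorem comp_trans (u : E7 ≃ₗ[ℝ] E7) : (phi0.compLinearMap u.toLinearMap).compLinearMap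
    L.toLinearMap = phi0.compLinearMap (L.trans u).toLinearMap := rfl

theorem IsPositive.comp (h : IsPositive φ) : IsPositive (φ.compLinearMap L.toLinearMap) := by
  obtain ⟨u, rfl⟩ := h
  exact ⟨L.trans u, rfl⟩

theorem IsPositive.met_comp (h : IsPositive φ) (a b : E7) :
    met (φ.compLinearMap L.toLinearMap) a b = met φ (L a) (L b) := by
  obtain ⟨u, rfl⟩ := h
  rw [comp_trans, met_pull, met_pull]
  rfl

theorem IsPositive.psi_comp (h : IsPositive φ) (a b c d : E7) :
    psi (φ.compLinearMap L.toLinearMap) ![a, b, c, d] = psi φ ![L a, L b, L c, L d] := by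
  obtain ⟨u, rfl⟩ := h
  rw [comp_trans, psi_pull_fun, psi_pull_fun]
  rfl

theorem IsPositive.deform_comp (h : IsPositive φ) (w : E7) :
    deformForm (φ.compLinearMap L.toLinearMap) w =
      (deformForm φ (L w)).compLinearMap L.toLinearMap := by
  refine ext_three fun a b c => ?_
  rw [deformForm_apply, h.psi_comp, pull_apply, pull_apply, deformForm_apply]
  rfl

theorem IsPositive.xi_comp (h : IsPositive φ) (w a : E7) :
    xi (φ.compLinearMap L.toLinearMap) w a = xi φ (L w) (L a) := by
  rw [xi, xi, nu, nu, h.met_comp, h.met_comp]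

end Pullback

theorem IsPositive.eq_zero_of_contract {P : E7 [⋀^Fin 3]→ₗ[ℝ] ℝ} (h : IsPositive P) {K : E7}
    (hK : ∀ a b, P ![K, a, b] = 0) : K = 0 := by
  obtain ⟨u, rfl⟩ := h
  have h1 := phi0_contract (u K) (u K)
  have h2 : ∀ j k, phi0 ![u K, stdVec j, stdVec k] = 0 := fun j k => by
    have := hK (frame u j) (frame u k)
    rwa [fun3_pull, map_frame, map_frame] at this
  simp only [h2, mul_zero, Finset.sum_const_zero] at h1
  exact (map_eq_zero_iff u u.injective).mp (dot_self_eq_zero (by linarith))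

/-- The equation `dξ = κ ∧ ξ + (1/2) κ^♯ ⌟ φ̃` determines `κ`. -/
theorem IsPositive.eq_of_wedge_contract {P : E7 [⋀^Fin 3]→ₗ[ℝ] ℝ} (h : IsPositive P) {K K' : E7}
    (ξ : E7 → ℝ) (hK : ∀ a b, met P K a * ξ b - met P K b * ξ a + 1 / 2 * P ![K, a, b] =
      met P K' a * ξ b - met P K' b * ξ a + 1 / 2 * P ![K', a, b]) : K = K' := by
  set D := K - K' with hD
  have h1 : ∀ a b, met P D a * ξ b - met P D b * ξ a + 1 / 2 * P ![D, a, b] = 0 := by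
    intro a b
    rw [hD, (met_lin_left _ _).map_sub, (met_lin_left _ _).map_sub, (lin3₀ _ _ _).map_sub]
    linarith [hK a b]
  -- Inserting `D` into the first slot kills `P` and shows that `|D|² ξ` is a multiple of `D♭`.
  -- Hence `|D|² (D♭ ∧ ξ) = 0`, and `h1` leaves `|D|² (D ⌟ P) = 0`.
  have h2 : ∀ b, met P D D * ξ b = ξ D * met P D b := by
    intro b
    have h3 := h1 D b
    rw [P.map_eq_zero_of_eq ![D, D, b] (i := 0) (j := 1) rfl (by decide)] at h3
    linarith
  have h4 : met P D D = 0 := by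
    by_contra h0
    refine h0 ?_
    have : D = 0 := h.eq_zero_of_contract fun a b => by
      refine (mul_eq_zero.mp ?_).resolve_left h0
      linear_combination 2 * met P D D * h1 a b - 2 * met P D a * h2 b + 2 * met P D b * h2 a
    rw [this, (met_lin_left _ _).map_zero]
  exact sub_eq_zero.mp (h.met_self_eq_zero h4)

theorem xi_lin (φ : E7 [⋀^Fin 3]→ₗ[ℝ] ℝ) (v : E7) : IsLinearMap ℝ (xi φ v) :=
  ⟨fun _ _ => by simp only [xi, (met_linear _ _).map_add]; ring,
    fun _ _ => by simp only [xi, (met_linear _ _).map_smul, smul_eq_mul]; ring⟩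

/-- `|κ|²` does not depend on the coordinates. -/
theorem LocalDeform.kappaSq_transition {φ φ' : E7 → E7 [⋀^Fin 3]→ₗ[ℝ] ℝ} {v v' F : E7 → E7}
    {U U' : Set E7} {y : E7} (h : LocalDeform φ v U) (h' : LocalDeform φ' v' U') (hy : y ∈ U')
    (hFy : F y ∈ U) (hF : ContDiffAt ℝ ∞ F y)
    (hL : ∀ᶠ z in nhds y, ∃ L : E7 ≃ₗ[ℝ] E7, (∀ b, L b = fderiv ℝ F z b) ∧
      φ' z = (φ (F z)).compLinearMap L.toLinearMap ∧ v (F z) = L (v' z)) :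
    kappaSq φ' v' y = kappaSq φ v (F y) := by
  have hdF : DifferentiableAt ℝ F y := hF.differentiableAt (by simp)
  have hU : ∀ᶠ z in nhds y, F z ∈ U := hF.continuousAt (h.isOpen.mem_nhds hFy)
  have hξ : ∀ᶠ z in nhds y, ∀ b, xi (φ' z) (v' z) b =
      xi (φ (F z)) (v (F z)) (fderiv ℝ F z b) := by
    filter_upwards [hL, hU] with z hz hzU b
    obtain ⟨L, hL1, hL2, hL3⟩ := hz
    rw [hL2, (h.pos _ hzU).xi_comp, hL3, hL1 b]
  have hw : ∀ b, ContDiffAt ℝ ∞ (fun z => fderiv ℝ F z b) y := fun b =>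
    (hF.fderiv_right (m := ∞) (by simp)).clm_apply contDiffAt_const
  -- The last term contains the second derivative of the transition map. It is symmetric in `a` and
  -- `b`, so it cancels in `dξ`.
  have hd : ∀ a b, dXi φ' v' y a b = dXi φ v (F y) (fderiv ℝ F y a) (fderiv ℝ F y b) +
      xi (φ (F y)) (v (F y)) (fderiv ℝ (fun z => fderiv ℝ F z b) y a) := by
    intro a b
    have d1 : ∀ c, DifferentiableAt ℝ (fun z => xi (φ z) (v z) c) (F y) := fun c =>
      (h.smooth_xi hFy c).differentiableAt (by simp)
    have e1 : (fun z => xi (φ' z) (v' z) b) =ᶠ[nhds y]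
        fun z => xi (φ (F z)) (v (F z)) (fderiv ℝ F z b) := hξ.mono fun z hz => hz b
    rw [dXi, e1.fderiv_eq, fderiv_lin_apply (L := fun z x => xi (φ (F z)) (v (F z)) x)
      (fun z => xi_lin _ _) (fun i => (d1 _).comp y hdF)
      ((hw b).differentiableAt (by simp))]
    have e2 : fderiv ℝ (fun z => xi (φ (F z)) (v (F z)) (fderiv ℝ F y b)) y = _ :=
      fderiv_comp y (d1 (fderiv ℝ F y b)) hdF
    rw [e2]
    rfl
  obtain ⟨L, hL1, hL2, hL3⟩ := hL.self_of_nhds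
  have hdef : deformField φ' v' y = (deformField φ v (F y)).compLinearMap L.toLinearMap := by
    rw [deformField, hL2, (h.pos _ hFy).deform_comp, ← hL3]
    rfl
  have hpt := h.pos_deform hFy
  have hpt' := h'.pos_deform hy
  have hm : ∀ a b, met (deformField φ' v' y) a b = met (deformField φ v (F y)) (L a) (L b) := by
    intro a b
    rw [hdef, hpt.met_comp]
  -- The definition of `κ` contains the torsion, whose transformation law would need that of the
  -- Christoffel symbols. The equation for `dξ`, which determines `κ` pointwise, avoids this.
  have key : kappaVec φ' v' y = L.symm (kappaVec φ v (F y)) := by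
    refine hpt'.eq_of_wedge_contract (xi (φ' y) (v' y)) fun a b => ?_
    rw [h'.met_kappaVec hy, h'.met_kappaVec hy, ← h'.dXi_eq hy a b, hd, hd,
      fderiv_symm hF b a, hm, hm, LinearEquiv.apply_symm_apply, h.met_kappaVec hFy,
      h.met_kappaVec hFy, hξ.self_of_nhds, hξ.self_of_nhds, hdef, pull_apply]
    have h3 := h.dXi_eq hFy (fderiv ℝ F y a) (fderiv ℝ F y b)
    simp only [LinearEquiv.coe_coe, LinearEquiv.apply_symm_apply, ← hL1] at h3 ⊢
    linarith
  rw [kappaSq, kappaSq, key, hm, LinearEquiv.apply_symm_apply]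

/-- A deformation of a torsion-free structure by a parallel vector field is torsion-free. -/
theorem torsion_deformField_eq_zero {φ : E7 → E7 [⋀^Fin 3]→ₗ[ℝ] ℝ} {v : E7 → E7} {y : E7}
    (hp : IsPositive (φ y)) (hs : SmoothAt φ y) (hv : ContDiffAt ℝ ∞ v y)
    (hT : ∀ a m, torsion φ y a m = 0) (hN : ∀ a, nabla φ v y a = 0) (a m : Fin 7) :
    torsion (deformField φ v) y a m = 0 := by
  -- The Christoffel endomorphisms of `φ` also generate the derivative of `φ̃`: they do so for `φ`
  -- and `ψ` since `T = 0`, and for `v` since `∇v = 0`. They are symmetric, so `torsion_eq_zero`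
  -- applies to `φ̃`.
  refine torsion_eq_zero (φ := deformField φ v) (hp.deform (v y)).1 (hs.deform hp hv) (chr φ y) (chr_symm hp hs)
    (fun a b c d => ?_) a m
  have h1 := fderiv_deformField hp hs hv a b c d
  have h2 : dPsi φ y a (v y) b c d = _ := fderiv_psi hp (fun i j k => hs.differentiableAt _)
      (fun i j k => dForm_eq_act hp hs hT a _ _ _) (v y) b c d
  have h3 : psi (φ y) ![fderiv ℝ v y a, b, c, d] + psi (φ y) ![chr φ y a (v y), b, c, d] = 0 := by
    rw [← form4_add₀, ← nabla, hN, (lin4₀ _ _ _ _).map_zero]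
  rw [dForm] at h1
  rw [h1, h2, dForm_eq_act hp hs hT, act_apply₃, act_apply₃]
  simp only [deformField, deformForm_apply]
  linear_combination h3

theorem covDerivVec_eq {φ : E7 → E7 [⋀^Fin 3]→ₗ[ℝ] ℝ} {v : E7 → E7} {y : E7}
    (hv : DifferentiableAt ℝ v y) (a b : Fin 7) :
    covDerivVec φ v y a b = nabla φ v y (stdVec a) b := by
  have h1 : chr φ y (stdVec a) (v y) b = ∑ c, v y c * chr φ y (stdVec a) (stdVec c) b :=
    lin_eq_sum (F := fun w => chr φ y (stdVec a) w b)
      ⟨fun _ _ => by simp, fun _ _ => by simp⟩ (v y)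
  rw [covDerivVec, nabla, PiLp.add_apply, h1, pd, fderiv_coord hv]
  simp only [chr_stdVec]
  congr 1
  exact Finset.sum_congr rfl fun c _ => mul_comm _ _

theorem nabla_eq_zero_iff {φ : E7 → E7 [⋀^Fin 3]→ₗ[ℝ] ℝ} {v : E7 → E7} {y : E7}
    (hv : DifferentiableAt ℝ v y) :
    (∀ a, nabla φ v y a = 0) ↔ ∀ a b, covDerivVec φ v y a b = 0 := by
  simp only [covDerivVec_eq hv]
  refine ⟨fun h a b => by rw [h]; rfl, fun h a => ?_⟩
  ext b
  refine lin_ext (F := fun a => nabla φ v y a b) (G := fun _ => 0) ⟨fun _ _ => ?_, fun _ _ => ?_⟩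
    ⟨fun _ _ => by simp, fun _ _ => by simp⟩ (fun i => h i b) a
  · simp [nabla, chr_add]
    ring
  · simp [nabla, chr_smul]
    ring

/-! ### Coordinate representations -/

section Charts

open IsManifold

variable {M : Type*} [TopologicalSpace M] [ChartedSpace E7 M]

/-- A field of 3-forms, each form being regarded as a form on `ℝ⁷`. -/
def formAt (φ : FormField M) (p : M) : E7 [⋀^Fin 3]→ₗ[ℝ] ℝ := φ p

/-- A vector field, each vector being regarded as a vector of `ℝ⁷`. -/
def vecAt (v : VecField M) (p : M) : E7 := v p

variable {x x' : OpenPartialHomeomorph M E7} {φ : FormField M}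
  {v : VecField M} {p : M}

theorem mdifferentiable_chart (hx : x ∈ maximalAtlas (𝓡 7) ∞ M) :
    x.MDifferentiable (𝓡 7) (𝓡 7) :=
  ⟨(contMDiffOn_of_mem_maximalAtlas hx).mdifferentiableOn (by simp),
    (contMDiffOn_symm_of_mem_maximalAtlas hx).mdifferentiableOn (by simp)⟩

theorem smoothAt_formInChart (hφ : IsG2Structure φ) (hx : x ∈ maximalAtlas (𝓡 7) ∞ M) {y : E7}
    (hy : y ∈ x.target) : SmoothAt (formInChart x φ) y := fun i j k =>
  (hφ.1 x hx i j k).contDiffAt (x.open_target.mem_nhds hy)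

theorem exists_chart_equiv (hx : x ∈ maximalAtlas (𝓡 7) ∞ M) (hp : p ∈ x.source) :
    ∃ L : E7 ≃ₗ[ℝ] E7, (∀ b : E7, L b = mfderiv (𝓡 7) (𝓡 7) x.symm (x p) b) ∧
      (∀ b : E7, L.symm b = mfderiv (𝓡 7) (𝓡 7) x p b) ∧
      (∀ φ : FormField M, formInChart x φ (x p) = (formAt φ p).compLinearMap L.toLinearMap) ∧
      ∀ v : VecField M, vecInChart x v (x p) = L.symm (vecAt v p) := by
  let L : E7 ≃ₗ[ℝ] E7 := ((mdifferentiable_chart hx).mfderiv hp).toLinearEquiv.symm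
  have h1 : ∀ b : E7, L b = mfderiv (𝓡 7) (𝓡 7) x.symm (x p) b := fun b => rfl
  have h2 : ∀ b : E7, L.symm b = mfderiv (𝓡 7) (𝓡 7) x p b := fun b => rfl
  refine ⟨L, h1, h2, fun φ => ?_, fun v => ?_⟩
  · have e : formInChart x φ (x p) = (formAt φ (x.symm (x p))).compLinearMap L.toLinearMap := rfl
    rw [e, x.left_inv hp]
  -- Written with values in the fixed space `E7`, the function allows its base point to be rewritten
  -- without transport between tangent spaces.
  · let G : M → E7 := fun q => mfderiv (𝓡 7) (𝓡 7) x q (v q)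
    have e : vecInChart x v (x p) = G (x.symm (x p)) := rfl
    rw [e, x.left_inv hp]
    rfl

theorem isPositive_formInChart (hφ : IsG2Structure φ) (hx : x ∈ maximalAtlas (𝓡 7) ∞ M)
    (hp : p ∈ x.source) : IsPositive (formInChart x φ (x p)) := by
  obtain ⟨L, -, -, h, -⟩ := exists_chart_equiv hx hp
  rw [h]
  exact IsPositive.comp L (hφ.2 p)

theorem formInChart_deform (hφ : IsG2Structure φ) (hx : x ∈ maximalAtlas (𝓡 7) ∞ M)
    (v : VecField M) (hp : p ∈ x.source) : formInChart x (deform φ v) (x p) =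
      deformField (formInChart x φ) (vecInChart x v) (x p) := by
  obtain ⟨L, -, -, h, h'⟩ := exists_chart_equiv hx hp
  rw [h, deformField, h, h', IsPositive.deform_comp (φ := formAt φ p) L (hφ.2 p),
    LinearEquiv.apply_symm_apply]
  rfl

theorem normSq_inChart (hφ : IsG2Structure φ) (hx : x ∈ maximalAtlas (𝓡 7) ∞ M)
    (v : VecField M) (hp : p ∈ x.source) : normSq (formInChart x φ) (vecInChart x v) (x p) =
      met (formAt φ p) (vecAt v p) (vecAt v p) := by
  obtain ⟨L, -, -, h, h'⟩ := exists_chart_equiv hx hp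
  rw [normSq, h, h', IsPositive.met_comp (φ := formAt φ p) L (hφ.2 p), LinearEquiv.apply_symm_apply]

/-- The coordinate representation is the fibre component of the tangent map of the chart, applied to
the section `v` along the inverse chart; each of these maps is smooth. -/
theorem contDiffAt_vecInChart [IsManifold (𝓡 7) ∞ M] (hv : IsSmoothVecField v) (hx : x ∈ maximalAtlas (𝓡 7) ∞ M) {y : E7}
    (hy : y ∈ x.target) : ContDiffAt ℝ ∞ (vecInChart x v) y := by
  have h1 : ContMDiffAt (𝓡 7) (𝓡 7) ∞ x.symm y := contMDiffAt_symm_of_mem_maximalAtlas hx hy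
  have h2 : ContMDiffAt (𝓡 7) (𝓡 7).tangent ∞
      (fun z => (⟨x.symm z, v (x.symm z)⟩ : TangentBundle (𝓡 7) M)) y :=
    ContMDiffAt.comp (g := fun p : M => (⟨p, v p⟩ : TangentBundle (𝓡 7) M)) y (hv _) h1
  have h3 : ContMDiffOn (𝓡 7).tangent (𝓡 7).tangent ∞ (tangentMapWithin (𝓡 7) (𝓡 7) x x.source)
      (Bundle.TotalSpace.proj ⁻¹' x.source) :=
    have : IsManifold (𝓡 7) 1 M := IsManifold.of_le (n := ∞) (by simp)
    (contMDiffOn_of_mem_maximalAtlas hx).contMDiffOn_tangentMapWithin (by simp)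
      x.open_source.uniqueMDiffOn
  have h4 : ContMDiffAt (𝓡 7).tangent (𝓡 7).tangent ∞ (tangentMapWithin (𝓡 7) (𝓡 7) x x.source)
      (⟨x.symm y, v (x.symm y)⟩ : TangentBundle (𝓡 7) M) :=
    h3.contMDiffAt ((x.open_source.preimage (FiberBundle.continuous_proj E7 _)).mem_nhds
      (x.map_target hy))
  have h5 := ((contMDiff_snd_tangentBundle_modelSpace (n := ∞) E7 (𝓡 7)).contMDiffAt.comp y
    (h4.comp y h2))
  have h6 := h5.contDiffAt
  refine h6.congr_of_eventuallyEq ?_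
  filter_upwards [x.open_target.mem_nhds hy] with z hz
  change mfderiv (𝓡 7) (𝓡 7) x (x.symm z) (v (x.symm z)) =
    mfderivWithin (𝓡 7) (𝓡 7) x x.source (x.symm z) (v (x.symm z))
  rw [mfderivWithin_of_isOpen x.open_source (x.map_target hz)]

end Charts

/-! ### Global arguments -/

theorem torsion_congr {φ φ' : E7 → E7 [⋀^Fin 3]→ₗ[ℝ] ℝ} {y : E7} (h : φ =ᶠ[nhds y] φ')
    (a m : Fin 7) : torsion φ y a m = torsion φ' y a m := by
  have h0 : φ y = φ' y := h.self_of_nhds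
  have h1 : ∀ a b c d, pd a (fun z => comp3 (φ z) b c d) y = pd a (fun z => comp3 (φ' z) b c d) y :=
    fun a b c d => by
      have e : (fun z => comp3 (φ z) b c d) =ᶠ[nhds y] fun z => comp3 (φ' z) b c d :=
        h.mono fun z hz => by simp only [hz]
      rw [pd, pd, e.fderiv_eq]
  have h2 : ∀ a i j, pd a (fun z => metric (φ z) i j) y = pd a (fun z => metric (φ' z) i j) y :=
    fun a i j => by
      have e : (fun z => metric (φ z) i j) =ᶠ[nhds y] fun z => metric (φ' z) i j :=
        h.mono fun z hz => by simp only [hz]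
      rw [pd, pd, e.fderiv_eq]
  simp only [torsion, covDerivForm, christoffel, h0, h1, h2]

section Global

open IsManifold

variable {M : Type*} [TopologicalSpace M] [ChartedSpace E7 M]
  {x x' : OpenPartialHomeomorph M E7} {φ : FormField M} {v : VecField M} {p : M}

theorem formInChart_deform_eventuallyEq (hφ : IsG2Structure φ) (v : VecField M)
    (hx : x ∈ maximalAtlas (𝓡 7) ∞ M) {y : E7} (hy : y ∈ x.target) :
    formInChart x (deform φ v) =ᶠ[nhds y] deformField (formInChart x φ) (vecInChart x v) := by
  filter_upwards [x.open_target.mem_nhds hy] with z hz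
  rw [← x.right_inv hz]
  exact formInChart_deform hφ hx v (x.map_target hz)

theorem localDeform_inChart [IsManifold (𝓡 7) ∞ M] (hφ : IsG2Structure φ) (hT : TorsionInW1W7 φ)
    (hv : IsSmoothVecField v) (hd : TorsionFree (deform φ v))
    (hx : x ∈ maximalAtlas (𝓡 7) ∞ M) :
    LocalDeform (formInChart x φ) (vecInChart x v) x.target where
  isOpen := x.open_target
  pos y hy := by
    rw [← x.right_inv hy]
    exact isPositive_formInChart hφ hx (x.map_target hy)
  smooth y hy := smoothAt_formInChart hφ hx hy
  torsion y hy := by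
    obtain ⟨t, τ, h⟩ := hT x hx y hy
    refine ⟨t, WithLp.toLp 2 τ, fun a m => ?_⟩
    rw [h, lin_eq_sum (lin3₀ (formInChart x φ y) _ _) (WithLp.toLp 2 τ)]
    rfl
  smooth_vec y hy := contDiffAt_vecInChart hv hx hy
  torsion_deform y hy a m := by
    rw [← torsion_congr (formInChart_deform_eventuallyEq hφ v hx hy)]
    exact hd x hx y hy a m

/-- The transition between two charts relates the coordinate representations. -/
theorem exists_transition (hx : x ∈ maximalAtlas (𝓡 7) ∞ M) (hx' : x' ∈ maximalAtlas (𝓡 7) ∞ M)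
    (φ : FormField M) (v : VecField M) (hp : p ∈ x.source) (hp' : p ∈ x'.source) :
    ContDiffAt ℝ ∞ (x ∘ x'.symm) (x' p) ∧ ∀ᶠ z in nhds (x' p), ∃ L : E7 ≃ₗ[ℝ] E7,
      (∀ b, L b = fderiv ℝ (x ∘ x'.symm) z b) ∧
      formInChart x' φ z = (formInChart x φ ((x ∘ x'.symm) z)).compLinearMap L.toLinearMap ∧
      vecInChart x v ((x ∘ x'.symm) z) = L (vecInChart x' v z) := by
  constructor
  · have h1 : ContMDiffAt (𝓡 7) (𝓡 7) ∞ x'.symm (x' p) :=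
      contMDiffAt_symm_of_mem_maximalAtlas hx' (x'.map_source hp')
    have h2 : ContMDiffAt (𝓡 7) (𝓡 7) ∞ x (x'.symm (x' p)) := by
      rw [x'.left_inv hp']
      exact contMDiffAt_of_mem_maximalAtlas hx hp
    exact (h2.comp (x' p) h1).contDiffAt
  · have hs : ∀ᶠ z in nhds (x' p), z ∈ x'.target ∧ x'.symm z ∈ x.source := by
      refine (x'.open_target.eventually_mem (x'.map_source hp')).and ?_
      refine (x'.continuousAt_symm (x'.map_source hp')).eventually_mem ?_
      rw [x'.left_inv hp']
      exact x.open_source.mem_nhds hp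
    filter_upwards [hs] with z hz
    obtain ⟨hz, hzx⟩ := hz
    obtain ⟨q, hq, rfl⟩ : ∃ q ∈ x'.source, x' q = z := ⟨x'.symm z, x'.map_target hz, x'.right_inv hz⟩
    rw [x'.left_inv hq] at hzx
    obtain ⟨L, -, hL2, hLφ, hLv⟩ := exists_chart_equiv hx hzx
    obtain ⟨L', hL1', -, hLφ', hLv'⟩ := exists_chart_equiv hx' hq
    have hF : (x ∘ x'.symm) (x' q) = x q := by rw [Function.comp_apply, x'.left_inv hq]
    refine ⟨L'.trans L.symm, fun b => ?_, ?_, ?_⟩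
    · have h1 : MDifferentiableAt (𝓡 7) (𝓡 7) x'.symm (x' q) :=
        (mdifferentiable_chart hx').mdifferentiableAt_symm hz
      have h2 : MDifferentiableAt (𝓡 7) (𝓡 7) x (x'.symm (x' q)) := by
        rw [x'.left_inv hq]
        exact (mdifferentiable_chart hx).mdifferentiableAt hzx
      have h3 : fderiv ℝ (x ∘ x'.symm) (x' q) b = mfderiv (𝓡 7) (𝓡 7) x (x'.symm (x' q))
          (mfderiv (𝓡 7) (𝓡 7) x'.symm (x' q) b) := by
        rw [← mfderiv_eq_fderiv, mfderiv_comp _ h2 h1]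
        rfl
      let G : M → E7 := fun r => mfderiv (𝓡 7) (𝓡 7) x r (L' b)
      have h4 : G (x'.symm (x' q)) = G q := by rw [x'.left_inv hq]
      rw [LinearEquiv.trans_apply, hL2, h3]
      refine h4.symm.trans ?_
      change mfderiv (𝓡 7) (𝓡 7) x (x'.symm (x' q)) (L' b) = _
      rw [hL1']
    · rw [hF, hLφ, hLφ']
      refine ext_three fun a b c => ?_
      simp only [pull_apply, LinearEquiv.coe_coe, LinearEquiv.trans_apply,
        LinearEquiv.apply_symm_apply]
    · rw [hF, hLv, hLv', LinearEquiv.trans_apply, LinearEquiv.apply_symm_apply]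

/-- `|κ|²` as a function on the manifold. -/
def kappaSqAt (φ : FormField M) (v : VecField M) (p : M) : ℝ :=
  kappaSq (formInChart (chartAt E7 p) φ) (vecInChart (chartAt E7 p) v) (chartAt E7 p p)

variable [IsManifold (𝓡 7) ∞ M]

theorem kappaSq_inChart (hφ : IsG2Structure φ) (hT : TorsionInW1W7 φ) (hv : IsSmoothVecField v)
    (hd : TorsionFree (deform φ v)) (hx : x ∈ maximalAtlas (𝓡 7) ∞ M) (hp : p ∈ x.source) :
    kappaSq (formInChart x φ) (vecInChart x v) (x p) = kappaSqAt φ v p := by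
  have hx' : chartAt E7 p ∈ maximalAtlas (𝓡 7) ∞ M := chart_mem_maximalAtlas p
  have hp' : p ∈ (chartAt E7 p).source := mem_chart_source E7 p
  obtain ⟨h1, h2⟩ := exists_transition hx hx' φ v hp hp'
  have hF : (x ∘ (chartAt E7 p).symm) (chartAt E7 p p) = x p := by
    rw [Function.comp_apply, (chartAt E7 p).left_inv hp']
  rw [kappaSqAt, (localDeform_inChart hφ hT hv hd hx).kappaSq_transition
    (localDeform_inChart hφ hT hv hd hx') ((chartAt E7 p).map_source hp')
    (by rw [hF]; exact x.map_source hp) h1 h2, hF]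

/-- On a compact manifold the 1-form `κ` vanishes. -/
theorem kappa_inChart_eq_zero [CompactSpace M] (hφ : IsG2Structure φ) (hT : TorsionInW1W7 φ)
    (hv : IsSmoothVecField v) (hd : TorsionFree (deform φ v)) (hx : x ∈ maximalAtlas (𝓡 7) ∞ M) :
    ∀ z ∈ x.target, ∀ a, kappa (formInChart x φ) (vecInChart x v) z a = 0 := by
  have hE : ∀ x ∈ maximalAtlas (𝓡 7) ∞ M, ∀ z ∈ x.target,
      kappaSq (formInChart x φ) (vecInChart x v) z = kappaSqAt φ v (x.symm z) := fun x hx z hz => by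
    rw [← kappaSq_inChart hφ hT hv hd hx (x.map_target hz), x.right_inv hz]
  have hc : Continuous (kappaSqAt φ v) := by
    rw [continuous_iff_continuousAt]
    intro p
    have hx : chartAt E7 p ∈ maximalAtlas (𝓡 7) ∞ M := chart_mem_maximalAtlas p
    have hp : p ∈ (chartAt E7 p).source := mem_chart_source E7 p
    refine ContinuousAt.congr (f := fun q => kappaSq (formInChart (chartAt E7 p) φ)
      (vecInChart (chartAt E7 p) v) (chartAt E7 p q)) ?_ ?_
    · exact ContinuousAt.comp (g := kappaSq (formInChart (chartAt E7 p) φ)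
        (vecInChart (chartAt E7 p) v)) ((localDeform_inChart hφ hT hv hd hx).continuousAt_kappaSq
        ((chartAt E7 p).map_source hp)) ((chartAt E7 p).continuousAt hp)
    · filter_upwards [(chartAt E7 p).open_source.mem_nhds hp] with q hq
      exact kappaSq_inChart hφ hT hv hd hx hq
  intro z hz a
  have hne : Nonempty M := ⟨x.symm z⟩
  -- The maximum of the globally defined function `|κ|²` is attained, and its value is zero by the
  -- local argument; since `|κ|² ≥ 0`, it vanishes everywhere.
  obtain ⟨p, -, hp⟩ := isCompact_univ.exists_isMaxOn Set.univ_nonempty hc.continuousOn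
  have h0 : kappaSqAt φ v p = 0 := by
    have hx : chartAt E7 p ∈ maximalAtlas (𝓡 7) ∞ M := chart_mem_maximalAtlas p
    have hps : p ∈ (chartAt E7 p).source := mem_chart_source E7 p
    refine (localDeform_inChart hφ hT hv hd hx).kappaSq_eq_zero ((chartAt E7 p).map_source hps) ?_
    filter_upwards [(chartAt E7 p).open_target.mem_nhds ((chartAt E7 p).map_source hps)] with w hw
    rw [hE _ hx w hw, kappaSq_inChart hφ hT hv hd hx hps]
    exact hp (Set.mem_univ _)
  refine (localDeform_inChart hφ hT hv hd hx).kappa_eq_zero hz (le_antisymm ?_ ?_) a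
  · rw [hE x hx z hz, ← h0]
    exact hp (Set.mem_univ _)
  · exact ((localDeform_inChart hφ hT hv hd hx).pos_deform hz).met_self_nonneg _

/-- On a compact manifold the function `|v|²` is locally constant. -/
theorem eventually_met_eq [CompactSpace M] (hφ : IsG2Structure φ) (hT : TorsionInW1W7 φ)
    (hv : IsSmoothVecField v) (hd : TorsionFree (deform φ v)) (p : M) :
    ∀ᶠ q in nhds p, met (formAt φ q) (vecAt v q) (vecAt v q) =
      met (formAt φ p) (vecAt v p) (vecAt v p) := by
  set f : M → ℝ := fun q => met (formAt φ q) (vecAt v q) (vecAt v q) with hf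
  have : LocallyConnectedSpace M := ChartedSpace.locallyConnectedSpace E7 M
  have hE : ∀ x ∈ maximalAtlas (𝓡 7) ∞ M, ∀ z ∈ x.target,
      normSq (formInChart x φ) (vecInChart x v) z = f (x.symm z) := fun x hx z hz => by
    have h1 := normSq_inChart hφ hx v (x.map_target hz)
    rwa [x.right_inv hz] at h1
  have hc : Continuous f := by
    rw [continuous_iff_continuousAt]
    intro p
    have hx : chartAt E7 p ∈ maximalAtlas (𝓡 7) ∞ M := chart_mem_maximalAtlas p
    have hp : p ∈ (chartAt E7 p).source := mem_chart_source E7 p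
    refine ContinuousAt.congr (f := fun q => normSq (formInChart (chartAt E7 p) φ)
      (vecInChart (chartAt E7 p) v) (chartAt E7 p q)) ?_ ?_
    · exact ContinuousAt.comp (g := normSq (formInChart (chartAt E7 p) φ)
        (vecInChart (chartAt E7 p) v)) ((localDeform_inChart hφ hT hv hd hx).smooth_normSq
        ((chartAt E7 p).map_source hp)).continuousAt ((chartAt E7 p).continuousAt hp)
    · filter_upwards [(chartAt E7 p).open_source.mem_nhds hp] with q hq
      exact normSq_inChart hφ hx v hq
  have hmax : ∀ q, IsLocalMax f q → ∀ᶠ r in nhds q, f r = f q := by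
    intro q hq
    have hx : chartAt E7 q ∈ maximalAtlas (𝓡 7) ∞ M := chart_mem_maximalAtlas q
    have hqs : q ∈ (chartAt E7 q).source := mem_chart_source E7 q
    have hy := (chartAt E7 q).map_source hqs
    have hqy : (chartAt E7 q).symm (chartAt E7 q q) = q := (chartAt E7 q).left_inv hqs
    have h1 : IsLocalMax (normSq (formInChart (chartAt E7 q) φ) (vecInChart (chartAt E7 q) v))
        (chartAt E7 q q) := by
      have h2 : ∀ᶠ z in nhds (chartAt E7 q q), f ((chartAt E7 q).symm z) ≤ f q := by
        have h3 : Filter.Tendsto (chartAt E7 q).symm (nhds (chartAt E7 q q)) (nhds q) := by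
          simpa only [hqy] using ((chartAt E7 q).continuousAt_symm hy).tendsto
        exact h3.eventually hq
      filter_upwards [h2, (chartAt E7 q).open_target.mem_nhds hy] with z hz hzt
      rw [hE _ hx z hzt, hE _ hx _ hy, hqy]
      exact hz
    have h3 := (localDeform_inChart hφ hT hv hd hx).eventually_normSq_eq
      (kappa_inChart_eq_zero hφ hT hv hd hx) hy h1
    filter_upwards [((chartAt E7 q).continuousAt hqs).eventually h3,
      (chartAt E7 q).open_source.mem_nhds hqs] with r hr hrs
    rw [hE _ hx _ hy, hqy, hE _ hx _ ((chartAt E7 q).map_source hrs),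
      (chartAt E7 q).left_inv hrs] at hr
    exact hr
  -- A connected component is closed, hence compact, and open because `M` is locally connected. The
  -- set where `|v|²` attains its maximum over the component is open, each such point being a local
  -- maximum on `M`, and closed, so it is the whole component.
  obtain ⟨q, hqC, hq⟩ := isClosed_connectedComponent.isCompact.exists_isMaxOn
    (⟨p, mem_connectedComponent⟩ : (connectedComponent p).Nonempty) hc.continuousOn
  have hS : IsClopen (connectedComponent p ∩ {r | f r = f q}) := by
    refine ⟨isClosed_connectedComponent.inter (isClosed_eq hc continuous_const), ?_⟩
    rw [isOpen_iff_mem_nhds]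
    rintro r ⟨hrC, hr : f r = f q⟩
    have hC := isOpen_connectedComponent.mem_nhds hrC
    have h1 : IsLocalMax f r := by
      filter_upwards [hC] with s hs
      rw [hr]
      exact hq hs
    filter_upwards [hC, hmax r h1] with s hs hs'
    exact ⟨hs, hs'.trans hr⟩
  have h2 := hS.connectedComponent_subset ⟨hqC, rfl⟩
  rw [← connectedComponent_eq hqC] at h2
  filter_upwards [isOpen_connectedComponent.mem_nhds mem_connectedComponent] with r hr
  exact (h2 hr).2.trans (h2 mem_connectedComponent).2.symm

theorem torsionFree_and_isParallel [CompactSpace M] (hφ : IsG2Structure φ) (hT : TorsionInW1W7 φ)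
    (hv : IsSmoothVecField v) (hd : TorsionFree (deform φ v)) :
    TorsionFree φ ∧ IsParallel φ v := by
  have key : ∀ x ∈ maximalAtlas (𝓡 7) ∞ M, ∀ y ∈ x.target,
      (∀ a m, torsion (formInChart x φ) y a m = 0) ∧
        ∀ a, nabla (formInChart x φ) (vecInChart x v) y a = 0 := by
    intro x hx y hy
    refine (localDeform_inChart hφ hT hv hd hx).torsion_eq_zero_and_nabla_eq_zero
      (kappa_inChart_eq_zero hφ hT hv hd hx) hy ?_
    filter_upwards [(x.continuousAt_symm hy).eventually
      (eventually_met_eq hφ hT hv hd (x.symm y)), x.open_target.mem_nhds hy] with z hz hzt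
    rw [← normSq_inChart hφ hx v (x.map_target hzt), ← normSq_inChart hφ hx v (x.map_target hy),
      x.right_inv hzt, x.right_inv hy] at hz
    exact hz
  refine ⟨fun x hx y hy => (key x hx y hy).1, fun x hx y hy => ?_⟩
  exact (nabla_eq_zero_iff ((contDiffAt_vecInChart hv hx hy).differentiableAt (by simp))).mp
    (key x hx y hy).2

theorem isG2Structure_deform (hφ : IsG2Structure φ) (hv : IsSmoothVecField v) :
    IsG2Structure (deform φ v) := by
  refine ⟨fun x hx a b c y hy => ?_, fun p => (IsPositive.deform (φ := formAt φ p) (hφ.2 p) _).1⟩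
  have hp : IsPositive (formInChart x φ y) := by
    rw [← x.right_inv hy]
    exact isPositive_formInChart hφ hx (x.map_target hy)
  have h1 := (smoothAt_formInChart hφ hx hy).deform hp (contDiffAt_vecInChart hv hx hy) a b c
  refine (h1.congr_of_eventuallyEq ?_).contDiffWithinAt
  filter_upwards [formInChart_deform_eventuallyEq hφ v hx hy] with z hz
  rw [hz]
  rfl

theorem torsionFree_deform (hφ : IsG2Structure φ) (hv : IsSmoothVecField v) (h0 : TorsionFree φ)
    (hN : IsParallel φ v) : TorsionFree (deform φ v) := by
  intro x hx y hy a m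
  have hp : IsPositive (formInChart x φ y) := by
    rw [← x.right_inv hy]
    exact isPositive_formInChart hφ hx (x.map_target hy)
  have hvs := contDiffAt_vecInChart hv hx hy
  rw [torsion_congr (formInChart_deform_eventuallyEq hφ v hx hy)]
  exact torsion_deformField_eq_zero hp (smoothAt_formInChart hφ hx hy) hvs (h0 x hx y hy)
    ((nabla_eq_zero_iff (hvs.differentiableAt (by simp))).mpr (hN x hx y hy)) a m

end Global

end G2

end

/-! ### The equivalence and the exclusion of the strict classes -/

theorem mainTheorem1 {M : Type*} [TopologicalSpace M] [T2Space M] [CompactSpace M]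
    [ChartedSpace (EuclideanSpace ℝ (Fin 7)) M] [IsManifold (𝓡 7) ∞ M]
    (φ : G2.FormField M) (hφ : G2.IsG2Structure φ) (hT : G2.TorsionInW1W7 φ)
    (v : G2.VecField M) (hv : G2.IsSmoothVecField v) :
    ((G2.IsG2Structure (G2.deform φ v) ∧ G2.TorsionFree (G2.deform φ v)) ↔
        (G2.TorsionFree φ ∧ G2.IsParallel φ v)) ∧
      ((G2.StrictW1 φ ∨ G2.StrictW7 φ ∨ G2.StrictW1W7 φ) →
        ¬ (G2.IsG2Structure (G2.deform φ v) ∧ G2.TorsionFree (G2.deform φ v))) := by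
  have hmp : G2.IsG2Structure (G2.deform φ v) ∧ G2.TorsionFree (G2.deform φ v) →
      G2.TorsionFree φ ∧ G2.IsParallel φ v := fun h =>
    G2.torsionFree_and_isParallel hφ hT hv h.2
  refine ⟨⟨hmp, fun h => ⟨G2.isG2Structure_deform hφ hv, G2.torsionFree_deform hφ hv h.1 h.2⟩⟩,
    fun hs hd => ?_⟩
  have h0 := (hmp hd).1
  rcases hs with hs | hs | hs
  · exact hs.2 h0
  · exact hs.2 h0
  -- Zero torsion lies in `W₁` with `τ₁ = 0`, which the strict mixed class excludes.
  · refine hs.2.1 fun x hx y hy => ⟨0, fun a m => ?_⟩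
    rw [h0 x hx y hy, zero_mul]
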